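/- An abstract decorated Gauss diagram $G^d$ consists of two finite families $\mathcal M^+,\mathcal M^-$ of disjoint oriented circles (not necessarily equally many), finitely many signed chords, each joining a point of a circle of $\mathcal M^+$ to a point of a circle of $\mathcal M^-$ (all ends distinct), and a coloring of its cycles, i.e. of the boundary components of the ribbon graph $\Gamma(G)$. Here $\Gamma(G)$ is the oriented surface obtained from the annuli $\mu\times[-1,1]$ over all circles $\mu$ by identifying, for each chord, the small squares around its two ends crosswise and preserving orientations, so that the crossing of the core of the $\mathcal M^+$-annulus with the core of the $\mathcal M^-$-annulus has the sign of the chord. The closed orientable surface $S(G^d)$ associated to $G^d$ is obtained from $\Gamma(G)$ by gluing in, for each color, a sphere with holes along all the cycles of this color, compatibly with orientations. The $3$-manifold associated to $G^d$ is obtained from $S(G^d)\times[-1,1]$ by attaching 2-handles along the curves of $\mathcal M^+\times\{1\}$ and of $\mathcal M^-\times\{-1\}$, and filling every boundary component homeomorphic to the $2$-sphere with a $3$-ball. Let $\partial^-H^+$ (resp. $\partial^-H^-$) be the part of its boundary on the side of $\mathcal M^+\times\{1\}$ (resp. $\mathcal M^-\times\{-1\}$), and let $\partial g^\pm$ be the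 sum of the genera of the components of $\partial^-H^\pm$. For every abstract decorated Gauss diagram $G^d$ the following holds. (1) If $\partial g^+=\partial g^-=0$, then the manifold associated to $G^d$ is a closed orientable $3$-manifold. (2) If $\partial g^+=0$ and $\partial g^-=1$, or $\partial g^+=1$ and $\partial g^-=0$, then the manifold associated to $G^d$ is the complement of a knot in some closed orientable $3$-manifold, i.e. it is homeomorphic to the complement of an open tubular neighbourhood of a knot in this manifold. Manifolds are not assumed to be connected. -/

import Mathlib

open Set Metric

noncomputable section

/-! ### Abstract Gauss diagrams -/

/-- An abstract Gauss diagram: two families of oriented circles, indexed by `Bool` (`true` is the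
family `𝓜⁺`, `false` is the family `𝓜⁻`), and signed chords, each joining a circle of `𝓜⁺` to a
circle of `𝓜⁻`. The `deg s i` chord ends lying on the circle `i` of the family `s` are numbered
`0, 1, …, deg s i - 1` in the cyclic order given by the orientation of the circle. -/
structure GaussDiagram where
  /-- the number of circles in each family -/
  numCircles : Bool → ℕ
  /-- the number of chords -/
  numChords : ℕ
  /-- the number of chord ends on each circle (circles without chords are allowed) -/
  deg : (s : Bool) → Fin (numCircles s) → ℕ
  /-- the circle on which the end of a chord in each family lies, and its place on that circle -/
  chordEnd : (s : Bool) → Fin numChords ≃ (Σ i : Fin (numCircles s), Fin (deg s i))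
  /-- the signs of the chords -/
  sign : Fin numChords → ℤˣ

namespace GaussDiagram

variable (G : GaussDiagram)

/-- The circles of both families. -/
abbrev Circles : Type := Σ s : Bool, Fin (G.numCircles s)

/-- The chord whose end follows the end of a given chord on its circle of the family `s`. The
edges of the family `s` that end in chords correspond to the chords at which they start:
the edge `h` goes from the end of `h` to the end of `G.succ s h`. -/
def succ (s : Bool) : Equiv.Perm (Fin G.numChords) :=
  ((G.chordEnd s).trans (Equiv.sigmaCongrRight fun i => finRotate (G.deg s i))).trans
    (G.chordEnd s).symm

/-- The two sides of the edges: `inl (s, h, δ)` is a side of the edge of the family `s` that starts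
at the chord `h`, and `inr (c, δ)` a side of a circle `c` without chords. The boundary of the ribbon
graph runs along the right side of an edge in the direction of the edge (`δ = 1`) and along its left
side in the opposite direction (`δ = -1`). -/
abbrev Arc : Type :=
  (Bool × Fin G.numChords × ℤˣ) ⊕ ({c : G.Circles // G.deg c.1 c.2 = 0} × ℤˣ)

/-- The right turn rule: the side of an edge along which the boundary of the ribbon graph continues.
Arriving at the chord `h'` along the family `s` in the direction `δ`, one changes to the other
family; its direction there is `-ε δ` when coming from `𝓜⁺` and `ε δ` when coming from `𝓜⁻`,
where `ε` is the sign of `h'`. -/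
def next : G.Arc → G.Arc
  | .inl (s, h, δ) =>
      let h' := if δ = 1 then G.succ s h else h
      let δ' := if s then -(G.sign h' * δ) else G.sign h' * δ
      .inl (!s, if δ' = 1 then h' else (G.succ (!s)).symm h', δ')
  | .inr a => .inr a

/-- The cycles of a Gauss diagram, i.e. the orbits of the right turn rule; they correspond to the
boundary components of the ribbon graph. -/
def Cycle : Type := Quot fun a b : G.Arc => G.next a = b

instance : Finite G.Cycle := inferInstanceAs (Finite (Quot _))

/-- The point of the unit circle with coordinate `u ∈ ℝ / max (deg s i) 1` on the circle `c`: the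
`k`-th chord end lies at `u = k`. -/
def pos (c : G.Circles) (u : ℝ) : Circle :=
  Circle.exp (2 * Real.pi * u / (max (G.deg c.1 c.2) 1 : ℕ))

/-- The annuli `μ × [-1, 1]` over the circles of both families, oriented by (direction of `μ`,
direction of `[-1, 1]`), so that the points `(u, y)` with `y > 0` are to the left of `μ`. -/
abbrev Annuli : Type := G.Circles × Circle × Icc (-1 : ℝ) 1

/-- The square with coordinates `(x, y) ∈ [-1, 1]²` around the upper end of the chord `h` is
identified with the square around its lower end, where `𝓜⁺` runs in the positive `x` direction and
`𝓜⁻` in the positive or negative `y` direction according to the sign of the chord; the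
identification preserves orientations. -/
inductive CouponRel : G.Annuli → G.Annuli → Prop
  | glue (h : Fin G.numChords) (x y v : Icc (-1 : ℝ) 1)
      (hv : (v : ℝ) = -((G.sign h : ℤ) : ℝ) * x) :
      CouponRel
        (⟨true, (G.chordEnd true h).1⟩,
          G.pos ⟨true, (G.chordEnd true h).1⟩
            (((G.chordEnd true h).2 : ℕ) + (x : ℝ) / 4), y)
        (⟨false, (G.chordEnd false h).1⟩,
          G.pos ⟨false, (G.chordEnd false h).1⟩
            (((G.chordEnd false h).2 : ℕ) + ((G.sign h : ℤ) : ℝ) * (y : ℝ) / 4), v)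

/-- The ribbon graph associated to a Gauss diagram. -/
def RibbonGraph : Type := Quot G.CouponRel

instance : TopologicalSpace G.RibbonGraph := inferInstanceAs (TopologicalSpace (Quot _))

/-- The left (`δ = -1`, `y = 1`) or right (`δ = 1`, `y = -1`) boundary of an annulus. -/
def edgeOfInterval (δ : ℤˣ) : Icc (-1 : ℝ) 1 :=
  if δ = 1 then ⟨-1, by norm_num⟩ else ⟨1, by norm_num⟩

/-- The parametrization by `t ∈ [0, 1]` of the sides of the edges in the boundary of the ribbon
graph, in the direction in which the boundary runs along them. Between the `k`-th and the
`(k + 1)`-st chord end, the side is the interval from `k + 1/4` to `k + 3/4`. -/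
def arcPoint : G.Arc → ℝ → G.RibbonGraph
  | .inl (s, h, δ), t =>
      Quot.mk _ (⟨s, (G.chordEnd s h).1⟩,
        G.pos ⟨s, (G.chordEnd s h).1⟩
          (((G.chordEnd s h).2 : ℕ) + 1 / 2 + ((δ : ℤ) : ℝ) * (t / 2 - 1 / 4)),
        edgeOfInterval δ)
  | .inr (c, δ), t =>
      Quot.mk _ (c.1, G.pos c.1 (((δ : ℤ) : ℝ) * t), edgeOfInterval δ)

end GaussDiagram

/-! ### Spheres with holes, closed orientable surfaces, closed orientable manifolds, knots -/

/-- The sphere `ℂ ∪ {∞}` with the open unit discs around the points `3 j`, `j ∈ J`, removed. -/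
def HoledSphere (J : Set ℕ) : Type :=
  {p : OnePoint ℂ // ∀ j ∈ J, ∀ z : ℂ, p = (z : OnePoint ℂ) → 1 ≤ ‖z - 3 * (j : ℂ)‖}

instance (J : Set ℕ) : TopologicalSpace (HoledSphere J) :=
  inferInstanceAs (TopologicalSpace (Subtype _))

/-- `p` is the point `3 j + w` of the `j`-th boundary circle. -/
def HoledSphere.IsBoundaryPoint {J : Set ℕ} (p : HoledSphere J) (j : ℕ) (w : Circle) : Prop :=
  j ∈ J ∧ p.1 = ((3 * (j : ℂ) + (w : ℂ) : ℂ) : OnePoint ℂ)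

/-- The closed orientable surface of genus `g`: a sphere with `2 g` holes, the boundaries of the
holes `2 k` and `2 k + 1` being glued by an orientation reversing reflection for each `k < g`. -/
def GenusSurface (g : ℕ) : Type :=
  Quot fun p q : HoledSphere {j | j < 2 * g} =>
    ∃ k < g, ∃ w : Circle, p.IsBoundaryPoint (2 * k) w ∧ q.IsBoundaryPoint (2 * k + 1) w⁻¹

instance (g : ℕ) : TopologicalSpace (GenusSurface g) := inferInstanceAs (TopologicalSpace (Quot _))

/-- A homeomorphism `e` between open subsets of `ℝⁿ` preserves the orientation at `x`, i.e. it has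
local degree `1` there: for a small radius `r`, the map `v ↦ e (x + r v) - e x` from the unit sphere
to `ℝⁿ ∖ {0}` is homotopic to the inclusion. -/
def PreservesOrientationAt {n : ℕ}
    (e : OpenPartialHomeomorph (EuclideanSpace ℝ (Fin n)) (EuclideanSpace ℝ (Fin n)))
    (x : EuclideanSpace ℝ (Fin n)) : Prop :=
  ∃ r > 0, closedBall x r ⊆ e.source ∧
    ∃ H : C(unitInterval × sphere (0 : EuclideanSpace ℝ (Fin n)) 1, EuclideanSpace ℝ (Fin n)),
      (∀ p, H p ≠ 0) ∧ (∀ v, H (0, v) = v) ∧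
        ∀ v, H (1, v) = e (x + r • (v : EuclideanSpace ℝ (Fin n))) - e x

/-- A closed orientable topological `n`-manifold (not necessarily connected): a compact Hausdorff
space with an atlas of charts to `ℝⁿ` all of whose transition maps preserve the orientation. -/
structure IsClosedOrientableManifold (n : ℕ) (X : Type) [TopologicalSpace X] : Prop where
  compact : CompactSpace X
  t2 : T2Space X
  oriented : ∃ _ : ChartedSpace (EuclideanSpace ℝ (Fin n)) X,
    ∀ e ∈ atlas (EuclideanSpace ℝ (Fin n)) X, ∀ e' ∈ atlas (EuclideanSpace ℝ (Fin n)) X,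
      ∀ x ∈ (e.symm.trans e').source, PreservesOrientationAt (e.symm.trans e') x

/-- `X` is the complement of a knot (its exterior, a space with boundary) in some closed orientable
`3`-manifold `N`: the open embedding `e` of `S¹ × {|z| < 2}` is a tubular neighbourhood of the
knot `e (S¹ × {0})`, and `X` is the complement of the smaller tubular neighbourhood
`e (S¹ × {|z| < 1})`. -/
def IsKnotComplement (X : Type) [TopologicalSpace X] : Prop :=
  ∃ (N : Type) (_ : TopologicalSpace N), IsClosedOrientableManifold 3 N ∧
    ∃ e : Circle × ball (0 : ℂ) 2 → N, Topology.IsOpenEmbedding e ∧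
      Nonempty (X ≃ₜ {x : N // x ∉ e '' {p | ‖(p.2 : ℂ)‖ < 1}})

/-! ### The surface and the manifold associated to a decorated Gauss diagram -/

/-- A decorated Gauss diagram: a Gauss diagram with a coloring of its cycles. -/
structure DecoratedGaussDiagram extends GaussDiagram where
  /-- the number of colors -/
  numColors : ℕ
  /-- the colors of the cycles -/
  color : toGaussDiagram.Cycle → Fin numColors
  /-- all colors are used -/
  color_surjective : Function.Surjective color

namespace DecoratedGaussDiagram

variable (G : DecoratedGaussDiagram)

/-- A numbering of the cycles, used only to choose the places of the holes in spheres. -/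
def cycleIndex (z : G.Cycle) : ℕ := (Finite.equivFin G.Cycle z : ℕ)

/-- The sphere with holes of a given color: one hole for each cycle of this color. -/
abbrev Region (c : Fin G.numColors) : Type := HoledSphere {j | ∃ z, G.color z = c ∧ G.cycleIndex z = j}

/-- The boundary component of the ribbon graph given by the cycle `z` consists of the sides
`a, next a, next (next a), …` of edges, where `a` is any side in `z`. It is glued at constant speed
to the boundary of the corresponding hole, reversing the boundary orientations. -/
inductive RegionRel : (G.RibbonGraph ⊕ Σ c, G.Region c) → (G.RibbonGraph ⊕ Σ c, G.Region c) → Prop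
  | glue (z : G.Cycle) (i : ℕ) (t : ℝ) (ht : t ∈ Icc (0 : ℝ) 1) (p : G.Region (G.color z))
      (hp : p.IsBoundaryPoint (G.cycleIndex z)
        (Circle.exp (2 * Real.pi * (i + t) / Function.minimalPeriod G.next (Quot.out z)))) :
      RegionRel (.inl (G.arcPoint (G.next^[i] (Quot.out z)) t)) (.inr ⟨G.color z, p⟩)

/-- The closed surface associated to a decorated Gauss diagram. -/
def Surface : Type := Quot G.RegionRel

instance : TopologicalSpace G.Surface := inferInstanceAs (TopologicalSpace (Quot _))

/-- The annulus in the surface around the curve given by the circle `c`. -/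
def annulus (c : G.Circles) (p : Circle × Icc (-1 : ℝ) 1) : G.Surface :=
  Quot.mk _ (.inl (Quot.mk _ (c, p)))

/-- The end of `[-1, 1]` at which the curves of the family `s` are placed. -/
def level (s : Bool) : Icc (-1 : ℝ) 1 := if s then ⟨1, by norm_num⟩ else ⟨-1, by norm_num⟩

/-- The collar `S × [-1, 1]` of the surface, together with a 2-handle `D² × [-1, 1]` for each circle
of `𝓜⁺` and `𝓜⁻`, before gluing. -/
abbrev CollarAndHandles : Type :=
  (G.Surface × Icc (-1 : ℝ) 1) ⊕ (G.Circles × closedBall (0 : ℂ) 1 × Icc (-1 : ℝ) 1)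

/-- The 2-handles are attached along the curves of `𝓜⁺ × {1}` and `𝓜⁻ × {-1}`. -/
inductive HandleRel : G.CollarAndHandles → G.CollarAndHandles → Prop
  | glue (c : G.Circles) (w : Circle) (t : Icc (-1 : ℝ) 1) (d : closedBall (0 : ℂ) 1)
      (hd : (d : ℂ) = w) :
      HandleRel (.inl (G.annulus c (w, t), level c.1)) (.inr (c, d, t))

/-- The manifold obtained from the collar by attaching the 2-handles. -/
def HandleManifold : Type := Quot G.HandleRel

instance : TopologicalSpace G.HandleManifold := inferInstanceAs (TopologicalSpace (Quot _))

/-- The boundary of the collar with handles on the side of the family `s`: the result of the surgery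
of `S × {±1}` along the curves of this family. -/
def surgered (s : Bool) : Set G.HandleManifold :=
  (fun x : G.Surface => (Quot.mk _ (.inl (x, level s)) : G.HandleManifold)) ''
      {x | ∀ (i : Fin (G.numCircles s)) (w : Circle) (t : Icc (-1 : ℝ) 1),
        (t : ℝ) ∈ Ioo (-1 : ℝ) 1 → x ≠ G.annulus ⟨s, i⟩ (w, t)} ∪
    {q | ∃ (i : Fin (G.numCircles s)) (d : closedBall (0 : ℂ) 1) (t : Icc (-1 : ℝ) 1),
        ((t : ℝ) = -1 ∨ (t : ℝ) = 1) ∧ q = Quot.mk _ (.inr (⟨s, i⟩, d, t))}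

/-- The underlying space of a connected component of the surgered surface. -/
abbrev Component {s : Bool} (C : ConnectedComponents (G.surgered s)) : Type :=
  {x : G.surgered s // (x : ConnectedComponents (G.surgered s)) = C}

/-- A component of the surgered surface is spherical if it is homeomorphic to the 2-sphere. -/
def IsSpherical {s : Bool} (C : ConnectedComponents (G.surgered s)) : Prop :=
  Nonempty (sphere (0 : EuclideanSpace ℝ (Fin 3)) 1 ≃ₜ G.Component C)

/-- The spherical boundary components on both sides. -/
abbrev Spheres : Type := Σ s : Bool, {C : ConnectedComponents (G.surgered s) // G.IsSpherical C}

/-- The spherical boundary components are filled with 3-balls. -/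
inductive FillRel :
    (G.HandleManifold ⊕ Σ _ : G.Spheres, closedBall (0 : EuclideanSpace ℝ (Fin 3)) 1) →
    (G.HandleManifold ⊕ Σ _ : G.Spheres, closedBall (0 : EuclideanSpace ℝ (Fin 3)) 1) → Prop
  | glue (B : G.Spheres) (v : sphere (0 : EuclideanSpace ℝ (Fin 3)) 1) :
      FillRel (.inl (Classical.choice B.2.2 v).1.1)
        (.inr ⟨B, ⟨v.1, sphere_subset_closedBall v.2⟩⟩)

/-- The 3-manifold (in general with boundary) associated to a decorated Gauss diagram. -/
def Manifold : Type := Quot G.FillRel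

instance : TopologicalSpace G.Manifold := inferInstanceAs (TopologicalSpace (Quot _))

/-- The components of the inner boundary `∂⁻H^±` of the compression body `H^±`: the components of
the surgered surface that have not been filled with balls. -/
abbrev InnerBoundary (s : Bool) : Type :=
  {C : ConnectedComponents (G.surgered s) // ¬ G.IsSpherical C}

/-- `∂g^± = k`: the genera of the components of the inner boundary `∂⁻H^±` have the sum `k`. Here
a surface has genus `m` if it is homeomorphic to the closed orientable surface of genus `m`. -/
def BoundaryGenus (s : Bool) (k : ℕ) : Prop :=
  ∃ γ : G.InnerBoundary s → ℕ,
    (∀ C, Nonempty (G.Component C.1 ≃ₜ GenusSurface (γ C))) ∧ HasSum γ k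

end DecoratedGaussDiagram

end

open Set Metric
open scoped Topology

noncomputable section

set_option linter.unusedSectionVars false
set_option linter.unusedVariables false

/-! The space is built by explicit gluings, so the theorem says that these gluings produce an
oriented 3-manifold whose only boundary is the unfilled part of the two surgered surfaces.

Topology. Every quotient glues disjoint closed parts of a compact Hausdorff space along a closed
partial bijection (`IsGluing`), so it is again compact Hausdorff and its identifications are known
exactly. Charts then cost nothing but a comparison of fibres: two maps from one compact space that
make the same identifications induce a homeomorphism (`exists_openPartialHomeomorph_of_fibers`).

Interior. The ribbon graph without the cores of its annuli is a product collar of its boundary, and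
this boundary is traversed by the right turn rule (`mk_trap_eq_iff`, `exists_trap`). Hence a sphere
with holes together with its collar is a sphere minus finitely many points, which is planar
(`exists_regionPlot`). The products of these with the open interval and the handles, each thickened
by the collar below its annulus (`exists_handlePlot`), cover everything outside the two surgered
surfaces (`exists_interiorPlot_iff`).

Orientation. No smooth structure is available, so orientation is measured by the local degree of
transition maps (`OP`, `Compat`). On a crossing square the transition between an upper and a lower
handle is a rotation in suitable coordinates, whatever the sign of the chord (`compat_coupon`);
between a handle and a region it is a shear followed by polar coordinates and a holomorphic map
(`compat_slab`). So the interior is oriented (`compat_interiorPlots`).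

Filling. The surgered surfaces have collars (`exists_collar`) and finitely many components. A ball
or a solid torus glued to a component forms, with the open collar, an open set covered by one plot.
This plot meets the oriented part in a connected set, so after a possible reflection it is
compatible everywhere, provided that it can be compared at one point (`IsFilling.exists_atlas`).
Such a point exists because every component contains a sphere with holes, near whose point at
infinity the interior plot respects the levels of the collar (`exists_levelPlot`); and a level
preserving homeomorphism preserves or reverses the orientation, because a homeomorphism germ of the
plane has winding number `1` or `-1` (`exists_planar_homotopy`, `OPR.of_level`). This argument needs
no charts of the surgered surface.

Conclusion. An unfilled component has positive genus. If both sums are zero, everything is filled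
and the manifold is closed. If the sums are zero and one, exactly one component is unfilled, and it
is a torus (`genusSurface_one`). Filling it with a solid torus, along any parametrization, gives a
closed oriented manifold in which the core of the solid torus is the required knot
(`IsFilling.isKnotComplement`). -/

/-! ### Gluing compact Hausdorff spaces along closed partial bijections -/

/-- A closed relation which is a bijection between two disjoint closed parts of a space. -/
structure IsGluing {X : Type*} [TopologicalSpace X] (r : X → X → Prop) : Prop where
  closed : IsClosed {p : X × X | r p.1 p.2}
  right : ∀ {a b b'}, r a b → r a b' → b = b'
  left : ∀ {a a' b}, r a b → r a' b → a = a'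
  disj : ∀ {a b c}, r a b → ¬ r b c

namespace IsGluing

variable {X : Type*} [TopologicalSpace X] {r : X → X → Prop}

/-- Chains of identifications never get longer than one step: by `disj` a point cannot be both a
target and a source, and two steps through a common source or target cancel by `right` and `left`.
-/
theorem mk_eq_iff (hr : IsGluing r) {a b : X} :
    Quot.mk r a = Quot.mk r b ↔ a = b ∨ r a b ∨ r b a := by
  constructor
  · intro h
    have h' := Quot.eqvGen_exact h
    clear h
    induction h' with
    | rel x y h => exact Or.inr (Or.inl h)
    | refl x => exact Or.inl rfl
    | symm x y _ ih =>
        rcases ih with h | h | h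
        · exact Or.inl h.symm
        · exact Or.inr (Or.inr h)
        · exact Or.inr (Or.inl h)
    | trans x y z _ _ ih1 ih2 =>
        rcases ih1 with rfl | h | h
        · exact ih2
        · rcases ih2 with rfl | h2 | h2
          · exact Or.inr (Or.inl h)
          · exact (hr.disj h h2).elim
          · exact Or.inl (hr.left h h2)
        · rcases ih2 with rfl | h2 | h2
          · exact Or.inr (Or.inr h)
          · exact Or.inl (hr.right h h2)
          · exact (hr.disj h2 h).elim
  · rintro (rfl | h | h)
    · rfl
    · exact Quot.sound h
    · exact (Quot.sound h).symm

/-- By `mk_eq_iff` the saturation of a closed set adds only two projections of closed subsets of the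
square, and projections along a compact factor are closed. -/
theorem isClosedMap_mk [CompactSpace X] (hr : IsGluing r) :
    IsClosedMap (Quot.mk r) := by
  intro Z hZ
  have key : Quot.mk r ⁻¹' (Quot.mk r '' Z) =
      Z ∪ Prod.snd '' ({p : X × X | r p.1 p.2} ∩ Prod.fst ⁻¹' Z) ∪
        Prod.fst '' ({p : X × X | r p.1 p.2} ∩ Prod.snd ⁻¹' Z) := by
    ext x
    simp only [mem_preimage, mem_image, mem_union, mem_inter_iff, mem_ofPred_eq, Prod.exists,
      exists_eq_right, exists_and_right]
    constructor
    · rintro ⟨y, hy, h⟩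
      rcases hr.mk_eq_iff.1 h with rfl | h | h
      · exact Or.inl (Or.inl hy)
      · exact Or.inl (Or.inr ⟨y, h, hy⟩)
      · exact Or.inr ⟨y, h, hy⟩
    · rintro ((h | ⟨y, h, hy⟩) | ⟨y, h, hy⟩)
      · exact ⟨x, h, rfl⟩
      · exact ⟨y, hy, Quot.sound h⟩
      · exact ⟨y, hy, (Quot.sound h).symm⟩
  have : IsClosed (Quot.mk r ⁻¹' (Quot.mk r '' Z)) := by
    rw [key]
    refine (hZ.union ?_).union ?_
    · exact isClosedMap_snd_of_compactSpace _ (hr.closed.inter (hZ.preimage continuous_fst))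
    · exact isClosedMap_fst_of_compactSpace _ (hr.closed.inter (hZ.preimage continuous_snd))
  exact isQuotientMap_quot_mk.isClosed_preimage.1 this

/-- A closed quotient of a normal space: disjoint open neighbourhoods of two fibres are shrunk to
saturated ones by removing the images of their complements. -/
theorem t2Space [CompactSpace X] [T2Space X] (hr : IsGluing r) : T2Space (Quot r) := by
  have hcl := hr.isClosedMap_mk
  have hcont : Continuous (Quot.mk r) := continuous_quot_mk
  have hsing : ∀ q : Quot r, IsClosed ({q} : Set (Quot r)) := by
    intro q
    obtain ⟨x, rfl⟩ := Quot.exists_rep q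
    simpa using hcl {x} isClosed_singleton
  refine ⟨fun p q hpq => ?_⟩
  have h1 := (hsing p).preimage hcont
  have h2 := (hsing q).preimage hcont
  obtain ⟨U, V, hU, hV, hpU, hqV, hUV⟩ := normal_separation h1 h2
    (Disjoint.preimage _ (by simpa using hpq))
  refine ⟨(Quot.mk r '' Uᶜ)ᶜ, (Quot.mk r '' Vᶜ)ᶜ, (hcl _ hU.isClosed_compl).isOpen_compl,
    (hcl _ hV.isClosed_compl).isOpen_compl, ?_, ?_, ?_⟩
  · rintro ⟨x, hx, rfl⟩; exact hx (hpU rfl)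
  · rintro ⟨x, hx, rfl⟩; exact hx (hqV rfl)
  · rw [Set.disjoint_left]
    intro z hz hz'
    obtain ⟨x, rfl⟩ := Quot.exists_rep z
    by_cases hx : x ∈ U
    · exact hz' ⟨x, fun h => Set.disjoint_left.1 hUV hx h, rfl⟩
    · exact hz ⟨x, hx, rfl⟩

/-- A closed partial bijection parametrized by a compact space. -/
theorem of_compact {K : Type*} [TopologicalSpace K] [CompactSpace K] [T2Space X] {f g : K → X}
    (hf : Continuous f) (hg : Continuous g) (h : ∀ a b, r a b ↔ ∃ k, f k = a ∧ g k = b)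
    (hfg : ∀ k k', f k = f k' ↔ g k = g k') (hdisj : ∀ k k', g k ≠ f k') : IsGluing r where
  closed := by
    have : {p : X × X | r p.1 p.2} = range fun k => (f k, g k) := by
      ext p
      simp [h, Prod.ext_iff]
    rw [this]
    exact (isCompact_range (hf.prodMk hg)).isClosed
  right := by
    intro a b b' h1 h2
    obtain ⟨k, rfl, rfl⟩ := (h _ _).1 h1
    obtain ⟨k', h3, rfl⟩ := (h _ _).1 h2
    exact ((hfg _ _).1 h3).symm
  left := by
    intro a b b' h1 h2
    obtain ⟨k, rfl, rfl⟩ := (h _ _).1 h1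
    obtain ⟨k', rfl, h3⟩ := (h _ _).1 h2
    exact ((hfg _ _).2 h3).symm
  disj := by
    intro a b c h1 h2
    obtain ⟨k, rfl, rfl⟩ := (h _ _).1 h1
    obtain ⟨k', h3, rfl⟩ := (h _ _).1 h2
    exact hdisj _ _ h3.symm

end IsGluing

/-- Two maps from a compact space with the same fibres over open sets `U` and `V` of Hausdorff spaces
induce a homeomorphism of `U` and `V`. -/
theorem exists_openPartialHomeomorph_of_fibers {P A B : Type*} [TopologicalSpace P]
    [TopologicalSpace A] [TopologicalSpace B] [CompactSpace P] [Nonempty P] [T2Space A] [T2Space B]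
    {p : P → A} {q : P → B} (hp : Continuous p) (hq : Continuous q) {U : Set A} {V : Set B}
    (hU : IsOpen U) (hV : IsOpen V) (hUr : U ⊆ range p) (hVr : V ⊆ range q)
    (hUV : ∀ x, p x ∈ U ↔ q x ∈ V)
    (hfib : ∀ x y, p x ∈ U → p y ∈ U → (p x = p y ↔ q x = q y)) :
    ∃ e : OpenPartialHomeomorph A B, e.source = U ∧ e.target = V ∧ (∀ x, p x ∈ U → e (p x) = q x) ∧
      ∀ x, p x ∈ U → e.symm (q x) = p x := by
  choose! f hf using fun a (ha : a ∈ U) => hUr ha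
  choose! g hg using fun a (ha : a ∈ V) => hVr ha
  have hqf : ∀ a ∈ U, q (f a) ∈ V := fun a ha => (hUV _).1 (by rw [hf a ha]; exact ha)
  have hpg : ∀ a ∈ V, p (g a) ∈ U := fun a ha => (hUV _).2 (by rw [hg a ha]; exact ha)
  have h1 : ∀ x, p x ∈ U → q (f (p x)) = q x := fun x hx =>
    (hfib _ _ (by rw [hf _ hx]; exact hx) hx).1 (hf _ hx)
  have h2 : ∀ x, p x ∈ U → p (g (q x)) = p x := fun x hx =>
    (hfib _ _ (hpg _ ((hUV _).1 hx)) hx).2 (hg _ ((hUV _).1 hx))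
  have hpc : IsClosedMap p := hp.isClosedMap
  have hqc : IsClosedMap q := hq.isClosedMap
  refine ⟨{ toFun := fun a => q (f a), invFun := fun b => p (g b), source := U, target := V,
            map_source' := hqf, map_target' := hpg,
            left_inv' := fun a ha => ?_, right_inv' := fun b hb => ?_,
            open_source := hU, open_target := hV,
            continuousOn_toFun := ?_, continuousOn_invFun := ?_ }, rfl, rfl, h1, h2⟩
  · have := h2 (f a) (by rw [hf a ha]; exact ha)
    rw [this, hf a ha]
  · have := h1 (g b) (hpg b hb)
    rw [this, hg b hb]
  · rw [continuousOn_iff_isClosed]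
    intro Z hZ
    -- Over `U` the preimage of `Z` does not depend on the choice of the lifts, since the fibres
    -- agree; it is therefore the trace of the image of a closed set under the closed map `p`.
    refine ⟨p '' (q ⁻¹' Z), hpc _ (hZ.preimage hq), ?_⟩
    ext a
    constructor
    · rintro ⟨h, ha⟩
      exact ⟨⟨f a, h, hf a ha⟩, ha⟩
    · rintro ⟨⟨x, hx, rfl⟩, ha⟩
      refine ⟨?_, ha⟩
      simp only [mem_preimage, h1 x ha]
      exact hx
  · rw [continuousOn_iff_isClosed]
    intro Z hZ
    refine ⟨q '' (p ⁻¹' Z), hqc _ (hZ.preimage hp), ?_⟩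
    ext a
    constructor
    · rintro ⟨h, ha⟩
      exact ⟨⟨g a, h, hg a ha⟩, ha⟩
    · rintro ⟨⟨x, hx, rfl⟩, ha⟩
      refine ⟨?_, ha⟩
      have hx' := (hUV x).2 ha
      simp only [mem_preimage, h2 x hx']
      exact hx

/-! ### Local orientation behaviour of maps -/

section OP

variable {F : Type*} [NormedAddCommGroup F] [NormedSpace ℝ F]

/-- The punctured open ball. -/
abbrev PBall (F : Type*) [NormedAddCommGroup F] (r : ℝ) : Type _ := {v : F // v ≠ 0 ∧ ‖v‖ < r}

/-- The nonzero vectors. -/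
abbrev NZ (F : Type*) [NormedAddCommGroup F] : Type _ := {v : F // v ≠ 0}

/-- The inclusion of a punctured ball. -/
def PBall.incl (F : Type*) [NormedAddCommGroup F] (r : ℝ) : C(PBall F r, NZ F) :=
  ⟨fun v => ⟨v.1, v.2.1⟩, by fun_prop⟩

/-- The inclusion of punctured balls. -/
def PBall.res {F : Type*} [NormedAddCommGroup F] {r s : ℝ} (h : r ≤ s) : C(PBall F r, PBall F s) :=
  ⟨fun v => ⟨v.1, v.2.1, v.2.2.trans_le h⟩, by fun_prop⟩

/-- `f` has local degree one at `x`: its increments at `x` are homotopic to the inclusion, as maps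
from a punctured ball to the nonzero vectors. -/
def OP (f : F → F) (x : F) : Prop :=
  ∃ r > 0, ∃ φ : C(PBall F r, NZ F), (∀ v, (φ v : F) = f (x + v) - f x) ∧
    (PBall.incl F r).Homotopic φ

theorem OP.restrict {f : F → F} {x : F} {r s : ℝ} (h : s ≤ r) {φ : C(PBall F r, NZ F)}
    (hφ : ∀ v, (φ v : F) = f (x + v) - f x) (hh : (PBall.incl F r).Homotopic φ) :
    (∀ v, ((φ.comp (PBall.res h)) v : F) = f (x + v) - f x) ∧
      (PBall.incl F s).Homotopic (φ.comp (PBall.res h)) :=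
  ⟨fun v => hφ _, hh.comp (ContinuousMap.Homotopic.refl (PBall.res h))⟩

theorem OP.congr {f g : F → F} {x : F} (hf : OP f x) (h : f =ᶠ[𝓝 x] g) : OP g x := by
  obtain ⟨r, hr, φ, h1, h2⟩ := hf
  obtain ⟨s, hs, hs'⟩ := Metric.eventually_nhds_iff.1 h
  obtain ⟨h3, h4⟩ := OP.restrict (min_le_left r s) h1 h2
  refine ⟨min r s, lt_min hr hs, _, fun v => ?_, h4⟩
  rw [h3, hs' (by simpa using hs : dist x x < s), hs' (y := x + v)]
  simpa using v.2.2.trans_le (min_le_right _ _)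

/-- `f` is continuous near `x` and takes its value at `x` only once near `x`. -/
def Tame (f : F → F) (x : F) : Prop :=
  ∃ r > 0, ContinuousOn f (ball x r) ∧ ∀ y ∈ ball x r, y ≠ x → f y ≠ f x

/-- The increments of a map. -/
def diffMap (f : F → F) (x : F) (r : ℝ) (hc : ContinuousOn f (ball x r))
    (hn : ∀ y ∈ ball x r, y ≠ x → f y ≠ f x) : C(PBall F r, NZ F) :=
  ⟨fun v => ⟨f (x + v) - f x, sub_ne_zero.2 (hn _ (by simpa using v.2.2) (by simpa using v.2.1))⟩, by
    refine Continuous.subtype_mk (Continuous.sub ?_ continuous_const) _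
    exact hc.comp_continuous (by fun_prop) fun v => by simpa using v.2.2⟩

theorem Tame.of_injOn {f : F → F} {x : F} {U : Set F} (hU : IsOpen U) (hx : x ∈ U)
    (hc : ContinuousOn f U) (hi : InjOn f U) : Tame f x := by
  obtain ⟨r, hr, h⟩ := Metric.isOpen_iff.1 hU x hx
  exact ⟨r, hr, hc.mono h, fun y hy hne he => hne (hi (h hy) hx he)⟩

theorem Tame.continuousAt {f : F → F} {x : F} (h : Tame f x) : ContinuousAt f x := by
  obtain ⟨r, hr, h1, _⟩ := h
  exact h1.continuousAt (ball_mem_nhds _ hr)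

theorem exists_small {f : F → F} {x : F} (h : ContinuousAt f x) {s : ℝ} (hs : 0 < s) :
    ∃ r > 0, ∀ v : F, ‖v‖ < r → ‖f (x + v) - f x‖ < s := by
  obtain ⟨r, hr, h⟩ := Metric.continuousAt_iff.1 h s hs
  refine ⟨r, hr, fun v hv => ?_⟩
  rw [← dist_eq_norm]
  exact h (by simpa using hv)

/-- After shrinking, the increments of `f` land in the punctured ball on which those of `g` are
homotopic to the inclusion; composing the two homotopies suffices. -/
theorem OP.comp {f g : F → F} {x : F} (hf : OP f x) (hg : OP g (f x)) (hc : ContinuousAt f x) :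
    OP (g ∘ f) x := by
  obtain ⟨r, hr, φ, h1, h2⟩ := hf
  obtain ⟨s, hs, ψ, h3, h4⟩ := hg
  obtain ⟨δ, hδ, hδ'⟩ := exists_small hc hs
  obtain ⟨h5, h6⟩ := OP.restrict (min_le_left r δ) h1 h2
  set φ' := φ.comp (PBall.res (min_le_left r δ)) with hφ'
  let φ'' : C(PBall F (min r δ), PBall F s) := ⟨fun v => ⟨φ' v, (φ' v).2, by
    rw [h5]; exact hδ' _ (v.2.2.trans_le (min_le_right _ _))⟩, by fun_prop⟩
  refine ⟨min r δ, lt_min hr hδ, ψ.comp φ'', fun v => ?_, ?_⟩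
  · have : ((φ'' v : PBall F s) : F) = f (x + v) - f x := h5 v
    simp [h3, this]
  · refine h6.trans ?_
    have h7 : φ' = (PBall.incl F s).comp φ'' := by ext v; rfl
    rw [h7]
    exact h4.comp (ContinuousMap.Homotopic.refl φ'')

/-- All explicit orientation computations go through this form: a real-parameter homotopy that does
not vanish on a punctured ball carries the local degree from one pair of map and point to another.
-/
theorem OP.of_homotopy {f g : F → F} {x y : F} (hg : OP g y) {r : ℝ} (hr : 0 < r)
    (K : ℝ → F → F) (hK : ContinuousOn (Function.uncurry K) (Icc 0 1 ×ˢ {v | v ≠ 0 ∧ ‖v‖ < r}))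
    (h0 : ∀ v, v ≠ 0 → ‖v‖ < r → K 0 v = g (y + v) - g y)
    (h1 : ∀ v, v ≠ 0 → ‖v‖ < r → K 1 v = f (x + v) - f x)
    (hn : ∀ s ∈ Icc (0 : ℝ) 1, ∀ v, v ≠ 0 → ‖v‖ < r → K s v ≠ 0) : OP f x := by
  obtain ⟨s, hs, φ, h3, h4⟩ := hg
  obtain ⟨h5, h6⟩ := OP.restrict (min_le_left s r) h3 h4
  have hlt : ∀ v : PBall F (min s r), ‖v.1‖ < r := fun v => v.2.2.trans_le (min_le_right _ _)
  let H : C(unitInterval × PBall F (min s r), NZ F) :=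
    ⟨fun p => ⟨K p.1 p.2, hn _ p.1.2 _ p.2.2.1 (hlt p.2)⟩, by
      refine Continuous.subtype_mk ?_ _
      exact hK.comp_continuous (f := fun p : unitInterval × PBall F (min s r) => ((p.1 : ℝ), (p.2 : F)))
        (by fun_prop) fun p => ⟨p.1.2, p.2.2.1, hlt p.2⟩⟩
  refine ⟨min s r, lt_min hs hr, H.comp ⟨fun v => (1, v), by fun_prop⟩, fun v => ?_, ?_⟩
  · exact h1 v v.2.1 (hlt v)
  · refine h6.trans ⟨⟨H, fun v => ?_, fun v => rfl⟩⟩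
    refine Subtype.ext ?_
    rw [h5]
    exact h0 v v.2.1 (hlt v)

theorem OP.id (x : F) : OP (fun v => v) x :=
  ⟨1, one_pos, PBall.incl F 1, fun v => by simp [PBall.incl], ContinuousMap.Homotopic.refl _⟩

theorem OP.of_straight_aux {f g : F → F} {x y : F} (hg : OP g y) {r : ℝ} (hr : 0 < r)
    (hfc : ContinuousOn f (ball x r)) (hgc : ContinuousOn g (ball y r))
    (hn : ∀ s ∈ Icc (0 : ℝ) 1, ∀ v, v ≠ 0 → ‖v‖ < r →
      (1 - s) • (g (y + v) - g y) + s • (f (x + v) - f x) ≠ 0) : OP f x := by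
  refine hg.of_homotopy hr (fun s v => (1 - s) • (g (y + v) - g y) + s • (f (x + v) - f x)) ?_
    (by simp) (by simp) hn
  have h1 : ContinuousOn (fun p : ℝ × F => g (y + p.2)) (Icc 0 1 ×ˢ {v | v ≠ 0 ∧ ‖v‖ < r}) :=
    hgc.comp (by fun_prop) fun p hp => by simpa using hp.2.2
  have h2 : ContinuousOn (fun p : ℝ × F => f (x + p.2)) (Icc 0 1 ×ˢ {v | v ≠ 0 ∧ ‖v‖ < r}) :=
    hfc.comp (by fun_prop) fun p hp => by simpa using hp.2.2
  simp only [Function.uncurry_def]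
  exact ((continuousOn_const.sub continuousOn_fst).smul (h1.sub continuousOn_const)).add
    (continuousOn_fst.smul (h2.sub continuousOn_const))

theorem OP.of_straight {f : F → F} {x : F} {r : ℝ} (hr : 0 < r)
    (hfc : ContinuousOn f (ball x r))
    (hn : ∀ s ∈ Icc (0 : ℝ) 1, ∀ v, v ≠ 0 → ‖v‖ < r →
      (1 - s) • v + s • (f (x + v) - f x) ≠ 0) : OP f x :=
  (OP.id (0 : F)).of_straight_aux hr hfc continuousOn_id (by simpa using hn)

/-- The local degree of an injective map is constant on convex sets. -/
theorem OP.of_convex {f : F → F} {U : Set F} (hU : IsOpen U) (hUc : Convex ℝ U)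
    (hc : ContinuousOn f U) (hi : InjOn f U) {x y : F} (hx : x ∈ U) (hy : y ∈ U) (h : OP f x) :
    OP f y := by
  obtain ⟨r, hr, h1⟩ := Metric.isOpen_iff.1 hU x hx
  obtain ⟨r', hr', h2⟩ := Metric.isOpen_iff.1 hU y hy
  have hmem : ∀ s ∈ Icc (0 : ℝ) 1, ∀ v, ‖v‖ < min r r' → ((1 - s) • x + s • y) + v ∈ U := by
    intro s hs v hv
    have : ((1 - s) • x + s • y) + v = (1 - s) • (x + v) + s • (y + v) := by module
    rw [this]
    refine hUc (h1 ?_) (h2 ?_) (by linarith [hs.2]) hs.1 (by ring)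
    · simpa using hv.trans_le (min_le_left _ _)
    · simpa using hv.trans_le (min_le_right _ _)
  have hmem0 : ∀ s ∈ Icc (0 : ℝ) 1, ((1 - s) • x + s • y) ∈ U := fun s hs => by
    simpa using hmem s hs 0 (by simpa using And.intro hr hr')
  -- The base point moves along the segment from `x` to `y`; injectivity keeps the increments away
  -- from zero.
  refine h.of_homotopy (lt_min hr hr')
    (fun s v => f (((1 - s) • x + s • y) + v) - f ((1 - s) • x + s • y)) ?_ (by simp) (by simp) ?_
  · refine ContinuousOn.sub ?_ ?_
    · exact hc.comp (f := fun p : ℝ × F => ((1 - p.1) • x + p.1 • y) + p.2) (by fun_prop)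
        fun p hp => hmem _ hp.1 _ hp.2.2
    · exact hc.comp (f := fun p : ℝ × F => ((1 - p.1) • x + p.1 • y)) (by fun_prop)
        fun p hp => hmem0 _ hp.1
  · intro s hs v hv hvr he
    have := hi (hmem s hs v hvr) (hmem0 s hs) (sub_eq_zero.1 he)
    exact hv (by simpa using this)

/-- Cancellation on the right: the increments of `T`, applied along the homotopy from the inclusion
to the increments of `f`, join the increments of `T` to those of `T ∘ f`. The homotopy has to stay
where `T` is controlled, hence the rescaling in the proof. This lemma yields inverses and changes of
parametrization without any degree theory. -/
theorem OP.of_comp {f T : F → F} {x : F} (hTf : OP (T ∘ f) x) (hf : OP f x)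
    (hc : ContinuousAt f x) (hT : Tame T (f x)) : OP T (f x) := by
  obtain ⟨s, hs, hTc, hTn⟩ := hT
  obtain ⟨r₁, hr₁, ψ, h1, h2⟩ := hTf
  obtain ⟨r₂, hr₂, φ, h3, ⟨K⟩⟩ := hf
  obtain ⟨δ, hδ, hδ'⟩ := exists_small hc hs
  set τ := diffMap T (f x) s hTc hTn with hτ
  obtain ⟨r, hr, hrr⟩ : ∃ r > 0, r ≤ r₁ ∧ r ≤ r₂ ∧ r ≤ δ ∧ r ≤ s :=
    ⟨min (min r₁ r₂) (min δ s), by positivity, by simp, by simp, by simp, by simp⟩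
  obtain ⟨hrr₁, hrr₂, hrδ, hrs⟩ := hrr
  obtain ⟨h5, h6⟩ := OP.restrict hrr₁ h1 h2
  -- the rescaled homotopy
  have hK0 : ∀ p, (K p : F) ≠ 0 := fun p => (K p).2
  have hφ : ∀ v : PBall F r, ‖(φ (PBall.res hrr₂ v) : F)‖ < s := fun v => by
    rw [h3]; exact hδ' _ (v.2.2.trans_le hrδ)
  have hφ0 : ∀ v : PBall F r, 0 < ‖(φ (PBall.res hrr₂ v) : F)‖ := fun v => by
    simpa using (φ (PBall.res hrr₂ v)).2
  -- The direction is taken from `K` and the length from `c`, which interpolates between the lengths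
  -- of the two ends. Both are less than `s`, so the modified homotopy remains in the ball where `T`
  -- is tame.
  let c : unitInterval × PBall F r → ℝ := fun p =>
    ((1 - (p.1 : ℝ)) * ‖(p.2 : F)‖ + p.1 * ‖(φ (PBall.res hrr₂ p.2) : F)‖)
  have hc0 : ∀ p, 0 < c p := fun p => by
    have h7 : 0 < ‖(p.2 : F)‖ := by simpa using p.2.2.1
    have h8 := hφ0 p.2
    rcases eq_or_lt_of_le p.1.2.1 with h | h
    · simp only [c, ← h]; simpa using p.2.2.1
    · have : 0 ≤ (1 - (p.1 : ℝ)) := by linarith [p.1.2.2]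
      simp only [c]; positivity
  have hcs : ∀ p, c p < s := fun p => by
    have h7 : ‖(p.2 : F)‖ < s := p.2.2.2.trans_le hrs
    have h8 := hφ p.2
    have h9 : 0 ≤ (p.1 : ℝ) := p.1.2.1
    have h10 : (p.1 : ℝ) ≤ 1 := p.1.2.2
    have : c p ≤ max ‖(p.2 : F)‖ ‖(φ (PBall.res hrr₂ p.2) : F)‖ := by
      simp only [c]
      nlinarith [le_max_left ‖(p.2 : F)‖ ‖(φ (PBall.res hrr₂ p.2) : F)‖,
        le_max_right ‖(p.2 : F)‖ ‖(φ (PBall.res hrr₂ p.2) : F)‖]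
    exact this.trans_lt (max_lt h7 h8)
  have hcc : Continuous c := by fun_prop
  let k : unitInterval × PBall F r → F := fun p => (K (p.1, PBall.res hrr₂ p.2) : F)
  have hkc : Continuous k := by fun_prop
  have hk0 : ∀ p, ‖k p‖ ≠ 0 := fun p => by simpa using hK0 _
  let K' : C(unitInterval × PBall F r, PBall F s) := ⟨fun p => ⟨(c p / ‖k p‖) • k p, by
      refine ⟨smul_ne_zero (div_ne_zero (hc0 p).ne' (hk0 p)) (by simpa using hk0 p), ?_⟩
      rw [norm_smul, norm_div, norm_norm, div_mul_cancel₀ _ (hk0 p), Real.norm_of_nonneg (hc0 p).le]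
      exact hcs p⟩, by
    refine Continuous.subtype_mk ?_ _
    exact (hcc.div (by fun_prop) hk0).smul hkc⟩
  refine ⟨r, hr, τ.comp (PBall.res hrs), fun v => rfl, h6.trans ?_⟩
  symm
  refine ⟨⟨τ.comp K', fun v => ?_, fun v => ?_⟩⟩
  · have : K' (0, v) = PBall.res hrs v := by
      refine Subtype.ext ?_
      have h1 : k (0, v) = (v : F) := by
        simp only [k, K.apply_zero]; rfl
      have h2 : c (0, v) = ‖(v : F)‖ := by simp [c]
      have h3 : ‖(v : F)‖ ≠ 0 := by simpa using v.2.1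
      simp [K', h1, h2, h3, PBall.res]
    simp [this]
  · have h1 : ((K' (1, v) : PBall F s) : F) = f (x + v) - f x := by
      have h1 : k (1, v) = f (x + v) - f x := by
        simp only [k, K.apply_one, h3]; rfl
      have h2 : c (1, v) = ‖f (x + v) - f x‖ := by simp [c, h3, PBall.res]
      have h4 : ‖f (x + v) - f x‖ ≠ 0 := by rw [← h1]; exact hk0 _
      simp [K', h1, h2, h4]
    refine Subtype.ext ?_
    have h7 := h5 v
    simp only [Function.comp_apply] at h7
    rw [h7]
    change T (f x + (K' (1, v) : PBall F s)) - T (f x) = _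
    rw [h1]; simp

/-- The inclusion is conjugated to the inclusion by every linear isomorphism, even by one that
reverses orientation. This allows both changing the model space and moving a reflection past a map.
-/
theorem OP.conj {F' : Type*} [NormedAddCommGroup F'] [NormedSpace ℝ F'] (L : F ≃L[ℝ] F')
    {f : F → F} {x : F} (hf : OP f x) : OP (L ∘ f ∘ L.symm) (L x) := by
  obtain ⟨r, hr, φ, h1, h2⟩ := hf
  have hLs : ContinuousAt (fun v => ‖L.symm v‖) 0 := by fun_prop
  obtain ⟨r', hr', h3⟩ := Metric.continuousAt_iff.1 hLs r hr
  have h4 : ∀ v : F', ‖v‖ < r' → ‖L.symm v‖ < r := fun v hv => by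
    simpa using h3 (x := v) (by simpa using hv)
  let j : C(PBall F' r', PBall F r) := ⟨fun v => ⟨L.symm v, by simpa using v.2.1, h4 _ v.2.2⟩,
    by fun_prop⟩
  let l : C(NZ F, NZ F') := ⟨fun v => ⟨L v, by simpa using v.2⟩, by fun_prop⟩
  refine ⟨r', hr', l.comp (φ.comp j), fun v => ?_, ?_⟩
  · have : (l.comp (φ.comp j) v : F') = L (f (x + L.symm v) - f x) := by
      exact congrArg L (h1 (j v))
    rw [this]; simp
  · have h5 : PBall.incl F' r' = l.comp ((PBall.incl F r).comp j) := by
      ext v; simp [PBall.incl, l, j]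
    rw [h5]
    exact (ContinuousMap.Homotopic.refl l).comp (h2.comp (ContinuousMap.Homotopic.refl j))

end OP

/-- The homotopy is restricted to a sphere of small radius `ρ`. It is multiplied by a positive
factor running from `ρ⁻¹` to `1`, because the homotopy in the definition of `PreservesOrientationAt`
starts at `v` and not at `ρ • v`. -/
theorem PreservesOrientationAt.of_OP {n : ℕ}
    {e : OpenPartialHomeomorph (EuclideanSpace ℝ (Fin n)) (EuclideanSpace ℝ (Fin n))}
    {x : EuclideanSpace ℝ (Fin n)} (hx : x ∈ e.source) (h : OP e x) :
    PreservesOrientationAt e x := by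
  obtain ⟨r, hr, φ, h1, ⟨K⟩⟩ := h
  obtain ⟨s, hs, hs'⟩ := Metric.isOpen_iff.1 e.open_source x hx
  set ρ := min r s / 2 with hρ
  have hρ0 : 0 < ρ := by positivity
  have hρr : ρ < r := by rw [hρ]; linarith [min_le_left r s, lt_min hr hs]
  have hρs : ρ < s := by rw [hρ]; linarith [min_le_right r s, lt_min hr hs]
  let j : C(sphere (0 : EuclideanSpace ℝ (Fin n)) 1, PBall (EuclideanSpace ℝ (Fin n)) r) :=
    ⟨fun v => ⟨ρ • (v : EuclideanSpace ℝ (Fin n)), smul_ne_zero hρ0.ne' (by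
        have := v.2; intro h; simp [h] at this), by
        have : ‖(v : EuclideanSpace ℝ (Fin n))‖ = 1 := by simp
        rw [norm_smul, this, mul_one, Real.norm_of_nonneg hρ0.le]; exact hρr⟩, by fun_prop⟩
  refine ⟨ρ, hρ0, (closedBall_subset_ball hρs).trans hs',
    ⟨fun p => ((1 - (p.1 : ℝ)) * ρ⁻¹ + p.1) • (K (p.1, j p.2) : EuclideanSpace ℝ (Fin n)),
      by fun_prop⟩, fun p => ?_, fun v => ?_, fun v => ?_⟩
  · refine smul_ne_zero ?_ (K _).2
    have h1 : 0 ≤ (p.1 : ℝ) := p.1.2.1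
    have h2 : (p.1 : ℝ) ≤ 1 := p.1.2.2
    have h3 : 0 < ρ⁻¹ := by positivity
    rcases eq_or_lt_of_le h1 with h | h
    · rw [← h]; simpa using h3.ne'
    · have : 0 ≤ (1 - (p.1 : ℝ)) * ρ⁻¹ := mul_nonneg (by linarith) h3.le
      linarith
  · have : (K (0, j v) : EuclideanSpace ℝ (Fin n)) = ρ • (v : EuclideanSpace ℝ (Fin n)) := by
      rw [K.apply_zero]; rfl
    simp only [ContinuousMap.coe_mk, this, smul_smul]
    simp [hρ0.ne']
  · have := h1 (j v)
    simp only [ContinuousMap.coe_mk, K.apply_one, this]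
    simp [j]

/-! ### Compatibly oriented plots -/

section Plots

variable {F : Type*} [NormedAddCommGroup F] [NormedSpace ℝ F] {M : Type*} [TopologicalSpace M]

/-- The plots `e` and `e'` of `M` induce the same orientation at `m`. -/
def Compat (e e' : OpenPartialHomeomorph F M) (m : M) : Prop :=
  m ∈ e.target ∧ m ∈ e'.target ∧ OP (fun x => e'.symm (e x)) (e.symm m)

theorem tame_transition (e e' : OpenPartialHomeomorph F M) {m : M} (h : m ∈ e.target)
    (h' : m ∈ e'.target) : Tame (fun x => e'.symm (e x)) (e.symm m) :=
  Tame.of_injOn (e.trans e'.symm).open_source (by simp [h, h'])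
    (e.trans e'.symm).continuousOn (e.trans e'.symm).injOn

theorem Compat.refl (e : OpenPartialHomeomorph F M) {m : M} (h : m ∈ e.target) :
    Compat e e m := by
  refine ⟨h, h, (OP.id _).congr ?_⟩
  filter_upwards [e.open_source.mem_nhds (e.map_target h)] with x hx
  simp [hx]

theorem eventually_symm (e : OpenPartialHomeomorph F M) {m : M} (h : m ∈ e.target) {s : Set M}
    (hs : s ∈ 𝓝 m) : ∀ᶠ x in 𝓝 (e.symm m), x ∈ e.source ∧ e x ∈ s := by
  have h1 := e.map_target h
  have h2 : s ∈ 𝓝 (e (e.symm m)) := by rwa [e.right_inv h]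
  filter_upwards [e.open_source.mem_nhds h1, (e.continuousAt h1).preimage_mem_nhds h2] with x a b
    using ⟨a, b⟩

theorem Compat.trans {e e' e'' : OpenPartialHomeomorph F M} {m : M} (h : Compat e e' m)
    (h' : Compat e' e'' m) : Compat e e'' m := by
  refine ⟨h.1, h'.2.1, ?_⟩
  have h1 : e'.symm (e (e.symm m)) = e'.symm m := by rw [e.right_inv h.1]
  have h2 := h.2.2.comp (g := fun x => e''.symm (e' x)) (by rw [h1]; exact h'.2.2)
    (tame_transition e e' h.1 h.2.1).continuousAt
  refine h2.congr ?_
  filter_upwards [eventually_symm e h.1 (e'.open_target.mem_nhds h.2.1)] with x hx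
  simp [hx.2]

/-- The two transition maps compose to the identity, so `OP.of_comp` gives the degree of the
inverse. -/
theorem Compat.symm {e e' : OpenPartialHomeomorph F M} {m : M} (h : Compat e e' m) :
    Compat e' e m := by
  refine ⟨h.2.1, h.1, ?_⟩
  have h1 : e'.symm (e (e.symm m)) = e'.symm m := by rw [e.right_inv h.1]
  rw [← h1]
  refine OP.of_comp ((OP.id _).congr ?_) h.2.2 (tame_transition e e' h.1 h.2.1).continuousAt
    (by rw [h1]; exact tame_transition e' e h.2.1 h.1)
  filter_upwards [eventually_symm e h.1 (e'.open_target.mem_nhds h.2.1)] with x hx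
  simp [hx.2, hx.1]

/-- Transition maps are rarely explicit. Here both plots are compared through a common
parametrization of the space near the point, and the parametrization is cancelled by `OP.of_comp`.
-/
theorem Compat.of_param {e e' : OpenPartialHomeomorph F M} {f f' : F → F} {b : F} {m : M}
    (hm : e (f b) = m) (hf : OP f b)
    (hf' : OP f' b) (hc : ContinuousAt f b) (hc' : ContinuousAt f' b) (hs : f b ∈ e.source)
    (hs' : f' b ∈ e'.source) (h : ∀ᶠ x in 𝓝 b, e (f x) = e' (f' x)) : Compat e e' m := by
  subst hm
  have h0 := h.self_of_nhds
  have ht' : e (f b) ∈ e'.target := by rw [h0]; exact e'.map_source hs'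
  refine ⟨e.map_source hs, ht', ?_⟩
  have h1 := tame_transition e e' (e.map_source hs) ht'
  rw [e.left_inv hs] at h1 ⊢
  refine OP.of_comp (hf'.congr ?_) hf hc h1
  filter_upwards [h, hc'.preimage_mem_nhds (e'.open_source.mem_nhds hs')] with x hx hx'
  simp only [Function.comp_apply, hx]
  exact (e'.left_inv hx').symm

/-- The transition map is injective and continuous on a small ball, which is convex, so
`OP.of_convex` makes its local degree constant there. -/
theorem Compat.eventually_iff {e e' : OpenPartialHomeomorph F M} {m : M} (h : m ∈ e.target)
    (h' : m ∈ e'.target) : ∀ᶠ m' in 𝓝 m, (Compat e e' m' ↔ Compat e e' m) := by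
  have hx : e.symm m ∈ (e.trans e'.symm).source := by simp [h, h']
  obtain ⟨r, hr, hr'⟩ := Metric.isOpen_iff.1 (e.trans e'.symm).open_source _ hx
  have h1 := (e.continuousAt_symm h).preimage_mem_nhds (ball_mem_nhds _ hr)
  filter_upwards [h1, e.open_target.mem_nhds h, e'.open_target.mem_nhds h'] with m' hm' h2 h3
  have hc := (e.trans e'.symm).continuousOn.mono hr'
  have hi := (e.trans e'.symm).injOn.mono hr'
  refine ⟨fun H => ⟨h, h', ?_⟩, fun H => ⟨h2, h3, ?_⟩⟩
  · exact OP.of_convex isOpen_ball (convex_ball _ _) hc hi hm' (mem_ball_self hr) H.2.2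
  · exact OP.of_convex isOpen_ball (convex_ball _ _) hc hi (mem_ball_self hr) hm' H.2.2

/-- Local constancy lets compatibility pass to limit points; this handles the points where sides of
edges meet, at which the coordinates of a single side do not form a neighbourhood. -/
theorem Compat.of_closure {e e' : OpenPartialHomeomorph F M} {m : M} (h : m ∈ e.target)
    (h' : m ∈ e'.target) (hm : ∃ᶠ m' in 𝓝 m, Compat e e' m') : Compat e e' m := by
  obtain ⟨m', h1, h2⟩ := (hm.and_eventually (Compat.eventually_iff h h')).exists
  exact h2.1 h1

theorem eventually_iff_preconnected {X : Type*} [TopologicalSpace X] {W : Set X}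
    (hW : IsPreconnected W) {p : X → Prop} (hp : ∀ x ∈ W, ∀ᶠ y in 𝓝 x, (p y ↔ p x)) {x y : X}
    (hx : x ∈ W) (hy : y ∈ W) (h : p x) : p y := by
  by_contra hn
  have h1 : ∀ x ∈ W, p x → x ∈ interior {z | p z} := fun x hx h => by
    rw [mem_interior_iff_mem_nhds]
    filter_upwards [hp x hx] with z hz
    exact hz.2 h
  have h2 : ∀ x ∈ W, ¬ p x → x ∈ interior {z | ¬ p z} := fun x hx h => by
    rw [mem_interior_iff_mem_nhds]
    filter_upwards [hp x hx] with z hz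
    exact fun h' => h (hz.1 h')
  obtain ⟨z, _, hz, hz'⟩ := hW _ _ isOpen_interior isOpen_interior
    (fun z hz => by
      by_cases h' : p z
      · exact Or.inl (h1 z hz h')
      · exact Or.inr (h2 z hz h')) ⟨x, hx, h1 x hx h⟩ ⟨y, hy, h2 y hy hn⟩
  exact interior_subset hz' (interior_subset hz)

theorem Compat.map {N : Type*} [TopologicalSpace N] (a : OpenPartialHomeomorph M N)
    {e e' : OpenPartialHomeomorph F M} {m : M} (hm : m ∈ a.source) (h : Compat e e' m) :
    Compat (e.trans a) (e'.trans a) (a m) := by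
  refine ⟨by simp [hm, h.1], by simp [hm, h.2.1], ?_⟩
  have h1 : (e.trans a).symm (a m) = e.symm m := by simp [hm]
  rw [h1]
  refine h.2.2.congr ?_
  filter_upwards [eventually_symm e h.1 (a.open_source.mem_nhds hm)] with x hx
  simp [hx.2]

/-- Plots that cover a compact Hausdorff space and induce the same orientation make it a closed
orientable manifold. -/
theorem isClosedOrientableManifold_of_plots {n : ℕ} {N : Type} [TopologicalSpace N] [CompactSpace N]
    [T2Space N] (L : EuclideanSpace ℝ (Fin n) ≃L[ℝ] F) (A : Set (OpenPartialHomeomorph F N))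
    (hcov : ∀ m, ∃ e ∈ A, m ∈ e.target)
    (hA : ∀ e ∈ A, ∀ e' ∈ A, ∀ m ∈ e.target, m ∈ e'.target → Compat e e' m) :
    IsClosedOrientableManifold n N := by
  refine ⟨inferInstance, inferInstance, ?_⟩
  choose e he hm using hcov
  let ch : OpenPartialHomeomorph F N → OpenPartialHomeomorph N (EuclideanSpace ℝ (Fin n)) :=
    fun e => e.symm.trans L.symm.toHomeomorph.toOpenPartialHomeomorph
  refine ⟨{ atlas := ch '' A
            chartAt := fun m => ch (e m)
            mem_chart_source := fun m => by simp [ch, hm m]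
            chart_mem_atlas := fun m => ⟨e m, he m, rfl⟩ }, ?_⟩
  rintro _ ⟨e, he, rfl⟩ _ ⟨e', he', rfl⟩ x hx
  refine PreservesOrientationAt.of_OP hx ?_
  have h1 : L x ∈ e.source ∧ e (L x) ∈ e'.target := by
    simpa [ch] using hx
  have h2 := (hA e he e' he' (e (L x)) (e.map_source h1.1) h1.2).2.2
  rw [e.left_inv h1.1] at h2
  have h3 := OP.conj L.symm h2
  rw [ContinuousLinearEquiv.symm_apply_apply] at h3
  exact h3

end Plots

/-! ### Reflections -/

section Reflection

variable {F : Type*} [NormedAddCommGroup F] [NormedSpace ℝ F] {M : Type*} [TopologicalSpace M]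

/-- `f` has local degree one at `x` up to composition with `R`. -/
def OPR (R : F ≃L[ℝ] F) (f : F → F) (x : F) : Prop := OP f x ∨ OP (fun y => R (f y)) x

variable {R : F ≃L[ℝ] F}

/-- Since `R` is an involution, conjugation by it preserves local degree one. It can thus be moved
past a map, and two reflections cancel. -/
theorem OPR.comp (hR : ∀ v, R (R v) = v) {f g : F → F} {x : F} (hf : OPR R f x)
    (hg : OPR R g (f x)) (hc : ContinuousAt f x) : OPR R (fun y => g (f y)) x := by
  have hRs : ∀ v, R.symm v = R v := fun v => by
    rw [ContinuousLinearEquiv.symm_apply_eq, hR]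
  rcases hf with hf | hf <;> rcases hg with hg | hg
  · exact Or.inl (hf.comp hg hc)
  · exact Or.inr (hf.comp hg hc)
  · refine Or.inr ?_
    have h1 := OP.conj R hg
    have h2 := hf.comp h1 (R.continuous.continuousAt.comp hc)
    refine h2.congr (Filter.Eventually.of_forall fun y => ?_)
    simp
  · refine Or.inl ?_
    have h1 := OP.conj R hg
    have h2 := hf.comp h1 (R.continuous.continuousAt.comp hc)
    refine h2.congr (Filter.Eventually.of_forall fun y => ?_)
    simp [hR]

/-- The plot precomposed with `R`. -/
def reflPlot (R : F ≃L[ℝ] F) (e : OpenPartialHomeomorph F M) : OpenPartialHomeomorph F M :=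
  R.toHomeomorph.toOpenPartialHomeomorph.trans e

theorem reflPlot_target (e : OpenPartialHomeomorph F M) : (reflPlot R e).target = e.target := by
  simp [reflPlot]

theorem compat_reflPlot_right {e e' : OpenPartialHomeomorph F M} {m : M}
    (hR : ∀ v, R (R v) = v) (hm : m ∈ e.target) (hm' : m ∈ e'.target)
    (h : OP (fun x => R (e'.symm (e x))) (e.symm m)) : Compat e (reflPlot R e') m := by
  have hRs : ∀ v, R.symm v = R v := fun v => by
    rw [ContinuousLinearEquiv.symm_apply_eq, hR]
  refine ⟨hm, by rwa [reflPlot_target], h.congr (Filter.Eventually.of_forall fun y => ?_)⟩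
  simp [reflPlot, hRs]

/-- If a plot `ψ` meets the domain of an oriented atlas in a preconnected set and its orientation
can be compared at one point, then `ψ` or its reflection is compatible with the atlas. -/
theorem exists_compat_plot (hR : ∀ v, R (R v) = v) (A : Set (OpenPartialHomeomorph F M))
    (hA : ∀ e ∈ A, ∀ e' ∈ A, ∀ m ∈ e.target, m ∈ e'.target → Compat e e' m)
    (ψ : OpenPartialHomeomorph F M) {W : Set M} (hW : IsPreconnected W)
    (hWt : ∀ m, m ∈ W ↔ m ∈ ψ.target ∧ ∃ e ∈ A, m ∈ e.target) 
    (h0 : W.Nonempty → ∃ e ∈ A, ∃ m ∈ e.target, m ∈ ψ.target ∧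
      OPR R (fun x => ψ.symm (e x)) (e.symm m)) :
    ∃ ψ' : OpenPartialHomeomorph F M, ψ'.target = ψ.target ∧
      ∀ e ∈ A, ∀ m ∈ e.target, m ∈ ψ.target → Compat e ψ' m := by
  rcases W.eq_empty_or_nonempty with h | h
  · refine ⟨ψ, rfl, fun e he m hm hm' => ?_⟩
    have : m ∈ W := (hWt m).2 ⟨hm', e, he, hm⟩
    rw [h] at this; exact this.elim
  obtain ⟨e₀, he₀, m₀, hm₀, hm₀', hOP⟩ := h0 h
  obtain ⟨ψ', h1, h2⟩ : ∃ ψ' : OpenPartialHomeomorph F M, ψ'.target = ψ.target ∧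
      Compat e₀ ψ' m₀ := by
    rcases hOP with hOP | hOP
    · exact ⟨ψ, rfl, hm₀, hm₀', hOP⟩
    · exact ⟨reflPlot R ψ, reflPlot_target ψ, compat_reflPlot_right hR hm₀ hm₀' hOP⟩
  refine ⟨ψ', h1, fun e he m hm hm' => ?_⟩
  -- Compatibility with some member of `A` is the same as compatibility with any fixed member around
  -- the point, because `A` is oriented. Hence it is locally constant on `W`.
  have h3 : ∀ m ∈ W, ∀ᶠ y in 𝓝 m, ((∃ e ∈ A, Compat e ψ' y) ↔ ∃ e ∈ A, Compat e ψ' m) := by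
    intro m hm
    obtain ⟨h4, e₁, he₁, h5⟩ := (hWt m).1 hm
    have h6 : ∀ y ∈ e₁.target, (∃ e ∈ A, Compat e ψ' y) → Compat e₁ ψ' y := by
      rintro y hy ⟨e₂, he₂, h7⟩
      exact (hA e₁ he₁ e₂ he₂ y hy h7.1).trans h7
    filter_upwards [e₁.open_target.mem_nhds h5,
      Compat.eventually_iff (e' := ψ') h5 (by rw [h1]; exact h4)] with y hy hy'
    exact ⟨fun H => ⟨e₁, he₁, hy'.1 (h6 y hy H)⟩, fun H => ⟨e₁, he₁, hy'.2 (h6 m h5 H)⟩⟩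
  obtain ⟨e₂, he₂, h7⟩ := eventually_iff_preconnected hW h3 ((hWt m₀).2 ⟨hm₀', e₀, he₀, hm₀⟩)
    ((hWt m).2 ⟨hm', e, he, hm⟩) ⟨e₀, he₀, h2⟩
  exact (hA e he e₂ he₂ m hm h7.1).trans h7

end Reflection

/-! ### The winding number of a planar homeomorphism -/

/-- The values lie in the multiples of `2πi`, and distinct multiples are more than `1` apart, so a
continuous function with such values is locally constant. -/
theorem eq_of_exp_eq_one {S : Set ℂ} (hS : IsPreconnected S) (hSo : IsOpen S) {a : ℂ → ℂ}
    (ha : ContinuousOn a S) (h1 : ∀ z ∈ S, Complex.exp (a z) = 1) {z w : ℂ} (hz : z ∈ S)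
    (hw : w ∈ S) : a w = a z := by
  refine eventually_iff_preconnected hS (p := fun y => a y = a z) (fun x hx => ?_) hz hw rfl
  have h2 : ∀ᶠ y in 𝓝 x, a y = a x := by
    have := Metric.tendsto_nhds.1 (ha.continuousAt (hSo.mem_nhds hx)) 1 one_pos
    filter_upwards [this, hSo.mem_nhds hx] with y hy hyS
    obtain ⟨n, hn⟩ := Complex.exp_eq_one_iff.1 (h1 y hyS)
    obtain ⟨m, hm⟩ := Complex.exp_eq_one_iff.1 (h1 x hx)
    rw [dist_eq_norm, hn, hm, ← sub_mul, norm_mul] at hy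
    have h3 : ‖(2 * Real.pi * Complex.I : ℂ)‖ = 2 * Real.pi := by
      simp [abs_of_pos Real.pi_pos]
    rw [h3] at hy
    have h4 : ‖((n : ℂ) - m)‖ < 1 := by
      have := Real.pi_gt_three
      nlinarith [norm_nonneg ((n : ℂ) - m)]
    have h5 : ‖((n - m : ℤ) : ℂ)‖ < 1 := by push_cast; exact h4
    rw [Complex.norm_intCast] at h5
    have h6 : |n - m| < 1 := by exact_mod_cast h5
    have : n = m := by
      have := Int.abs_lt_one_iff.1 h6; omega
    rw [hn, hm, this]
  filter_upwards [h2] with y hy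
  rw [hy]

/-- The map `f ∘ exp` lifts through the covering `exp`, whose total space is simply connected. The
integer `d` by which the lift shifts over one period is the winding number of `f`. -/
theorem exists_exp_lift {f : ℂ → ℂ} (hf : ∀ z, z ≠ 0 → ContinuousAt f z) (h0 : ∀ z, z ≠ 0 → f z ≠ 0) :
    ∃ F : ℂ → ℂ, Continuous F ∧ (∀ w, Complex.exp (F w) = f (Complex.exp w)) ∧
      ∃ d : ℤ, ∀ w, ∀ n : ℤ,
        F (w + n * (2 * Real.pi * Complex.I)) = F w + (n * d : ℤ) * (2 * Real.pi * Complex.I) := by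
  let φ : C(ℂ, {z : ℂ // z ≠ 0}) := ⟨fun w => ⟨f (Complex.exp w), h0 _ (Complex.exp_ne_zero w)⟩, by
    refine Continuous.subtype_mk (continuous_iff_continuousAt.2 fun w => ?_) _
    exact (hf _ (Complex.exp_ne_zero w)).comp Complex.continuous_exp.continuousAt⟩
  obtain ⟨F, ⟨-, hF⟩, -⟩ := Complex.isCoveringMap_exp.existsUnique_continuousMap_lifts φ 0
    (Complex.log (f 1)) (by
      refine Subtype.ext ?_
      simp [φ, Complex.exp_log (h0 1 one_ne_zero)])
  have hF' : ∀ w, Complex.exp (F w) = f (Complex.exp w) := fun w => by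
    have := congrFun hF w
    exact congrArg Subtype.val this
  refine ⟨F, F.continuous, hF', ?_⟩
  have hper : ∀ w, Complex.exp (F (w + 2 * Real.pi * Complex.I) - F w) = 1 := fun w => by
    rw [Complex.exp_sub, hF', hF', Complex.exp_periodic w]
    exact div_self (h0 _ (Complex.exp_ne_zero w))
  obtain ⟨d, hd⟩ := Complex.exp_eq_one_iff.1 (hper 0)
  have hd' : ∀ w, F (w + 2 * Real.pi * Complex.I) = F w + d * (2 * Real.pi * Complex.I) := fun w => by
    have := eq_of_exp_eq_one (S := univ) isPreconnected_univ isOpen_univ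
      (a := fun w => F (w + 2 * Real.pi * Complex.I) - F w)
      (by fun_prop) (fun w _ => hper w) (mem_univ 0) (mem_univ w)
    simp only [hd] at this
    rw [← this]; ring
  refine ⟨d, fun w n => ?_⟩
  induction n using Int.induction_on with
  | zero => simp
  | succ n ih =>
    have := hd' (w + n * (2 * Real.pi * Complex.I))
    push_cast at ih ⊢
    rw [ih] at this
    rw [show w + ((n : ℂ) + 1) * (2 * Real.pi * Complex.I) =
      w + n * (2 * Real.pi * Complex.I) + 2 * Real.pi * Complex.I by ring, this]
    ring
  | pred n ih =>
    have := hd' (w + (-(n : ℂ) - 1) * (2 * Real.pi * Complex.I))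
    rw [show w + (-(n : ℂ) - 1) * (2 * Real.pi * Complex.I) + 2 * Real.pi * Complex.I =
      w + -(n : ℂ) * (2 * Real.pi * Complex.I) by ring] at this
    push_cast at ih ⊢
    rw [ih] at this
    linear_combination -this

/-- The homotopy `exp ((1 - s) L (log z) + s F (log z))`. -/
def expHomotopy (L F : ℂ → ℂ) (s : ℝ) (z : ℂ) : ℂ :=
  if z = 0 then 0 else Complex.exp ((1 - s) * L (Complex.log z) + s * F (Complex.log z))

/-- Another branch of the logarithm changes `L` and `F` by the same multiple of `2πi`, so the convex
combination changes by this multiple as well. This is where equality of the winding numbers enters.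
-/
theorem expHomotopy_exp {L F : ℂ → ℂ} {d : ℤ}
    (hL : ∀ w, ∀ n : ℤ,
        L (w + n * (2 * Real.pi * Complex.I)) = L w + (n * d : ℤ) * (2 * Real.pi * Complex.I))
    (hF : ∀ w, ∀ n : ℤ,
        F (w + n * (2 * Real.pi * Complex.I)) = F w + (n * d : ℤ) * (2 * Real.pi * Complex.I))
    (s : ℝ) (w : ℂ) : expHomotopy L F s (Complex.exp w) =
      Complex.exp ((1 - s) * L w + s * F w) := by
  rw [expHomotopy, if_neg (Complex.exp_ne_zero w)]
  obtain ⟨n, hn⟩ := Complex.exp_eq_exp_iff_exists_int.1 (Complex.exp_log (Complex.exp_ne_zero w))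
  rw [hn, hL, hF, Complex.exp_eq_exp_iff_exists_int]
  exact ⟨n * d, by ring⟩

theorem continuous_expHomotopy {L F : ℂ → ℂ} {d : ℤ} (hLc : Continuous L) (hFc : Continuous F)
    (hL : ∀ w, ∀ n : ℤ,
        L (w + n * (2 * Real.pi * Complex.I)) = L w + (n * d : ℤ) * (2 * Real.pi * Complex.I))
    (hF : ∀ w, ∀ n : ℤ,
        F (w + n * (2 * Real.pi * Complex.I)) = F w + (n * d : ℤ) * (2 * Real.pi * Complex.I))
    {s₀ : ℝ} {z₀ : ℂ} (hz : z₀ ≠ 0) :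
    ContinuousAt (Function.uncurry (expHomotopy L F)) (s₀, z₀) := by
  -- A branch of the logarithm that is continuous near `z₀`, even if `z₀` lies on the cut of the
  -- principal branch.
  let w : ℂ → ℂ := fun z => Complex.log (z / z₀) + Complex.log z₀
  have hw : ContinuousAt w z₀ := by
    refine ContinuousAt.add ?_ continuousAt_const
    refine ContinuousAt.clog (by fun_prop) ?_
    rw [div_self hz]; exact Complex.one_mem_slitPlane
  have hcont : ContinuousAt (fun p : ℝ × ℂ =>
      Complex.exp ((1 - p.1) * L (w p.2) + p.1 * F (w p.2))) (s₀, z₀) := by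
    have h1 : ContinuousAt (fun p : ℝ × ℂ => w p.2) (s₀, z₀) :=
      ContinuousAt.comp (f := Prod.snd) (g := w) hw continuousAt_snd
    have h2 := hLc.continuousAt.comp h1
    have h3 := hFc.continuousAt.comp h1
    have h4 : ContinuousAt (fun p : ℝ × ℂ => ((p.1 : ℝ) : ℂ)) (s₀, z₀) := by fun_prop
    exact (((continuousAt_const.sub h4).mul h2).add (h4.mul h3)).cexp
  refine hcont.congr ?_
  have : ∀ᶠ p : ℝ × ℂ in 𝓝 (s₀, z₀), p.2 ≠ 0 := continuousAt_snd.eventually_ne hz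
  filter_upwards [this] with p hp
  have h5 : Complex.exp (w p.2) = p.2 := by
    simp only [w]
    rw [Complex.exp_add, Complex.exp_log (div_ne_zero hp hz), Complex.exp_log hz,
      div_mul_cancel₀ _ hz]
  rw [← expHomotopy_exp hL hF, h5]
  rfl

/-- A homeomorphism of neighbourhoods of the origin in the plane is homotopic to the identity or to
the complex conjugation. -/
theorem exists_planar_homotopy {f g : ℂ → ℂ} {ε : ℝ} (hε : 0 < ε) (hf : ContinuousOn f (ball 0 ε))
    (hg : ContinuousOn g (ball 0 ε)) (hf0 : f 0 = 0) (hg0 : g 0 = 0)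
    (hgf : ∀ z ∈ ball (0 : ℂ) ε, g (f z) = z) (hfg : ∀ z ∈ ball (0 : ℂ) ε, f (g z) = z) :
    ∃ r > 0, ∃ K : ℝ → ℂ → ℂ, ContinuousOn (Function.uncurry K) (Icc 0 1 ×ˢ ball 0 r) ∧
      (∀ s, ∀ z ∈ ball (0 : ℂ) r, K s z = 0 → z = 0) ∧ (∀ z ∈ ball (0 : ℂ) r, K 1 z = f z) ∧
      ((∀ z, K 0 z = z) ∨ ∀ z, K 0 z = starRingEnd ℂ z) := by
  have hfne : ∀ z ∈ ball (0 : ℂ) ε, z ≠ 0 → f z ≠ 0 := fun z hz h h' => by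
    have := hgf z hz; rw [h', hg0] at this; exact h this.symm
  have hgne : ∀ z ∈ ball (0 : ℂ) ε, z ≠ 0 → g z ≠ 0 := fun z hz h h' => by
    have := hfg z hz; rw [h', hf0] at this; exact h this.symm
  -- truncation to a bounded ball
  let c : ℝ → ℂ → ℂ := fun r z => ((min 1 (r / ‖z‖) : ℝ) : ℂ) * z
  have hc1 : ∀ r > 0, ∀ z, ‖z‖ ≤ r → c r z = z := fun r hr z hz => by
    rcases eq_or_ne z 0 with rfl | h
    · simp [c]
    · have : 1 ≤ r / ‖z‖ := (one_le_div (norm_pos_iff.2 h)).2 hz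
      simp [c, min_eq_left this]
  have hc2 : ∀ r > 0, ∀ z, ‖c r z‖ ≤ r := fun r hr z => by
    rcases le_total ‖z‖ r with h | h
    · rw [hc1 r hr z h]; exact h
    · have h0 : 0 < ‖z‖ := hr.trans_le h
      have : r / ‖z‖ ≤ 1 := (div_le_one h0).2 h
      have h3 : 0 < r / ‖z‖ := by positivity
      simp only [c, min_eq_right this, norm_mul, Complex.norm_real, Real.norm_of_nonneg h3.le]
      rw [div_mul_cancel₀ _ h0.ne']
  have hc3 : ∀ r > 0, ∀ z, z ≠ 0 → c r z ≠ 0 := fun r hr z hz => by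
    refine mul_ne_zero ?_ hz
    have : 0 < r / ‖z‖ := by have := norm_pos_iff.2 hz; positivity
    exact_mod_cast (lt_min one_pos this).ne'
  have hc4 : ∀ r > 0, ∀ z, z ≠ 0 → ContinuousAt (c r) z := fun r hr z hz => by
    have h1 : ContinuousAt (fun z : ℂ => min 1 (r / ‖z‖)) z :=
      continuousAt_const.min (continuousAt_const.div continuous_norm.continuousAt (by simpa using hz))
    exact (Complex.continuous_ofReal.continuousAt.comp h1).mul continuousAt_id
  -- Precomposing with the radial truncation makes the germ globally defined and nonvanishing
  -- outside zero without changing it on the smaller ball, so `exists_exp_lift` applies.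
  have hlift : ∀ f : ℂ → ℂ, ContinuousOn f (ball 0 ε) → (∀ z ∈ ball (0 : ℂ) ε, z ≠ 0 → f z ≠ 0) →
      ∀ r > 0, r < ε → ∃ F : ℂ → ℂ, Continuous F ∧
        (∀ w, ‖Complex.exp w‖ ≤ r → Complex.exp (F w) = f (Complex.exp w)) ∧
      ∃ d : ℤ, ∀ w, ∀ n : ℤ,
        F (w + n * (2 * Real.pi * Complex.I)) = F w + (n * d : ℤ) * (2 * Real.pi * Complex.I) := by
    intro f hf hfne r hr hrε
    have hmem : ∀ z, c r z ∈ ball (0 : ℂ) ε := fun z => by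
      simpa using (hc2 r hr z).trans_lt hrε
    obtain ⟨F, h1, h2, h3⟩ := exists_exp_lift (f := fun z => f (c r z))
      (fun z hz => ContinuousAt.comp (g := f) (hf.continuousAt (isOpen_ball.mem_nhds (hmem z)))
        (hc4 r hr z hz))
      (fun z hz => hfne _ (hmem z) (hc3 r hr z hz))
    exact ⟨F, h1, fun w hw => by rw [h2, hc1 r hr _ hw], h3⟩
  obtain ⟨δ, hδ, hδ'⟩ : ∃ δ > 0, δ < ε ∧ ∀ z, ‖z‖ ≤ δ → ‖f z‖ ≤ ε / 2 := by
    have hc := hf.continuousAt (isOpen_ball.mem_nhds (mem_ball_self hε))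
    obtain ⟨δ, hδ, h⟩ := Metric.continuousAt_iff.1 hc (ε / 2) (by positivity)
    refine ⟨min (δ / 2) (ε / 2), by positivity, (min_le_right _ _).trans_lt (by linarith),
      fun z hz => ?_⟩
    have := h (x := z) (by
      simpa using hz.trans_lt ((min_le_left _ _).trans_lt (by linarith)))
    rw [hf0, dist_zero_right] at this
    exact this.le
  obtain ⟨hδε, hδf⟩ := hδ'
  obtain ⟨F, hFc, hFe, d, hd⟩ := hlift f hf hfne δ hδ hδε
  obtain ⟨G, hGc, hGe, d', hd'⟩ := hlift g hg hgne (ε / 2) (by positivity) (by linarith)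
  have hexp : ∀ w : ℂ, w.re < Real.log δ → ‖Complex.exp w‖ ≤ δ := fun w hw => by
    rw [Complex.norm_exp, ← Real.exp_log hδ]
    exact Real.exp_le_exp.2 hw.le
  -- On a left half plane `G ∘ F` differs from the identity by a constant multiple of `2πi`.
  -- Comparing a point with its translate by one period gives the product of the winding numbers of
  -- mutually inverse germs.
  have hdd : d * d' = 1 := by
    let S : Set ℂ := {w | w.re < Real.log δ}
    have hS : IsPreconnected S := (convex_halfSpace_re_lt _).isPreconnected
    have hSo : IsOpen S := isOpen_lt Complex.continuous_re continuous_const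
    have h1 : ∀ w ∈ S, Complex.exp (G (F w) - w) = 1 := fun w hw => by
      have h2 := hexp w hw
      rw [Complex.exp_sub, hGe, hFe w h2, hgf _ (by simpa using h2.trans_lt hδε),
        div_self (Complex.exp_ne_zero w)]
      rw [hFe w h2]; exact hδf _ h2
    have h0 : ((Real.log δ - 1 : ℝ) : ℂ) ∈ S := by simp [S]
    have h0' : ((Real.log δ - 1 : ℝ) : ℂ) + (1 : ℤ) * (2 * Real.pi * Complex.I) ∈ S := by simp [S]
    have h3 := eq_of_exp_eq_one hS hSo (a := fun w => G (F w) - w) (by fun_prop) h1 h0 h0'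
    simp only [hd, hd'] at h3
    have h4 : ((d * d' : ℤ) : ℂ) * (2 * Real.pi * Complex.I) = 1 * (2 * Real.pi * Complex.I) := by
      push_cast at h3 ⊢
      linear_combination h3
    have h5 := mul_right_cancel₀ Complex.two_pi_I_ne_zero h4
    exact_mod_cast h5
  have main : ∀ L : ℂ → ℂ, Continuous L → (∀ w, (L w).re = w.re) → (∀ w, ∀ n : ℤ,
        L (w + n * (2 * Real.pi * Complex.I)) = L w + (n * d : ℤ) * (2 * Real.pi * Complex.I)) →
      ContinuousOn (Function.uncurry (expHomotopy L F)) (Icc 0 1 ×ˢ ball 0 δ) ∧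
      (∀ s, ∀ z ∈ ball (0 : ℂ) δ, expHomotopy L F s z = 0 → z = 0) ∧
      (∀ z ∈ ball (0 : ℂ) δ, expHomotopy L F 1 z = f z) := by
    intro L hLc hLre hLper
    refine ⟨?_, ?_, ?_⟩
    · rintro ⟨s, z⟩ ⟨hs, hz⟩
      simp only at hs hz
      rcases eq_or_ne z 0 with rfl | hz0
      · have hval : Function.uncurry (expHomotopy L F) (s, 0) = 0 := by simp [expHomotopy]
        rw [ContinuousWithinAt, hval]
        -- At the origin the homotopy is not an exponential. Continuity follows from the bound by
        -- the larger of the norms of `z` and `f z`: the logarithm of the norm of the homotopy is a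
        -- convex combination of the logarithms of these two.
        have hlim : Filter.Tendsto (fun p : ℝ × ℂ => max ‖p.2‖ ‖f p.2‖)
            (𝓝[Icc 0 1 ×ˢ ball 0 δ] (s, 0)) (𝓝 0) := by
          have h1 : ContinuousAt (fun p : ℝ × ℂ => max ‖p.2‖ ‖f p.2‖) (s, 0) := by
            have := hf.continuousAt (isOpen_ball.mem_nhds (mem_ball_self hε))
            have h2 : ContinuousAt (fun p : ℝ × ℂ => f p.2) (s, 0) :=
              ContinuousAt.comp (f := Prod.snd) (g := f) this continuousAt_snd
            exact continuousAt_snd.norm.max h2.norm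
          have h3 := h1.tendsto.mono_left (nhdsWithin_le_nhds (s := Icc 0 1 ×ˢ ball 0 δ))
          simpa [hf0] using h3
        refine squeeze_zero_norm' ?_ hlim
        filter_upwards [self_mem_nhdsWithin] with p hp
        rcases eq_or_ne p.2 0 with h | h
        · simp [Function.uncurry_def, expHomotopy, h]
        · simp only [Function.uncurry_def, expHomotopy, if_neg h]
          have h1 : ‖p.2‖ = Real.exp (Complex.log p.2).re := by
            rw [← Complex.norm_exp, Complex.exp_log h]
          have h2 : ‖f p.2‖ = Real.exp (F (Complex.log p.2)).re := by
            rw [← Complex.norm_exp, hFe, Complex.exp_log h]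
            rw [Complex.exp_log h]; simpa using (mem_ball.1 hp.2).le
          rw [Complex.norm_exp, h1, h2, ← (Real.exp_monotone.map_max)]
          refine Real.exp_le_exp.2 ?_
          have h3 : ((1 - (p.1 : ℂ)) * L (Complex.log p.2) + p.1 * F (Complex.log p.2)).re =
              (1 - p.1) * (Complex.log p.2).re + p.1 * (F (Complex.log p.2)).re := by
            simp [hLre]
          rw [h3]
          have h4 := hp.1.1
          have h5 := hp.1.2
          nlinarith [le_max_left (Complex.log p.2).re (F (Complex.log p.2)).re,
            le_max_right (Complex.log p.2).re (F (Complex.log p.2)).re]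
      · exact (continuous_expHomotopy hLc hFc hLper hd hz0).continuousWithinAt
    · intro s z hz h
      by_contra hz0
      rw [expHomotopy, if_neg hz0] at h
      exact Complex.exp_ne_zero _ h
    · intro z hz
      rcases eq_or_ne z 0 with rfl | hz0
      · simp [expHomotopy, hf0]
      · simp only [expHomotopy, if_neg hz0]
        have h1 := hFe (Complex.log z) (by rw [Complex.exp_log hz0]; simpa using (mem_ball.1 hz).le)
        rw [Complex.exp_log hz0] at h1
        simpa using h1
  -- The model with winding number `1` is the identity, the one with winding number `-1` is complex
  -- conjugation; their lifts are the identity and conjugation again.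
  rcases Int.eq_one_or_neg_one_of_mul_eq_one hdd with h | h
  · obtain ⟨h1, h2, h3⟩ := main (fun w => w) continuous_id (fun w => rfl) (fun w n => by simp [h])
    refine ⟨δ, hδ, _, h1, h2, h3, Or.inl fun z => ?_⟩
    rcases eq_or_ne z 0 with rfl | hz0
    · simp [expHomotopy]
    · simp [expHomotopy, hz0, Complex.exp_log hz0]
  · obtain ⟨h1, h2, h3⟩ := main (fun w => starRingEnd ℂ w) Complex.continuous_conj
      (fun w => by simp) (fun w n => by
        simp only [map_add, map_mul, map_intCast, map_ofNat, Complex.conj_ofReal, Complex.conj_I, h]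
        push_cast; ring)
    refine ⟨δ, hδ, _, h1, h2, h3, Or.inr fun z => ?_⟩
    rcases eq_or_ne z 0 with rfl | hz0
    · simp [expHomotopy]
    · simp [expHomotopy, hz0, Complex.exp_conj, Complex.exp_log hz0]

/-! ### Orientation of explicit maps of `ℂ × ℝ` -/

/-- The reflection of `ℂ × ℝ`. -/
def R3 : (ℂ × ℝ) ≃L[ℝ] (ℂ × ℝ) := Complex.conjCLE.prodCongr (ContinuousLinearEquiv.refl ℝ ℝ)

theorem R3_apply (v : ℂ × ℝ) : R3 v = (starRingEnd ℂ v.1, v.2) := rfl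

theorem R3_R3 (v : ℂ × ℝ) : R3 (R3 v) = v := by simp [R3_apply]

theorem OP.of_components {f : ℂ × ℝ → ℂ × ℝ} {x : ℂ × ℝ} {r : ℝ} (hr : 0 < r)
    (hc : ContinuousOn f (ball x r))
    (h : ∀ s ∈ Icc (0 : ℝ) 1, ∀ v : ℂ × ℝ, ‖v‖ < r →
      (1 - s) * v.1.re + s * ((f (x + v)).1.re - (f x).1.re) = 0 →
      (1 - s) * v.1.im + s * ((f (x + v)).1.im - (f x).1.im) = 0 →
      (1 - s) * v.2 + s * ((f (x + v)).2 - (f x).2) = 0 → v = 0) : OP f x := by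
  refine OP.of_straight hr hc fun s hs v hv hvr he => hv (h s hs v hvr ?_ ?_ ?_)
  · simpa using congrArg (fun p : ℂ × ℝ => p.1.re) he
  · simpa using congrArg (fun p : ℂ × ℝ => p.1.im) he
  · simpa using congrArg (fun p : ℂ × ℝ => p.2) he

theorem eq_zero_of_components {v : ℂ × ℝ} (h1 : v.1.re = 0) (h2 : v.1.im = 0) (h3 : v.2 = 0) :
    v = 0 := Prod.ext (Complex.ext h1 h2) h3

/-- A map which is strictly increasing in each coordinate. -/
theorem OP.of_strictMonoOn {φ₁ φ₂ φ₃ : ℝ → ℝ} {x : ℂ × ℝ} {r : ℝ} (hr : 0 < r)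
    (h1 : StrictMonoOn φ₁ (ball x.1.re r)) (h2 : StrictMonoOn φ₂ (ball x.1.im r))
    (h3 : StrictMonoOn φ₃ (ball x.2 r)) (hc1 : ContinuousOn φ₁ (ball x.1.re r))
    (hc2 : ContinuousOn φ₂ (ball x.1.im r)) (hc3 : ContinuousOn φ₃ (ball x.2 r)) :
    OP (fun y : ℂ × ℝ => ((⟨φ₁ y.1.re, φ₂ y.1.im⟩ : ℂ), φ₃ y.2)) x := by
  have hre : ∀ v : ℂ × ℝ, ‖v‖ < r → |v.1.re| < r := fun v hv =>
    ((Complex.abs_re_le_norm _).trans (norm_fst_le v)).trans_lt hv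
  have him : ∀ v : ℂ × ℝ, ‖v‖ < r → |v.1.im| < r := fun v hv =>
    ((Complex.abs_im_le_norm _).trans (norm_fst_le v)).trans_lt hv
  have hsn : ∀ v : ℂ × ℝ, ‖v‖ < r → |v.2| < r := fun v hv => (norm_snd_le v).trans_lt hv
  have key : ∀ (φ : ℝ → ℝ) (a : ℝ), StrictMonoOn φ (ball a r) → ∀ s ∈ Icc (0 : ℝ) 1, ∀ b, |b| < r →
      (1 - s) * b + s * (φ (a + b) - φ a) = 0 → b = 0 := by
    intro φ a h s hs b hb he
    have ha : a ∈ ball a r := mem_ball_self hr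
    have hab : a + b ∈ ball a r := by simpa using hb
    rcases lt_trichotomy b 0 with h0 | h0 | h0
    · have := h hab ha (by linarith)
      nlinarith [hs.1, hs.2, mul_nonneg hs.1 (sub_nonneg.2 this.le),
        mul_nonneg (sub_nonneg.2 hs.2) (neg_nonneg.2 h0.le)]
    · exact h0
    · have := h ha hab (by linarith)
      nlinarith [hs.1, hs.2, mul_nonneg hs.1 (sub_nonneg.2 this.le),
        mul_nonneg (sub_nonneg.2 hs.2) h0.le]
  refine OP.of_components hr ?_ fun s hs v hv e1 e2 e3 => eq_zero_of_components
    (key _ _ h1 s hs _ (hre v hv) e1) (key _ _ h2 s hs _ (him v hv) e2)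
    (key _ _ h3 s hs _ (hsn v hv) e3)
  have hm : ∀ y ∈ ball x r, |y.1.re - x.1.re| < r ∧ |y.1.im - x.1.im| < r ∧ |y.2 - x.2| < r := by
    intro y hy
    have : ‖y - x‖ < r := by rwa [← dist_eq_norm]
    exact ⟨hre _ this, him _ this, hsn _ this⟩
  have g1 : ContinuousOn (fun y : ℂ × ℝ => φ₁ y.1.re) (ball x r) :=
    hc1.comp (by fun_prop) fun y hy => (hm y hy).1
  have g2 : ContinuousOn (fun y : ℂ × ℝ => φ₂ y.1.im) (ball x r) :=
    hc2.comp (by fun_prop) fun y hy => (hm y hy).2.1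
  have g3 : ContinuousOn (fun y : ℂ × ℝ => φ₃ y.2) (ball x r) :=
    hc3.comp (by fun_prop) fun y hy => (hm y hy).2.2
  refine ContinuousOn.prodMk ?_ g3
  exact Complex.equivRealProdCLM.symm.continuous.comp_continuousOn (g1.prodMk g2)

/-- A cyclic permutation of the coordinates. -/
theorem OP.cyclic {α β γ : ℝ} (h : 0 < α * β * γ) (x : ℂ × ℝ) :
    OP (fun y : ℂ × ℝ => ((⟨α * y.2, β * y.1.re⟩ : ℂ), γ * y.1.im)) x := by
  refine OP.of_components one_pos (Continuous.continuousOn ?_) fun s hs v hv e1 e2 e3 => ?_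
  · refine Continuous.prodMk ?_ (by fun_prop)
    exact Complex.equivRealProdCLM.symm.continuous.comp
      (f := fun y : ℂ × ℝ => (α * y.2, β * y.1.re)) (by fun_prop)
  · simp only [Prod.fst_add, Prod.snd_add, Complex.add_re, Complex.add_im, mul_add,
      add_sub_cancel_left] at e1 e2 e3
    -- This is the determinant of the linear system `e1`, `e2`, `e3`; the three combinations below
    -- are the rows of the adjugate matrix.
    have hD : (1 - s) ^ 3 + s ^ 3 * (α * β * γ) ≠ 0 := by
      have h1 : 0 ≤ (1 - s) := by linarith [hs.2]
      rcases eq_or_lt_of_le hs.1 with h0 | h0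
      · rw [← h0]; norm_num
      · positivity
    refine eq_zero_of_components ?_ ?_ ?_ <;> refine (mul_eq_zero.1 ?_).resolve_left hD
    · linear_combination (1 - s) ^ 2 * e1 - s * α * (1 - s) * e3 + s ^ 2 * α * γ * e2
    · linear_combination (1 - s) ^ 2 * e2 - s * β * (1 - s) * e1 + s ^ 2 * α * β * e3
    · linear_combination (1 - s) ^ 2 * e3 - s * γ * (1 - s) * e2 + s ^ 2 * β * γ * e1

/-- A rotation by a right angle. -/
theorem OP.rot (x : ℂ × ℝ) : OP (fun y : ℂ × ℝ => ((⟨y.1.re, -y.2⟩ : ℂ), y.1.im)) x := by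
  refine OP.of_components one_pos (Continuous.continuousOn ?_) fun s hs v hv e1 e2 e3 => ?_
  · refine Continuous.prodMk ?_ (by fun_prop)
    exact Complex.equivRealProdCLM.symm.continuous.comp
      (f := fun y : ℂ × ℝ => (y.1.re, -y.2)) (by fun_prop)
  · simp only [Prod.fst_add, Prod.snd_add, Complex.add_re, Complex.add_im] at e1 e2 e3
    have hD : (1 - s) ^ 2 + s ^ 2 ≠ 0 := by nlinarith [sq_nonneg (2 * s - 1)]
    refine eq_zero_of_components (by linarith) ?_ ?_ <;>
      refine (mul_eq_zero.1 ?_).resolve_left hD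
    · linear_combination (1 - s) * e2 + s * e3
    · linear_combination (1 - s) * e3 - s * e2

/-- A shear. -/
theorem OP.shear {φ : ℝ → ℝ → ℝ} {x : ℂ × ℝ} (hφ : Continuous (Function.uncurry φ))
    {r : ℝ} (hr : 0 < r) (hm : StrictMonoOn (fun t => φ t x.1.im) (ball x.1.re r)) :
    OP (fun y : ℂ × ℝ => ((⟨φ y.1.re y.1.im, y.1.im⟩ : ℂ), y.2)) x := by
  refine OP.of_components hr (Continuous.continuousOn ?_) fun s hs v hv e1 e2 e3 => ?_
  · refine Continuous.prodMk ?_ (by fun_prop)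
    refine Complex.equivRealProdCLM.symm.continuous.comp
      (f := fun y : ℂ × ℝ => (φ y.1.re y.1.im, y.1.im)) (Continuous.prodMk ?_ (by fun_prop))
    exact hφ.comp (f := fun y : ℂ × ℝ => (y.1.re, y.1.im)) (by fun_prop)
  · simp only [Prod.fst_add, Prod.snd_add, Complex.add_re, Complex.add_im] at e1 e2 e3
    have h2 : v.1.im = 0 := by linarith
    refine eq_zero_of_components ?_ h2 (by linarith)
    rw [h2, add_zero] at e1
    have ha : x.1.re ∈ ball x.1.re r := mem_ball_self hr
    have hab : x.1.re + v.1.re ∈ ball x.1.re r := by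
      simpa using ((Complex.abs_re_le_norm _).trans (norm_fst_le v)).trans_lt hv
    rcases lt_trichotomy v.1.re 0 with h0 | h0 | h0
    · have := hm hab ha (by linarith)
      simp only at this
      nlinarith [hs.1, hs.2, mul_nonneg hs.1 (sub_nonneg.2 this.le),
        mul_nonneg (sub_nonneg.2 hs.2) (neg_nonneg.2 h0.le)]
    · exact h0
    · have := hm ha hab (by linarith)
      simp only at this
      nlinarith [hs.1, hs.2, mul_nonneg hs.1 (sub_nonneg.2 this.le),
        mul_nonneg (sub_nonneg.2 hs.2) h0.le]

/-- The path `exp (s log c)` joins `1` to `c` among the nonzero complex numbers. -/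
theorem OP.mul_const {c : ℂ} (hc : c ≠ 0) (x : ℂ × ℝ) : OP (fun y : ℂ × ℝ => (c * y.1, y.2)) x := by
  refine (OP.id x).of_homotopy one_pos
    (fun s v => (Complex.exp (s * Complex.log c) * v.1, v.2)) ?_ ?_ ?_ ?_
  · refine Continuous.continuousOn ?_
    simp only [Function.uncurry_def]
    fun_prop
  · intro v _ _; simp
  · intro v _ _; simp [Complex.exp_log hc, mul_add]
  · intro s _ v hv _ h
    simp only [Prod.mk_eq_zero, mul_eq_zero, Complex.exp_ne_zero, false_or] at h
    exact hv (Prod.ext h.1 h.2)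

/-- Holomorphic maps preserve the orientation. -/
theorem OP.holomorphic {g : ℂ → ℂ} {c : ℂ} {x : ℂ × ℝ} (hg : HasDerivAt g c x.1) (hc : c ≠ 0)
    (hcont : ∀ᶠ z in 𝓝 x.1, ContinuousAt g z) : OP (fun y : ℂ × ℝ => (g y.1, y.2)) x := by
  -- An error of at most half the size of the derivative keeps the straight homotopy to
  -- multiplication by `c` away from zero.
  have h1 : 0 < ‖c‖ / 2 := by have := norm_pos_iff.2 hc; positivity
  have h2 := (hasDerivAt_iff_isLittleO.1 hg).def h1
  obtain ⟨r, hr, hr'⟩ := Metric.eventually_nhds_iff.1 (h2.and hcont)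
  refine (OP.mul_const hc x).of_straight_aux hr ?_ (by fun_prop) ?_
  · refine ContinuousOn.prodMk (fun y hy => ?_) (by fun_prop)
    have hd : dist y.1 x.1 < r := lt_of_le_of_lt (by rw [Prod.dist_eq]; exact le_max_left _ _) hy
    exact (ContinuousAt.comp (f := Prod.fst) (g := g) (hr' hd).2 continuousAt_fst).continuousWithinAt
  · intro s hs v hv hvr he
    have e1 := congrArg Prod.fst he
    have e2 := congrArg Prod.snd he
    simp only [Prod.snd_add, Prod.fst_add, Prod.smul_snd, Prod.snd_sub, smul_eq_mul, Prod.smul_fst,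
      Prod.fst_sub, add_sub_cancel_left, Prod.snd_zero, Prod.fst_zero] at e1 e2
    have h3 : v.2 = 0 := by linarith
    have hd : dist (x.1 + v.1) x.1 < r := by simpa using (norm_fst_le v).trans_lt hvr
    have h4 := (hr' hd).1
    simp only [add_sub_cancel_left, smul_eq_mul] at h4
    have h5 : c * v.1 = -((s : ℂ) * (g (x.1 + v.1) - g x.1 - v.1 * c)) := by
      simp only [Complex.real_smul] at e1
      push_cast at e1
      linear_combination e1
    have h6 := congrArg norm h5
    rw [norm_neg, norm_mul, norm_mul, Complex.norm_real, Real.norm_of_nonneg hs.1] at h6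
    have h7 : ‖v.1‖ = 0 := by
      by_contra h0
      have h8 : 0 < ‖v.1‖ := lt_of_le_of_ne (norm_nonneg _) (Ne.symm h0)
      have h9 : s * ‖g (x.1 + v.1) - g x.1 - v.1 * c‖ ≤ 1 * (‖c‖ / 2 * ‖v.1‖) :=
        mul_le_mul hs.2 h4 (norm_nonneg _) zero_le_one
      nlinarith [mul_pos h1 h8]
    exact hv (Prod.ext (norm_eq_zero.1 h7) h3)

/-- A level preserving homeomorphism preserves or reverses the orientation. -/
theorem OPR.of_level (φ : OpenPartialHomeomorph (ℂ × ℝ) (ℂ × ℝ)) {x : ℂ × ℝ} (hx : x ∈ φ.source)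
    (h : ℂ → ℂ) (hh : ∀ᶠ y in 𝓝 x, φ y = (h y.1, y.2)) : OPR R3 φ x := by
  obtain ⟨r, hr, hr'⟩ := Metric.eventually_nhds_iff.1 (hh.and (φ.open_source.mem_nhds hx))
  have hφx : φ x = (h x.1, x.2) := (hr' (by simpa using hr)).1
  have hmemf : ∀ z ∈ ball (0 : ℂ) r, dist (x.1 + z, x.2) x < r := fun z hz => by
    simpa [Prod.dist_eq] using hz
  -- On the level of `x` the map and its inverse are planar germs `f` and `g` that fix the origin.
  -- The planar homotopy times the identity of the line is the required homotopy, after composition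
  -- with `R3` if it starts at the conjugation.
  let f : ℂ → ℂ := fun z => h (x.1 + z) - h x.1
  let g : ℂ → ℂ := fun w => (φ.symm (h x.1 + w, x.2)).1 - x.1
  have hf1 : ∀ z ∈ ball (0 : ℂ) r, φ (x.1 + z, x.2) = (h x.1 + f z, x.2) := fun z hz => by
    rw [(hr' (hmemf z hz)).1]; simp [f]
  have hfc : ContinuousOn f (ball 0 r) := by
    have h1 : ContinuousOn (fun z : ℂ => (φ (x.1 + z, x.2)).1 - h x.1) (ball 0 r) := by
      refine ContinuousOn.sub (continuous_fst.comp_continuousOn ?_) continuousOn_const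
      exact φ.continuousOn.comp (by fun_prop) fun z hz => (hr' (hmemf z hz)).2
    refine h1.congr fun z hz => ?_
    simp only [hf1 z hz, add_sub_cancel_left]
  -- points near the image
  have hxt : (h x.1, x.2) ∈ φ.target := by rw [← hφx]; exact φ.map_source hx
  have h1 : ∀ᶠ w in 𝓝 (0 : ℂ), (h x.1 + w, x.2) ∈ φ.target ∧
      dist (φ.symm (h x.1 + w, x.2)) x < r := by
    have hc : ContinuousAt (fun w : ℂ => (h x.1 + w, x.2)) 0 := by fun_prop
    have h2 := hc.preimage_mem_nhds (t := φ.target) (by simpa using φ.open_target.mem_nhds hxt)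
    have h3 : ContinuousAt (fun w : ℂ => φ.symm (h x.1 + w, x.2)) 0 :=
      ContinuousAt.comp (g := φ.symm) (f := fun w : ℂ => (h x.1 + w, x.2))
        (by simpa using φ.continuousAt_symm hxt) hc
    have h4 : φ.symm (h x.1 + 0, x.2) = x := by rw [add_zero, ← hφx, φ.left_inv hx]
    have h5 := h3.preimage_mem_nhds (t := ball x r) (by rw [h4]; exact ball_mem_nhds x hr)
    filter_upwards [h2, h5] with w a b using ⟨a, b⟩
  obtain ⟨ρ, hρ, hρ'⟩ := Metric.eventually_nhds_iff.1 h1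
  have hg1 : ∀ w ∈ ball (0 : ℂ) ρ, φ.symm (h x.1 + w, x.2) = (x.1 + g w, x.2) ∧
      h (x.1 + g w) = h x.1 + w := fun w hw => by
    obtain ⟨h2, h3⟩ := hρ' (by simpa using hw)
    have h4 := (hr' h3).1
    rw [φ.right_inv h2, Prod.mk.injEq] at h4
    have h5 : φ.symm (h x.1 + w, x.2) = (x.1 + g w, x.2) := Prod.ext (by simp [g]) h4.2.symm
    refine ⟨h5, ?_⟩
    rw [h5] at h4
    exact h4.1.symm
  have hgc : ContinuousOn g (ball 0 ρ) := by
    refine ContinuousOn.sub (continuous_fst.comp_continuousOn ?_) continuousOn_const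
    exact φ.symm.continuousOn.comp (by fun_prop) fun z hz => (hρ' (by simpa using hz)).1
  obtain ⟨δ, hδ, K, hK1, hK2, hK3, hK4⟩ := exists_planar_homotopy (f := f) (g := g) (ε := min r ρ)
    (lt_min hr hρ) (hfc.mono (ball_subset_ball (min_le_left _ _)))
    (hgc.mono (ball_subset_ball (min_le_right _ _))) (by simp [f])
    (by
      simp only [g, add_zero, ← hφx, φ.left_inv hx, sub_self])
    (fun z hz => by
      have hz' := ball_subset_ball (min_le_left r ρ) hz
      simp only [g]
      rw [← hf1 z hz', φ.left_inv (hr' (hmemf z hz')).2]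
      simp)
    (fun z hz => by
      simp only [f, (hg1 z (ball_subset_ball (min_le_right _ _) hz)).2, add_sub_cancel_left])
  have hv1 : ∀ v : ℂ × ℝ, ‖v‖ < min δ r → v.1 ∈ ball (0 : ℂ) δ := fun v hv => by
    simpa using (norm_fst_le v).trans_lt (hv.trans_le (min_le_left _ _))
  have hvr : ∀ v : ℂ × ℝ, ‖v‖ < min δ r → φ (x + v) - φ x = (f v.1, v.2) := fun v hv => by
    rw [(hr' (y := x + v) (by simpa using hv.trans_le (min_le_right _ _))).1, hφx]
    simp [f]
  have hKc : ContinuousOn (fun p : ℝ × (ℂ × ℝ) => K p.1 p.2.1)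
      (Icc 0 1 ×ˢ {v | v ≠ 0 ∧ ‖v‖ < min δ r}) :=
    hK1.comp (f := fun p : ℝ × (ℂ × ℝ) => (p.1, p.2.1)) (by fun_prop)
      fun p hp => ⟨hp.1, hv1 _ hp.2.2⟩
  rcases hK4 with hK4 | hK4
  · refine Or.inl ((OP.id (0 : ℂ × ℝ)).of_homotopy (lt_min hδ hr) (fun s v => (K s v.1, v.2)) ?_ ?_ ?_ ?_)
    · exact hKc.prodMk (by fun_prop)
    · intro v _ _; simp [hK4]
    · intro v _ hv; rw [hvr v hv, hK3 _ (hv1 v hv)]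
    · intro s _ v hv0 hv he
      rw [Prod.mk_eq_zero] at he
      exact hv0 (Prod.ext (hK2 s _ (hv1 v hv) he.1) he.2)
  · refine Or.inr ((OP.id (0 : ℂ × ℝ)).of_homotopy (lt_min hδ hr)
      (fun s v => (starRingEnd ℂ (K s v.1), v.2)) ?_ ?_ ?_ ?_)
    · exact (Complex.continuous_conj.comp_continuousOn hKc).prodMk (by fun_prop)
    · intro v _ _; simp [hK4]
    · intro v _ hv
      rw [← map_sub, hvr v hv, hK3 _ (hv1 v hv), R3_apply]
    · intro s _ v hv0 hv he
      rw [Prod.mk_eq_zero, map_eq_zero] at he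
      exact hv0 (Prod.ext (hK2 s _ (hv1 v hv) he.1) he.2)

/-! ### Points of the annuli -/

namespace GaussDiagram

variable (G : GaussDiagram)

theorem pos_eq_iff {c : G.Circles} {u u' : ℝ} :
    G.pos c u = G.pos c u' ↔ ∃ m : ℤ, u = u' + m * ((max (G.deg c.1 c.2) 1 : ℕ) : ℝ) := by
  have hD : (0 : ℝ) < ((max (G.deg c.1 c.2) 1 : ℕ) : ℝ) := by
    exact_mod_cast lt_of_lt_of_le one_pos (le_max_right _ _)
  have h2 := Real.pi_pos
  rw [pos, pos, Circle.exp_eq_exp]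
  refine exists_congr fun m => ?_
  rw [div_eq_iff hD.ne', add_mul, div_mul_cancel₀ _ hD.ne']
  constructor
  · intro h
    have : (2 * Real.pi) * u =
      (2 * Real.pi) * (u' + m * ((max (G.deg c.1 c.2) 1 : ℕ) : ℝ)) := by linear_combination h
    exact mul_left_cancel₀ (by positivity) this
  · intro h
    rw [h]; ring

theorem pos_surjective (c : G.Circles) : Function.Surjective (G.pos c) := by
  intro w
  have hD : ((max (G.deg c.1 c.2) 1 : ℕ) : ℝ) ≠ 0 := by
    exact_mod_cast (lt_of_lt_of_le one_pos (le_max_right _ _)).ne'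
  refine ⟨Complex.arg w / (2 * Real.pi) * ((max (G.deg c.1 c.2) 1 : ℕ) : ℝ), ?_⟩
  rw [pos, ← Circle.exp_arg w]
  congr 1
  have := Real.pi_ne_zero
  simp only [Circle.exp_arg]
  field_simp

theorem continuous_pos (c : G.Circles) : Continuous (G.pos c) := by
  unfold pos; fun_prop

/-- The point at distance `w` from the end of the chord `h` and height `y` in its annulus. -/
def annPt (s : Bool) (h : Fin G.numChords) (w : ℝ) (y : Icc (-1 : ℝ) 1) : G.Annuli :=
  (⟨s, (G.chordEnd s h).1⟩, G.pos ⟨s, (G.chordEnd s h).1⟩ (((G.chordEnd s h).2 : ℕ) + w), y)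

variable {G}

theorem sigma_fin_ext {ι : Type*} {f : ι → ℕ} {p q : Σ i, Fin (f i)} (h1 : p.1 = q.1)
    (h2 : (p.2 : ℕ) = q.2) : p = q := by
  obtain ⟨i, k⟩ := p
  obtain ⟨j, l⟩ := q
  obtain rfl : i = j := h1
  exact congrArg _ (Fin.ext h2)

theorem finRotate_val (n : ℕ) (i : Fin n) : ((finRotate n i : Fin n) : ℕ) = (i + 1) % n := by
  cases n with
  | zero => exact i.elim0
  | succ n =>
    rw [finRotate_apply, Fin.val_add]
    simp

theorem chordEnd_succ (s : Bool) (g : Fin G.numChords) : G.chordEnd s (G.succ s g) =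
    ⟨(G.chordEnd s g).1, finRotate _ (G.chordEnd s g).2⟩ := by
  simp [succ]

theorem annPt_eq_iff {s s' : Bool} {g h : Fin G.numChords} {w w' : ℝ} {y y' : Icc (-1 : ℝ) 1} :
    G.annPt s g w y = G.annPt s' h w' y' ↔ s = s' ∧ (G.chordEnd s g).1 = (G.chordEnd s h).1 ∧
      (∃ m : ℤ, ((G.chordEnd s g).2 : ℕ) + w =
        ((G.chordEnd s h).2 : ℕ) + w' + m * (G.deg s (G.chordEnd s g).1 : ℝ)) ∧ y = y' := by
  by_cases hs : s = s'
  swap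
  · simp [annPt, hs]
  subst hs
  by_cases hc : (G.chordEnd s g).1 = (G.chordEnd s h).1
  swap
  · simp [annPt, hc]
  have h0 : max (G.deg s (G.chordEnd s g).1) 1 = G.deg s (G.chordEnd s g).1 :=
    max_eq_left (Nat.one_le_iff_ne_zero.2 fun h0 => by
      have := (G.chordEnd s g).2.2; omega)
  have h1 : (⟨s, (G.chordEnd s h).1⟩ : G.Circles) = ⟨s, (G.chordEnd s g).1⟩ := by rw [hc]
  rw [hc] at h0
  simp only [annPt, h1, Prod.mk.injEq, true_and, pos_eq_iff, hc, h0]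

theorem continuous_annPt (s : Bool) (h : Fin G.numChords) :
    Continuous fun p : ℝ × Icc (-1 : ℝ) 1 => G.annPt s h p.1 p.2 := by
  unfold annPt
  exact continuous_const.prodMk (((G.continuous_pos _).comp (by fun_prop)).prodMk continuous_snd)

/-- The next chord end is one unit ahead; when the numbering wraps around, the difference is a full
period of the circle. -/
theorem annPt_succ (s : Bool) (g : Fin G.numChords) (w : ℝ) (y : Icc (-1 : ℝ) 1) :
    G.annPt s (G.succ s g) w y = G.annPt s g (1 + w) y := by
  rw [annPt_eq_iff]
  have h1 : (G.chordEnd s (G.succ s g)).1 = (G.chordEnd s g).1 := by rw [chordEnd_succ]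
  refine ⟨rfl, h1, ?_, rfl⟩
  have h2 : ((G.chordEnd s (G.succ s g)).2 : ℕ) =
      ((G.chordEnd s g).2 + 1) % (G.deg s (G.chordEnd s g).1) := by
    rw [chordEnd_succ, ← finRotate_val]
  rw [h2, h1]
  have h3 := Nat.mod_add_div ((G.chordEnd s g).2 + 1 : ℕ) (G.deg s (G.chordEnd s g).1)
  generalize ((G.chordEnd s g).2 + 1 : ℕ) / G.deg s (G.chordEnd s g).1 = Q at h3
  generalize ((G.chordEnd s g).2 + 1 : ℕ) % G.deg s (G.chordEnd s g).1 = P at h3 ⊢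
  refine ⟨-(Q : ℤ), ?_⟩
  have h4 : (P : ℝ) + (G.deg s (G.chordEnd s g).1) * Q = ((G.chordEnd s g).2 : ℕ) + 1 := by
    exact_mod_cast h3
  push_cast
  linear_combination h4

/-- Two points of an annulus at distance at most `1/2` of an edge midpoint and at most `1/4` of a
chord end. -/
theorem annPt_window {s s' : Bool} {g h : Fin G.numChords} {e w : ℝ} {y y' : Icc (-1 : ℝ) 1}
    (he : |e| ≤ 1 / 2) (hw : |w| ≤ 1 / 4)
    (H : G.annPt s g (1 / 2 + e) y = G.annPt s' h w y') :
    s = s' ∧ y = y' ∧ ((h = g ∧ w = 1 / 2 + e) ∨ (h = G.succ s g ∧ w = e - 1 / 2)) := by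
  obtain ⟨rfl, hc, ⟨m, hm⟩, hy⟩ := annPt_eq_iff.1 H
  refine ⟨rfl, hy, ?_⟩
  rw [abs_le] at he hw
  have hN : ((((G.chordEnd s h).2 : ℕ) + m * (G.deg s (G.chordEnd s g).1 : ℕ) -
      ((G.chordEnd s g).2 : ℕ) : ℤ) : ℝ) = 1 / 2 + e - w := by
    push_cast; linarith
  set N : ℤ := (((G.chordEnd s h).2 : ℕ) + m * (G.deg s (G.chordEnd s g).1 : ℕ) -
      ((G.chordEnd s g).2 : ℕ) : ℤ) with hNdef
  have h1 : (-1 : ℝ) < N := by linarith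
  have h2 : (N : ℝ) < 2 := by linarith
  have h1' : (-1 : ℤ) < N := by exact_mod_cast h1
  have h2' : N < 2 := by exact_mod_cast h2
  have hk := (G.chordEnd s g).2.2
  have hl : ((G.chordEnd s h).2 : ℕ) < G.deg s (G.chordEnd s g).1 := by
    have := (G.chordEnd s h).2.2
    have h3 : G.deg s (G.chordEnd s h).1 = G.deg s (G.chordEnd s g).1 := by rw [hc]
    omega
  -- The difference of the two positions on the line lies strictly between `-1` and `2`: the chord
  -- end is either the start or the end of the edge.
  obtain h0 | h0 : N = 0 ∨ N = 1 := by omega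
  · left
    rw [h0] at hN hNdef
    refine ⟨?_, by push_cast at hN; linarith⟩
    apply (G.chordEnd s).injective
    refine sigma_fin_ext hc.symm ?_
    have hm0 : m = 0 := by nlinarith
    rw [hm0] at hNdef; omega
  · right
    rw [h0] at hN hNdef
    refine ⟨?_, by push_cast at hN; linarith⟩
    apply (G.chordEnd s).injective
    rw [chordEnd_succ]
    refine sigma_fin_ext hc.symm ?_
    rw [finRotate_val]
    obtain h5 | h5 : (((G.chordEnd s g).2 : ℕ) + 1 < G.deg s (G.chordEnd s g).1) ∨
      (((G.chordEnd s g).2 : ℕ) + 1 = G.deg s (G.chordEnd s g).1) := by omega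
    · rw [Nat.mod_eq_of_lt h5]
      have hm0 : m = 0 := by nlinarith
      rw [hm0] at hNdef; omega
    · have hm0 : m = 1 := by nlinarith
      rw [h5, Nat.mod_self]
      rw [hm0] at hNdef; omega

/-- The squares around chord ends are embedded and disjoint. The point is referred to the edge after
or before the chord end, according to the sign of `w'`, in order to use `annPt_window`. -/
theorem annPt_inj {s s' : Bool} {g h : Fin G.numChords} {w w' : ℝ} {y y' : Icc (-1 : ℝ) 1}
    (hw' : |w'| ≤ 1 / 4) (hw : |w| ≤ 1 / 4) (H : G.annPt s g w' y = G.annPt s' h w y') :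
    s = s' ∧ y = y' ∧ h = g ∧ w = w' := by
  rw [abs_le] at hw hw'
  obtain ⟨rfl, hc, ⟨m, hm⟩, hy⟩ := annPt_eq_iff.1 H
  refine ⟨rfl, hy, ?_⟩
  rcases le_total 0 w' with h0 | h0
  · have h1 : G.annPt s g (1 / 2 + (w' - 1 / 2)) y = G.annPt s h w y' := by rw [← H]; congr 1; ring
    obtain ⟨-, -, h2 | h2⟩ := annPt_window (by rw [abs_le]; constructor <;> linarith)
      (by rw [abs_le]; exact hw) h1
    · exact ⟨h2.1, by linarith [h2.2]⟩
    · linarith [h2.2]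
  · set g' := (G.succ s).symm g
    have h1 : G.annPt s g' (1 / 2 + (w' + 1 / 2)) y = G.annPt s h w y' := by
      rw [← H, show g = G.succ s g' by simp [g'], annPt_succ]; congr 1; ring
    obtain ⟨-, -, h2 | h2⟩ := annPt_window (by rw [abs_le]; constructor <;> linarith)
      (by rw [abs_le]; exact hw) h1
    · linarith [h2.2]
    · exact ⟨by rw [h2.1]; simp [g'], by linarith [h2.2]⟩

theorem annPt_mk_eq_iff_window {s s' : Bool} {g h : Fin G.numChords} {e e' : ℝ}
    {y y' : Icc (-1 : ℝ) 1} (he : |e| < 1 / 2) (he' : |e'| < 1 / 2)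
    (H : G.annPt s g (1 / 2 + e) y = G.annPt s' h (1 / 2 + e') y') :
    s = s' ∧ y = y' ∧ g = h ∧ e = e' := by
  obtain ⟨rfl, hc, ⟨m, hm⟩, hy⟩ := annPt_eq_iff.1 H
  refine ⟨rfl, hy, ?_⟩
  rw [abs_lt] at he he'
  have hN : ((((G.chordEnd s h).2 : ℕ) + m * (G.deg s (G.chordEnd s g).1 : ℕ) -
      ((G.chordEnd s g).2 : ℕ) : ℤ) : ℝ) = e - e' := by
    push_cast; linarith
  set N : ℤ := (((G.chordEnd s h).2 : ℕ) + m * (G.deg s (G.chordEnd s g).1 : ℕ) -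
      ((G.chordEnd s g).2 : ℕ) : ℤ) with hNdef
  have h1 : (-1 : ℝ) < N := by linarith
  have h2 : (N : ℝ) < 1 := by linarith
  have h1' : (-1 : ℤ) < N := by exact_mod_cast h1
  have h2' : N < 1 := by exact_mod_cast h2
  have h0 : N = 0 := by omega
  have hk := (G.chordEnd s g).2.2
  have hl : ((G.chordEnd s h).2 : ℕ) < G.deg s (G.chordEnd s g).1 := by
    have := (G.chordEnd s h).2.2
    have h3 : G.deg s (G.chordEnd s h).1 = G.deg s (G.chordEnd s g).1 := by rw [hc]
    omega
  rw [h0] at hN hNdef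
  refine ⟨?_, by push_cast at hN; linarith⟩
  apply (G.chordEnd s).injective
  refine sigma_fin_ext hc ?_
  have hm0 : m = 0 := by nlinarith
  rw [hm0] at hNdef; omega

theorem couponRel_iff {p q : G.Annuli} : G.CouponRel p q ↔
    ∃ (h : Fin G.numChords) (x y v : Icc (-1 : ℝ) 1), (v : ℝ) = -((G.sign h : ℤ) : ℝ) * x ∧
      G.annPt true h ((x : ℝ) / 4) y = p ∧
      G.annPt false h (((G.sign h : ℤ) : ℝ) * (y : ℝ) / 4) v = q := by
  constructor
  · rintro ⟨h, x, y, v, hv⟩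
    exact ⟨h, x, y, v, hv, rfl, rfl⟩
  · rintro ⟨h, x, y, v, hv, rfl, rfl⟩
    exact CouponRel.glue h x y v hv

theorem units_real (δ : ℤˣ) : ((δ : ℤ) : ℝ) = 1 ∨ ((δ : ℤ) : ℝ) = -1 := by
  rcases Int.units_eq_one_or δ with rfl | rfl <;> simp

theorem units_mul_mem (δ : ℤˣ) (x : Icc (-1 : ℝ) 1) : ((δ : ℤ) : ℝ) * x ∈ Icc (-1 : ℝ) 1 := by
  have h1 := x.2.1
  have h2 := x.2.2
  rcases units_real δ with h | h <;> rw [h] <;> constructor <;> linarith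

theorem abs_units_mul (δ : ℤˣ) (x : ℝ) : |((δ : ℤ) : ℝ) * x| = |x| := by
  rcases units_real δ with h | h <;> rw [h] <;> simp

/-- The relation is parametrized by the chords times a square. Both parametrizations are injective
by `annPt_inj`, and their images lie in annuli of different families. -/
theorem couponRel_isGluing : IsGluing G.CouponRel := by
  let f : Fin G.numChords × Icc (-1 : ℝ) 1 × Icc (-1 : ℝ) 1 → G.Annuli := fun k =>
    G.annPt true k.1 ((k.2.1 : ℝ) / 4) k.2.2
  let g : Fin G.numChords × Icc (-1 : ℝ) 1 × Icc (-1 : ℝ) 1 → G.Annuli := fun k =>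
    G.annPt false k.1 (((G.sign k.1 : ℤ) : ℝ) * (k.2.2 : ℝ) / 4)
      ⟨((-G.sign k.1 : ℤˣ) : ℤ) * (k.2.1 : ℝ), units_mul_mem _ _⟩
  have hq : ∀ x : Icc (-1 : ℝ) 1, |(x : ℝ) / 4| ≤ 1 / 4 := fun x => by
    rw [abs_le]; constructor <;> linarith [x.2.1, x.2.2]
  have hf : ∀ k k', f k = f k' ↔ k = k' := by
    rintro ⟨h, x, y⟩ ⟨h', x', y'⟩
    refine ⟨fun H => ?_, fun H => by rw [H]⟩
    obtain ⟨-, h1, h2, h3⟩ := annPt_inj (hq x) (hq x') H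
    simp only at h1 h2 h3
    rw [h1, h2, show x = x' from Subtype.ext (by linarith)]
  have hg : ∀ k k', g k = g k' ↔ k = k' := by
    rintro ⟨h, x, y⟩ ⟨h', x', y'⟩
    refine ⟨fun H => ?_, fun H => by rw [H]⟩
    obtain ⟨-, h1, h2, h3⟩ := annPt_inj (by rw [mul_div_assoc, abs_units_mul]; exact hq y)
      (by rw [mul_div_assoc, abs_units_mul]; exact hq y') H
    simp only [Subtype.mk.injEq] at h1 h2 h3
    subst h2
    rcases units_real (G.sign h') with h4 | h4 <;> push_cast at h1 <;> rw [h4] at h1 h3 <;>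
      rw [show x = x' from Subtype.ext (by linarith), show y = y' from Subtype.ext (by linarith)]
  refine IsGluing.of_compact (f := f) (g := g) ?_ ?_ ?_ ?_ ?_
  · refine continuous_prod_of_discrete_left.2 fun h => ?_
    exact (continuous_annPt _ h).comp (f := fun p : Icc (-1 : ℝ) 1 × Icc (-1 : ℝ) 1 => (_, _))
      (by fun_prop)
  · refine continuous_prod_of_discrete_left.2 fun h => ?_
    exact (continuous_annPt _ h).comp (f := fun p : Icc (-1 : ℝ) 1 × Icc (-1 : ℝ) 1 => (_, _))
      (by fun_prop)
  · intro a b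
    rw [couponRel_iff]
    constructor
    · rintro ⟨h, x, y, v, hv, rfl, rfl⟩
      refine ⟨(h, x, y), rfl, ?_⟩
      simp only [g]
      congr 1
      exact Subtype.ext (by rw [hv]; push_cast; ring)
    · rintro ⟨⟨h, x, y⟩, rfl, rfl⟩
      exact ⟨h, x, y, _, by push_cast; ring, rfl, rfl⟩
  · intro k k'
    rw [hf, hg]
  · intro k k' H
    have := congrArg (fun p : G.Annuli => p.1.1) H
    simp [f, g, annPt] at this

instance : CompactSpace G.Circles := inferInstance

instance : T2Space G.RibbonGraph := couponRel_isGluing.t2Space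

instance : CompactSpace G.RibbonGraph := inferInstanceAs (CompactSpace (Quot _))

end GaussDiagram

namespace GaussDiagram

variable {G : GaussDiagram}

/-! ### The ribbon graph as a collar of its boundary -/

/-- The height of the points at depth `r` from the side `δ` of an annulus. -/
def depth (δ : ℤˣ) (r : ℝ) : Icc (-1 : ℝ) 1 :=
  projIcc (-1) 1 (by norm_num) (-(((δ : ℤ) : ℝ) * (1 - r)))

theorem depth_coe (δ : ℤˣ) {r : ℝ} (hr : r ∈ Icc (0 : ℝ) 1) :
    (depth δ r : ℝ) = -(((δ : ℤ) : ℝ) * (1 - r)) := by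
  rw [depth, projIcc_of_mem]
  rcases units_real δ with h | h <;> rw [h] <;> constructor <;> linarith [hr.1, hr.2]

theorem continuous_depth (δ : ℤˣ) : Continuous (depth δ) :=
  continuous_projIcc.comp (by fun_prop)

theorem depth_zero (δ : ℤˣ) : depth δ 0 = edgeOfInterval δ := by
  refine Subtype.ext ?_
  rw [depth_coe δ (by simp)]
  rcases Int.units_eq_one_or δ with rfl | rfl <;> simp [edgeOfInterval]

variable (G) in
/-- The point at depth `r` below the point `t` of a side of an edge, the interval being extended
linearly such that the sides meet along the diagonals of the squares around the chord ends. -/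
def trap : G.Arc → ℝ → ℝ → G.Annuli
  | .inl (s, h, δ), t, r =>
      G.annPt s h (1 / 2 + ((δ : ℤ) : ℝ) * ((1 + r) * (t / 2 - 1 / 4))) (depth δ r)
  | .inr (c, δ), t, r => (c.1, G.pos c.1 (((δ : ℤ) : ℝ) * t), depth δ r)

theorem arcPoint_eq (a : G.Arc) (t : ℝ) : G.arcPoint a t = Quot.mk _ (G.trap a t 0) := by
  rcases a with ⟨s, h, δ⟩ | ⟨c, δ⟩
  · simp only [arcPoint, trap, annPt, depth_zero, add_zero, one_mul, add_assoc]; rfl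
  · simp only [arcPoint, trap, depth_zero]; rfl

theorem continuous_trap (a : G.Arc) : Continuous fun p : ℝ × ℝ => G.trap a p.1 p.2 := by
  rcases a with ⟨s, h, δ⟩ | ⟨c, δ⟩
  · have := continuous_depth δ
    exact (continuous_annPt s h).comp (f := fun p : ℝ × ℝ => (_, depth δ p.2)) (by fun_prop)
  · have := continuous_depth δ
    simp only [trap]
    exact continuous_const.prodMk (((G.continuous_pos _).comp (by fun_prop)).prodMk (by fun_prop))

/-- The points of consecutive sides at which the sides meet. -/
def Joined (a : G.Arc) (t : ℝ) (a' : G.Arc) (t' : ℝ) : Prop :=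
  (a = a' ∧ t = t') ∨ (t = 1 ∧ t' = 0 ∧ a' = G.next a) ∨ (t = 0 ∧ t' = 1 ∧ a = G.next a')

theorem Joined.symm {a a' : G.Arc} {t t' : ℝ} (h : Joined a t a' t') : Joined a' t' a t := by
  rcases h with ⟨h1, h2⟩ | ⟨h1, h2, h3⟩ | ⟨h1, h2, h3⟩
  · exact Or.inl ⟨h1.symm, h2.symm⟩
  · exact Or.inr (Or.inr ⟨h2, h1, h3⟩)
  · exact Or.inr (Or.inl ⟨h2, h1, h3⟩)

/-- The extended side ends on the diagonal of the square on which the height is four times the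
position along the circle; by `trap_start` it begins on the other diagonal. The coupon matches the
diagonals, which makes the sides fit together at every depth. -/
theorem trap_end (s : Bool) (g : Fin G.numChords) (δ : ℤˣ) (r : ℝ) :
    G.trap (.inl (s, g, δ)) 1 r = G.annPt s (if δ = 1 then G.succ s g else g)
      (-(((δ : ℤ) : ℝ) * (1 - r)) / 4) (depth δ r) := by
  rcases Int.units_eq_one_or δ with rfl | rfl
  · rw [if_pos rfl, annPt_succ]
    simp only [trap]; congr 1; push_cast; ring
  · rw [if_neg (by decide)]
    simp only [trap]; congr 1; push_cast; ring

theorem trap_start (s : Bool) (h : Fin G.numChords) (δ : ℤˣ) (r : ℝ) :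
    G.trap (.inl (s, if δ = 1 then h else (G.succ s).symm h, δ)) 0 r = G.annPt s h
      ((((δ : ℤ) : ℝ) * (1 - r)) / 4) (depth δ r) := by
  rcases Int.units_eq_one_or δ with rfl | rfl
  · rw [if_pos rfl]
    simp only [trap]; congr 1; push_cast; ring
  · rw [if_neg (by decide)]
    conv_rhs => rw [← Equiv.apply_symm_apply (G.succ s) h, annPt_succ]
    simp only [trap]; congr 1; push_cast; ring

/-- The sign rule in `next` is exactly what makes the coupon carry the end of a side to the start of
its successor, at every depth and not only on the boundary. On a circle without chords a side is
followed by itself, and its two ends differ by a full turn. -/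
theorem mk_trap_next (a : G.Arc) {r : ℝ} (hr : r ∈ Icc (0 : ℝ) 1) :
    (Quot.mk _ (G.trap a 1 r) : G.RibbonGraph) = Quot.mk _ (G.trap (G.next a) 0 r) := by
  rcases a with ⟨s, g, δ⟩ | ⟨c, δ⟩
  · set h := if δ = 1 then G.succ s g else g with hh
    set δ' := if s then -(G.sign h * δ) else G.sign h * δ with hδ'
    have hn : G.next (.inl (s, g, δ)) =
      .inl (!s, if δ' = 1 then h else (G.succ (!s)).symm h, δ') := rfl
    rw [hn, trap_end, ← hh, trap_start]
    have hε : ((G.sign h : ℤ) : ℝ) * ((G.sign h : ℤ) : ℝ) = 1 := by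
      rcases units_real (G.sign h) with h | h <;> rw [h] <;> norm_num
    cases s
    · have h1 : ((δ' : ℤ) : ℝ) = ((G.sign h : ℤ) : ℝ) * ((δ : ℤ) : ℝ) := by simp [hδ']
      symm
      refine Quot.sound (couponRel_iff.2 ⟨h, depth (-δ') r, depth δ' r, depth δ r, ?_, ?_, ?_⟩)
      · rw [depth_coe _ hr, depth_coe _ hr]; push_cast
        rw [h1]; linear_combination ((δ : ℤ) : ℝ) * (1 - r) * hε
      · rw [depth_coe _ hr]; push_cast; simp
      · rw [depth_coe _ hr, h1]; congr 1
        linear_combination (-((δ : ℤ) : ℝ) * (1 - r)) / 4 * hε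
    · have h1 : ((δ' : ℤ) : ℝ) = -(((G.sign h : ℤ) : ℝ) * ((δ : ℤ) : ℝ)) := by simp [hδ']
      refine Quot.sound (couponRel_iff.2 ⟨h, depth δ r, depth δ r, depth δ' r, ?_, ?_, ?_⟩)
      · rw [depth_coe _ hr, depth_coe _ hr, h1]; ring
      · rw [depth_coe _ hr]
      · rw [depth_coe _ hr, h1]; simp only [Bool.not_true]; congr 1; ring
  · refine congrArg _ ?_
    simp only [trap, next, mul_zero, mul_one]
    congr 2
    refine (pos_eq_iff G).2 ⟨δ, ?_⟩
    rw [c.2]; simp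

/-- The arithmetic of a crossing. Here `σ = 1` or `σ = -1` says that the chord lies at the start or
at the end of the edge, and likewise for `σ'`. Since `σ * δ * (2 * t - 1)` is at least `-1`, the
right sides are at least `1 - r` and `1 - r'`, whereas the left sides are `1 - r'` and `1 - r` up to
sign. A minus sign would force both depths to be `1`; with plus signs all the inequalities are
equalities, so both points lie on diagonals. -/
theorem corner_real {δ δ' ε σ σ' r r' t t' : ℝ} (hδ : δ = 1 ∨ δ = -1) (hδ' : δ' = 1 ∨ δ' = -1)
    (hε : ε = 1 ∨ ε = -1) (hσ : σ = 1 ∨ σ = -1) (hσ' : σ' = 1 ∨ σ' = -1) (hr : r ∈ Icc (0 : ℝ) 1)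
    (hr' : r' ∈ Icc (0 : ℝ) 1) (hr1 : r < 1 ∨ r' < 1) (ht : t ∈ Icc (0 : ℝ) 1)
    (ht' : t' ∈ Icc (0 : ℝ) 1)
    (h1 : ε * δ' * σ * (1 - r') = 2 + (1 + r) * (σ * δ * (2 * t - 1)))
    (h2 : -(ε * δ * σ') * (1 - r) = 2 + (1 + r') * (σ' * δ' * (2 * t' - 1))) :
    r = r' ∧ δ' = ε * σ ∧ σ' = -(ε * δ) ∧ σ * δ * (2 * t - 1) = -1 ∧
      σ' * δ' * (2 * t' - 1) = -1 := by
  have hA : ∀ {σ δ t : ℝ}, (σ = 1 ∨ σ = -1) → (δ = 1 ∨ δ = -1) → t ∈ Icc (0 : ℝ) 1 →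
      -1 ≤ σ * δ * (2 * t - 1) := by
    intro σ δ t h h' ht
    rcases h with rfl | rfl <;> rcases h' with rfl | rfl <;> linarith [ht.1, ht.2]
  have hA1 := hA hσ hδ ht
  have hA2 := hA hσ' hδ' ht'
  set A := σ * δ * (2 * t - 1)
  set A' := σ' * δ' * (2 * t' - 1)
  have hp1 : 0 ≤ (1 + r) * (A + 1) := mul_nonneg (by linarith [hr.1]) (by linarith)
  have hp2 : 0 ≤ (1 + r') * (A' + 1) := mul_nonneg (by linarith [hr'.1]) (by linarith)
  obtain ⟨hr0, hr2⟩ := hr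
  obtain ⟨hr0', hr2'⟩ := hr'
  have hB : ε * δ' * σ = 1 ∨ ε * δ' * σ = -1 := by
    rcases hε with rfl | rfl <;> rcases hδ' with rfl | rfl <;> rcases hσ with rfl | rfl <;> norm_num
  have hB' : ε * δ * σ' = 1 ∨ ε * δ * σ' = -1 := by
    rcases hε with rfl | rfl <;> rcases hδ with rfl | rfl <;> rcases hσ' with rfl | rfl <;> norm_num
  have hσσ : σ * σ = 1 := by rcases hσ with rfl | rfl <;> norm_num
  have hεε : ε * ε = 1 := by rcases hε with rfl | rfl <;> norm_num
  have hδδ : δ * δ = 1 := by rcases hδ with rfl | rfl <;> norm_num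
  rcases hB with hB | hB
  swap
  · rw [hB] at h1
    have h3 : r = 1 := by linarith
    have h4 : r' = 1 := by linarith
    rcases hr1 with h | h <;> linarith
  rcases hB' with hB' | hB'
  · rw [hB'] at h2
    have h3 : r = 1 := by linarith
    have h4 : r' = 1 := by linarith
    rcases hr1 with h | h <;> linarith
  rw [hB] at h1
  rw [hB'] at h2
  have hrr : r = r' := by linarith
  have h5 : (1 + r) * (A + 1) = 0 := by linarith
  have h6 : (1 + r') * (A' + 1) = 0 := by linarith
  refine ⟨hrr, ?_, ?_, ?_, ?_⟩
  · linear_combination ε * σ * hB - δ' * σ * σ * hεε - δ' * hσσ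
  · linear_combination ε * δ * hB' - σ' * δ * δ * hεε - σ' * hδδ
  · have := (mul_eq_zero.1 h5).resolve_left (by linarith); linarith
  · have := (mul_eq_zero.1 h6).resolve_left (by linarith); linarith

theorem trap_half_le (δ : ℤˣ) {t r : ℝ} (ht : t ∈ Icc (0 : ℝ) 1) (hr : r ∈ Icc (0 : ℝ) 1) :
    |((δ : ℤ) : ℝ) * ((1 + r) * (t / 2 - 1 / 4))| ≤ (1 + r) / 4 := by
  have h1 : 0 ≤ (1 + r) * t := mul_nonneg (by linarith [hr.1]) ht.1
  have h2 : 0 ≤ (1 + r) * (1 - t) := mul_nonneg (by linarith [hr.1]) (by linarith [ht.2])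
  rw [abs_units_mul, abs_le]
  constructor <;> linarith

/-- Inside a square a trapezoid fills only the part where four times the distance along the circle
is at least the height in absolute value. A coupon exchanges these two numbers, so two identified
points of trapezoids lie on a common diagonal. -/
theorem couponRel_trap {a a' : G.Arc} {t t' r r' : ℝ} (hr : r ∈ Icc (0 : ℝ) 1)
    (hr' : r' ∈ Icc (0 : ℝ) 1) (hr1 : r < 1 ∨ r' < 1) (ht : t ∈ Icc (0 : ℝ) 1)
    (ht' : t' ∈ Icc (0 : ℝ) 1) (H : G.CouponRel (G.trap a t r) (G.trap a' t' r')) :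
    r = r' ∧ Joined a t a' t' := by
  obtain ⟨h, x, y, v, hv, hp, hq⟩ := couponRel_iff.1 H
  have hno : ∀ {s : Bool} {w : ℝ} {y : Icc (-1 : ℝ) 1} {c : {c : G.Circles // G.deg c.1 c.2 = 0}}
      {z : Circle × Icc (-1 : ℝ) 1}, G.annPt s h w y ≠ (c.1, z) := by
    intro s w y c z he
    have h1 := (G.chordEnd s h).2.2
    have h2 : (⟨s, (G.chordEnd s h).1⟩ : G.Circles) = c.1 := congrArg Prod.fst he
    have h3 := c.2
    rw [← h2] at h3
    simp only at h3
    omega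
  rcases a with ⟨s, g, δ⟩ | ⟨c, δ⟩
  swap
  · exact (hno hp).elim
  rcases a' with ⟨s', g', δ'⟩ | ⟨c, δ'⟩
  swap
  · exact (hno hq).elim
  have hx4 : |(x : ℝ) / 4| ≤ 1 / 4 := by rw [abs_le]; constructor <;> linarith [x.2.1, x.2.2]
  have hy4 : |((G.sign h : ℤ) : ℝ) * (y : ℝ) / 4| ≤ 1 / 4 := by
    rw [mul_div_assoc, abs_units_mul, abs_le]; constructor <;> linarith [y.2.1, y.2.2]
  have he := trap_half_le δ ht hr
  have he' := trap_half_le δ' ht' hr'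
  obtain ⟨rfl, hy, h1⟩ := annPt_window (he.trans (by linarith [hr.2])) hx4 hp.symm
  obtain ⟨rfl, hv', h2⟩ := annPt_window (he'.trans (by linarith [hr'.2])) hy4 hq.symm
  have hy' := congrArg Subtype.val hy
  rw [depth_coe δ hr] at hy'
  have hv'' := congrArg Subtype.val hv'
  rw [depth_coe δ' hr', hv] at hv''
  -- The sign `σ` encodes at which end of the edge the chord sits, so that both alternatives of
  -- `annPt_window` become one equation.
  obtain ⟨σ, hσ, hσh, hxσ⟩ : ∃ σ : ℤˣ, h = (if σ = 1 then g else G.succ true g) ∧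
      (σ = 1 ∨ σ = -1) ∧ ((σ : ℤ) : ℝ) * x =
        2 + (1 + r) * (((σ : ℤ) : ℝ) * ((δ : ℤ) : ℝ) * (2 * t - 1)) := by
    rcases h1 with h1 | h1
    · exact ⟨1, by simpa using h1.1, Or.inl rfl, by push_cast; linarith [h1.2]⟩
    · exact ⟨-1, by rw [if_neg (by decide)]; exact h1.1, Or.inr rfl, by push_cast; linarith [h1.2]⟩
  obtain ⟨σ', hσ', hσh', hxσ'⟩ : ∃ σ' : ℤˣ, h = (if σ' = 1 then g' else G.succ false g') ∧
      (σ' = 1 ∨ σ' = -1) ∧ ((σ' : ℤ) : ℝ) * (((G.sign h : ℤ) : ℝ) * y) =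
        2 + (1 + r') * (((σ' : ℤ) : ℝ) * ((δ' : ℤ) : ℝ) * (2 * t' - 1)) := by
    rcases h2 with h1 | h1
    · exact ⟨1, by simpa using h1.1, Or.inl rfl, by push_cast; linarith [h1.2]⟩
    · exact ⟨-1, by rw [if_neg (by decide)]; exact h1.1, Or.inr rfl, by push_cast; linarith [h1.2]⟩
  have hεε : ((G.sign h : ℤ) : ℝ) * ((G.sign h : ℤ) : ℝ) = 1 := by
    rcases units_real (G.sign h) with h | h <;> rw [h] <;> norm_num
  have hx2 : (x : ℝ) = ((G.sign h : ℤ) : ℝ) * ((δ' : ℤ) : ℝ) * (1 - r') := by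
    linear_combination ((G.sign h : ℤ) : ℝ) * hv'' - (x : ℝ) * hεε
  obtain ⟨hrr, k1, k2, k3, k4⟩ := corner_real (units_real δ) (units_real δ')
    (units_real (G.sign h)) (units_real σ) (units_real σ') hr hr' hr1 ht ht'
    (by rw [← hxσ, hx2]; ring) (by rw [← hxσ', ← hy']; ring)
  refine ⟨hrr, ?_⟩
  have k1' : δ' = G.sign h * σ := by
    refine Units.ext ?_
    exact_mod_cast k1
  have k2' : σ' = -(G.sign h * δ) := by
    refine Units.ext ?_
    push_cast
    exact_mod_cast k2
  clear hσh hσh' h1 h2 k1 k2 hxσ hxσ' he he' hp hq H hx4 hy4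
  have hδσ : δ = σ ∨ δ = -σ := by
    rcases Int.units_eq_one_or δ with rfl | rfl <;> rcases Int.units_eq_one_or σ with rfl | rfl <;>
      simp
  have hs2 : G.sign h * G.sign h = 1 := Int.units_mul_self _
  have hσσ : ((σ : ℤ) : ℝ) * ((σ : ℤ) : ℝ) = 1 := by
    rcases units_real σ with h | h <;> rw [h] <;> norm_num
  have hk4 : ((σ' : ℤ) : ℝ) * ((δ' : ℤ) : ℝ) = -(((δ : ℤ) : ℝ) * ((σ : ℤ) : ℝ)) := by
    rw [k1', k2']; push_cast
    linear_combination (-((δ : ℤ) : ℝ) * ((σ : ℤ) : ℝ)) * hεε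
  rw [hk4] at k4
  rcases hδσ with rfl | rfl
  · -- the case `t = 0`, `t' = 1`
    rw [hσσ] at k3 k4
    refine Or.inr (Or.inr ⟨by linarith, by linarith, ?_⟩)
    have hσδ : σ' = -δ' := by rw [k2', k1']
    have hh : (if δ' = 1 then G.succ false g' else g') = h := by
      rcases Int.units_eq_one_or δ' with h0 | h0 <;> rw [h0] at hσδ ⊢ <;> rw [hσ', hσδ] <;> simp
    have hd : G.sign h * δ' = δ := by rw [k1', ← mul_assoc, hs2, one_mul]
    simp only [next, Bool.not_false, hh, Bool.false_eq_true, if_false, hd]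
    refine congrArg Sum.inl ?_
    refine Prod.ext rfl (Prod.ext ?_ rfl)
    rcases Int.units_eq_one_or δ with h0 | h0 <;> rw [h0] at hσ ⊢ <;> rw [hσ] <;> simp
  · have hk : ((((-σ : ℤˣ)) : ℤ) : ℝ) = -((σ : ℤ) : ℝ) := by push_cast; ring
    rw [hk] at k3 k4
    refine Or.inr (Or.inl ⟨by linear_combination (-1 / 2 : ℝ) * k3 + (1 / 2 - t) * hσσ,
      by linear_combination (1 / 2 : ℝ) * k4 + (1 / 2 - t') * hσσ, ?_⟩)
    have hσδ : σ' = δ' := by rw [k2', k1']; simp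
    have hh : (if -σ = 1 then G.succ true g else g) = h := by
      rcases Int.units_eq_one_or σ with h0 | h0 <;> rw [h0] at hσ ⊢ <;> rw [hσ] <;> simp
    have hd : -(G.sign h * -σ) = δ' := by rw [k1']; simp
    simp only [next, Bool.not_true, hh, if_true, hd]
    refine congrArg Sum.inl ?_
    refine Prod.ext rfl (Prod.ext ?_ rfl)
    rcases Int.units_eq_one_or δ' with h0 | h0 <;> rw [h0] at hσδ ⊢ <;> rw [hσ', hσδ] <;> simp

/-- Off the core the height determines the depth and the side, and the windows around edge midpoints
are disjoint. Only the two ends of a side of a chordless circle coincide. On the core both sides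
meet, which is why one depth has to be less than `1`. -/
theorem trap_eq_trap {a a' : G.Arc} {t t' r r' : ℝ} (hr : r ∈ Icc (0 : ℝ) 1)
    (hr' : r' ∈ Ico (0 : ℝ) 1) (ht : t ∈ Icc (0 : ℝ) 1)
    (ht' : t' ∈ Icc (0 : ℝ) 1) (H : G.trap a t r = G.trap a' t' r') :
    r = r' ∧ Joined a t a' t' := by
  have hr'' := Ico_subset_Icc_self hr'
  have hd : ∀ {δ δ' : ℤˣ}, depth δ r = depth δ' r' → r = r' ∧ δ = δ' := by
    intro δ δ' h
    have h1 := congrArg Subtype.val h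
    rw [depth_coe _ hr, depth_coe _ hr''] at h1
    rcases Int.units_eq_one_or δ with rfl | rfl <;> rcases Int.units_eq_one_or δ' with rfl | rfl <;>
      push_cast at h1
    · exact ⟨by linarith, rfl⟩
    · linarith [hr.2, hr'.2]
    · linarith [hr.2, hr'.2]
    · exact ⟨by linarith, rfl⟩
  have hno : ∀ {h : Fin G.numChords} {s : Bool} {w : ℝ} {y : Icc (-1 : ℝ) 1}
      {c : {c : G.Circles // G.deg c.1 c.2 = 0}}
      {z : Circle × Icc (-1 : ℝ) 1}, G.annPt s h w y ≠ (c.1, z) := by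
    intro h s w y c z he
    have h1 := (G.chordEnd s h).2.2
    have h2 : (⟨s, (G.chordEnd s h).1⟩ : G.Circles) = c.1 := congrArg Prod.fst he
    have h3 := c.2
    rw [← h2] at h3
    simp only at h3
    omega
  rcases a with ⟨s, g, δ⟩ | ⟨c, δ⟩ <;> rcases a' with ⟨s', g', δ'⟩ | ⟨c', δ'⟩
  · have hdep : depth δ r = depth δ' r' := congrArg (fun p : G.Annuli => p.2.2) H
    obtain ⟨rfl, rfl⟩ := hd hdep
    obtain ⟨rfl, -, rfl, he⟩ := annPt_mk_eq_iff_window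
      ((trap_half_le δ ht hr).trans_lt (by linarith [hr'.2]))
      ((trap_half_le δ ht' hr).trans_lt (by linarith [hr'.2])) H
    refine ⟨rfl, Or.inl ⟨rfl, ?_⟩⟩
    have h1 : ((δ : ℤ) : ℝ) ≠ 0 := by rcases units_real δ with h | h <;> rw [h] <;> norm_num
    have h2 := mul_left_cancel₀ (by linarith [hr.1] : (1 + r) ≠ 0) (mul_left_cancel₀ h1 he)
    linarith
  · exact (hno H).elim
  · exact (hno H.symm).elim
  · have hdep : depth δ r = depth δ' r' := congrArg (fun p : G.Annuli => p.2.2) H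
    obtain ⟨rfl, rfl⟩ := hd hdep
    obtain rfl : c = c' := Subtype.ext (congrArg Prod.fst H)
    refine ⟨rfl, ?_⟩
    have hp : G.pos c.1 (((δ : ℤ) : ℝ) * t) = G.pos c.1 (((δ : ℤ) : ℝ) * t') :=
      congrArg (fun p : G.Annuli => p.2.1) H
    obtain ⟨m, hm⟩ := (pos_eq_iff G).1 hp
    rw [c.2] at hm
    obtain ⟨n, hn⟩ : ∃ n : ℤ, t = t' + n := by
      rcases units_real δ with h | h <;> rw [h] at hm
      · exact ⟨m, by push_cast at hm; simpa using hm⟩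
      · exact ⟨-m, by push_cast at hm ⊢; simp at hm; linarith⟩
    have h1 : (-1 : ℝ) ≤ n := by linarith [ht.1, ht'.2]
    have h2 : (n : ℝ) ≤ 1 := by linarith [ht.2, ht'.1]
    have h1' : (-1 : ℤ) ≤ n := by exact_mod_cast h1
    have h2' : n ≤ 1 := by exact_mod_cast h2
    obtain rfl | rfl | rfl : n = -1 ∨ n = 0 ∨ n = 1 := by omega
    · push_cast at hn
      exact Or.inr (Or.inr ⟨by linarith [ht.1, ht'.2], by linarith [ht.1, ht'.2], rfl⟩)
    · push_cast at hn
      exact Or.inl ⟨rfl, by linarith⟩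
    · push_cast at hn
      exact Or.inr (Or.inl ⟨by linarith [ht.2, ht'.1], by linarith [ht.2, ht'.1], rfl⟩)

/-- The complement of the cores in the ribbon graph is thus a product of the boundary with a
half-open interval: the identifications at depth `r < 1` are those on the boundary itself. -/
theorem mk_trap_eq_iff {a a' : G.Arc} {t t' r r' : ℝ} (hr : r ∈ Icc (0 : ℝ) 1)
    (hr' : r' ∈ Ico (0 : ℝ) 1) (ht : t ∈ Icc (0 : ℝ) 1) (ht' : t' ∈ Icc (0 : ℝ) 1) :
    (Quot.mk _ (G.trap a t r) : G.RibbonGraph) = Quot.mk _ (G.trap a' t' r') ↔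
      r = r' ∧ Joined a t a' t' := by
  have hr'' := Ico_subset_Icc_self hr'
  constructor
  · intro H
    rcases couponRel_isGluing.mk_eq_iff.1 H with H | H | H
    · exact trap_eq_trap hr hr' ht ht' H
    · exact couponRel_trap hr hr'' (Or.inr hr'.2) ht ht' H
    · have := couponRel_trap hr'' hr (Or.inl hr'.2) ht' ht H
      exact ⟨this.1.symm, this.2.symm⟩
  · rintro ⟨rfl, ⟨rfl, rfl⟩ | ⟨rfl, rfl, rfl⟩ | ⟨rfl, rfl, rfl⟩⟩
    · rfl
    · exact mk_trap_next _ hr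
    · exact (mk_trap_next _ hr).symm

end GaussDiagram

namespace GaussDiagram

variable {G : GaussDiagram}

theorem exists_annPt (p : G.Annuli) (h0 : G.deg p.1.1 p.1.2 ≠ 0) :
    ∃ (g : Fin G.numChords) (e : ℝ), |e| ≤ 1 / 2 ∧ p = G.annPt p.1.1 g (1 / 2 + e) p.2.2 := by
  obtain ⟨c, w, y⟩ := p
  simp only at h0
  obtain ⟨u, rfl⟩ := G.pos_surjective c w
  have hD : (0 : ℤ) < (G.deg c.1 c.2 : ℤ) := by exact_mod_cast Nat.pos_of_ne_zero h0
  set k : ℤ := ⌊u⌋ % (G.deg c.1 c.2 : ℤ) with hk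
  have hk0 : 0 ≤ k := Int.emod_nonneg _ hD.ne'
  have hk1 : k < G.deg c.1 c.2 := Int.emod_lt_of_pos _ hD
  have hk2 := Int.emod_add_mul_ediv ⌊u⌋ (G.deg c.1 c.2 : ℤ)
  rw [← hk] at hk2
  set Q := ⌊u⌋ / (G.deg c.1 c.2 : ℤ)
  let κ : Fin (G.deg c.1 c.2) := ⟨k.toNat, by omega⟩
  set g := (G.chordEnd c.1).symm ⟨c.2, κ⟩ with hg
  have hgc : G.chordEnd c.1 g = ⟨c.2, κ⟩ := by simp [hg]
  refine ⟨g, Int.fract u - 1 / 2, ?_, ?_⟩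
  · rw [abs_le]
    constructor <;> linarith [Int.fract_nonneg u, Int.fract_lt_one u]
  · have h1 : (⟨c.1, (G.chordEnd c.1 g).1⟩ : G.Circles) = c := by rw [hgc]
    have h2 : ((G.chordEnd c.1 g).2 : ℕ) = k.toNat := by rw [hgc]
    simp only [annPt, h1, h2]
    refine congrArg (fun z => (c, z, y)) ((pos_eq_iff G).2 ⟨Q, ?_⟩)
    have h3 : ((k.toNat : ℕ) : ℝ) = ((k : ℤ) : ℝ) := by
      rw [← Int.cast_natCast, Int.toNat_of_nonneg hk0]
    have h4 : ((k : ℤ) : ℝ) + (G.deg c.1 c.2 : ℝ) * Q = ⌊u⌋ := by exact_mod_cast hk2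
    rw [h3, max_eq_left (Nat.one_le_iff_ne_zero.2 h0)]
    have h5 := Int.floor_add_fract u
    linear_combination (-1 : ℝ) * h5 - h4

theorem exists_side (y : Icc (-1 : ℝ) 1) : ∃ δ : ℤˣ, ∃ r ∈ Icc (0 : ℝ) 1,
    y = depth δ r ∧ r = 1 - |(y : ℝ)| := by
  have h1 := y.2.1
  have h2 := y.2.2
  rcases le_total 0 (y : ℝ) with h | h
  · refine ⟨-1, 1 - |(y : ℝ)|, ?_, Subtype.ext ?_, rfl⟩
    · rw [abs_of_nonneg h]; constructor <;> linarith
    · rw [depth_coe _ (by rw [abs_of_nonneg h]; constructor <;> linarith), abs_of_nonneg h]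
      push_cast; ring
  · refine ⟨1, 1 - |(y : ℝ)|, ?_, Subtype.ext ?_, rfl⟩
    · rw [abs_of_nonpos h]; constructor <;> linarith
    · rw [depth_coe _ (by rw [abs_of_nonpos h]; constructor <;> linarith), abs_of_nonpos h]
      push_cast; ring

theorem exists_trap_eq_annPt {s : Bool} {g : Fin G.numChords} {e : ℝ} {y : Icc (-1 : ℝ) 1}
    (he : |e| ≤ (2 - |(y : ℝ)|) / 4) : ∃ a : G.Arc, ∃ t ∈ Icc (0 : ℝ) 1, ∃ r ∈ Icc (0 : ℝ) 1,
      G.annPt s g (1 / 2 + e) y = G.trap a t r := by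
  obtain ⟨δ, r, hr, hy, hry⟩ := exists_side y
  have hr0 : (0 : ℝ) < 1 + r := by linarith [hr.1]
  have he' : |((δ : ℤ) : ℝ) * e| ≤ (1 + r) / 4 := by
    rw [abs_units_mul]; linarith
  rw [abs_le] at he'
  refine ⟨.inl (s, g, δ), 1 / 2 + 2 * (((δ : ℤ) : ℝ) * e) / (1 + r), ⟨?_, ?_⟩, r, hr, ?_⟩
  · have : -(1 / 2) ≤ 2 * (((δ : ℤ) : ℝ) * e) / (1 + r) := by
      rw [le_div_iff₀ hr0]; linarith
    linarith
  · have : 2 * (((δ : ℤ) : ℝ) * e) / (1 + r) ≤ 1 / 2 := by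
      rw [div_le_iff₀ hr0]; linarith
    linarith
  · simp only [trap, ← hy]
    congr 2
    have hδ : ((δ : ℤ) : ℝ) * ((δ : ℤ) : ℝ) = 1 := by
      rcases units_real δ with h | h <;> rw [h] <;> norm_num
    field_simp
    linear_combination -(16 * e) * hδ

theorem exists_trap_of_near {s : Bool} {h : Fin G.numChords} {w : ℝ} {y : Icc (-1 : ℝ) 1}
    (hw : |w| ≤ 1 / 4) (hy : |(y : ℝ)| ≤ 4 * |w|) :
    ∃ a : G.Arc, ∃ t ∈ Icc (0 : ℝ) 1, ∃ r ∈ Icc (0 : ℝ) 1, G.annPt s h w y = G.trap a t r := by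
  rcases le_total 0 w with h0 | h0
  · have := exists_trap_eq_annPt (s := s) (g := h) (e := w - 1 / 2) (y := y) (by
      rw [abs_of_nonneg h0] at hy hw
      rw [abs_of_nonpos (by linarith)]; linarith)
    rwa [show 1 / 2 + (w - 1 / 2) = w by ring] at this
  · have := exists_trap_eq_annPt (s := s) (g := (G.succ s).symm h) (e := w + 1 / 2) (y := y) (by
      rw [abs_of_nonpos h0] at hy hw
      rw [abs_of_nonneg (by linarith)]; linarith)
    rwa [show 1 / 2 + (w + 1 / 2) = 1 + w by ring, ← annPt_succ, Equiv.apply_symm_apply] at this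

/-- A point of an annulus that lies in none of its trapezoids is in a square, close to the axis of
the crossing circle. Seen from that circle it lies in a trapezoid. -/
theorem exists_trap (p : G.Annuli) : ∃ a : G.Arc, ∃ t ∈ Icc (0 : ℝ) 1, ∃ r ∈ Icc (0 : ℝ) 1,
    (Quot.mk _ p : G.RibbonGraph) = Quot.mk _ (G.trap a t r) := by
  by_cases h0 : G.deg p.1.1 p.1.2 = 0
  · obtain ⟨c, w, y⟩ := p
    simp only at h0
    obtain ⟨u, rfl⟩ := G.pos_surjective c w
    obtain ⟨δ, r, hr, hy, hry⟩ := exists_side y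
    have hδ : ((δ : ℤ) : ℝ) * ((δ : ℤ) : ℝ) = 1 := by
      rcases units_real δ with h | h <;> rw [h] <;> norm_num
    refine ⟨.inr (⟨c, h0⟩, δ), Int.fract (((δ : ℤ) : ℝ) * u),
      ⟨Int.fract_nonneg _, (Int.fract_lt_one _).le⟩, r, hr, congrArg _ ?_⟩
    simp only [trap, ← hy]
    refine congrArg (fun z => (c, z, y)) ((pos_eq_iff G).2 ⟨δ * ⌊((δ : ℤ) : ℝ) * u⌋, ?_⟩)
    rw [h0]
    have h5 := Int.floor_add_fract (((δ : ℤ) : ℝ) * u)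
    push_cast
    simp only [zero_le_one, sup_of_le_right, mul_one]
    linear_combination (-((δ : ℤ) : ℝ)) * h5 - u * hδ
  · obtain ⟨g, e, he, hp⟩ := exists_annPt p h0
    set s := p.1.1
    set y := p.2.2
    rw [hp]
    have hy1 : |(y : ℝ)| ≤ 1 := abs_le.2 y.2
    by_cases he1 : |e| ≤ (2 - |(y : ℝ)|) / 4
    · obtain ⟨a, t, ht, r, hr, h⟩ := exists_trap_eq_annPt (s := s) (g := g) he1
      exact ⟨a, t, ht, r, hr, congrArg _ h⟩
    push Not at he1
    obtain ⟨h, w, hw, hpw⟩ : ∃ h w, |w| < |(y : ℝ)| / 4 ∧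
        G.annPt s g (1 / 2 + e) y = G.annPt s h w y := by
      rcases le_total 0 e with h0 | h0
      · rw [abs_of_nonneg h0] at he1 he
        refine ⟨G.succ s g, e - 1 / 2, ?_, ?_⟩
        · rw [abs_of_nonpos (by linarith)]; linarith
        · rw [annPt_succ]; congr 1; ring
      · rw [abs_of_nonpos h0] at he1 he
        refine ⟨g, 1 / 2 + e, ?_, rfl⟩
        rw [abs_of_nonneg (by linarith)]; linarith
    have hw1 : 4 * |w| ≤ 1 := by linarith
    have hw4 : |4 * w| ≤ 1 := by rw [abs_mul]; simpa using hw1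
    have hε := units_real (G.sign h)
    have hεε : ((G.sign h : ℤ) : ℝ) * ((G.sign h : ℤ) : ℝ) = 1 := by
      rcases hε with h | h <;> rw [h] <;> norm_num
    -- The coupon exchanges `4 * w` and `y` up to sign, and thereby reverses the inequality between
    -- their absolute values.
    have key : ∃ (h' : Fin G.numChords) (w' : ℝ) (y' : Icc (-1 : ℝ) 1), |w'| ≤ 1 / 4 ∧
        |(y' : ℝ)| ≤ 4 * |w'| ∧ (Quot.mk _ (G.annPt s h w y) : G.RibbonGraph) =
          Quot.mk _ (G.annPt (!s) h' w' y') := by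
      cases s
      · -- from the lower to the upper circle
        let x' : Icc (-1 : ℝ) 1 := ⟨((-G.sign h : ℤˣ) : ℤ) * (y : ℝ), units_mul_mem _ _⟩
        let y' : Icc (-1 : ℝ) 1 := ⟨((G.sign h : ℤ) : ℝ) * (4 * w), units_mul_mem _ ⟨4 * w, abs_le.1 hw4⟩⟩
        refine ⟨h, (x' : ℝ) / 4, y', ?_, ?_, (Quot.sound (couponRel_iff.2
          ⟨h, x', y', y, ?_, rfl, ?_⟩)).symm⟩
        · rw [abs_div, show |(4 : ℝ)| = 4 by norm_num, abs_units_mul]; linarith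
        · simp only [x', y']
          rw [abs_div, show |(4 : ℝ)| = 4 by norm_num, abs_units_mul, abs_units_mul, abs_mul,
            show |(4 : ℝ)| = 4 by norm_num]
          linarith
        · simp only [x']; push_cast; linear_combination (-(y : ℝ)) * hεε
        · congr 1; simp only [y']; linear_combination w * hεε
      · let v : Icc (-1 : ℝ) 1 := ⟨((-G.sign h : ℤˣ) : ℤ) * (4 * w), units_mul_mem _ ⟨4 * w, abs_le.1 hw4⟩⟩
        refine ⟨h, ((G.sign h : ℤ) : ℝ) * (y : ℝ) / 4, v, ?_, ?_, Quot.sound (couponRel_iff.2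
          ⟨h, ⟨4 * w, abs_le.1 hw4⟩, y, v, ?_, ?_, rfl⟩)⟩
        · rw [mul_div_assoc, abs_units_mul, abs_div, show |(4 : ℝ)| = 4 by norm_num]; linarith
        · simp only [v]
          rw [mul_div_assoc, abs_units_mul, abs_units_mul, abs_div, abs_mul,
            show |(4 : ℝ)| = 4 by norm_num]
          linarith
        · simp only [v]; push_cast; ring
        · congr 1; simp only; ring
    obtain ⟨h', w', y', hw', hy', hm⟩ := key
    obtain ⟨a, t, ht, r, hr, he2⟩ := exists_trap_of_near (s := !s) (h := h') hw' hy'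
    exact ⟨a, t, ht, r, hr, by rw [hpw, hm, he2]⟩

/-! ### The cycles -/

/-- Sides with the same successor have the same end in the ribbon graph, and by the collar
description two ends `t = 1` are joined only if the sides are equal. -/
theorem next_injective : Function.Injective G.next := by
  intro a b h
  have h0 : (0 : ℝ) ∈ Icc (0 : ℝ) 1 := by simp
  have h1 : (1 : ℝ) ∈ Icc (0 : ℝ) 1 := by simp
  have h2 : (Quot.mk _ (G.trap a 1 0) : G.RibbonGraph) = Quot.mk _ (G.trap b 1 0) := by
    rw [mk_trap_next a h0, mk_trap_next b h0, h]
  rcases ((mk_trap_eq_iff h0 (by simp) h1 h1).1 h2).2 with h3 | h3 | h3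
  · exact h3.1
  · exact absurd h3.2.1 one_ne_zero
  · exact absurd h3.1 one_ne_zero

/-- The cycle to which a side belongs. -/
def cyc (a : G.Arc) : G.Cycle := Quot.mk _ a

theorem cyc_next (a : G.Arc) : cyc (G.next a) = cyc a := (Quot.sound (r := fun a b : G.Arc => G.next a = b) rfl).symm

theorem cyc_iterate (n : ℕ) (a : G.Arc) : cyc (G.next^[n] a) = cyc a := by
  induction n with
  | zero => rfl
  | succ n ih => rw [Function.iterate_succ_apply', cyc_next, ih]

theorem cyc_out (z : G.Cycle) : cyc (Quot.out z) = z := Quot.out_eq z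

/-- The number of sides in a cycle. -/
def len (z : G.Cycle) : ℕ := Function.minimalPeriod G.next (Quot.out z)

theorem len_pos (z : G.Cycle) : 0 < len z :=
  Function.minimalPeriod_pos_of_mem_periodicPts
    (Function.Injective.mem_periodicPts next_injective _)

theorem iterate_len (z : G.Cycle) : G.next^[len z] (Quot.out z) = Quot.out z :=
  Function.iterate_minimalPeriod

/-- An injective self-map of a finite set permutes it, so the equivalence relation that it generates
is already its forward orbit relation. -/
theorem exists_index (a : G.Arc) :
    ∃ i < len (cyc a), G.next^[i] (Quot.out (cyc a)) = a := by
  have key : ∀ a b : G.Arc, (Relation.EqvGen fun a b : G.Arc => G.next a = b) a b →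
      ∃ n, G.next^[n] a = b := by
    intro a b h
    induction h with
    | rel a b h => exact ⟨1, h⟩
    | refl a => exact ⟨0, rfl⟩
    | symm a b _ ih =>
      obtain ⟨n, rfl⟩ := ih
      have hp : a ∈ Function.periodicPts G.next :=
        Function.Injective.mem_periodicPts next_injective _
      obtain ⟨m, hm, hm'⟩ := hp
      -- With a period `m > 0`, going back `n` steps is going forward `m * n - n` steps.
      refine ⟨m * n - n, ?_⟩
      rw [← Function.iterate_add_apply, Nat.sub_add_cancel (Nat.le_mul_of_pos_left n hm)]
      exact hm'.mul_const n
    | trans a b c _ _ ih1 ih2 =>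
      obtain ⟨n, rfl⟩ := ih1
      obtain ⟨m, rfl⟩ := ih2
      exact ⟨m + n, Function.iterate_add_apply _ _ _ _⟩
  obtain ⟨n, hn⟩ := key _ _ (Quot.eqvGen_exact (Quot.out_eq (cyc a)))
  refine ⟨n % len (cyc a), Nat.mod_lt _ (len_pos _), ?_⟩
  rw [← hn, cyc_iterate, cyc_out]
  exact Function.iterate_mod_minimalPeriod_eq

/-- The place of a side in its cycle. -/
def index (a : G.Arc) : ℕ := (exists_index a).choose

theorem index_lt (a : G.Arc) : index a < len (cyc a) := (exists_index a).choose_spec.1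

theorem iterate_index (a : G.Arc) : G.next^[index a] (Quot.out (cyc a)) = a :=
  (exists_index a).choose_spec.2

theorem iterate_eq_of_lt {z : G.Cycle} {i j : ℕ} (hi : i < len z) (hj : j < len z)
    (h : G.next^[i] (Quot.out z) = G.next^[j] (Quot.out z)) : i = j :=
  (Function.iterate_eq_iterate_iff_of_lt_minimalPeriod hi hj).1 h

/-- The point of the boundary of a hole to which the point `t` of a side is glued. -/
def ang (a : G.Arc) (t : ℝ) : Circle :=
  Circle.exp (2 * Real.pi * (index a + t) / len (cyc a))

theorem continuous_ang (a : G.Arc) : Continuous (ang a) := by unfold ang; fun_prop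

theorem circle_exp_eq_iff {n : ℕ} (hn : 0 < n) {x y : ℝ} :
    Circle.exp (2 * Real.pi * x / n) = Circle.exp (2 * Real.pi * y / n) ↔
      ∃ m : ℤ, x = y + m * n := by
  have hD : (0 : ℝ) < n := by exact_mod_cast hn
  have h2 := Real.pi_pos
  rw [Circle.exp_eq_exp]
  refine exists_congr fun m => ?_
  rw [div_eq_iff hD.ne', add_mul, div_mul_cancel₀ _ hD.ne']
  constructor
  · intro h
    have : (2 * Real.pi) * x = (2 * Real.pi) * (y + m * n) := by linear_combination h
    exact mul_left_cancel₀ (by positivity) this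
  · intro h
    rw [h]; ring

theorem index_iterate (z : G.Cycle) (i : ℕ) :
    ∃ m : ℤ, (i : ℝ) = index (G.next^[i] (Quot.out z)) + m * len z := by
  set a := G.next^[i] (Quot.out z) with ha
  have hz : cyc a = z := by rw [ha, cyc_iterate, cyc_out]
  have h1 := index_lt a
  have h2 := iterate_index a
  rw [hz] at h1 h2
  have h3 : index a = i % len z := by
    refine iterate_eq_of_lt h1 (Nat.mod_lt _ (len_pos _)) ?_
    rw [h2, ha]
    exact Function.iterate_mod_minimalPeriod_eq.symm
  rw [h3]
  have := Nat.mod_add_div i (len z)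
  generalize i / len z = Q at this
  generalize i % len z = P at this ⊢
  refine ⟨(Q : ℤ), ?_⟩
  have h4 : (P : ℝ) + len z * (Q : ℝ) = i := by exact_mod_cast this
  push_cast
  linarith

theorem ang_iterate (z : G.Cycle) (i : ℕ) (t : ℝ) :
    ang (G.next^[i] (Quot.out z)) t =
      Circle.exp (2 * Real.pi * (i + t) / Function.minimalPeriod G.next (Quot.out z)) := by
  rw [ang, cyc_iterate, cyc_out]
  refine (circle_exp_eq_iff (len_pos z)).2 ?_
  obtain ⟨m, hm⟩ := index_iterate z i
  exact ⟨-m, by push_cast; linarith⟩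

theorem ang_next (a : G.Arc) : ang a 1 = ang (G.next a) 0 := by
  have h1 : G.next a = G.next^[index a + 1] (Quot.out (cyc a)) := by
    rw [Function.iterate_succ_apply', iterate_index]
  rw [h1, ang_iterate, ang]
  push_cast
  rw [add_zero]
  rfl

/-- Consecutive sides occupy consecutive arcs of equal length on the circle. The difference of the
two indices, modulo the length of the cycle, is `-1`, `0` or `1`; the outer values are the passages
to the next side, including the one that closes the cycle. -/
theorem ang_eq_iff {a a' : G.Arc} {t t' : ℝ} (hc : cyc a = cyc a') (ht : t ∈ Icc (0 : ℝ) 1)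
    (ht' : t' ∈ Icc (0 : ℝ) 1) : ang a t = ang a' t' ↔ Joined a t a' t' := by
  constructor
  · intro h
    rw [ang, ang, ← hc] at h
    obtain ⟨m, hm⟩ := (circle_exp_eq_iff (len_pos _)).1 h
    have h1 := index_lt a
    have h1' := index_lt a'
    have h2 := iterate_index a
    have h2' := iterate_index a'
    rw [← hc] at h1' h2'
    set n := len (cyc a)
    set i := index a
    set i' := index a'
    have hN : (((i : ℤ) - i' - m * n : ℤ) : ℝ) = t' - t := by push_cast; linarith
    have h3 : (-1 : ℝ) ≤ ((i : ℤ) - i' - m * n : ℤ) := by linarith [ht.2, ht'.1]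
    have h4 : (((i : ℤ) - i' - m * n : ℤ) : ℝ) ≤ 1 := by linarith [ht.1, ht'.2]
    have h3' : (-1 : ℤ) ≤ ((i : ℤ) - i' - m * n : ℤ) := by exact_mod_cast h3
    have h4' : ((i : ℤ) - i' - m * n : ℤ) ≤ 1 := by exact_mod_cast h4
    generalize hNN : ((i : ℤ) - i' - m * n : ℤ) = N at *
    have hm1 : -1 ≤ m := by nlinarith
    have hm2 : m ≤ 1 := by nlinarith
    have hstep : ∀ {b b' : G.Arc} {j j' : ℕ}, j < n → j' < n →
        G.next^[j] (Quot.out (cyc a)) = b → G.next^[j'] (Quot.out (cyc a)) = b' →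
        ((j' : ℤ) = j + 1 ∨ (j' : ℤ) = j + 1 - n) → b' = G.next b := by
      rintro b b' j j' hj hj' rfl rfl h
      rw [← Function.iterate_succ_apply' G.next]
      rcases h with h | h
      · have : j' = j + 1 := by omega
        rw [this]
      · have h6 : j' = 0 := by omega
        have h7 : j.succ = n := by omega
        rw [h6, h7]
        exact (iterate_len (cyc a)).symm
    obtain h5 | h5 | h5 : N = -1 ∨ N = 0 ∨ N = 1 := by omega
    · rw [h5] at hN hNN
      push_cast at hN
      have ht1 : t = 1 := by linarith [ht.2, ht'.1]
      have ht0 : t' = 0 := by linarith [ht.2, ht'.1]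
      refine Or.inr (Or.inl ⟨ht1, ht0, hstep h1 h1' h2 h2' ?_⟩)
      obtain rfl | rfl | rfl : m = -1 ∨ m = 0 ∨ m = 1 := by omega
      all_goals omega
    · rw [h5] at hN hNN
      push_cast at hN
      refine Or.inl ⟨?_, by linarith⟩
      have : i = i' := by
        obtain rfl | rfl | rfl : m = -1 ∨ m = 0 ∨ m = 1 := by omega
        all_goals omega
      rw [← h2, ← h2', this]
    · rw [h5] at hN hNN
      push_cast at hN
      have ht1 : t' = 1 := by linarith [ht.1, ht'.2]
      have ht0 : t = 0 := by linarith [ht.1, ht'.2]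
      refine Or.inr (Or.inr ⟨ht0, ht1, hstep h1' h1 h2' h2 ?_⟩)
      obtain rfl | rfl | rfl : m = -1 ∨ m = 0 ∨ m = 1 := by omega
      all_goals omega
  · rintro (⟨rfl, rfl⟩ | ⟨rfl, rfl, rfl⟩ | ⟨rfl, rfl, rfl⟩)
    · rfl
    · exact ang_next a
    · exact (ang_next a').symm

theorem Joined.cyc_eq {a a' : G.Arc} {t t' : ℝ} (h : Joined a t a' t') : cyc a = cyc a' := by
  rcases h with ⟨rfl, -⟩ | ⟨-, -, rfl⟩ | ⟨-, -, rfl⟩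
  · rfl
  · exact (cyc_next a).symm
  · exact cyc_next a'

theorem exists_ang (z : G.Cycle) (w : Circle) :
    ∃ a : G.Arc, cyc a = z ∧ ∃ t ∈ Icc (0 : ℝ) 1, ang a t = w := by
  have hn : (0 : ℝ) < len z := by exact_mod_cast len_pos z
  obtain ⟨θ, hθ, hw⟩ : ∃ θ : ℝ, 0 ≤ θ ∧ Circle.exp (2 * Real.pi * θ / len z) = w := by
    obtain ⟨φ, rfl⟩ := Circle.exp_surjective w
    have h2 := Real.pi_pos
    refine ⟨Int.fract (φ / (2 * Real.pi)) * len z, by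
      have := Int.fract_nonneg (φ / (2 * Real.pi)); positivity, ?_⟩
    rw [Circle.exp_eq_exp]
    refine ⟨-⌊φ / (2 * Real.pi)⌋, ?_⟩
    have h3 := Int.floor_add_fract (φ / (2 * Real.pi))
    have h4 : (2 * Real.pi) * (φ / (2 * Real.pi)) = φ := by field_simp
    rw [← mul_assoc, mul_div_cancel_right₀ _ hn.ne']
    push_cast
    linear_combination (2 * Real.pi) * h3 + h4
  refine ⟨G.next^[⌊θ⌋₊] (Quot.out z), by rw [cyc_iterate, cyc_out], θ - ⌊θ⌋₊, ⟨?_, ?_⟩, ?_⟩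
  · linarith [Nat.floor_le hθ]
  · linarith [Nat.lt_floor_add_one θ]
  · rw [ang_iterate, ← hw, add_sub_cancel]
    rfl

end GaussDiagram

/-! ### The surface of a decorated Gauss diagram -/

namespace GaussDiagram

variable {G : GaussDiagram}

theorem annPt_ne {h : Fin G.numChords} {s : Bool} {w : ℝ} {y : Icc (-1 : ℝ) 1}
    {c : {c : G.Circles // G.deg c.1 c.2 = 0}} {z : Circle × Icc (-1 : ℝ) 1} :
    G.annPt s h w y ≠ (c.1, z) := by
  intro he
  have h1 := (G.chordEnd s h).2.2
  have h2 : (⟨s, (G.chordEnd s h).1⟩ : G.Circles) = c.1 := congrArg Prod.fst he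
  have h3 := c.2
  rw [← h2] at h3
  simp only at h3
  omega

theorem abs_depth_zero (δ : ℤˣ) : |(depth δ 0 : ℝ)| = 1 := by
  rw [depth_coe _ (by simp), abs_neg, abs_units_mul]; norm_num

/-- The boundary of the ribbon graph lies on the boundary of the annuli. -/
theorem abs_eq_one_of_mk_trap_zero {a : G.Arc} {t : ℝ} (ht : t ∈ Icc (0 : ℝ) 1) {p : G.Annuli}
    (H : (Quot.mk _ (G.trap a t 0) : G.RibbonGraph) = Quot.mk _ p) : |(p.2.2 : ℝ)| = 1 := by
  have hfar : ∀ {s h w y}, |w| ≤ 1 / 4 → G.annPt s h w y = G.trap a t 0 →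
      1 / 4 ≤ |w| ∧ |(y : ℝ)| = 1 := by
    intro s h w y hw he
    rcases a with ⟨s', g, δ⟩ | ⟨c, δ⟩
    · have h2 := trap_half_le δ ht (r := 0) (by simp)
      obtain ⟨-, h3, h4⟩ := annPt_window (h2.trans (by norm_num)) hw he.symm
      refine ⟨?_, h3 ▸ abs_depth_zero δ⟩
      rw [abs_le] at h2
      rcases h4 with ⟨-, h4⟩ | ⟨-, h4⟩
      · rw [h4]; exact (by linarith [h2.1] : (1 : ℝ) / 4 ≤ _).trans (le_abs_self _)
      · rw [h4]; exact (by linarith [h2.2] : (1 : ℝ) / 4 ≤ _).trans (neg_le_abs _)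
    · exact (annPt_ne he).elim
  rcases couponRel_isGluing.mk_eq_iff.1 H with H | H | H
  · rw [← H]
    rcases a with ⟨s, h, δ⟩ | ⟨c, δ⟩ <;> exact abs_depth_zero δ
  · obtain ⟨h, x, y, v, hv, h1, rfl⟩ := couponRel_iff.1 H
    have hx : |(x : ℝ)| ≤ 1 := abs_le.2 x.2
    obtain ⟨h2, -⟩ := hfar (by rw [abs_div, show |(4 : ℝ)| = 4 by norm_num]; linarith) h1
    rw [abs_div, show |(4 : ℝ)| = 4 by norm_num] at h2
    change |(v : ℝ)| = 1
    rw [hv, neg_mul, abs_neg, abs_units_mul]; linarith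
  · obtain ⟨h, x, y, v, hv, rfl, h1⟩ := couponRel_iff.1 H
    have hy : |(y : ℝ)| ≤ 1 := abs_le.2 y.2
    obtain ⟨h2, -⟩ := hfar (by
      rw [mul_div_assoc, abs_units_mul, abs_div, show |(4 : ℝ)| = 4 by norm_num]; linarith) h1
    rw [mul_div_assoc, abs_units_mul, abs_div, show |(4 : ℝ)| = 4 by norm_num] at h2
    change |(y : ℝ)| = 1
    linarith

theorem isOpenMap_pos (c : G.Circles) : IsOpenMap (G.pos c) := by
  have hD : ((max (G.deg c.1 c.2) 1 : ℕ) : ℝ) ≠ 0 := by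
    exact_mod_cast (lt_of_lt_of_le one_pos (le_max_right _ _)).ne'
  have h2 := Real.pi_pos.ne'
  have : G.pos c = Circle.exp ∘ fun u => (2 * Real.pi / ((max (G.deg c.1 c.2) 1 : ℕ) : ℝ)) * u := by
    funext u; simp only [pos, Function.comp]; congr 1; ring
  rw [this]
  exact isLocalHomeomorph_circleExp.isOpenMap.comp (Homeomorph.mulLeft₀ _ (by positivity)).isOpenMap

theorem isOpen_strip (s : Bool) (h : Fin G.numChords) :
    IsOpen {p : G.Annuli | ∃ w y, |w| < 1 / 4 ∧ G.annPt s h w y = p} := by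
  have : {p : G.Annuli | ∃ w y, |w| < 1 / 4 ∧ G.annPt s h w y = p} =
      {(⟨s, (G.chordEnd s h).1⟩ : G.Circles)} ×ˢ
        ((G.pos ⟨s, (G.chordEnd s h).1⟩ '' ((fun w => ((G.chordEnd s h).2 : ℕ) + w) ''
          {w : ℝ | |w| < 1 / 4})) ×ˢ univ) := by
    ext ⟨c, z, y⟩
    simp only [mem_ofPred_eq, annPt, mem_prod, mem_singleton_iff, mem_image, mem_univ, and_true,
      Prod.mk.injEq]
    constructor
    · rintro ⟨w, y, hw, rfl, rfl, rfl⟩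
      exact ⟨rfl, _, ⟨w, hw, rfl⟩, rfl⟩
    · rintro ⟨rfl, _, ⟨w, hw, rfl⟩, rfl⟩
      exact ⟨w, y, hw, rfl, rfl, rfl⟩
  rw [this]
  refine (isOpen_discrete _).prod (IsOpen.prod (isOpenMap_pos _ _ ?_) isOpen_univ)
  exact isOpenMap_add_left _ _ (isOpen_lt continuous_abs continuous_const)

/-- The projection of the annuli to the ribbon graph. -/
def rmk (p : G.Annuli) : G.RibbonGraph := Quot.mk _ p

theorem continuous_rmk : Continuous (rmk (G := G)) := continuous_quot_mk

theorem rmk_trap_eq_iff {a a' : G.Arc} {t t' r r' : ℝ} (hr : r ∈ Icc (0 : ℝ) 1)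
    (hr' : r' ∈ Ico (0 : ℝ) 1) (ht : t ∈ Icc (0 : ℝ) 1) (ht' : t' ∈ Icc (0 : ℝ) 1) :
    rmk (G.trap a t r) = rmk (G.trap a' t' r') ↔ r = r' ∧ Joined a t a' t' :=
  mk_trap_eq_iff hr hr' ht ht'

/-- The preimage in the annuli consists of the open annulus itself and of the open strips that the
crossing circles cut out of their annuli at the chords on `c`. -/
theorem isOpen_ribbon_annulus (c : G.Circles) :
    IsOpen {q : G.RibbonGraph | ∃ w : Circle, ∃ t : Icc (-1 : ℝ) 1, (t : ℝ) ∈ Ioo (-1 : ℝ) 1 ∧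
      rmk (c, w, t) = q} := by
  change IsOpen (rmk ⁻¹' _)
  set A : Set G.Annuli := {c} ×ˢ (univ ×ˢ {t : Icc (-1 : ℝ) 1 | (t : ℝ) ∈ Ioo (-1 : ℝ) 1}) with hA
  have hAo : IsOpen A := (isOpen_discrete _).prod
    (isOpen_univ.prod (isOpen_Ioo.preimage continuous_subtype_val))
  set B : Set G.Annuli := ⋃ h : {h : Fin G.numChords // (G.chordEnd c.1 h).1 = c.2},
    {p : G.Annuli | ∃ w y, |w| < 1 / 4 ∧ G.annPt (!c.1) h w y = p} with hB
  have hBo : IsOpen B := isOpen_iUnion fun h => isOpen_strip _ _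
  convert hAo.union hBo using 1
  have lt_of : ∀ {x : Icc (-1 : ℝ) 1}, |(x : ℝ)| < 1 ↔ (x : ℝ) ∈ Ioo (-1 : ℝ) 1 := by
    intro x; rw [abs_lt]; rfl
  ext p
  simp only [mem_preimage, mem_ofPred_eq, mem_union]
  constructor
  · rintro ⟨w, t, ht, H⟩
    rcases couponRel_isGluing.mk_eq_iff.1 H with rfl | H | H
    · exact Or.inl ⟨rfl, trivial, ht⟩
    · obtain ⟨h, x, y, v, hv, h1, rfl⟩ := couponRel_iff.1 H
      have h2 : (⟨true, (G.chordEnd true h).1⟩ : G.Circles) = c := congrArg Prod.fst h1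
      have h3 : y = t := congrArg (fun p : G.Annuli => p.2.2) h1
      subst h2 h3
      refine Or.inr (mem_iUnion.2 ⟨⟨h, rfl⟩, _, _, ?_, rfl⟩)
      rw [mul_div_assoc, abs_units_mul, abs_div, show |(4 : ℝ)| = 4 by norm_num]
      have := lt_of.2 ht
      linarith
    · obtain ⟨h, x, y, v, hv, rfl, h1⟩ := couponRel_iff.1 H
      have h2 : (⟨false, (G.chordEnd false h).1⟩ : G.Circles) = c := congrArg Prod.fst h1
      have h3 : v = t := congrArg (fun p : G.Annuli => p.2.2) h1
      subst h2 h3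
      refine Or.inr (mem_iUnion.2 ⟨⟨h, rfl⟩, _, _, ?_, rfl⟩)
      have := lt_of.2 ht
      rw [hv, neg_mul, abs_neg, abs_units_mul] at this
      rw [abs_div, show |(4 : ℝ)| = 4 by norm_num]
      linarith
  · rintro (⟨h1, -, h2⟩ | hm)
    · obtain ⟨c', w, t⟩ := p
      obtain rfl : c' = c := h1
      exact ⟨w, t, h2, rfl⟩
    · obtain ⟨⟨h, hc⟩, w, y, hw, rfl⟩ := mem_iUnion.1 hm
      clear hm hA hB hBo hAo A B
      have hw4 : |4 * w| < 1 := by rw [abs_mul, show |(4 : ℝ)| = 4 by norm_num]; linarith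
      have hεε : ((G.sign h : ℤ) : ℝ) * ((G.sign h : ℤ) : ℝ) = 1 := by
        rcases units_real (G.sign h) with h | h <;> rw [h] <;> norm_num
      obtain ⟨s, i⟩ := c
      change (G.chordEnd s h).1 = i at hc
      subst hc
      cases s
      · let v : Icc (-1 : ℝ) 1 :=
          ⟨((-G.sign h : ℤˣ) : ℤ) * (4 * w), units_mul_mem _ ⟨4 * w, abs_le.1 hw4.le⟩⟩
        refine ⟨G.pos _ (((G.chordEnd false h).2 : ℕ) + ((G.sign h : ℤ) : ℝ) * (y : ℝ) / 4), v, ?_,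
          (Quot.sound (couponRel_iff.2 ⟨h, ⟨4 * w, abs_le.1 hw4.le⟩, y, v, ?_, ?_, rfl⟩)).symm⟩
        · rw [← lt_of]; simp only [v]; rw [abs_units_mul]; exact hw4
        · simp only [v]; push_cast; ring
        · simp only [Bool.not_false]; congr 1; ring
      · let y' : Icc (-1 : ℝ) 1 :=
          ⟨((G.sign h : ℤ) : ℝ) * (4 * w), units_mul_mem _ ⟨4 * w, abs_le.1 hw4.le⟩⟩
        let x : Icc (-1 : ℝ) 1 := ⟨((-G.sign h : ℤˣ) : ℤ) * (y : ℝ), units_mul_mem _ _⟩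
        refine ⟨G.pos _ (((G.chordEnd true h).2 : ℕ) + (x : ℝ) / 4), y', ?_,
          Quot.sound (couponRel_iff.2 ⟨h, x, y', y, ?_, rfl, ?_⟩)⟩
        · rw [← lt_of]; simp only [y']; rw [abs_units_mul]; exact hw4
        · simp only [x]; push_cast; linear_combination (-(y : ℝ)) * hεε
        · simp only [Bool.not_true]; congr 1; simp only [y']; linear_combination w * hεε

end GaussDiagram

namespace DecoratedGaussDiagram

open GaussDiagram

variable {G : DecoratedGaussDiagram}

instance (J : Set ℕ) : CompactSpace (HoledSphere J) := by
  have : IsClosed {p : OnePoint ℂ | ∀ j ∈ J, ∀ z : ℂ, p = (z : OnePoint ℂ) →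
      1 ≤ ‖z - 3 * (j : ℂ)‖} := by
    have h : {p : OnePoint ℂ | ∀ j ∈ J, ∀ z : ℂ, p = (z : OnePoint ℂ) → 1 ≤ ‖z - 3 * (j : ℂ)‖} =
        (⋃ j ∈ J, ((↑) : ℂ → OnePoint ℂ) '' ball (3 * (j : ℂ)) 1)ᶜ := by
      ext p
      simp only [mem_ofPred_eq, mem_compl_iff, mem_iUnion, mem_image, mem_ball, dist_eq_norm,
        not_exists, not_and]
      constructor
      · rintro h j hj z hz rfl
        exact absurd (h j hj z rfl) (not_le.2 hz)
      · rintro h j hj z rfl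
        by_contra hz
        exact h j hj z (not_le.1 hz) rfl
    rw [h, isClosed_compl_iff]
    exact isOpen_biUnion fun j _ => OnePoint.isOpenEmbedding_coe.isOpenMap _ isOpen_ball
  exact isCompact_iff_compactSpace.1 this.isCompact

instance (J : Set ℕ) : T2Space (HoledSphere J) := inferInstanceAs (T2Space (Subtype _))

/-- The point at infinity of a sphere with holes. -/
def HoledSphere.infty (J : Set ℕ) : HoledSphere J := ⟨OnePoint.infty, by simp⟩

instance (J : Set ℕ) : Nonempty (HoledSphere J) := ⟨HoledSphere.infty J⟩

theorem norm_three_sub {j k : ℕ} (h : j ≠ k) : 3 ≤ ‖(3 * (j : ℂ) - 3 * (k : ℂ))‖ := by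
  have h1 : (1 : ℝ) ≤ |((j : ℤ) - (k : ℤ) : ℤ)| := by
    have : (1 : ℤ) ≤ |(j : ℤ) - k| := Int.one_le_abs (by omega)
    exact_mod_cast this
  rw [← mul_sub, norm_mul, show ((j : ℂ) - k) = (((j : ℤ) - (k : ℤ) : ℤ) : ℂ) by push_cast; rfl,
    Complex.norm_intCast]
  simp only [Complex.norm_ofNat]
  push_cast at h1 ⊢
  linarith

theorem cycleIndex_injective : Function.Injective G.cycleIndex := fun z z' h =>
  (Finite.equivFin G.Cycle).injective (Fin.ext h)

/-- The point `t` of the side `a`, as a point of the boundary of a hole. -/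
def holePt (a : G.Arc) (t : ℝ) : G.Region (G.color (cyc a)) :=
  ⟨((3 * (G.cycleIndex (cyc a) : ℂ) + (ang a t : ℂ) : ℂ) : OnePoint ℂ), by
    rintro j ⟨z, hz, rfl⟩ u hu
    rw [OnePoint.coe_eq_coe] at hu
    subst hu
    by_cases h : z = cyc a
    · subst h; simp [Circle.norm_coe]
    · have := norm_three_sub (fun h' => h (cycleIndex_injective h').symm :
        G.cycleIndex (cyc a) ≠ G.cycleIndex z)
      have h2 := norm_sub_le (3 * (G.cycleIndex (cyc a) : ℂ) + (ang a t : ℂ) -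
        3 * (G.cycleIndex z : ℂ)) (ang a t : ℂ)
      rw [show (3 * (G.cycleIndex (cyc a) : ℂ) + (ang a t : ℂ) -
        3 * (G.cycleIndex z : ℂ)) - (ang a t : ℂ) = 3 * (G.cycleIndex (cyc a) : ℂ) -
        3 * (G.cycleIndex z : ℂ) by ring, Circle.norm_coe] at h2
      linarith⟩

theorem continuous_holePt (a : G.Arc) : Continuous (holePt (G := G) a) := by
  have := continuous_ang a
  exact Continuous.subtype_mk (OnePoint.continuous_coe.comp (by fun_prop)) _

theorem sigma_region_ext {x y : Σ c, G.Region c} (h1 : x.1 = y.1) (h2 : x.2.1 = y.2.1) : x = y := by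
  obtain ⟨c, p⟩ := x
  obtain ⟨c', p'⟩ := y
  obtain rfl : c = c' := h1
  exact congrArg _ (Subtype.ext h2)

theorem regionRel_iff {x y : G.RibbonGraph ⊕ Σ c, G.Region c} : G.RegionRel x y ↔
    ∃ k : G.Arc × Icc (0 : ℝ) 1, Sum.inl (rmk (G.trap k.1 k.2 0)) = x ∧
      Sum.inr ⟨G.color (cyc k.1), holePt k.1 k.2⟩ = y := by
  constructor
  · rintro ⟨z, i, t, ht, p, hp⟩
    have hz : cyc (G.next^[i] (Quot.out z)) = z := by rw [cyc_iterate, cyc_out]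
    refine ⟨(G.next^[i] (Quot.out z), ⟨t, ht⟩), ?_, ?_⟩
    · rw [arcPoint_eq]; rfl
    · refine congrArg Sum.inr (sigma_region_ext (congrArg G.color hz) ?_)
      rw [hp.2]
      simp only [holePt, hz, ang_iterate]
  · rintro ⟨⟨a, t, ht⟩, rfl, rfl⟩
    have := RegionRel.glue (G := G) (cyc a) (index a) t ht (holePt a t)
      ⟨⟨cyc a, rfl, rfl⟩, rfl⟩
    rwa [iterate_index, arcPoint_eq] at this

theorem holePt_eq_iff {a a' : G.Arc} {t t' : ℝ} (ht : t ∈ Icc (0 : ℝ) 1)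
    (ht' : t' ∈ Icc (0 : ℝ) 1) : (⟨_, holePt a t⟩ : Σ c, G.Region c) = ⟨_, holePt a' t'⟩ ↔
      Joined a t a' t' := by
  constructor
  · intro h
    have h1 : (holePt a t).1 = (holePt a' t').1 :=
      congrArg (fun x : Σ c, G.Region c => x.2.1) h
    simp only [holePt, OnePoint.coe_eq_coe] at h1
    by_cases hc : cyc a = cyc a'
    · rw [hc, add_right_inj, Circle.coe_inj] at h1
      exact (ang_eq_iff hc ht ht').1 h1
    · have h2 := norm_three_sub (fun h => hc (cycleIndex_injective h))
      have h3 : (3 * (G.cycleIndex (cyc a) : ℂ) - 3 * (G.cycleIndex (cyc a') : ℂ)) =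
        (ang a' t' : ℂ) - (ang a t : ℂ) := by linear_combination h1
      rw [h3] at h2
      have := norm_sub_le (ang a' t' : ℂ) (ang a t : ℂ)
      rw [Circle.norm_coe, Circle.norm_coe] at this
      linarith
  · intro h
    have hc := h.cyc_eq
    refine sigma_region_ext (congrArg G.color hc) ?_
    simp only [holePt, hc, (ang_eq_iff hc ht ht').2 h]

/-- The parametrization by sides is not injective, since consecutive sides share a point. But the
point of the ribbon graph and the point on the hole coincide in exactly the same cases, those of
`Joined`. -/
theorem regionRel_isGluing : IsGluing G.RegionRel := by
  refine IsGluing.of_compact (K := G.Arc × Icc (0 : ℝ) 1)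
    (f := fun k => Sum.inl (rmk (G.trap k.1 k.2 0)))
    (g := fun k => Sum.inr ⟨G.color (cyc k.1), holePt k.1 k.2⟩) ?_ ?_
    (fun _ _ => regionRel_iff) ?_ ?_
  · refine continuous_inl.comp (continuous_rmk.comp ?_)
    rw [continuous_prod_of_discrete_left]
    exact fun a => (continuous_trap a).comp (by fun_prop : Continuous fun t : Icc (0 : ℝ) 1 => ((t : ℝ), (0 : ℝ)))
  · refine continuous_inr.comp ?_
    rw [continuous_prod_of_discrete_left]
    exact fun a => continuous_sigmaMk.comp ((continuous_holePt a).comp continuous_subtype_val)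
  · rintro ⟨a, t⟩ ⟨a', t'⟩
    rw [Sum.inl_injective.eq_iff, Sum.inr_injective.eq_iff]
    rw [rmk_trap_eq_iff (by simp) (by simp) t.2 t'.2, holePt_eq_iff t.2 t'.2, and_iff_right rfl]
  · simp

instance : CompactSpace (Σ c, G.Region c) := inferInstance

instance : T2Space G.Surface := regionRel_isGluing.t2Space

instance : CompactSpace G.Surface := inferInstanceAs (CompactSpace (Quot _))

/-- The inclusion of the ribbon graph. -/
def ribbon (x : G.RibbonGraph) : G.Surface := Quot.mk _ (.inl x)

/-- The inclusion of a sphere with holes. -/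
def region (c : Fin G.numColors) (p : G.Region c) : G.Surface := Quot.mk _ (.inr ⟨c, p⟩)

/-- The point of the surface at depth `r` below the point `t` of a side of an edge. -/
def slab (a : G.Arc) (t r : ℝ) : G.Surface := ribbon (rmk (G.trap a t r))

theorem continuous_ribbon : Continuous (ribbon (G := G)) := continuous_quot_mk.comp continuous_inl

theorem continuous_region (c : Fin G.numColors) : Continuous (region (G := G) c) :=
  continuous_quot_mk.comp (continuous_inr.comp continuous_sigmaMk)

theorem continuous_slab (a : G.Arc) : Continuous fun p : ℝ × ℝ => slab (G := G) a p.1 p.2 :=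
  continuous_ribbon.comp (continuous_rmk.comp (continuous_trap a))

theorem ribbon_injective : Function.Injective (ribbon (G := G)) := by
  intro x y h
  rcases regionRel_isGluing.mk_eq_iff.1 h with h | h | h
  · exact Sum.inl_injective h
  · obtain ⟨k, -, h⟩ := regionRel_iff.1 h
    cases h
  · obtain ⟨k, -, h⟩ := regionRel_iff.1 h
    cases h

theorem region_eq_iff {c c' : Fin G.numColors} {p : G.Region c} {p' : G.Region c'} :
    region c p = region c' p' ↔ c = c' ∧ p.1 = p'.1 := by
  constructor
  · intro h
    rcases regionRel_isGluing.mk_eq_iff.1 h with h | h | h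
    · have := Sum.inr_injective h
      exact ⟨congrArg Sigma.fst this, congrArg (fun x : Σ c, G.Region c => x.2.1) this⟩
    · obtain ⟨k, h, -⟩ := regionRel_iff.1 h
      cases h
    · obtain ⟨k, h, -⟩ := regionRel_iff.1 h
      cases h
  · rintro ⟨rfl, h⟩
    rw [Subtype.ext h]

theorem ribbon_eq_region_iff {x : G.RibbonGraph} {c : Fin G.numColors} {p : G.Region c} :
    ribbon x = region c p ↔ ∃ a : G.Arc, ∃ t ∈ Icc (0 : ℝ) 1, x = rmk (G.trap a t 0) ∧
      G.color (cyc a) = c ∧ p.1 = (holePt a t).1 := by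
  constructor
  · intro h
    rcases regionRel_isGluing.mk_eq_iff.1 h with h | h | h
    · cases h
    · obtain ⟨⟨a, t⟩, h1, h2⟩ := regionRel_iff.1 h
      have h2 := Sum.inr_injective h2
      exact ⟨a, t, t.2, (Sum.inl_injective h1).symm, congrArg Sigma.fst h2,
        (congrArg (fun x : Σ c, G.Region c => x.2.1) h2).symm⟩
    · obtain ⟨k, h, -⟩ := regionRel_iff.1 h
      cases h
  · rintro ⟨a, t, ht, rfl, rfl, hp⟩
    obtain rfl : p = holePt a t := Subtype.ext hp
    exact Quot.sound (regionRel_iff.2 ⟨(a, ⟨t, ht⟩), rfl, rfl⟩)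

theorem slab_eq_region_iff {a : G.Arc} {t r : ℝ} (ht : t ∈ Icc (0 : ℝ) 1) (hr : r ∈ Icc (0 : ℝ) 1)
    {c : Fin G.numColors} {p : G.Region c} :
    slab a t r = region c p ↔ r = 0 ∧ G.color (cyc a) = c ∧ p.1 = (holePt a t).1 := by
  rw [slab, ribbon_eq_region_iff]
  constructor
  · rintro ⟨a', t', ht', h1, h2, h3⟩
    obtain ⟨rfl, hJ⟩ := (rmk_trap_eq_iff hr (by simp) ht ht').1 h1
    have := (holePt_eq_iff ht ht').2 hJ
    refine ⟨rfl, by rw [hJ.cyc_eq, h2], ?_⟩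
    rw [h3]
    exact (congrArg (fun x : Σ c, G.Region c => x.2.1) this).symm
  · rintro ⟨rfl, h2, h3⟩
    exact ⟨a, t, ht, rfl, h2, h3⟩

theorem slab_eq_iff {a a' : G.Arc} {t t' r r' : ℝ} (hr : r ∈ Icc (0 : ℝ) 1)
    (hr' : r' ∈ Ico (0 : ℝ) 1) (ht : t ∈ Icc (0 : ℝ) 1) (ht' : t' ∈ Icc (0 : ℝ) 1) :
    slab a t r = slab a' t' r' ↔ r = r' ∧ Joined a t a' t' := by
  rw [← rmk_trap_eq_iff hr hr' ht ht']
  exact ribbon_injective.eq_iff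

theorem exists_slab_or_region (x : G.Surface) :
    (∃ a : G.Arc, ∃ t ∈ Icc (0 : ℝ) 1, ∃ r ∈ Icc (0 : ℝ) 1, slab a t r = x) ∨
      ∃ c, ∃ p : G.Region c, region c p = x := by
  obtain ⟨x | ⟨c, p⟩, rfl⟩ := Quot.exists_rep x
  · obtain ⟨p, rfl⟩ := Quot.exists_rep x
    obtain ⟨a, t, ht, r, hr, h⟩ := exists_trap p
    exact Or.inl ⟨a, t, ht, r, hr, congrArg ribbon h.symm⟩
  · exact Or.inr ⟨c, p, rfl⟩

/-! ### The annuli in the surface -/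

theorem continuous_annulus (c : G.Circles) : Continuous (G.annulus c) :=
  continuous_quot_mk.comp (continuous_inl.comp (continuous_quot_mk.comp (by fun_prop)))

/-- Coupons only relate annuli of different families, so the annuli of one family stay embedded and
disjoint in the surface. -/
theorem annulus_eq_iff {c c' : G.Circles} {p p' : Circle × Icc (-1 : ℝ) 1} (hs : c.1 = c'.1) :
    G.annulus c p = G.annulus c' p' ↔ c = c' ∧ p = p' := by
  refine ⟨fun h => ?_, by rintro ⟨rfl, rfl⟩; rfl⟩
  rcases couponRel_isGluing.mk_eq_iff.1 (ribbon_injective h) with h | h | h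
  · exact ⟨congrArg Prod.fst h, congrArg Prod.snd h⟩
  · obtain ⟨k, x, y, v, -, h1, h2⟩ := couponRel_iff.1 h
    have h1 : true = c.1 := congrArg (fun p : G.Annuli => p.1.1) h1
    have h2 : false = c'.1 := congrArg (fun p : G.Annuli => p.1.1) h2
    rw [← h1, ← h2] at hs
    cases hs
  · obtain ⟨k, x, y, v, -, h1, h2⟩ := couponRel_iff.1 h
    have h1 : true = c'.1 := congrArg (fun p : G.Annuli => p.1.1) h1
    have h2 : false = c.1 := congrArg (fun p : G.Annuli => p.1.1) h2
    rw [← h1, ← h2] at hs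
    cases hs

/-- Regions are attached along the boundary of the ribbon graph, whose points have height `1` or
`-1` in every annulus containing them; an open annulus contains none of them. -/
theorem isOpen_annulus (c : G.Circles) :
    IsOpen {x : G.Surface | ∃ w : Circle, ∃ t : Icc (-1 : ℝ) 1, (t : ℝ) ∈ Ioo (-1 : ℝ) 1 ∧
      G.annulus c (w, t) = x} := by
  change IsOpen ((Quot.mk G.RegionRel) ⁻¹' _)
  rw [isOpen_sum_iff]
  constructor
  · convert isOpen_ribbon_annulus c using 1
    ext q
    simp only [mem_preimage, mem_ofPred_eq]
    refine exists_congr fun w => exists_congr fun t => and_congr_right fun _ => ?_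
    exact ribbon_injective.eq_iff
  · convert isOpen_empty using 1
    refine eq_empty_iff_forall_notMem.2 ?_
    rintro ⟨c', p⟩ ⟨w, t, ht, h⟩
    obtain ⟨a, t', ht', h1, -⟩ := ribbon_eq_region_iff.1 (h : ribbon _ = region c' p)
    have := abs_eq_one_of_mk_trap_zero ht' h1.symm
    simp only at this
    rcases abs_eq (zero_le_one) |>.1 this with h | h <;> rw [h] at ht <;> simp at ht

end DecoratedGaussDiagram

/-! ### Charts of the surface around the spheres with holes -/

theorem tendsto_inv_sub_coclosedCompact (z₀ : ℂ) :
    Filter.Tendsto (fun z : ℂ => (z - z₀)⁻¹) (Filter.coclosedCompact ℂ) (𝓝 0) := by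
  rw [Filter.coclosedCompact_eq_cocompact, ← Metric.cobounded_eq_cocompact]
  refine Filter.tendsto_inv₀_cobounded.comp ?_
  rw [Metric.cobounded_eq_cocompact]
  exact (Homeomorph.subRight z₀).isClosedEmbedding.tendsto_cocompact

/-- The coordinate `w ↦ z₀ + 1 / w` on the sphere. -/
def invPlot (z₀ : ℂ) : OpenPartialHomeomorph ℂ (OnePoint ℂ) where
  toFun w := if w = 0 then OnePoint.infty else ((z₀ + w⁻¹ : ℂ) : OnePoint ℂ)
  invFun p := OnePoint.elim p 0 fun z => (z - z₀)⁻¹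
  source := univ
  target := {((z₀ : ℂ) : OnePoint ℂ)}ᶜ
  map_source' w _ := by
    by_cases h : w = 0 <;> simp [h]
  map_target' _ _ := trivial
  left_inv' w _ := by
    by_cases h : w = 0 <;> simp [h]
  right_inv' p hp := by
    induction p using OnePoint.rec with
    | infty => simp
    | coe z =>
      have : z - z₀ ≠ 0 := sub_ne_zero.2 fun h => hp (by rw [h]; rfl)
      simp [this]
  open_source := isOpen_univ
  open_target := isOpen_compl_singleton
  continuousOn_toFun := by
    refine continuousOn_univ.2 (continuous_iff_continuousAt.2 fun w => ?_)
    by_cases h : w = 0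
    · subst h
      rw [← continuousWithinAt_compl_self, ContinuousWithinAt, if_pos rfl]
      have h1 : Filter.Tendsto (fun w : ℂ => z₀ + w⁻¹) (𝓝[≠] 0) (Filter.coclosedCompact ℂ) := by
        rw [Filter.coclosedCompact_eq_cocompact]
        refine (Homeomorph.addLeft z₀).isClosedEmbedding.tendsto_cocompact.comp ?_
        rw [← Metric.cobounded_eq_cocompact]
        exact Filter.tendsto_inv₀_nhdsNE_zero
      refine (OnePoint.tendsto_coe_infty.comp h1).congr' ?_
      filter_upwards [self_mem_nhdsWithin] with x hx
      exact (if_neg hx).symm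
    · have h1 : ContinuousAt (fun w : ℂ => ((z₀ + w⁻¹ : ℂ) : OnePoint ℂ)) w :=
        OnePoint.continuous_coe.continuousAt.comp (continuousAt_const.add (continuousAt_inv₀ h))
      refine h1.congr ?_
      filter_upwards [isOpen_ne.mem_nhds h] with x hx
      rw [if_neg hx]
  continuousOn_invFun := by
    intro p hp
    refine ContinuousAt.continuousWithinAt ?_
    induction p using OnePoint.rec with
    | infty =>
      rw [OnePoint.continuousAt_infty']
      exact tendsto_inv_sub_coclosedCompact z₀
    | coe z =>
      have : z - z₀ ≠ 0 := sub_ne_zero.2 fun h => hp (by rw [h]; rfl)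
      rw [OnePoint.continuousAt_coe]
      exact (continuousAt_id.sub continuousAt_const).inv₀ this


theorem invPlot_zero (z₀ : ℂ) : invPlot z₀ 0 = OnePoint.infty := if_pos rfl

theorem invPlot_of_ne (z₀ : ℂ) {w : ℂ} (hw : w ≠ 0) :
    invPlot z₀ w = ((z₀ + w⁻¹ : ℂ) : OnePoint ℂ) := if_neg hw

namespace DecoratedGaussDiagram

open GaussDiagram

variable {G : DecoratedGaussDiagram}

/-- The sphere with holes of color `c`, together with its collar. -/
def regionDomain (c : Fin G.numColors) : Set G.Surface :=
  {x | (∃ p, region c p = x) ∨ ∃ a : G.Arc, G.color (cyc a) = c ∧ ∃ t ∈ Icc (0 : ℝ) 1,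
    ∃ r ∈ Ico (0 : ℝ) 1, slab a t r = x}

theorem isCompact_slab (a : G.Arc) {R : Set ℝ} (hR : IsCompact R) :
    IsCompact ((fun p : ℝ × ℝ => slab (G := G) a p.1 p.2) '' (Icc (0 : ℝ) 1 ×ˢ R)) :=
  (isCompact_Icc.prod hR).image (continuous_slab a)

/-- The complement is a finite union of compact sets: the other regions, the full collars of cycles
of other colors, and the cores at depth `1`. -/
theorem isOpen_regionDomain (c : Fin G.numColors) : IsOpen (regionDomain c) := by
  have : (regionDomain c)ᶜ = (⋃ c' : {c' // c' ≠ c}, range (region (G := G) c'.1)) ∪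
      (⋃ a : {a : G.Arc // G.color (cyc a) ≠ c}, (fun p : ℝ × ℝ => slab (G := G) a.1 p.1 p.2) ''
        (Icc (0 : ℝ) 1 ×ˢ Icc (0 : ℝ) 1)) ∪
      ⋃ a : G.Arc, (fun p : ℝ × ℝ => slab (G := G) a p.1 p.2) '' (Icc (0 : ℝ) 1 ×ˢ {1}) := by
    ext x
    simp only [mem_compl_iff, mem_union, mem_iUnion, mem_image, mem_prod, Prod.exists, mem_range,
      mem_singleton_iff]
    constructor
    · intro hx
      rcases exists_slab_or_region x with ⟨a, t, ht, r, hr, rfl⟩ | ⟨c', p, rfl⟩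
      · by_cases hc : G.color (cyc a) = c
        · rcases hr.2.lt_or_eq with h | rfl
          · exact (hx (Or.inr ⟨a, hc, t, ht, r, ⟨hr.1, h⟩, rfl⟩)).elim
          · exact Or.inr ⟨a, t, 1, ⟨ht, rfl⟩, rfl⟩
        · exact Or.inl (Or.inr ⟨⟨a, hc⟩, t, r, ⟨ht, hr⟩, rfl⟩)
      · by_cases hc : c' = c
        · subst hc; exact (hx (Or.inl ⟨p, rfl⟩)).elim
        · exact Or.inl (Or.inl ⟨⟨c', hc⟩, p, rfl⟩)
    · rintro h (⟨p, rfl⟩ | ⟨a, hc, t, ht, r, hr, rfl⟩)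
      · rcases h with (⟨⟨c', hc⟩, p', h⟩ | ⟨⟨a, hc⟩, t, r, ⟨ht, hr⟩, h⟩) | ⟨a, t, r, ⟨ht, rfl⟩, h⟩
        · exact hc (region_eq_iff.1 h).1
        · exact hc ((slab_eq_region_iff ht hr).1 h).2.1
        · exact one_ne_zero ((slab_eq_region_iff ht (by simp)).1 h).1
      · rcases h with (⟨⟨c', hc'⟩, p', h⟩ | ⟨⟨a', hc'⟩, t', r', ⟨ht', hr'⟩, h⟩) |
          ⟨a', t', r', ⟨ht', rfl⟩, h⟩
        · exact hc' (((slab_eq_region_iff ht ⟨hr.1, hr.2.le⟩).1 h.symm).2.1.symm.trans hc)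
        · have := ((slab_eq_iff hr' hr ht' ht).1 h).2.cyc_eq
          exact hc' (by rw [this, hc])
        · exact hr.2.ne ((slab_eq_iff (by simp) hr ht' ht).1 h).1.symm
  rw [← isClosed_compl_iff, this]
  refine ((isClosed_iUnion_of_finite fun c' => ?_).union (isClosed_iUnion_of_finite fun a => ?_)).union
    (isClosed_iUnion_of_finite fun a => ?_)
  · exact (isCompact_range (continuous_region _)).isClosed
  · exact (isCompact_slab _ isCompact_Icc).isClosed
  · exact (isCompact_slab _ isCompact_singleton).isClosed

/-- The point of the hole at depth `r` below the point `t` of a side of an edge. -/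
def holeCoord (a : G.Arc) (t r : ℝ) : ℂ :=
  3 * (G.cycleIndex (cyc a) : ℂ) + (1 - r : ℝ) * (ang a t : ℂ)

theorem norm_holeCoord_sub (a : G.Arc) (t : ℝ) {r : ℝ} (hr : r ≤ 1) :
    ‖holeCoord a t r - 3 * (G.cycleIndex (cyc a) : ℂ)‖ = 1 - r := by
  rw [holeCoord, add_sub_cancel_left, norm_mul, Circle.norm_coe, Complex.norm_real, mul_one,
    Real.norm_of_nonneg (by linarith)]

theorem continuous_holeCoord (a : G.Arc) : Continuous fun p : ℝ × ℝ => holeCoord (G := G) a p.1 p.2 := by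
  have := continuous_ang a
  unfold holeCoord
  fun_prop

/-- The criterion is that of `slab_eq_iff`: collar and punctured disc make the same identifications,
the distance from the centre of the hole being `1 - r`. Different holes do not interfere because
their centres are at least `3` apart. -/
theorem holeCoord_eq_iff {a a' : G.Arc} {t t' r r' : ℝ} (hr : r ∈ Icc (0 : ℝ) 1)
    (hr' : r' ∈ Ico (0 : ℝ) 1) (ht : t ∈ Icc (0 : ℝ) 1) (ht' : t' ∈ Icc (0 : ℝ) 1) :
    holeCoord a t r = holeCoord a' t' r' ↔ r = r' ∧ Joined a t a' t' := by
  constructor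
  · intro h
    have h1 := norm_holeCoord_sub (G := G) a t hr.2
    have h2 := norm_holeCoord_sub (G := G) a' t' hr'.2.le
    by_cases hc : cyc a = cyc a'
    · rw [h, hc, h2] at h1
      have hrr : r = r' := by linarith
      subst hrr
      refine ⟨rfl, ?_⟩
      rw [holeCoord, holeCoord, hc, add_right_inj] at h
      have h3 : ((1 - r : ℝ) : ℂ) ≠ 0 := by
        rw [Complex.ofReal_ne_zero]; linarith [hr'.2]
      exact (ang_eq_iff hc ht ht').1 (Circle.coe_inj.1 (mul_left_cancel₀ h3 h))
    · have h3 := norm_three_sub (fun h => hc (cycleIndex_injective h))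
      have h4 := norm_sub_le (holeCoord a' t' r' - 3 * (G.cycleIndex (cyc a') : ℂ))
        (holeCoord a t r - 3 * (G.cycleIndex (cyc a) : ℂ))
      rw [h1, h2, h, show (holeCoord a' t' r' - 3 * (G.cycleIndex (cyc a') : ℂ)) -
        (holeCoord a' t' r' - 3 * (G.cycleIndex (cyc a) : ℂ)) =
        3 * (G.cycleIndex (cyc a) : ℂ) - 3 * (G.cycleIndex (cyc a') : ℂ) by ring] at h4
      linarith [hr.1, hr'.1]
  · rintro ⟨rfl, h⟩
    have hc := h.cyc_eq
    rw [holeCoord, holeCoord, hc, (ang_eq_iff hc ht ht').2 h]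

theorem holeCoord_eq_region_iff {a : G.Arc} {t r : ℝ} (hr : r ∈ Icc (0 : ℝ) 1)
    {p : G.Region (G.color (cyc a))} :
    ((holeCoord a t r : ℂ) : OnePoint ℂ) = p.1 ↔ r = 0 ∧ p.1 = (holePt a t).1 := by
  constructor
  · intro h
    have h1 := p.2 _ ⟨cyc a, rfl, rfl⟩ _ h.symm
    rw [norm_holeCoord_sub _ _ hr.2] at h1
    have h2 : r = 0 := by linarith [hr.1]
    subst h2
    refine ⟨rfl, ?_⟩
    rw [← h, holeCoord, holePt]
    simp
  · rintro ⟨rfl, h⟩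
    rw [h, holeCoord, holePt]
    simp

theorem holeCoord_eq_center_iff {a : G.Arc} {t r : ℝ} (hr : r ∈ Icc (0 : ℝ) 1) {z : G.Cycle} :
    holeCoord a t r = 3 * (G.cycleIndex z : ℂ) ↔ r = 1 ∧ z = cyc a := by
  have h1 := norm_holeCoord_sub (G := G) a t hr.2
  constructor
  · intro h
    by_cases hz : z = cyc a
    · rw [h, hz, sub_self, norm_zero] at h1
      exact ⟨by linarith, hz⟩
    · have h3 := norm_three_sub (fun h => hz (cycleIndex_injective h))
      rw [h] at h1
      linarith [hr.1]
  · rintro ⟨rfl, rfl⟩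
    simp [holeCoord]

/-- The collars of the cycles fill the holes up to their centres, so the region with its collar is
the sphere minus these centres. Inverting at one centre `z₀` puts it into the plane, with the point
at infinity of the sphere at the origin. -/
theorem exists_regionPlot (c : Fin G.numColors) :
    ∃ (e : OpenPartialHomeomorph ℂ G.Surface) (z₀ : ℂ), e.target = regionDomain c ∧
      (0 : ℂ) ∈ e.source ∧ e 0 = region c (HoledSphere.infty _) ∧
      ∀ a : G.Arc, G.color (cyc a) = c → ∀ t ∈ Icc (0 : ℝ) 1, ∀ r ∈ Ico (0 : ℝ) 1,
        holeCoord a t r - z₀ ≠ 0 ∧ (holeCoord a t r - z₀)⁻¹ ∈ e.source ∧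
          e (holeCoord a t r - z₀)⁻¹ = slab a t r := by
  -- Every color is used, so at least one centre is missing; otherwise the region would be a whole
  -- sphere and have no planar coordinate.
  obtain ⟨y₀, rfl⟩ := G.color_surjective c
  set c := G.color y₀ with hc
  let P := ({a : G.Arc // G.color (cyc a) = c} × Icc (0 : ℝ) 1 × Icc (0 : ℝ) 1) ⊕ G.Region c
  let p : P → G.Surface := Sum.elim (fun k => slab k.1.1 k.2.1 k.2.2) (region c)
  let q : P → OnePoint ℂ := Sum.elim (fun k => (holeCoord k.1.1 k.2.1 k.2.2 : ℂ)) fun x => x.1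
  let C : Set (OnePoint ℂ) := (fun z : G.Cycle => ((3 * (G.cycleIndex z : ℂ) : ℂ) : OnePoint ℂ)) ''
    {z | G.color z = c}
  have hp : Continuous p := by
    refine Continuous.sumElim ?_ (continuous_region c)
    rw [continuous_prod_of_discrete_left]
    exact fun a => (continuous_slab a.1).comp
      (by fun_prop : Continuous fun k : Icc (0 : ℝ) 1 × Icc (0 : ℝ) 1 => ((k.1 : ℝ), (k.2 : ℝ)))
  have hq : Continuous q := by
    refine Continuous.sumElim ?_ continuous_subtype_val
    rw [continuous_prod_of_discrete_left]
    exact fun a => OnePoint.continuous_coe.comp ((continuous_holeCoord a.1).comp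
      (by fun_prop : Continuous fun k : Icc (0 : ℝ) 1 × Icc (0 : ℝ) 1 => ((k.1 : ℝ), (k.2 : ℝ))))
  have hC : IsOpen Cᶜ := by
    rw [isOpen_compl_iff]
    exact ((toFinite _).image _).isClosed
  have hmemC : ∀ z : ℂ, (z : OnePoint ℂ) ∈ C ↔ ∃ y, G.color y = c ∧ z = 3 * (G.cycleIndex y : ℂ) := by
    intro z
    simp only [C, mem_image, mem_ofPred_eq, OnePoint.coe_eq_coe, eq_comm]
  have hinf : OnePoint.infty ∈ Cᶜ := by
    rintro ⟨y, -, h⟩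
    exact OnePoint.coe_ne_infty _ h
  have hpU : ∀ x, p x ∈ regionDomain c ↔ q x ∈ Cᶜ := by
    rintro (⟨⟨a, ha⟩, ⟨t, ht⟩, ⟨r, hr⟩⟩ | x)
    · simp only [p, q, Sum.elim_inl, mem_compl_iff, hmemC, not_exists, not_and]
      constructor
      · rintro (⟨x, h⟩ | ⟨a', ha', t', ht', r', hr', h⟩) y hy he
        · have := ((slab_eq_region_iff ht hr).1 h.symm).1
          exact zero_ne_one (this.symm.trans ((holeCoord_eq_center_iff hr).1 he).1)
        · have := ((slab_eq_iff hr hr' ht ht').1 h.symm).1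
          exact hr'.2.ne (this.symm.trans ((holeCoord_eq_center_iff hr).1 he).1)
      · intro h
        refine Or.inr ⟨a, ha, t, ht, r, ⟨hr.1, lt_of_le_of_ne hr.2 fun h1 => ?_⟩, rfl⟩
        exact h (cyc a) ha ((holeCoord_eq_center_iff hr).2 ⟨h1, rfl⟩)
    · simp only [p, q, Sum.elim_inr, mem_compl_iff]
      refine ⟨fun _ => ?_, fun _ => Or.inl ⟨x, rfl⟩⟩
      rintro ⟨y, hy, h⟩
      have := x.2 _ ⟨y, hy, rfl⟩ _ h.symm
      rw [sub_self, norm_zero] at this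
      linarith
  have hUr : regionDomain c ⊆ range p := by
    rintro x (⟨x, rfl⟩ | ⟨a, ha, t, ht, r, hr, rfl⟩)
    · exact ⟨.inr x, rfl⟩
    · exact ⟨.inl (⟨a, ha⟩, ⟨t, ht⟩, ⟨r, hr.1, hr.2.le⟩), rfl⟩
  have hVr : Cᶜ ⊆ range q := by
    intro z hz
    by_cases h : ∀ j ∈ {j | ∃ z, G.color z = c ∧ G.cycleIndex z = j}, ∀ u : ℂ,
        z = (u : OnePoint ℂ) → 1 ≤ ‖u - 3 * (j : ℂ)‖
    · exact ⟨.inr ⟨z, h⟩, rfl⟩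
    · push Not at h
      obtain ⟨_, ⟨y, hy, rfl⟩, u, rfl, hu⟩ := h
      have hu0 : u - 3 * (G.cycleIndex y : ℂ) ≠ 0 := fun h =>
        hz ((hmemC u).2 ⟨y, hy, sub_eq_zero.1 h⟩)
      -- Polar coordinates around the centre: the argument determines the place on the cycle, the
      -- distance `1 - r` the depth.
      obtain ⟨a, rfl, t, ht, hat⟩ :=
        exists_ang y (Circle.exp (Complex.arg (u - 3 * (G.cycleIndex y : ℂ))))
      refine ⟨.inl (⟨a, hy⟩, ⟨t, ht⟩, ⟨1 - ‖u - 3 * (G.cycleIndex (cyc a) : ℂ)‖, by linarith,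
        by linarith [norm_nonneg (u - 3 * (G.cycleIndex (cyc a) : ℂ))]⟩), ?_⟩
      simp only [q, Sum.elim_inl, OnePoint.coe_eq_coe, holeCoord, hat, Circle.coe_exp,
        sub_sub_cancel, Complex.norm_mul_exp_arg_mul_I]
      ring
  have hfib : ∀ x y, p x ∈ regionDomain c → p y ∈ regionDomain c → (p x = p y ↔ q x = q y) := by
    have key : ∀ (a : G.Arc) (ha : G.color (cyc a) = c) (t r : ℝ) (ht : t ∈ Icc (0 : ℝ) 1)
        (hr : r ∈ Icc (0 : ℝ) 1) (x : G.Region c), slab a t r = region c x ↔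
          ((holeCoord a t r : ℂ) : OnePoint ℂ) = x.1 := by
      intro a ha t r ht hr x
      clear_value c
      subst ha
      rw [slab_eq_region_iff ht hr, holeCoord_eq_region_iff hr, and_iff_right rfl]
    rintro (⟨⟨a, ha⟩, ⟨t, ht⟩, ⟨r, hr⟩⟩ | x) (⟨⟨a', ha'⟩, ⟨t', ht'⟩, ⟨r', hr'⟩⟩ | y) hx hy
    · simp only [p, q, Sum.elim_inl, OnePoint.coe_eq_coe] at hx hy ⊢
      have hr1 : r' < 1 := lt_of_le_of_ne hr'.2 fun h1 => by
        refine (hpU (.inl (⟨a', ha'⟩, ⟨t', ht'⟩, ⟨r', hr'⟩))).1 hy ((hmemC _).2 ⟨cyc a', ha', ?_⟩)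
        exact (holeCoord_eq_center_iff hr').2 ⟨h1, rfl⟩
      rw [slab_eq_iff hr ⟨hr'.1, hr1⟩ ht ht', holeCoord_eq_iff hr ⟨hr'.1, hr1⟩ ht ht']
    · exact key a ha t r ht hr y
    · exact eq_comm.trans ((key a' ha' t' r' ht' hr' x).trans eq_comm)
    · simp only [p, q, Sum.elim_inr, region_eq_iff, and_iff_right]
  obtain ⟨E, hEs, hEt, hE, hE'⟩ := exists_openPartialHomeomorph_of_fibers hp hq
    (isOpen_regionDomain c) hC hUr hVr hpU hfib
  have hz₀ : ((3 * (G.cycleIndex y₀ : ℂ) : ℂ) : OnePoint ℂ) ∈ C := (hmemC _).2 ⟨y₀, rfl, rfl⟩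
  refine ⟨(invPlot (3 * (G.cycleIndex y₀ : ℂ))).trans E.symm, 3 * (G.cycleIndex y₀ : ℂ), ?_, ?_, ?_,
    fun a ha t ht r hr => ?_⟩
  · rw [OpenPartialHomeomorph.trans_target]
    simp only [OpenPartialHomeomorph.symm_target, OpenPartialHomeomorph.symm_symm, hEs]
    refine inter_eq_left.2 fun x hx h => ?_
    have h2 : E x ∈ E.target := E.map_source (hEs ▸ hx)
    rw [hEt] at h2
    rw [mem_singleton_iff.1 h] at h2
    exact h2 hz₀
  · rw [OpenPartialHomeomorph.trans_source, OpenPartialHomeomorph.symm_source, hEt]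
    exact ⟨trivial, by rwa [mem_preimage, invPlot_zero]⟩
  · have h : q (.inr (HoledSphere.infty _)) ∈ Cᶜ := hinf
    have h2 := hE' (.inr (HoledSphere.infty _)) ((hpU _).2 h)
    simp only [p, q, Sum.elim_inr] at h2
    rw [← h2, OpenPartialHomeomorph.coe_trans, Function.comp, invPlot_zero]
    rfl
  · have hr' := Ico_subset_Icc_self hr
    have h0 : holeCoord a t r - 3 * (G.cycleIndex y₀ : ℂ) ≠ 0 := fun h =>
      hr.2.ne ((holeCoord_eq_center_iff hr').1 (sub_eq_zero.1 h)).1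
    have h1 : p (.inl (⟨a, ha⟩, ⟨t, ht⟩, ⟨r, hr'⟩)) ∈ regionDomain c :=
      Or.inr ⟨a, ha, t, ht, r, hr, rfl⟩
    have h2 := hE' _ h1
    have h3 := (hpU _).1 h1
    simp only [p, q, Sum.elim_inl] at h2 h3
    have h4 : invPlot (3 * (G.cycleIndex y₀ : ℂ)) (holeCoord a t r - 3 * (G.cycleIndex y₀ : ℂ))⁻¹ =
        ((holeCoord a t r : ℂ) : OnePoint ℂ) := by
      rw [invPlot_of_ne _ (inv_ne_zero h0), inv_inv, add_sub_cancel]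
    refine ⟨h0, ?_, ?_⟩
    · rw [OpenPartialHomeomorph.trans_source, OpenPartialHomeomorph.symm_source, hEt]
      exact ⟨trivial, by rw [mem_preimage, h4]; exact h3⟩
    · rw [OpenPartialHomeomorph.coe_trans, Function.comp, h4, h2]

end DecoratedGaussDiagram

/-! ### The collar of the surface with handles -/

/-- The projection to `[-1, 1]`. -/
def ic (t : ℝ) : Icc (-1 : ℝ) 1 := projIcc (-1) 1 (by norm_num) t

theorem ic_coe {t : ℝ} (ht : t ∈ Icc (-1 : ℝ) 1) : (ic t : ℝ) = t := by
  rw [ic, projIcc_of_mem _ ht]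

theorem ic_val (t : Icc (-1 : ℝ) 1) : ic t = t := projIcc_val _ t

theorem continuous_ic : Continuous ic := by
  unfold ic
  exact continuous_projIcc

theorem ic_inj {t t' : ℝ} (ht : t ∈ Icc (-1 : ℝ) 1) (ht' : t' ∈ Icc (-1 : ℝ) 1) :
    ic t = ic t' ↔ t = t' := by
  rw [Subtype.ext_iff, ic_coe ht, ic_coe ht']

/-- The direction of a complex number. -/
def dir (z : ℂ) : Circle := Circle.exp (Complex.arg z)

theorem norm_mul_dir (z : ℂ) : (‖z‖ : ℂ) * dir z = z := by
  rw [dir, Circle.coe_exp, Complex.norm_mul_exp_arg_mul_I]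

theorem dir_mul {ρ : ℝ} (hρ : 0 < ρ) (w : Circle) : dir (ρ * w) = w := by
  rw [dir, Complex.arg_real_mul _ hρ, Circle.exp_arg]

theorem norm_mul_circle {ρ : ℝ} (hρ : 0 ≤ ρ) (w : Circle) : ‖(ρ : ℂ) * w‖ = ρ := by
  rw [norm_mul, Circle.norm_coe, Complex.norm_real, mul_one, Real.norm_of_nonneg hρ]

theorem continuousOn_dir : ContinuousOn dir {z | z ≠ 0} := by
  have h : ContinuousOn (fun z : ℂ => z / ‖z‖) {z | z ≠ 0} :=
    continuousOn_id.div (by fun_prop) fun z hz => by simpa using hz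
  have hi : @Topology.IsInducing Circle ℂ _ _ (fun w : Circle => (w : ℂ)) := ⟨rfl⟩
  rw [hi.continuousOn_iff]
  refine h.congr fun z hz => ?_
  have hz' : (‖z‖ : ℂ) ≠ 0 := by simpa using hz
  rw [eq_div_iff hz', mul_comm]
  exact norm_mul_dir z

/-- The retraction to the unit disc. -/
def retr (z : ℂ) : closedBall (0 : ℂ) 1 :=
  ⟨((max 1 ‖z‖)⁻¹ : ℝ) * z, by
    have h : 0 < max 1 ‖z‖ := lt_max_of_lt_left one_pos
    rw [mem_closedBall_zero_iff, norm_mul, Complex.norm_real, Real.norm_of_nonneg (by positivity),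
      inv_mul_le_iff₀ h, mul_one]
    exact le_max_right _ _⟩

theorem continuous_retr : Continuous retr := by
  refine Continuous.subtype_mk ?_ _
  have : Continuous fun z : ℂ => (max 1 ‖z‖)⁻¹ :=
    Continuous.inv₀ (by fun_prop) fun z => (lt_max_of_lt_left one_pos).ne'
  fun_prop

theorem retr_coe {z : ℂ} (hz : ‖z‖ ≤ 1) : (retr z : ℂ) = z := by
  simp [retr, max_eq_left hz]

namespace DecoratedGaussDiagram

open GaussDiagram

variable {G : DecoratedGaussDiagram}

/-- The end of `[-1, 1]` at which the curves of the family `s` are placed, as a real number. -/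
def lev (s : Bool) : ℝ := if s then 1 else -1

theorem level_coe (s : Bool) : (level s : ℝ) = lev s := by cases s <;> rfl

theorem level_injective : Function.Injective level := by
  intro s s' h
  have := congrArg Subtype.val h
  rw [level_coe, level_coe] at this
  cases s <;> cases s' <;> simp [lev] at this ⊢ <;> norm_num at this

theorem lev_cases (s : Bool) : lev s = 1 ∨ lev s = -1 := by cases s <;> simp [lev]

theorem lev_mul_self (s : Bool) : lev s * lev s = 1 := by
  rcases lev_cases s with h | h <;> rw [h] <;> norm_num

theorem lev_mul_mem {s : Bool} {t : ℝ} : lev s * t ∈ Icc (-1 : ℝ) 1 ↔ t ∈ Icc (-1 : ℝ) 1 := by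
  rcases lev_cases s with h | h <;> rw [h] <;> constructor <;> rintro ⟨h1, h2⟩ <;>
    constructor <;> linarith

theorem lev_mul_mem_Ioo {s : Bool} {t : ℝ} : lev s * t ∈ Ioo (-1 : ℝ) 1 ↔ t ∈ Ioo (-1 : ℝ) 1 := by
  rcases lev_cases s with h | h <;> rw [h] <;> constructor <;> rintro ⟨h1, h2⟩ <;>
    constructor <;> linarith

theorem lev_of_ne {s s' : Bool} (h : s ≠ s') : lev s' = -lev s := by
  cases s <;> cases s' <;> simp [lev] at h ⊢

/-- A point of the collar of the surface. -/
def lay (x : G.Surface) (h : ℝ) : G.HandleManifold := Quot.mk _ (.inl (x, ic h))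

/-- A point of a handle. -/
def hnd (c : G.Circles) (d : closedBall (0 : ℂ) 1) (t : ℝ) : G.HandleManifold :=
  Quot.mk _ (.inr (c, d, ic t))

/-- A point of an annulus. -/
def ann (c : G.Circles) (w : Circle) (t : ℝ) : G.Surface := G.annulus c (w, ic t)

theorem ann_eq_iff {c c' : G.Circles} {w w' : Circle} {t t' : ℝ} (hs : c.1 = c'.1)
    (ht : t ∈ Icc (-1 : ℝ) 1) (ht' : t' ∈ Icc (-1 : ℝ) 1) :
    ann c w t = ann c' w' t' ↔ c = c' ∧ w = w' ∧ t = t' := by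
  rw [ann, ann, annulus_eq_iff hs, Prod.mk.injEq, ic_inj ht ht']

theorem handleRel_iff {x y : G.CollarAndHandles} : G.HandleRel x y ↔
    ∃ k : G.Circles × Circle × Icc (-1 : ℝ) 1,
      Sum.inl (G.annulus k.1 k.2, level k.1.1) = x ∧
      Sum.inr (k.1, ⟨(k.2.1 : ℂ), by simp [Circle.norm_coe]⟩, k.2.2) = y := by
  constructor
  · rintro ⟨c, w, t, d, hd⟩
    obtain rfl : d = ⟨(w : ℂ), by simp [Circle.norm_coe]⟩ := Subtype.ext hd
    exact ⟨(c, w, t), rfl, rfl⟩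
  · rintro ⟨⟨c, w, t⟩, rfl, rfl⟩
    exact HandleRel.glue c w t _ rfl

/-- The level records the family, and the annuli of one family are disjoint, so the attaching map of
all handles together is injective. -/
theorem handleRel_isGluing : IsGluing G.HandleRel := by
  refine IsGluing.of_compact (K := G.Circles × Circle × Icc (-1 : ℝ) 1)
    (f := fun k => Sum.inl (G.annulus k.1 k.2, level k.1.1))
    (g := fun k => Sum.inr (k.1, ⟨(k.2.1 : ℂ), by simp [Circle.norm_coe]⟩, k.2.2)) ?_ ?_
    (fun _ _ => handleRel_iff) ?_ ?_
  · refine continuous_inl.comp ?_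
    rw [continuous_prod_of_discrete_left]
    exact fun c => (continuous_annulus c).prodMk
      (continuous_const : Continuous fun _ => level c.1)
  · fun_prop
  · rintro ⟨c, w, t⟩ ⟨c', w', t'⟩
    rw [Sum.inl_injective.eq_iff, Sum.inr_injective.eq_iff, Prod.mk.injEq]
    simp only [Prod.mk.injEq, Subtype.mk.injEq, Circle.coe_inj]
    constructor
    · rintro ⟨h1, h2⟩
      have := (annulus_eq_iff (level_injective h2)).1 h1
      simpa using this
    · rintro ⟨rfl, rfl, rfl⟩
      exact ⟨rfl, rfl⟩
  · simp

instance : T2Space G.HandleManifold := handleRel_isGluing.t2Space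

instance : CompactSpace G.HandleManifold := inferInstanceAs (CompactSpace (Quot _))

theorem continuous_lay : Continuous fun p : G.Surface × ℝ => lay p.1 p.2 := by
  have := continuous_ic
  exact continuous_quot_mk.comp (continuous_inl.comp (by fun_prop))

theorem continuous_hnd (c : G.Circles) :
    Continuous fun p : closedBall (0 : ℂ) 1 × ℝ => hnd c p.1 p.2 := by
  have := continuous_ic
  exact continuous_quot_mk.comp (continuous_inr.comp (by fun_prop))

theorem continuous_ann (c : G.Circles) : Continuous fun p : Circle × ℝ => ann c p.1 p.2 := by
  have := continuous_ic
  exact (continuous_annulus c).comp (by fun_prop)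

theorem lay_eq_iff {x x' : G.Surface} {h h' : ℝ} (hh : h ∈ Icc (-1 : ℝ) 1)
    (hh' : h' ∈ Icc (-1 : ℝ) 1) : lay x h = lay x' h' ↔ x = x' ∧ h = h' := by
  constructor
  · intro H
    rcases handleRel_isGluing.mk_eq_iff.1 H with H | H | H
    · have := Prod.mk.inj (Sum.inl_injective H)
      exact ⟨this.1, (ic_inj hh hh').1 this.2⟩
    · obtain ⟨k, -, h⟩ := handleRel_iff.1 H
      cases h
    · obtain ⟨k, -, h⟩ := handleRel_iff.1 H
      cases h
  · rintro ⟨rfl, rfl⟩; rfl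

theorem hnd_eq_iff {c c' : G.Circles} {d d' : closedBall (0 : ℂ) 1} {t t' : ℝ}
    (hh : t ∈ Icc (-1 : ℝ) 1) (hh' : t' ∈ Icc (-1 : ℝ) 1) :
    hnd c d t = hnd c' d' t' ↔ c = c' ∧ d = d' ∧ t = t' := by
  constructor
  · intro H
    rcases handleRel_isGluing.mk_eq_iff.1 H with H | H | H
    · have := Sum.inr_injective H
      simp only [Prod.mk.injEq, ic_inj hh hh'] at this
      exact this
    · obtain ⟨k, h, -⟩ := handleRel_iff.1 H
      cases h
    · obtain ⟨k, h, -⟩ := handleRel_iff.1 H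
      cases h
  · rintro ⟨rfl, rfl, rfl⟩; rfl

theorem lay_eq_hnd_iff {x : G.Surface} {h : ℝ} (hh : h ∈ Icc (-1 : ℝ) 1) {c : G.Circles}
    {d : closedBall (0 : ℂ) 1} {t : ℝ} (ht : t ∈ Icc (-1 : ℝ) 1) :
    lay x h = hnd c d t ↔ h = lev c.1 ∧ ∃ w : Circle, (d : ℂ) = w ∧ x = ann c w t := by
  constructor
  · intro H
    rcases handleRel_isGluing.mk_eq_iff.1 H with H | H | H
    · cases H
    · obtain ⟨⟨c', w, t'⟩, h1, h2⟩ := handleRel_iff.1 H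
      have h1 := Prod.mk.inj (Sum.inl_injective h1)
      have h2 := Sum.inr_injective h2
      simp only [Prod.mk.injEq] at h2
      obtain ⟨rfl, rfl, rfl⟩ := h2
      refine ⟨?_, w, rfl, h1.1.symm⟩
      rw [← level_coe, h1.2, ic_coe hh]
    · obtain ⟨k, h, -⟩ := handleRel_iff.1 H
      cases h
  · rintro ⟨rfl, w, hd, rfl⟩
    have h1 : ic (lev c.1) = level c.1 := Subtype.ext (by rw [ic_coe hh, level_coe])
    rw [lay, h1]
    exact Quot.sound (HandleRel.glue c w (ic t) d hd)

theorem exists_lay_or_hnd (m : G.HandleManifold) :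
    (∃ x : G.Surface, ∃ h ∈ Icc (-1 : ℝ) 1, lay x h = m) ∨
      ∃ (c : G.Circles) (d : closedBall (0 : ℂ) 1), ∃ t ∈ Icc (-1 : ℝ) 1, hnd c d t = m := by
  obtain ⟨⟨x, h⟩ | ⟨c, d, t⟩, rfl⟩ := Quot.exists_rep m
  · exact Or.inl ⟨x, h, h.2, by rw [lay, ic_val]⟩
  · exact Or.inr ⟨c, d, t, t.2, by rw [hnd, ic_val]⟩

/-- A handle together with the part of the collar below it: the point `(ζ, t)` lies in the handle
for `‖ζ‖ ≤ 1` and below the annulus for `1 ≤ ‖ζ‖ ≤ 3`. -/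
def extHnd (c : G.Circles) (ζ : ℂ) (t : ℝ) : G.HandleManifold :=
  if ‖ζ‖ ≤ 1 then hnd c (retr ζ) t else lay (ann c (dir ζ) t) (lev c.1 * (2 - ‖ζ‖))

theorem extHnd_of_le {c : G.Circles} {ζ : ℂ} (hζ : ‖ζ‖ ≤ 1) (t : ℝ) :
    extHnd c ζ t = hnd c (retr ζ) t := if_pos hζ

/-- For norm `1` the two formulas agree by the attaching map of the handle; at this radius the
height is the level of the family. -/
theorem extHnd_of_ge {c : G.Circles} {ζ : ℂ} (hζ : 1 ≤ ‖ζ‖) {t : ℝ} (ht : t ∈ Icc (-1 : ℝ) 1) :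
    extHnd c ζ t = lay (ann c (dir ζ) t) (lev c.1 * (2 - ‖ζ‖)) := by
  rcases hζ.lt_or_eq with h | h
  · exact if_neg (not_le.2 h)
  · rw [extHnd_of_le h.symm.le, ← h, eq_comm, lay_eq_hnd_iff (lev_mul_mem.2 (by norm_num)) ht]
    refine ⟨by ring, dir ζ, ?_, rfl⟩
    rw [retr_coe h.symm.le]
    conv_lhs => rw [← norm_mul_dir ζ, ← h]
    simp

theorem extHnd_mul {c : G.Circles} {ρ : ℝ} (hρ : 1 ≤ ρ) (w : Circle) {t : ℝ}
    (ht : t ∈ Icc (-1 : ℝ) 1) : extHnd c (ρ * w) t = lay (ann c w t) (lev c.1 * (2 - ρ)) := by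
  have h0 : 0 < ρ := by linarith
  rw [extHnd_of_ge (by rwa [norm_mul_circle h0.le]) ht, norm_mul_circle h0.le, dir_mul h0]

theorem continuousOn_extHnd (c : G.Circles) :
    ContinuousOn (fun p : ℂ × ℝ => extHnd c p.1 p.2) {p | p.2 ∈ Icc (-1 : ℝ) 1} := by
  have h1 : ContinuousOn (fun p : ℂ × ℝ => extHnd c p.1 p.2)
      ({p | p.2 ∈ Icc (-1 : ℝ) 1} ∩ {p | ‖p.1‖ ≤ 1}) := by
    refine ((continuous_hnd c).comp (f := fun p : ℂ × ℝ => (retr p.1, p.2))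
      (by have := continuous_retr; fun_prop)).continuousOn.congr fun p hp => ?_
    exact extHnd_of_le hp.2 _
  have h2 : ContinuousOn (fun p : ℂ × ℝ => extHnd c p.1 p.2)
      ({p | p.2 ∈ Icc (-1 : ℝ) 1} ∩ {p | 1 ≤ ‖p.1‖}) := by
    have hd : ContinuousOn (fun p : ℂ × ℝ => dir p.1)
        ({p | p.2 ∈ Icc (-1 : ℝ) 1} ∩ {p | 1 ≤ ‖p.1‖}) :=
      continuousOn_dir.comp continuousOn_fst fun p hp h => by
        have h3 : (1 : ℝ) ≤ ‖p.1‖ := hp.2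
        rw [h, norm_zero] at h3; linarith
    have h3 : ContinuousOn (fun p : ℂ × ℝ => lay (ann c (dir p.1) p.2) (lev c.1 * (2 - ‖p.1‖)))
        ({p | p.2 ∈ Icc (-1 : ℝ) 1} ∩ {p | 1 ≤ ‖p.1‖}) := by
      refine continuous_lay.comp_continuousOn (f := fun p : ℂ × ℝ => (_, _)) (ContinuousOn.prodMk ?_
        (by fun_prop))
      exact (continuous_ann c).comp_continuousOn (f := fun p : ℂ × ℝ => (_, _)) (hd.prodMk (by fun_prop))
    exact h3.congr fun p hp => extHnd_of_ge hp.2 hp.1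
  have hcl1 : IsClosed {p : ℂ × ℝ | ‖p.1‖ ≤ 1} := isClosed_le (by fun_prop) (by fun_prop)
  have hcl2 : IsClosed {p : ℂ × ℝ | 1 ≤ ‖p.1‖} := isClosed_le (by fun_prop) (by fun_prop)
  have hI : IsClosed {p : ℂ × ℝ | p.2 ∈ Icc (-1 : ℝ) 1} := isClosed_Icc.preimage continuous_snd
  refine (h1.union_of_isClosed h2 (hI.inter hcl1) (hI.inter hcl2)).mono fun p hp => ?_
  rcases le_total ‖p.1‖ 1 with h | h
  · exact Or.inl ⟨hp, h⟩
  · exact Or.inr ⟨hp, h⟩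

/-- In the handle the point is its own coordinate, and below the annulus the height gives back the
radius. Handles of opposite families overlap in the collar, hence the hypothesis `hs`. -/
theorem extHnd_inj {c c' : G.Circles} (hs : c.1 = c'.1) {ζ ζ' : ℂ} (hζ : ‖ζ‖ ≤ 3) (hζ' : ‖ζ'‖ ≤ 3)
    {t t' : ℝ} (ht : t ∈ Icc (-1 : ℝ) 1) (ht' : t' ∈ Icc (-1 : ℝ) 1)
    (h : extHnd c ζ t = extHnd c' ζ' t') : c = c' ∧ ζ = ζ' ∧ t = t' := by
  have hm : ∀ {s : Bool} {ζ : ℂ}, 1 ≤ ‖ζ‖ → ‖ζ‖ ≤ 3 → lev s * (2 - ‖ζ‖) ∈ Icc (-1 : ℝ) 1 :=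
    fun h1 h3 => lev_mul_mem.2 ⟨by linarith, by linarith⟩
  have hl : ∀ {s : Bool} {a b : ℝ}, lev s * a = lev s * b → a = b := fun {s a b} h =>
    mul_left_cancel₀ (by rcases lev_cases s with h | h <;> rw [h] <;> norm_num : lev s ≠ 0) h
  have mixed : ∀ {c c' : G.Circles} {ζ ζ' : ℂ} {t t' : ℝ}, c.1 = c'.1 → ‖ζ‖ ≤ 1 → 1 < ‖ζ'‖ →
      ‖ζ'‖ ≤ 3 → t ∈ Icc (-1 : ℝ) 1 → t' ∈ Icc (-1 : ℝ) 1 → extHnd c ζ t ≠ extHnd c' ζ' t' := by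
    intro c c' ζ ζ' t t' hs h1 h2 h3 ht ht' h
    rw [extHnd_of_le h1, extHnd_of_ge h2.le ht', eq_comm, lay_eq_hnd_iff (hm h2.le h3) ht, hs] at h
    have := hl (h.1.trans (mul_one _).symm)
    linarith
  rcases le_or_gt ‖ζ‖ 1 with h1 | h1 <;> rcases le_or_gt ‖ζ'‖ 1 with h2 | h2
  · rw [extHnd_of_le h1, extHnd_of_le h2, hnd_eq_iff ht ht', Subtype.ext_iff, retr_coe h1,
      retr_coe h2] at h
    exact h
  · exact (mixed hs h1 h2 hζ' ht ht' h).elim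
  · exact (mixed hs.symm h2 h1 hζ ht' ht h.symm).elim
  · rw [extHnd_of_ge h1.le ht, extHnd_of_ge h2.le ht', lay_eq_iff (hm h1.le hζ) (hm h2.le hζ'),
      ann_eq_iff hs ht ht', ← hs] at h
    obtain ⟨⟨hc, hd, htt⟩, hn⟩ := h
    have h3 : ‖ζ‖ = ‖ζ'‖ := by linarith [hl hn]
    exact ⟨hc, by rw [← norm_mul_dir ζ, ← norm_mul_dir ζ', hd, h3], htt⟩

/-- The image of `extHnd` in the interior. -/
def handleDomain (c : G.Circles) : Set G.HandleManifold :=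
  {m | ∃ ζ : ℂ, ‖ζ‖ < 3 ∧ ∃ t ∈ Ioo (-1 : ℝ) 1, extHnd c ζ t = m}

theorem lay_mem_handleDomain_iff {c : G.Circles} {x : G.Surface} {h : ℝ} (hh : h ∈ Icc (-1 : ℝ) 1) :
    lay x h ∈ handleDomain c ↔ -1 < lev c.1 * h ∧ ∃ w, ∃ t ∈ Ioo (-1 : ℝ) 1, ann c w t = x := by
  constructor
  · rintro ⟨ζ, hζ, t, ht, H⟩
    have ht' := Ioo_subset_Icc_self ht
    rcases le_or_gt ‖ζ‖ 1 with h1 | h1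
    · rw [extHnd_of_le h1, eq_comm, lay_eq_hnd_iff hh ht'] at H
      obtain ⟨rfl, w, -, rfl⟩ := H
      exact ⟨by rw [lev_mul_self]; norm_num, w, t, ht, rfl⟩
    · rw [extHnd_of_ge h1.le ht', lay_eq_iff (lev_mul_mem.2 ⟨by linarith, by linarith⟩) hh] at H
      obtain ⟨rfl, rfl⟩ := H
      refine ⟨?_, _, t, ht, rfl⟩
      rw [← mul_assoc, lev_mul_self]; linarith
  · rintro ⟨h1, w, t, ht, rfl⟩
    have h2 := (lev_mul_mem (s := c.1)).2 hh
    refine ⟨((2 - lev c.1 * h : ℝ) : ℂ) * w, ?_, t, ht, ?_⟩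
    · rw [norm_mul_circle (by linarith [h2.2])]; linarith
    · rw [extHnd_mul (by linarith [h2.2]) w (Ioo_subset_Icc_self ht), sub_sub_cancel, ← mul_assoc,
        lev_mul_self, one_mul]

theorem hnd_mem_handleDomain_iff {c c' : G.Circles} {d : closedBall (0 : ℂ) 1} {t : ℝ}
    (ht : t ∈ Icc (-1 : ℝ) 1) :
    hnd c' d t ∈ handleDomain c ↔ c' = c ∧ t ∈ Ioo (-1 : ℝ) 1 := by
  have hd : ‖(d : ℂ)‖ ≤ 1 := mem_closedBall_zero_iff.1 d.2
  have h0 : hnd c' d t = extHnd c' d t := by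
    rw [extHnd_of_le hd, show retr d = d from Subtype.ext (retr_coe hd)]
  constructor
  · rintro ⟨ζ, hζ, t', ht', H⟩
    by_cases hs : c.1 = c'.1
    · rw [h0] at H
      obtain ⟨rfl, -, rfl⟩ := extHnd_inj hs hζ.le (by linarith) (Ioo_subset_Icc_self ht') ht H
      exact ⟨rfl, ht'⟩
    · rcases le_or_gt ‖ζ‖ 1 with h1 | h1
      · rw [extHnd_of_le h1, hnd_eq_iff (Ioo_subset_Icc_self ht') ht] at H
        exact (hs (congrArg _ H.1)).elim
      · rw [extHnd_of_ge h1.le (Ioo_subset_Icc_self ht'),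
          lay_eq_hnd_iff (lev_mul_mem.2 ⟨by linarith, by linarith⟩) ht, lev_of_ne hs] at H
        have := H.1
        rcases lev_cases c.1 with h | h <;> rw [h] at this <;> linarith
  · rintro ⟨rfl, h⟩
    exact ⟨d, by linarith, t, h, h0.symm⟩

theorem isOpen_handleDomain (c : G.Circles) : IsOpen (handleDomain c) := by
  change IsOpen ((Quot.mk G.HandleRel) ⁻¹' _)
  rw [isOpen_sum_iff]
  constructor
  · have h1 : IsOpen {x : G.Surface | ∃ w, ∃ t ∈ Ioo (-1 : ℝ) 1, ann c w t = x} := by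
      convert isOpen_annulus c using 3
      refine exists_congr fun w => ?_
      constructor
      · rintro ⟨t, ht, rfl⟩
        exact ⟨ic t, by rwa [ic_coe (Ioo_subset_Icc_self ht)], rfl⟩
      · rintro ⟨t, ht, rfl⟩
        exact ⟨t, ht, by rw [ann, ic_val]⟩
    have h2 : IsOpen {h : Icc (-1 : ℝ) 1 | -1 < lev c.1 * (h : ℝ)} :=
      isOpen_lt (by fun_prop) (by fun_prop)
    convert h1.prod h2 using 1
    ext ⟨x, h⟩
    have h3 : (Quot.mk G.HandleRel (Sum.inl (x, h)) : G.HandleManifold) = lay x h := by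
      rw [lay, ic_val]
    exact (Eq.to_iff (congrArg (· ∈ handleDomain c) h3)).trans
      ((lay_mem_handleDomain_iff h.2).trans and_comm)
  · have h2 : IsOpen {t : Icc (-1 : ℝ) 1 | (t : ℝ) ∈ Ioo (-1 : ℝ) 1} :=
      isOpen_Ioo.preimage continuous_subtype_val
    convert (isOpen_discrete {c}).prod (isOpen_univ.prod h2) using 1
    ext ⟨c', d, t⟩
    have h3 : (Quot.mk G.HandleRel (Sum.inr (c', d, t)) : G.HandleManifold) = hnd c' d t := by
      rw [hnd, ic_val]
    refine (Eq.to_iff (congrArg (· ∈ handleDomain c) h3)).trans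
      ((hnd_mem_handleDomain_iff t.2).trans ?_)
    simp

/-- The plot of the interior around a handle. -/
theorem exists_handlePlot (c : G.Circles) : ∃ e : OpenPartialHomeomorph (ℂ × ℝ) G.HandleManifold,
    e.source = ball (0 : ℂ) 3 ×ˢ Ioo (-1 : ℝ) 1 ∧ e.target = handleDomain c ∧
      ∀ ζ : ℂ, ‖ζ‖ < 3 → ∀ t ∈ Ioo (-1 : ℝ) 1, e (ζ, t) = extHnd c ζ (-lev c.1 * t) := by
  let p : (closedBall (0 : ℂ) 3 × Icc (-1 : ℝ) 1) → ℂ × ℝ := fun x => (x.1, x.2)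
  -- Below the annulus the radius is `2 - lev c.1 * h`, so it runs along or against the height
  -- depending on the family. The factor `-lev c.1` on the other coordinate compensates this sign,
  -- which makes the plots of both families induce the same orientation.
  let q : (closedBall (0 : ℂ) 3 × Icc (-1 : ℝ) 1) → G.HandleManifold := fun x => extHnd c x.1 (-lev c.1 * x.2)
  have hn : ∀ {t : ℝ}, t ∈ Icc (-1 : ℝ) 1 → -lev c.1 * t ∈ Icc (-1 : ℝ) 1 := fun {t} h => by
    rw [neg_mul, ← mul_neg]; exact lev_mul_mem.2 ⟨by linarith [h.2], by linarith [h.1]⟩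
  have hn' : ∀ {t : ℝ}, -lev c.1 * t ∈ Ioo (-1 : ℝ) 1 ↔ t ∈ Ioo (-1 : ℝ) 1 := fun {t} => by
    rw [neg_mul, ← mul_neg, lev_mul_mem_Ioo]
    constructor <;> rintro ⟨h1, h2⟩ <;> constructor <;> linarith
  have hp : Continuous p := by fun_prop
  have hq : Continuous q := (continuousOn_extHnd c).comp_continuous
    (by fun_prop : Continuous fun x : (closedBall (0 : ℂ) 3 × Icc (-1 : ℝ) 1) => ((x.1 : ℂ), -lev c.1 * (x.2 : ℝ))) fun x => hn x.2.2
  have hb : ∀ x : (closedBall (0 : ℂ) 3 × Icc (-1 : ℝ) 1), ‖(x.1 : ℂ)‖ ≤ 3 := fun x => mem_closedBall_zero_iff.1 x.1.2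
  have hl : ∀ {a b : ℝ}, -lev c.1 * a = -lev c.1 * b → a = b := fun {a b} h =>
    mul_left_cancel₀ (by rcases lev_cases c.1 with h | h <;> rw [h] <;> norm_num : -lev c.1 ≠ 0) h
  have : Nonempty (closedBall (0 : ℂ) 3 × Icc (-1 : ℝ) 1) := ⟨(⟨0, by simp⟩, ⟨0, by simp⟩)⟩
  refine (exists_openPartialHomeomorph_of_fibers hp hq
    (isOpen_ball.prod isOpen_Ioo : IsOpen (ball (0 : ℂ) 3 ×ˢ Ioo (-1 : ℝ) 1))
    (isOpen_handleDomain c) ?_ ?_ ?_ ?_).imp fun e ⟨h1, h2, h3, _⟩ => ⟨h1, h2, fun ζ hζ t ht =>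
      h3 (⟨ζ, mem_closedBall_zero_iff.2 hζ.le⟩, ⟨t, Ioo_subset_Icc_self ht⟩)
        ⟨mem_ball_zero_iff.2 hζ, ht⟩⟩
  · rintro ⟨ζ, t⟩ ⟨h1, h2⟩
    exact ⟨(⟨ζ, ball_subset_closedBall h1⟩, ⟨t, Ioo_subset_Icc_self h2⟩), rfl⟩
  · rintro m ⟨ζ, hζ, t, ht, rfl⟩
    refine ⟨(⟨ζ, mem_closedBall_zero_iff.2 hζ.le⟩, ⟨-lev c.1 * t, hn (Ioo_subset_Icc_self ht)⟩), ?_⟩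
    simp only [q]
    rw [← mul_assoc, neg_mul_neg, lev_mul_self, one_mul]
  · intro x
    constructor
    · rintro ⟨h1, h2⟩
      exact ⟨x.1, mem_ball_zero_iff.1 h1, _, hn'.2 h2, rfl⟩
    · rintro ⟨ζ, hζ, t, ht, H⟩
      obtain ⟨-, rfl, rfl⟩ := extHnd_inj rfl hζ.le (hb x) (Ioo_subset_Icc_self ht) (hn x.2.2) H
      exact ⟨mem_ball_zero_iff.2 hζ, hn'.1 ht⟩
  · intro x y _ _
    constructor
    · intro h
      have h1 : (x.1 : ℂ) = y.1 := congrArg Prod.fst h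
      have h2 : (x.2 : ℝ) = y.2 := congrArg Prod.snd h
      simp only [q, h1, h2]
    · intro h
      obtain ⟨-, h1, h2⟩ := extHnd_inj rfl (hb x) (hb y) (hn x.2.2) (hn y.2.2) h
      exact Prod.ext h1 (hl h2)

/-- The plot of the interior of the collar. -/
theorem exists_layPlot [hS : Nonempty G.Surface] : ∃ e : OpenPartialHomeomorph (G.Surface × ℝ) G.HandleManifold,
    e.source = univ ×ˢ Ioo (-1 : ℝ) 1 ∧ e.target = {m | ∃ x, ∃ h ∈ Ioo (-1 : ℝ) 1, lay x h = m} ∧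
      ∀ x, ∀ h ∈ Ioo (-1 : ℝ) 1, e (x, h) = lay x h := by
  let p : (G.Surface × Icc (-1 : ℝ) 1) → G.Surface × ℝ := fun x => (x.1, x.2)
  let q : (G.Surface × Icc (-1 : ℝ) 1) → G.HandleManifold := fun x => lay x.1 x.2
  have hV : IsOpen {m : G.HandleManifold | ∃ x, ∃ h ∈ Ioo (-1 : ℝ) 1, lay x h = m} := by
    change IsOpen ((Quot.mk G.HandleRel) ⁻¹' _)
    rw [isOpen_sum_iff]
    constructor
    · have h2 : IsOpen {t : Icc (-1 : ℝ) 1 | (t : ℝ) ∈ Ioo (-1 : ℝ) 1} :=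
        isOpen_Ioo.preimage continuous_subtype_val
      convert isOpen_univ.prod h2 using 1
      ext ⟨x, h⟩
      have h3 : (Quot.mk G.HandleRel (Sum.inl (x, h)) : G.HandleManifold) = lay x h := by
        rw [lay, ic_val]
      simp only [mem_preimage, mem_ofPred_eq, mem_prod, mem_univ, true_and]
      constructor
      · rintro ⟨x', h', hh, H⟩
        obtain ⟨-, rfl⟩ := (lay_eq_iff (Ioo_subset_Icc_self hh) h.2).1 (H.trans h3)
        exact hh
      · intro hh
        exact ⟨x, h, hh, h3.symm⟩
    · convert isOpen_empty using 1
      refine eq_empty_iff_forall_notMem.2 ?_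
      rintro ⟨c, d, t⟩ ⟨x, h, hh, H⟩
      have h3 : (Quot.mk G.HandleRel (Sum.inr (c, d, t)) : G.HandleManifold) = hnd c d t := by
        rw [hnd, ic_val]
      have := ((lay_eq_hnd_iff (Ioo_subset_Icc_self hh) t.2).1 (H.trans h3)).1
      rw [this] at hh
      rcases lev_cases c.1 with h | h <;> rw [h] at hh <;> simp at hh
  have : Nonempty (G.Surface × Icc (-1 : ℝ) 1) := ⟨(hS.some, ⟨0, by simp⟩)⟩
  refine (exists_openPartialHomeomorph_of_fibers
    (by fun_prop : Continuous p) (continuous_lay.comp (by fun_prop : Continuous fun x : (G.Surface × Icc (-1 : ℝ) 1) => (x.1, (x.2 : ℝ))) :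
      Continuous q)
    (isOpen_univ.prod isOpen_Ioo : IsOpen ((univ : Set G.Surface) ×ˢ Ioo (-1 : ℝ) 1)) hV ?_ ?_ ?_ ?_).imp
    fun e ⟨h1, h2, h3, _⟩ =>
      ⟨h1, h2, fun x h hh => h3 (x, ⟨h, Ioo_subset_Icc_self hh⟩) ⟨trivial, hh⟩⟩
  · rintro ⟨x, h⟩ ⟨-, hh⟩
    exact ⟨(x, ⟨h, Ioo_subset_Icc_self hh⟩), rfl⟩
  · rintro m ⟨x, h, hh, rfl⟩
    exact ⟨(x, ⟨h, Ioo_subset_Icc_self hh⟩), rfl⟩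
  · rintro ⟨x, h⟩
    constructor
    · rintro ⟨-, hh⟩
      exact ⟨x, h, hh, rfl⟩
    · rintro ⟨x', h', hh, H⟩
      obtain ⟨-, rfl⟩ := (lay_eq_iff (Ioo_subset_Icc_self hh) h.2).1 H
      exact ⟨trivial, hh⟩
  · rintro ⟨x, h⟩ ⟨x', h'⟩ _ _
    exact Prod.mk_inj.trans (lay_eq_iff h.2 h'.2).symm

end DecoratedGaussDiagram

/-! ### The orientation of the collar with handles -/

/-- Cylindrical coordinates. -/
theorem OP.polar {α β γ : ℝ} (h : 0 < α * β * γ) (ρ₀ θ₀ τ₀ : ℝ) (x : ℂ × ℝ)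
    (hx : 0 < ρ₀ + α * x.2) : OP (fun y : ℂ × ℝ =>
      (((ρ₀ + α * y.2 : ℝ) : ℂ) * Circle.exp (θ₀ + β * y.1.re), τ₀ + γ * y.1.im)) x := by
  -- The map is a cyclic permutation of scaled coordinates, followed by a logarithm and translations
  -- coordinate by coordinate, followed by the complex exponential, which turns logarithmic radius
  -- and angle into a complex number.
  have h1 := OP.cyclic h x
  have h2 : OP (fun y : ℂ × ℝ => ((⟨Real.log (ρ₀ + y.1.re), θ₀ + y.1.im⟩ : ℂ), τ₀ + y.2))
      ((⟨α * x.2, β * x.1.re⟩ : ℂ), γ * x.1.im) := by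
    have hpos : ∀ u ∈ ball (α * x.2) (ρ₀ + α * x.2), 0 < ρ₀ + u := fun u hu => by
      have := (abs_lt.1 (by simpa [Real.dist_eq] using hu : |u - α * x.2| < _)).1
      linarith
    refine OP.of_strictMonoOn (φ₁ := fun u => Real.log (ρ₀ + u)) (φ₂ := fun u => θ₀ + u)
      (φ₃ := fun u => τ₀ + u) hx ?_ ?_ ?_ ?_ (by fun_prop) (by fun_prop)
    · intro u hu v hv huv
      exact Real.log_lt_log (hpos u hu) (by linarith)
    · intro u _ v _ huv
      simpa using huv
    · intro u _ v _ huv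
      simpa using huv
    · exact ContinuousOn.log (by fun_prop) fun u hu => (hpos u hu).ne'
  have hc1 : Continuous fun y : ℂ × ℝ => ((⟨α * y.2, β * y.1.re⟩ : ℂ), γ * y.1.im) := by
    refine Continuous.prodMk ?_ (by fun_prop)
    exact Complex.equivRealProdCLM.symm.continuous.comp
      (f := fun y : ℂ × ℝ => (α * y.2, β * y.1.re)) (by fun_prop)
  have h3 := h1.comp h2 hc1.continuousAt
  have hc3 : ContinuousAt (fun y : ℂ × ℝ =>
      ((⟨Real.log (ρ₀ + α * y.2), θ₀ + β * y.1.re⟩ : ℂ), τ₀ + γ * y.1.im)) x := by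
    refine ContinuousAt.prodMk ?_ (by fun_prop)
    exact Complex.equivRealProdCLM.symm.continuous.continuousAt.comp
      (f := fun y : ℂ × ℝ => (Real.log (ρ₀ + α * y.2), θ₀ + β * y.1.re))
      (ContinuousAt.prodMk (ContinuousAt.log (by fun_prop) hx.ne') (by fun_prop))
  have h4 := OP.comp (g := fun y : ℂ × ℝ => (Complex.exp y.1, y.2)) h3
    (OP.holomorphic (Complex.hasDerivAt_exp _) (Complex.exp_ne_zero _)
      (Filter.Eventually.of_forall fun z => Complex.continuous_exp.continuousAt)) hc3
  refine h4.congr ?_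
  have ho : IsOpen {y : ℂ × ℝ | 0 < ρ₀ + α * y.2} := isOpen_lt (by fun_prop) (by fun_prop)
  filter_upwards [ho.mem_nhds hx] with y hy
  have hy : 0 < ρ₀ + α * y.2 := hy
  refine Prod.ext ?_ rfl
  have h5 : ((⟨Real.log (ρ₀ + α * y.2), θ₀ + β * y.1.re⟩ : ℂ)) =
      (Real.log (ρ₀ + α * y.2) : ℂ) + ((θ₀ + β * y.1.re : ℝ) : ℂ) * Complex.I := by
    apply Complex.ext <;> simp
  simp only [Function.comp]
  rw [h5, Complex.exp_add, Circle.coe_exp, ← Complex.ofReal_exp, Real.exp_log hy]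

theorem GaussDiagram.pos_affine (G : GaussDiagram) (c : G.Circles) : ∃ κ : ℝ, 0 < κ ∧
    ∀ u, G.pos c u = Circle.exp (κ * u) := by
  have hD : (0 : ℝ) < ((max (G.deg c.1 c.2) 1 : ℕ) : ℝ) := by
    exact_mod_cast lt_of_lt_of_le one_pos (le_max_right _ _)
  have h2 := Real.pi_pos
  refine ⟨2 * Real.pi / ((max (G.deg c.1 c.2) 1 : ℕ) : ℝ), by positivity, fun u => ?_⟩
  simp only [GaussDiagram.pos]
  congr 1
  ring

theorem GaussDiagram.OP_polar_pos (G : GaussDiagram) (c : G.Circles) {α β γ : ℝ}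
    (h : 0 < α * β * γ) (ρ₀ u₀ τ₀ : ℝ) (x : ℂ × ℝ) (hx : 0 < ρ₀ + α * x.2) :
    OP (fun y : ℂ × ℝ =>
      (((ρ₀ + α * y.2 : ℝ) : ℂ) * G.pos c (u₀ + β * y.1.re), τ₀ + γ * y.1.im)) x := by
  obtain ⟨κ, hκ, hp⟩ := G.pos_affine c
  have := OP.polar (α := α) (β := κ * β) (γ := γ) (by
    rw [show α * (κ * β) * γ = κ * (α * β * γ) by ring]; positivity) ρ₀ (κ * u₀) τ₀ x hx
  refine this.congr (Filter.Eventually.of_forall fun y => ?_)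
  simp only [hp]
  congr 4
  ring

namespace GaussDiagram

variable {G : GaussDiagram}

/-- The circle on which a side lies. -/
def circ : G.Arc → G.Circles
  | .inl (s, h, _) => ⟨s, (G.chordEnd s h).1⟩
  | .inr (c, _) => c.1

/-- Both kinds of sides get one normal form, a shear that increases along the side followed by the
coordinates of the annulus; thus `compat_slab` is proved for both at once. -/
theorem exists_trap_eq (a : G.Arc) : ∃ (u₀ δ : ℝ) (X : ℝ → ℝ → ℝ), (δ = 1 ∨ δ = -1) ∧
    Continuous (Function.uncurry X) ∧ (∀ r, 0 < r → StrictMono fun t => X t r) ∧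
    ∀ t, ∀ r ∈ Icc (0 : ℝ) 1, G.trap a t r =
      (circ a, G.pos (circ a) (u₀ + δ * X t r), ic (-(δ * (1 - r)))) := by
  have hd : ∀ (δ : ℤˣ) r, depth δ r = ic (-(((δ : ℤ) : ℝ) * (1 - r))) := fun δ r => rfl
  rcases a with ⟨s, h, δ⟩ | ⟨c, δ⟩
  · refine ⟨((G.chordEnd s h).2 : ℕ) + 1 / 2, ((δ : ℤ) : ℝ), fun t r => (1 + r) * (t / 2 - 1 / 4),
      units_real δ, by fun_prop, fun r hr t t' htt => ?_, fun t r _ => ?_⟩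
    · simp only
      have : 0 < 1 + r := by linarith
      nlinarith
    · simp only [trap, annPt, hd, circ]
      congr 3
      ring
  · refine ⟨0, ((δ : ℤ) : ℝ), fun t r => t, units_real δ, by fun_prop,
      fun r hr t t' htt => htt, fun t r _ => ?_⟩
    simp only [trap, hd, circ, zero_add]

end GaussDiagram

namespace DecoratedGaussDiagram

open GaussDiagram

variable {G : DecoratedGaussDiagram}

/-- The plot around a handle. -/
def handlePlot (c : G.Circles) : OpenPartialHomeomorph (ℂ × ℝ) G.HandleManifold :=
  (exists_handlePlot c).choose

theorem handlePlot_target (c : G.Circles) : (handlePlot c).target = handleDomain c :=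
  (exists_handlePlot c).choose_spec.2.1

theorem mem_handlePlot_source {c : G.Circles} {ζ : ℂ} {t : ℝ} :
    (ζ, t) ∈ (handlePlot c).source ↔ ‖ζ‖ < 3 ∧ t ∈ Ioo (-1 : ℝ) 1 := by
  rw [handlePlot, (exists_handlePlot c).choose_spec.1, mem_prod, mem_ball_zero_iff]

theorem handlePlot_apply (c : G.Circles) {ζ : ℂ} (hζ : ‖ζ‖ < 3) {t : ℝ} (ht : t ∈ Ioo (-1 : ℝ) 1) :
    handlePlot c (ζ, t) = extHnd c ζ (-lev c.1 * t) :=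
  (exists_handlePlot c).choose_spec.2.2 ζ hζ t ht

theorem handlePlot_lay (c : G.Circles) (w : Circle) {t h : ℝ} (ht : t ∈ Ioo (-1 : ℝ) 1)
    (hh : h ∈ Ioo (-1 : ℝ) 1) :
    (((2 + -lev c.1 * h : ℝ) : ℂ) * w, -lev c.1 * t) ∈ (handlePlot c).source ∧
    handlePlot c (((2 + -lev c.1 * h : ℝ) : ℂ) * w, -lev c.1 * t) = lay (ann c w t) h := by
  have h1 := (lev_mul_mem_Ioo (s := c.1)).2 hh
  have h2 : -lev c.1 * t ∈ Ioo (-1 : ℝ) 1 := by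
    rw [neg_mul, ← mul_neg]
    exact lev_mul_mem_Ioo.2 ⟨by linarith [ht.2], by linarith [ht.1]⟩
  have h3 : ‖((2 + -lev c.1 * h : ℝ) : ℂ) * w‖ < 3 := by
    rw [norm_mul_circle (by linarith [h1.2])]; linarith [h1.1]
  refine ⟨mem_handlePlot_source.2 ⟨h3, h2⟩, ?_⟩
  rw [handlePlot_apply c h3 h2, ← mul_assoc, neg_mul_neg, lev_mul_self, one_mul,
    extHnd_mul (by linarith [h1.2]) _ (Ioo_subset_Icc_self ht)]
  congr 1
  rw [show 2 - (2 + -lev c.1 * h) = lev c.1 * h by ring, ← mul_assoc, lev_mul_self, one_mul]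

/-- The plot around a sphere with holes in the surface. -/
def surfacePlot (c : Fin G.numColors) : OpenPartialHomeomorph ℂ G.Surface :=
  (exists_regionPlot c).choose

theorem nonempty_surface (c : Fin G.numColors) : Nonempty G.Surface :=
  ⟨region c (HoledSphere.infty _)⟩

/-- The plot of the interior of the collar around a sphere with holes. -/
def regionPlot (c : Fin G.numColors) : OpenPartialHomeomorph (ℂ × ℝ) G.HandleManifold :=
  ((surfacePlot c).prod (OpenPartialHomeomorph.refl ℝ)).trans
    (exists_layPlot (hS := nonempty_surface c)).choose

theorem mem_regionPlot_source {c : Fin G.numColors} {z : ℂ} {h : ℝ} :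
    (z, h) ∈ (regionPlot c).source ↔ z ∈ (surfacePlot c).source ∧ h ∈ Ioo (-1 : ℝ) 1 := by
  have := (exists_layPlot (G := G) (hS := nonempty_surface c)).choose_spec.1
  rw [regionPlot, OpenPartialHomeomorph.trans_source, this]
  simp

theorem regionPlot_apply {c : Fin G.numColors} {z : ℂ} {h : ℝ} (hh : h ∈ Ioo (-1 : ℝ) 1) :
    regionPlot c (z, h) = lay (surfacePlot c z) h :=
  (exists_layPlot (G := G) (hS := nonempty_surface c)).choose_spec.2.2 _ h hh

theorem surfacePlot_target (c : Fin G.numColors) : (surfacePlot c).target = regionDomain c :=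
  (exists_regionPlot c).choose_spec.choose_spec.1

theorem mem_regionPlot_target {c : Fin G.numColors} {m : G.HandleManifold} :
    m ∈ (regionPlot c).target ↔ ∃ x ∈ regionDomain c, ∃ h ∈ Ioo (-1 : ℝ) 1, lay x h = m := by
  constructor
  · intro hm
    have h1 := (regionPlot c).map_target hm
    have h2 := (regionPlot c).right_inv hm
    obtain ⟨h3, h4⟩ := mem_regionPlot_source.1 (show ((_, _) : ℂ × ℝ) ∈ _ from h1)
    refine ⟨_, surfacePlot_target c ▸ (surfacePlot c).map_source h3, _, h4, ?_⟩
    rw [← regionPlot_apply h4]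
    exact h2
  · rintro ⟨x, hx, h, hh, rfl⟩
    rw [← surfacePlot_target] at hx
    rw [← (surfacePlot c).right_inv hx, ← regionPlot_apply hh]
    exact (regionPlot c).map_source
      (mem_regionPlot_source.2 ⟨(surfacePlot c).map_target hx, hh⟩)

/-- The plots of the interior of the collar with handles. -/
def interiorPlots (G : DecoratedGaussDiagram) : Set (OpenPartialHomeomorph (ℂ × ℝ) G.HandleManifold) :=
  range handlePlot ∪ range regionPlot

theorem ann_coupon (g : Fin G.numChords) {x y : ℝ} (hx : x ∈ Icc (-1 : ℝ) 1)
    (hy : y ∈ Icc (-1 : ℝ) 1) :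
    ann (G := G) ⟨true, (G.chordEnd true g).1⟩
      (G.pos ⟨true, (G.chordEnd true g).1⟩ (((G.chordEnd true g).2 : ℕ) + 1 / 4 * x)) y =
    ann ⟨false, (G.chordEnd false g).1⟩
      (G.pos ⟨false, (G.chordEnd false g).1⟩ (((G.chordEnd false g).2 : ℕ) +
        1 / 4 * (((G.sign g : ℤ) : ℝ) * y))) (-((G.sign g : ℤ) : ℝ) * x) := by
  have h1 : -((G.sign g : ℤ) : ℝ) * x ∈ Icc (-1 : ℝ) 1 := by
    have := units_mul_mem (-G.sign g) ⟨x, hx⟩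
    push_cast at this
    exact this
  refine congrArg ribbon (Quot.sound (couponRel_iff.2 ⟨g, ic x, ic y, ic (-((G.sign g : ℤ) : ℝ) * x),
    by rw [ic_coe hx, ic_coe h1], ?_, ?_⟩))
  · rw [ic_coe hx, annPt]; congr 3; ring
  · rw [ic_coe hy, annPt]; congr 3; ring

theorem ofReal_mul_I_eta (z : ℂ) (ε : ℝ) : -Complex.I * ε * z = ⟨ε * z.im, -ε * z.re⟩ := by
  apply Complex.ext <;> simp

/-- In the coordinates of the square and the height, both handle plots are cylindrical coordinates
that preserve orientation, up to multiplication of the square by `-i ε`. This is a rotation for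
either sign `ε` of the chord, as the coupon preserves orientations. -/
theorem compat_coupon (g : Fin G.numChords) {x y h : ℝ} (hx : x ∈ Ioo (-1 : ℝ) 1)
    (hy : y ∈ Ioo (-1 : ℝ) 1) (hh : h ∈ Ioo (-1 : ℝ) 1) :
    Compat (handlePlot ⟨true, (G.chordEnd true g).1⟩) (handlePlot ⟨false, (G.chordEnd false g).1⟩)
      (lay (ann (G := G) ⟨true, (G.chordEnd true g).1⟩
        (G.pos ⟨true, (G.chordEnd true g).1⟩ (((G.chordEnd true g).2 : ℕ) + 1 / 4 * x)) y) h) := by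
  set ε : ℝ := ((G.sign g : ℤ) : ℝ) with hε
  have hεε : ε = 1 ∨ ε = -1 := units_real _
  have hmem : ∀ {u : ℝ}, u ∈ Ioo (-1 : ℝ) 1 → -ε * u ∈ Ioo (-1 : ℝ) 1 := by
    intro u hu
    rcases hεε with h | h <;> rw [h] <;> constructor <;> linarith [hu.1, hu.2]
  set c : G.Circles := ⟨true, (G.chordEnd true g).1⟩ with hc
  set c' : G.Circles := ⟨false, (G.chordEnd false g).1⟩ with hc'
  set k : ℝ := (((G.chordEnd true g).2 : ℕ) : ℝ)
  set k' : ℝ := (((G.chordEnd false g).2 : ℕ) : ℝ)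
  let f : ℂ × ℝ → ℂ × ℝ := fun z => (((2 + -1 * z.2 : ℝ) : ℂ) * G.pos c (k + 1 / 4 * z.1.re), 0 + -1 * z.1.im)
  let f₁ : ℂ × ℝ → ℂ × ℝ := fun z => (((2 + 1 * z.2 : ℝ) : ℂ) * G.pos c' (k' + 1 / 4 * z.1.re), 0 + 1 * z.1.im)
  let f' : ℂ × ℝ → ℂ × ℝ := fun z => f₁ (-Complex.I * ε * z.1, z.2)
  have hcp := G.continuous_pos c
  have hcp' := G.continuous_pos c'
  have hf1 : ∀ z : ℂ × ℝ, f z = (((2 + -lev c.1 * z.2 : ℝ) : ℂ) * G.pos c (k + 1 / 4 * z.1.re),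
      -lev c.1 * z.1.im) := fun z => by simp [f, lev, hc]
  have hf2 : ∀ z : ℂ × ℝ, f' z = (((2 + -lev c'.1 * z.2 : ℝ) : ℂ) *
      G.pos c' (k' + 1 / 4 * (ε * z.1.im)), -lev c'.1 * (-ε * z.1.re)) := fun z => by
    simp only [f', f₁, ofReal_mul_I_eta]
    simp [lev, hc']
  have hb1 := handlePlot_lay c (G.pos c (k + 1 / 4 * x)) hy hh
  have hb2 := handlePlot_lay c' (G.pos c' (k' + 1 / 4 * (ε * y))) (hmem hx) hh
  have hfc : Continuous f := by fun_prop
  have hfc' : Continuous f' := by fun_prop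
  refine Compat.of_param (f := f) (f' := f') (b := (⟨x, y⟩, h)) ?_ ?_ ?_ hfc.continuousAt
    hfc'.continuousAt ?_ ?_ ?_
  · rw [hf1]; exact hb1.2
  · exact G.OP_polar_pos c (by norm_num) _ _ _ _ (by simp only; linarith [hh.2])
  · have hne : -Complex.I * (ε : ℂ) ≠ 0 := by
      simp only [ne_eq, mul_eq_zero, neg_eq_zero, Complex.I_ne_zero, Complex.ofReal_eq_zero, false_or]
      rcases hεε with h | h <;> rw [h] <;> norm_num
    refine OP.comp (OP.mul_const hne (⟨x, y⟩, h))
      (G.OP_polar_pos c' (by norm_num) _ _ _ _ (by simp only; linarith [hh.1])) (by fun_prop)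
  · rw [hf1]; exact hb1.1
  · rw [hf2]; exact hb2.1
  · have h1 : IsOpen {z : ℂ × ℝ | z.1.re ∈ Ioo (-1 : ℝ) 1 ∧ z.1.im ∈ Ioo (-1 : ℝ) 1 ∧
        z.2 ∈ Ioo (-1 : ℝ) 1} :=
      (isOpen_Ioo.preimage (by fun_prop)).inter
        ((isOpen_Ioo.preimage (by fun_prop)).inter (isOpen_Ioo.preimage continuous_snd))
    filter_upwards [h1.mem_nhds ⟨hx, hy, hh⟩] with z hz
    rw [hf1, hf2, (handlePlot_lay c _ hz.2.1 hz.2.2).2, (handlePlot_lay c' _ (hmem hz.1) hz.2.2).2]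
    rw [ann_coupon g (Ioo_subset_Icc_self hz.1) (Ioo_subset_Icc_self hz.2.1)]

theorem slab_eq_ann (a : G.Arc) : ∃ (u₀ δ : ℝ) (X : ℝ → ℝ → ℝ), (δ = 1 ∨ δ = -1) ∧
    Continuous (Function.uncurry X) ∧ (∀ r, 0 < r → StrictMono fun t => X t r) ∧
    ∀ t, ∀ r ∈ Icc (0 : ℝ) 1, slab (G := G) a t r =
      ann (circ a) (G.pos (circ a) (u₀ + δ * X t r)) (-(δ * (1 - r))) := by
  obtain ⟨u₀, δ, X, h1, h2, h3, h4⟩ := exists_trap_eq a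
  exact ⟨u₀, δ, X, h1, h2, h3, fun t r hr => congrArg (fun p => ribbon (rmk p)) (h4 t r hr)⟩

/-- Both plots are read in the coordinates `t`, `r`, `h`. For the handle they give a shear followed
by cylindrical coordinates, where the direction `δ` and the level each occur twice and cancel. For
the region they give polar coordinates around the centre of a hole followed by an inversion. -/
theorem compat_slab (a : G.Arc) {t r h : ℝ} (ht : t ∈ Ioo (0 : ℝ) 1) (hr : r ∈ Ioo (0 : ℝ) 1)
    (hh : h ∈ Ioo (-1 : ℝ) 1) : Compat (handlePlot (circ a)) (regionPlot (G.color (cyc a)))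
      (lay (slab a t r) h) := by
  obtain ⟨u₀, δ, X, hδ, hXc, hX, hs⟩ := slab_eq_ann (G := G) a
  set c := circ a
  have hδδ : δ * δ = 1 := by rcases hδ with h | h <;> rw [h] <;> norm_num
  have hll := lev_mul_self c.1
  obtain ⟨z₀, -, -, -, hz⟩ := (exists_regionPlot (G.color (cyc a))).choose_spec
  have hz := hz a rfl
  have hcp := G.continuous_pos c
  set n : ℝ := (len (cyc a) : ℝ) with hn
  have hn0 : 0 < n := Nat.cast_pos.2 (len_pos (cyc a))
  let f₁ : ℂ × ℝ → ℂ × ℝ := fun z => (((2 + -lev c.1 * z.2 : ℝ) : ℂ) * G.pos c (u₀ + δ * z.1.re),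
    lev c.1 * δ + -(lev c.1 * δ) * z.1.im)
  let f : ℂ × ℝ → ℂ × ℝ := fun z => f₁ (⟨X z.1.re z.1.im, z.1.im⟩, z.2)
  let f' : ℂ × ℝ → ℂ × ℝ := fun z => ((holeCoord a z.1.re z.1.im - z₀)⁻¹, z.2)
  have hsh : Continuous fun z : ℂ × ℝ => ((⟨X z.1.re z.1.im, z.1.im⟩ : ℂ), z.2) := by
    refine Continuous.prodMk ?_ continuous_snd
    exact Complex.equivRealProdCLM.symm.continuous.comp
      (f := fun z : ℂ × ℝ => (X z.1.re z.1.im, z.1.im))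
      ((hXc.comp (by fun_prop : Continuous fun z : ℂ × ℝ => (z.1.re, z.1.im))).prodMk (by fun_prop))
  have hfc₁ : Continuous f₁ := by fun_prop
  have hfc : Continuous f := hfc₁.comp hsh
  have hh2 := (lev_mul_mem_Ioo (s := c.1)).2 hh
  have hf : ∀ z : ℂ × ℝ, f z = (((2 + -lev c.1 * z.2 : ℝ) : ℂ) *
      G.pos c (u₀ + δ * X z.1.re z.1.im), -lev c.1 * (-(δ * (1 - z.1.im)))) := fun z => by
    simp only [f, f₁]
    congr 1
    ring
  have hmem : ∀ {r : ℝ}, r ∈ Ioo (0 : ℝ) 1 → -(δ * (1 - r)) ∈ Ioo (-1 : ℝ) 1 := by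
    intro r hr
    rcases hδ with h | h <;> rw [h] <;> constructor <;> linarith [hr.1, hr.2]
  have hb1 := handlePlot_lay c (G.pos c (u₀ + δ * X t r)) (hmem hr) hh
  have hzb := hz t (Ioo_subset_Icc_self ht) r ⟨hr.1.le, hr.2⟩
  have hcont' : ContinuousAt f' (⟨t, r⟩, h) := by
    refine ContinuousAt.prodMk (ContinuousAt.inv₀ ?_ hzb.1) continuousAt_snd
    exact (((continuous_holeCoord a).comp
      (by fun_prop : Continuous fun z : ℂ × ℝ => (z.1.re, z.1.im))).sub continuous_const).continuousAt
  refine Compat.of_param (f := f) (f' := f') (b := (⟨t, r⟩, h)) ?_ ?_ ?_ hfc.continuousAt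
    hcont' ?_ ?_ ?_
  · rw [hf, hs _ _ (Ioo_subset_Icc_self hr)]; exact hb1.2
  · refine OP.comp (OP.shear hXc one_pos ((hX r hr.1).strictMonoOn _))
      (G.OP_polar_pos c ?_ _ _ _ _ ?_) hsh.continuousAt
    · rw [show -lev c.1 * δ * -(lev c.1 * δ) = (lev c.1 * lev c.1) * (δ * δ) by ring, hll, hδδ]
      norm_num
    · simp only; linarith [hh2.2]
  -- Multiplication by `i` turns `t + i r` into `-r + i t`. Then `log (1 - r)` and the angle are
  -- increasing functions of the two coordinates, and `g` is the holomorphic map that exponentiates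
  -- and inverts.
  · let g : ℂ → ℂ := fun z => (3 * (G.cycleIndex (cyc a) : ℂ) - z₀ + Complex.exp z)⁻¹
    let φ : ℂ × ℝ → ℂ × ℝ := fun y =>
      (⟨Real.log (1 + y.1.re), 2 * Real.pi * (index a + y.1.im) / n⟩, y.2)
    let I₁ : ℂ × ℝ → ℂ × ℝ := fun y => (Complex.I * y.1, y.2)
    have hgf : ∀ z : ℂ × ℝ, z.1.im < 1 → (fun y : ℂ × ℝ => (g y.1, y.2)) (φ (I₁ z)) = f' z := by
      intro z hz
      refine Prod.ext ?_ rfl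
      simp only [g, φ, I₁, f', holeCoord, ang]
      have h5 : ((⟨Real.log (1 + (Complex.I * z.1).re),
          2 * Real.pi * (index a + (Complex.I * z.1).im) / n⟩ : ℂ)) =
          (Real.log (1 - z.1.im) : ℂ) +
            ((2 * Real.pi * (index a + z.1.re) / n : ℝ) : ℂ) * Complex.I := by
        apply Complex.ext <;> simp <;> ring_nf
      rw [h5, Complex.exp_add, ← Complex.ofReal_exp, Real.exp_log (by linarith), Circle.coe_exp]
      congr 1
      ring
    have hI : OP I₁ (⟨t, r⟩, h) := OP.mul_const Complex.I_ne_zero _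
    have hI0 : I₁ (⟨t, r⟩, h) = (⟨-r, t⟩, h) := by
      refine Prod.ext (Complex.ext ?_ ?_) rfl <;> simp [I₁]
    have hφ : OP φ (I₁ (⟨t, r⟩, h)) := by
      rw [hI0]
      have hpos : ∀ u ∈ ball (-r) (1 - r), 0 < 1 + u := fun u hu => by
        have := (abs_lt.1 (by simpa [Real.dist_eq] using hu : |u + r| < _)).1
        linarith
      refine OP.of_strictMonoOn (φ₁ := fun u => Real.log (1 + u))
        (φ₂ := fun u => 2 * Real.pi * (index a + u) / n) (φ₃ := fun u => u)
        (r := 1 - r) (by linarith [hr.2]) ?_ ?_ ?_ ?_ (by fun_prop) (by fun_prop)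
      · intro u hu v hv huv
        exact Real.log_lt_log (hpos u hu) (by linarith)
      · intro u _ v _ huv
        have := Real.pi_pos
        simp only
        gcongr
      · exact strictMono_id.strictMonoOn _
      · exact ContinuousOn.log (by fun_prop) fun u hu => (hpos u hu).ne'
    have hφc : ContinuousAt φ (I₁ (⟨t, r⟩, h)) := by
      rw [hI0]
      refine ContinuousAt.prodMk ?_ (by fun_prop)
      refine Complex.equivRealProdCLM.symm.continuous.continuousAt.comp
        (f := fun y : ℂ × ℝ => (Real.log (1 + y.1.re), 2 * Real.pi * (index a + y.1.im) / n))
        (ContinuousAt.prodMk (ContinuousAt.log (by fun_prop) ?_) (by fun_prop))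
      simp only; linarith [hr.2]
    have h1 := hI.comp hφ (by fun_prop)
    have hne : 3 * (G.cycleIndex (cyc a) : ℂ) - z₀ +
        Complex.exp (φ (I₁ (⟨t, r⟩, h))).1 ≠ 0 := by
      have := congrArg Prod.fst (hgf (⟨t, r⟩, h) hr.2)
      simp only [g, f'] at this
      intro h0
      rw [h0, inv_zero, eq_comm, inv_eq_zero] at this
      exact hzb.1 this
    have h2 := OP.comp (g := fun y : ℂ × ℝ => (g y.1, y.2)) h1 (OP.holomorphic
      (((Complex.hasDerivAt_exp _).const_add _).inv hne) (by
        simp [hne, Complex.exp_ne_zero]) ?_) (hφc.comp (by fun_prop))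
    · refine h2.congr ?_
      have ho : IsOpen {y : ℂ × ℝ | y.1.im < 1} := isOpen_lt (by fun_prop) (by fun_prop)
      filter_upwards [ho.mem_nhds (show ((⟨t, r⟩, h) : ℂ × ℝ) ∈ _ from hr.2)] with z hz
      exact hgf z hz
    · have hcx : Continuous fun z : ℂ => 3 * (G.cycleIndex (cyc a) : ℂ) - z₀ + Complex.exp z := by
        fun_prop
      filter_upwards [(isOpen_ne.preimage hcx).mem_nhds hne] with z hz
      exact hcx.continuousAt.inv₀ hz
  · rw [hf]; exact hb1.1
  · exact mem_regionPlot_source.2 ⟨hzb.2.1, hh⟩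
  · have h1 : IsOpen {z : ℂ × ℝ | z.1.re ∈ Ioo (0 : ℝ) 1 ∧ z.1.im ∈ Ioo (0 : ℝ) 1 ∧
        z.2 ∈ Ioo (-1 : ℝ) 1} :=
      (isOpen_Ioo.preimage (by fun_prop)).inter
        ((isOpen_Ioo.preimage (by fun_prop)).inter (isOpen_Ioo.preimage continuous_snd))
    filter_upwards [h1.mem_nhds (show ((⟨t, r⟩, h) : ℂ × ℝ) ∈ _ from ⟨ht, hr, hh⟩)] with z hz'
    rw [hf, (handlePlot_lay c _ (hmem hz'.2.1) hz'.2.2).2, ← hs _ _ (Ioo_subset_Icc_self hz'.2.1)]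
    simp only [f']
    rw [regionPlot_apply hz'.2.2]
    congr 1
    exact (hz _ (Ioo_subset_Icc_self hz'.1) _ ⟨hz'.2.1.1.le, hz'.2.1.2⟩).2.2.symm

end DecoratedGaussDiagram

namespace DecoratedGaussDiagram

open GaussDiagram

variable {G : DecoratedGaussDiagram}

theorem compat_handle_aux {c c' : G.Circles} (hc : c.1 = true) (hc' : c'.1 = false) {w w' : Circle}
    {t t' h : ℝ} (ht : t ∈ Ioo (-1 : ℝ) 1) (ht' : t' ∈ Ioo (-1 : ℝ) 1) (hh : h ∈ Ioo (-1 : ℝ) 1)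
    (H : ann c w t = ann c' w' t') :
    Compat (handlePlot c) (handlePlot c') (lay (ann c w t) h) := by
  rcases couponRel_isGluing.mk_eq_iff.1 (ribbon_injective H) with H | H | H
  · have : c = c' := congrArg Prod.fst H
    rw [this, hc'] at hc
    cases hc
  · obtain ⟨g, x, y, v, hv, h1, h2⟩ := couponRel_iff.1 H
    obtain rfl : (⟨true, (G.chordEnd true g).1⟩ : G.Circles) = c := congrArg Prod.fst h1
    obtain rfl : (⟨false, (G.chordEnd false g).1⟩ : G.Circles) = c' := congrArg Prod.fst h2
    have h3 : y = ic t := congrArg (fun p : G.Annuli => p.2.2) h1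
    have h4 : v = ic t' := congrArg (fun p : G.Annuli => p.2.2) h2
    have h5 : G.pos ⟨true, (G.chordEnd true g).1⟩ (((G.chordEnd true g).2 : ℕ) + (x : ℝ) / 4) = w :=
      congrArg (fun p : G.Annuli => p.2.1) h1
    have hx : (x : ℝ) ∈ Ioo (-1 : ℝ) 1 := by
      rw [h4, ic_coe (Ioo_subset_Icc_self ht')] at hv
      rw [hv] at ht'
      rcases units_real (G.sign g) with h | h <;> rw [h] at ht' <;> constructor <;>
        linarith [ht'.1, ht'.2]
    have := compat_coupon g hx ht hh
    rw [show 1 / 4 * (x : ℝ) = x / 4 by ring, h5] at this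
    exact this
  · obtain ⟨g, x, y, v, hv, h1, h2⟩ := couponRel_iff.1 H
    have h1 : true = c'.1 := congrArg (fun p : G.Annuli => p.1.1) h1
    rw [hc'] at h1
    cases h1

/-- Different handles of one family have disjoint domains. Handles of opposite families meet only at
interior heights of the collar, at points inside a crossing square. -/
theorem compat_handle {c c' : G.Circles} {m : G.HandleManifold} (hm : m ∈ handleDomain c)
    (hm' : m ∈ handleDomain c') : Compat (handlePlot c) (handlePlot c') m := by
  by_cases hcc : c = c'
  · subst hcc
    exact Compat.refl _ (handlePlot_target c ▸ hm)
  rcases exists_lay_or_hnd m with ⟨x, h, hh, rfl⟩ | ⟨c'', d, t, ht, rfl⟩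
  swap
  · rw [hnd_mem_handleDomain_iff ht] at hm hm'
    exact (hcc (hm.1.symm.trans hm'.1)).elim
  rw [lay_mem_handleDomain_iff hh] at hm hm'
  obtain ⟨h1, w, t, ht, rfl⟩ := hm
  obtain ⟨h1', w', t', ht', H⟩ := hm'
  by_cases hs : c.1 = c'.1
  · exact (hcc ((ann_eq_iff hs (Ioo_subset_Icc_self ht) (Ioo_subset_Icc_self ht')).1 H.symm).1).elim
  have hh' : h ∈ Ioo (-1 : ℝ) 1 := by
    rw [lev_of_ne hs] at h1'
    rcases lev_cases c.1 with h | h <;> rw [h] at h1 h1' <;> constructor <;> linarith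
  cases hb : c.1
  · have hb' : c'.1 = true := by
      cases hb' : c'.1
      · exact (hs (hb.trans hb'.symm)).elim
      · rfl
    rw [← H]
    exact (compat_handle_aux hb' hb ht' ht hh' H).symm
  · have hb' : c'.1 = false := by
      cases hb' : c'.1
      · rfl
      · exact (hs (hb.trans hb'.symm)).elim
    exact compat_handle_aux hb hb' ht ht' hh' H.symm

/-- The common point lies at a depth strictly between `0` and `1` of a side `a`. There the region is
compatible with the handle of the circle carrying `a`, and this handle with the given one. -/
theorem compat_handle_region {c : G.Circles} {i : Fin G.numColors} {m : G.HandleManifold}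
    (hm : m ∈ handleDomain c) (hm' : m ∈ (regionPlot i).target) :
    Compat (handlePlot c) (regionPlot i) m := by
  have hm₀ := hm
  have hm₀' := hm'
  obtain ⟨x, hx, h, hh, rfl⟩ := mem_regionPlot_target.1 hm'
  obtain ⟨-, w, t, ht, hxt⟩ := (lay_mem_handleDomain_iff (Ioo_subset_Icc_self hh)).1 hm
  have hno : ∀ {a : G.Arc} {u : ℝ}, u ∈ Icc (0 : ℝ) 1 → rmk (c, w, ic t) ≠ rmk (G.trap a u 0) := by
    intro a u hu he
    have := abs_eq_one_of_mk_trap_zero hu he.symm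
    simp only [ic_coe (Ioo_subset_Icc_self ht)] at this
    rcases (abs_eq zero_le_one).1 this with h | h <;> rw [h] at ht <;> simp at ht
  rcases hx with ⟨p, rfl⟩ | ⟨a, rfl, u, hu, r, hr, rfl⟩
  · obtain ⟨a, u, hu, h1, -⟩ := ribbon_eq_region_iff.1 (show ribbon (rmk (c, w, ic t)) = _ from hxt)
    exact (hno hu h1).elim
  have hr0 : r ≠ 0 := by
    rintro rfl
    exact hno hu (ribbon_injective hxt)
  have hr' : r ∈ Ioo (0 : ℝ) 1 := ⟨lt_of_le_of_ne hr.1 (Ne.symm hr0), hr.2⟩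
  have hcont : Continuous fun u : ℝ => lay (slab a u r) h :=
    continuous_lay.comp ((((continuous_slab a).comp
      (by fun_prop : Continuous fun u : ℝ => (u, r)))).prodMk continuous_const)
  have htend : Filter.Tendsto (fun u : ℝ => lay (slab a u r) h) (𝓝[Ioo 0 1] u)
      (𝓝 (lay (slab a u r) h)) := hcont.continuousAt.tendsto.mono_left nhdsWithin_le_nhds
  have hne : (𝓝[Ioo (0 : ℝ) 1] u).NeBot :=
    mem_closure_iff_nhdsWithin_neBot.1 (by rwa [closure_Ioo zero_ne_one])
  -- At the ends of a side `compat_slab` does not apply; they are reached as limits of inner points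
  -- of the same side.
  refine Compat.of_closure (handlePlot_target c ▸ hm₀) hm₀' (htend.frequently ?_)
  refine Filter.Eventually.frequently ?_
  filter_upwards [self_mem_nhdsWithin, htend ((isOpen_handleDomain c).mem_nhds hm₀)] with u' hu' h2
  have h3 := compat_slab a hu' hr' hh
  exact (compat_handle h2 (handlePlot_target (circ a) ▸ h3.1)).trans h3

theorem regionDomain_disjoint {i j : Fin G.numColors} {x : G.Surface} (hi : x ∈ regionDomain i)
    (hj : x ∈ regionDomain j) : i = j := by
  rcases hi with ⟨p, rfl⟩ | ⟨a, rfl, t, ht, r, hr, rfl⟩ <;>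
    rcases hj with ⟨p', h⟩ | ⟨a', rfl, t', ht', r', hr', h⟩
  · exact (region_eq_iff.1 h).1.symm
  · exact ((slab_eq_region_iff ht' (Ico_subset_Icc_self hr')).1 h).2.1.symm
  · exact ((slab_eq_region_iff ht (Ico_subset_Icc_self hr)).1 h.symm).2.1
  · rw [((slab_eq_iff (Ico_subset_Icc_self hr') hr ht' ht).1 h).2.cyc_eq]

/-- Domains of different regions are disjoint, so only the pairs with a handle need an argument. -/
theorem compat_interiorPlots {e e' : OpenPartialHomeomorph (ℂ × ℝ) G.HandleManifold}
    (he : e ∈ G.interiorPlots) (he' : e' ∈ G.interiorPlots) {m : G.HandleManifold}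
    (hm : m ∈ e.target) (hm' : m ∈ e'.target) : Compat e e' m := by
  rcases he with ⟨c, rfl⟩ | ⟨i, rfl⟩ <;> rcases he' with ⟨c', rfl⟩ | ⟨i', rfl⟩
  · rw [handlePlot_target] at hm hm'
    exact compat_handle hm hm'
  · rw [handlePlot_target] at hm
    exact compat_handle_region hm hm'
  · rw [handlePlot_target] at hm'
    exact (compat_handle_region hm' hm).symm
  · obtain ⟨x, hx, h, hh, rfl⟩ := mem_regionPlot_target.1 hm
    obtain ⟨x', hx', h', hh', H⟩ := mem_regionPlot_target.1 hm'
    obtain ⟨rfl, rfl⟩ := (lay_eq_iff (Ioo_subset_Icc_self hh') (Ioo_subset_Icc_self hh)).1 H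
    obtain rfl := regionDomain_disjoint hx hx'
    exact Compat.refl _ hm

/-! ### The boundary of the collar with handles -/

/-- The complement of the open annuli of the family `s`. -/
def outer (G : DecoratedGaussDiagram) (s : Bool) : Set G.Surface :=
  {x | ∀ i w, ∀ t ∈ Ioo (-1 : ℝ) 1, x ≠ ann ⟨s, i⟩ w t}

theorem isClosed_outer (s : Bool) : IsClosed (outer G s) := by
  have : (outer G s)ᶜ = ⋃ i, {x : G.Surface | ∃ w : Circle, ∃ t : Icc (-1 : ℝ) 1,
      (t : ℝ) ∈ Ioo (-1 : ℝ) 1 ∧ G.annulus ⟨s, i⟩ (w, t) = x} := by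
    ext x
    simp only [outer, mem_compl_iff, mem_ofPred_eq, mem_iUnion]
    push Not
    refine exists_congr fun i => exists_congr fun w => ?_
    constructor
    · rintro ⟨t, ht, rfl⟩
      exact ⟨ic t, by rwa [ic_coe (Ioo_subset_Icc_self ht)], rfl⟩
    · rintro ⟨t, ht, rfl⟩
      exact ⟨t, ht, by rw [ann, ic_val]⟩
  rw [← isOpen_compl_iff, this]
  exact isOpen_iUnion fun i => isOpen_annulus _

theorem ann_mem_outer_iff {s : Bool} {i : Fin (G.numCircles s)} {w : Circle} {t : ℝ}
    (ht : t ∈ Icc (-1 : ℝ) 1) : ann ⟨s, i⟩ w t ∈ outer G s ↔ t = -1 ∨ t = 1 := by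
  constructor
  · intro h
    by_contra hn
    push Not at hn
    exact h i w t ⟨lt_of_le_of_ne ht.1 (Ne.symm hn.1), lt_of_le_of_ne ht.2 hn.2⟩ rfl
  · intro h j w' t' ht' he
    obtain ⟨-, -, rfl⟩ := (ann_eq_iff (c := ⟨s, i⟩) (c' := ⟨s, j⟩) rfl ht (Ioo_subset_Icc_self ht')).1 he
    rcases h with rfl | rfl <;> simp at ht'

theorem mem_surgered_iff {s : Bool} {m : G.HandleManifold} : m ∈ G.surgered s ↔
    (∃ x ∈ outer G s, lay x (lev s) = m) ∨
      ∃ (i : Fin (G.numCircles s)) (d : closedBall (0 : ℂ) 1) (t : ℝ), (t = -1 ∨ t = 1) ∧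
        hnd ⟨s, i⟩ d t = m := by
  have hl : ic (lev s) = level s := by rw [← level_coe, ic_val]
  refine or_congr ?_ ?_
  · simp only [lay, hl]
    refine exists_congr fun x => and_congr_left fun _ => ?_
    refine forall_congr' fun i => forall_congr' fun w => ?_
    constructor
    · intro h t ht
      exact h (ic t) (by rwa [ic_coe (Ioo_subset_Icc_self ht)])
    · intro h t ht
      have := h t ht
      rwa [ann, ic_val] at this
  · simp only [mem_ofPred_eq]
    refine exists_congr fun i => exists_congr fun d => ?_
    constructor
    · rintro ⟨t, ht, rfl⟩
      exact ⟨t, ht, by rw [hnd, ic_val]⟩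
    · rintro ⟨t, ht, rfl⟩
      exact ⟨ic t, by rwa [ic_coe (by rcases ht with rfl | rfl <;> simp)], rfl⟩

theorem lev_mem (s : Bool) : lev s ∈ Icc (-1 : ℝ) 1 := by
  rcases lev_cases s with h | h <;> rw [h] <;> simp

theorem lay_mem_surgered_iff {s : Bool} {x : G.Surface} {h : ℝ} (hh : h ∈ Icc (-1 : ℝ) 1) :
    lay x h ∈ G.surgered s ↔ h = lev s ∧ x ∈ outer G s := by
  rw [mem_surgered_iff]
  constructor
  · rintro (⟨x', hx', H⟩ | ⟨i, d, t, ht, H⟩)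
    · obtain ⟨rfl, rfl⟩ := (lay_eq_iff (lev_mem s) hh).1 H
      exact ⟨rfl, hx'⟩
    · have ht' : t ∈ Icc (-1 : ℝ) 1 := by rcases ht with rfl | rfl <;> simp
      obtain ⟨rfl, w, -, rfl⟩ := (lay_eq_hnd_iff hh ht').1 H.symm
      exact ⟨rfl, (ann_mem_outer_iff ht').2 ht⟩
  · rintro ⟨rfl, hx⟩
    exact Or.inl ⟨x, hx, rfl⟩

theorem hnd_mem_surgered_iff {s : Bool} {c : G.Circles} {d : closedBall (0 : ℂ) 1} {t : ℝ}
    (ht : t ∈ Icc (-1 : ℝ) 1) : hnd c d t ∈ G.surgered s ↔ c.1 = s ∧ (t = -1 ∨ t = 1) := by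
  rw [mem_surgered_iff]
  constructor
  · rintro (⟨x', hx', H⟩ | ⟨i, d', t', ht', H⟩)
    · obtain ⟨h1, w, -, rfl⟩ := (lay_eq_hnd_iff (lev_mem s) ht).1 H
      have h2 : c.1 = s := by
        by_contra h
        rw [lev_of_ne h] at h1
        rcases lev_cases c.1 with h | h <;> rw [h] at h1 <;> linarith
      subst h2
      exact ⟨rfl, (ann_mem_outer_iff ht).1 hx'⟩
    · have ht'' : t' ∈ Icc (-1 : ℝ) 1 := by rcases ht' with rfl | rfl <;> simp
      obtain ⟨rfl, -, rfl⟩ := (hnd_eq_iff ht'' ht).1 H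
      exact ⟨rfl, ht'⟩
  · obtain ⟨s', i⟩ := c
    rintro ⟨rfl, h⟩
    exact Or.inr ⟨i, d, t, h, rfl⟩

theorem center_mem_annulus (a : G.Arc) (t : ℝ) :
    ∃ w, slab (G := G) a t 1 = ann (circ a) w 0 := by
  obtain ⟨u₀, δ, X, -, -, -, hs⟩ := slab_eq_ann (G := G) a
  refine ⟨G.pos (circ a) (u₀ + δ * X t 1), ?_⟩
  rw [hs t 1 (by simp), sub_self, mul_zero, neg_zero]

/-- The interior plots cover the complement of the boundary. -/
theorem exists_interiorPlot_iff {m : G.HandleManifold} :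
    (∃ e ∈ G.interiorPlots, m ∈ e.target) ↔ ∀ s, m ∉ G.surgered s := by
  constructor
  · rintro ⟨e, ⟨c, rfl⟩ | ⟨i, rfl⟩, hm⟩ s hms
    · rw [handlePlot_target] at hm
      rcases exists_lay_or_hnd m with ⟨x, h, hh, rfl⟩ | ⟨c', d, t, ht, rfl⟩
      · obtain ⟨h1, w, t, ht, rfl⟩ := (lay_mem_handleDomain_iff hh).1 hm
        obtain ⟨rfl, h2⟩ := (lay_mem_surgered_iff hh).1 hms
        by_cases hs : c.1 = s
        · subst hs
          exact h2 c.2 w t ht rfl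
        · rw [lev_of_ne hs, mul_neg, lev_mul_self] at h1
          exact lt_irrefl _ h1
      · obtain ⟨-, h1⟩ := (hnd_mem_handleDomain_iff ht).1 hm
        obtain ⟨-, rfl | rfl⟩ := (hnd_mem_surgered_iff ht).1 hms <;> simp at h1
    · obtain ⟨x, hx, h, hh, rfl⟩ := mem_regionPlot_target.1 hm
      obtain ⟨rfl, -⟩ := (lay_mem_surgered_iff (Ioo_subset_Icc_self hh)).1 hms
      rcases lev_cases s with h | h <;> rw [h] at hh <;> simp at hh
  · intro hm
    have key : ∀ c : G.Circles, m ∈ handleDomain c → ∃ e ∈ G.interiorPlots, m ∈ e.target :=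
      fun c hc => ⟨_, Or.inl ⟨c, rfl⟩, handlePlot_target c ▸ hc⟩
    rcases exists_lay_or_hnd m with ⟨x, h, hh, rfl⟩ | ⟨c, d, t, ht, rfl⟩
    · by_cases hi : h ∈ Ioo (-1 : ℝ) 1
      · by_cases hx : ∃ i, x ∈ regionDomain i
        · obtain ⟨i, hi'⟩ := hx
          exact ⟨_, Or.inr ⟨i, rfl⟩, mem_regionPlot_target.2 ⟨x, hi', h, hi, rfl⟩⟩
        rcases exists_slab_or_region x with ⟨a, t, ht, r, hr, rfl⟩ | ⟨i, p, rfl⟩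
        · rcases hr.2.lt_or_eq with h1 | rfl
          · exact (hx ⟨_, Or.inr ⟨a, rfl, t, ht, r, ⟨hr.1, h1⟩, rfl⟩⟩).elim
          -- Only depth `1` escapes the regions. Such a point is on the core of an annulus and hence
          -- below a handle.
          · obtain ⟨w, hw⟩ := center_mem_annulus (G := G) a t
            refine key (circ a) ((lay_mem_handleDomain_iff hh).2 ⟨?_, w, 0, by simp, hw.symm⟩)
            exact (lev_mul_mem_Ioo.2 hi).1
        · exact (hx ⟨i, Or.inl ⟨p, rfl⟩⟩).elim
      · obtain ⟨s, rfl⟩ : ∃ s, h = lev s := by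
          by_cases h1 : h = 1
          · exact ⟨true, h1⟩
          · refine ⟨false, ?_⟩
            by_contra h2
            exact hi ⟨lt_of_le_of_ne hh.1 (Ne.symm h2), lt_of_le_of_ne hh.2 h1⟩
        have h1 : x ∉ outer G s := fun h => hm s ((lay_mem_surgered_iff hh).2 ⟨rfl, h⟩)
        simp only [outer, mem_ofPred_eq] at h1
        push Not at h1
        obtain ⟨i, w, t, ht, rfl⟩ := h1
        exact key ⟨s, i⟩ ((lay_mem_handleDomain_iff hh).2
          ⟨by rw [lev_mul_self]; norm_num, w, t, ht, rfl⟩)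
    · refine key c ((hnd_mem_handleDomain_iff ht).2 ⟨rfl, ?_⟩)
      have : ¬ (t = -1 ∨ t = 1) := fun h => hm c.1 ((hnd_mem_surgered_iff ht).2 ⟨rfl, h⟩)
      push Not at this
      exact ⟨lt_of_le_of_ne ht.1 (Ne.symm this.1), lt_of_le_of_ne ht.2 this.2⟩

end DecoratedGaussDiagram

/-! ### Collars of the boundary -/

/-- The collar must turn the corner where the end of a handle meets the surface. With depth `ρ` and
radius `β` on the end of the handle, the new radius is `(1 + ρ) * β` and the distance from that end
is `ρ * (1 - β)`; eliminating shows that these determine `ρ` and `β`. -/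
theorem corner_inj {ρ ρ' β β' : ℝ} (hρ : 0 ≤ ρ) (hρ' : 0 ≤ ρ') (hβ : β ≤ 1) (hβ' : β' ≤ 1)
    (h1 : (1 + ρ) * β = (1 + ρ') * β') (h2 : ρ * (1 - β) = ρ' * (1 - β')) : ρ = ρ' ∧ β = β' := by
  have key : ∀ {ρ ρ' β β' : ℝ}, 0 ≤ ρ → β ≤ 1 → (1 + ρ) * β = (1 + ρ') * β' →
      ρ * (1 - β) = ρ' * (1 - β') → ¬ ρ < ρ' := by
    intro ρ ρ' β β' hρ hβ h1 h2 h
    have h3 : (ρ' - ρ) * (1 + ρ') = (ρ' - ρ) * β := by linear_combination (-(1 + ρ')) * h2 - ρ' * h1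
    have := mul_left_cancel₀ (sub_ne_zero.2 h.ne') h3
    linarith
  have h : ρ = ρ' := le_antisymm (not_lt.1 (key hρ' hβ' h1.symm h2.symm)) (not_lt.1 (key hρ hβ h1 h2))
  subst h
  exact ⟨rfl, mul_left_cancel₀ (by linarith : 1 + ρ ≠ 0) h1⟩

theorem corner_lt {ρ β : ℝ} (hρ : ρ < 1 / 2) (hβ : β ≤ 1) :
    2 * (ρ * (1 - β)) + 2 * ((1 + ρ) * β) / 3 < 1 := by
  nlinarith

/-- Together with `corner_lt` this describes the image of the corner coordinates by a strict linear
inequality, from which openness of the collar is visible. -/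
theorem exists_corner {b τ : ℝ} (hb : 0 ≤ b) (hτ : 0 ≤ τ) (h : 2 * τ + 2 * b / 3 < 1) :
    ∃ ρ ∈ Ico (0 : ℝ) (1 / 2), ∃ β ∈ Icc (0 : ℝ) 1, (1 + ρ) * β = b ∧ ρ * (1 - β) = τ := by
  -- For `τ = 0` the quadratic below also has the root `0`, which would give `β = b`. For `b > 1`
  -- the right root is `b - 1`.
  by_cases h0 : τ = 0 ∧ 1 ≤ b
  · obtain ⟨rfl, h1⟩ := h0
    exact ⟨b - 1, ⟨by linarith, by linarith⟩, 1, by simp, by ring, by ring⟩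
  -- Eliminating `β` from the two equations gives this quadratic in `ρ`. It is not positive at `0`,
  -- and positive at `1 / 2` exactly by the inequality assumed in `h`.
  have hc : ContinuousOn (fun ρ : ℝ => ρ ^ 2 + ρ * (1 - τ - b) - τ) (Icc 0 (1 / 2)) := by fun_prop
  obtain ⟨ρ, hρ, hρ0⟩ := intermediate_value_Icc (by norm_num : (0 : ℝ) ≤ 1 / 2) hc
    (show (0 : ℝ) ∈ Icc _ _ by constructor <;> nlinarith)
  simp only at hρ0
  have hρ1 : ρ ≠ 1 / 2 := by rintro rfl; nlinarith
  have h1 : 0 < 1 + ρ := by linarith [hρ.1]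
  refine ⟨ρ, ⟨hρ.1, lt_of_le_of_ne hρ.2 hρ1⟩, b / (1 + ρ), ⟨by positivity, ?_⟩, by field_simp, ?_⟩
  · rw [div_le_one h1]
    rcases hρ.1.lt_or_eq with h2 | h2
    · have : 0 ≤ ρ * (1 + ρ - b) := by nlinarith
      have := nonneg_of_mul_nonneg_right this h2
      linarith
    · rw [← h2] at hρ0
      have h3 : τ = 0 := by linarith
      have : ¬ 1 ≤ b := fun h4 => h0 ⟨h3, h4⟩
      rw [← h2]; linarith
  · field_simp
    linear_combination hρ0

namespace DecoratedGaussDiagram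

open GaussDiagram

variable {G : DecoratedGaussDiagram}

theorem dir_eq_of_norm_one {z : ℂ} (h : ‖z‖ = 1) : (dir z : ℂ) = z := by
  have := norm_mul_dir z
  rwa [h, Complex.ofReal_one, one_mul] at this

theorem lay_eq_extHnd {x : G.Surface} {h : ℝ} (hh : h ∈ Icc (-1 : ℝ) 1) {c : G.Circles} {ζ : ℂ}
    (hζ : ‖ζ‖ ≤ 3) {t : ℝ} (ht : t ∈ Icc (-1 : ℝ) 1) (H : lay x h = extHnd c ζ t) :
    ‖ζ‖ = 2 - lev c.1 * h ∧ x = ann c (dir ζ) t := by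
  rcases le_or_gt ‖ζ‖ 1 with h1 | h1
  · rw [extHnd_of_le h1, lay_eq_hnd_iff hh ht] at H
    obtain ⟨rfl, w, hw, rfl⟩ := H
    rw [retr_coe h1] at hw
    subst hw
    rw [Circle.norm_coe, lev_mul_self]
    refine ⟨by norm_num, ?_⟩
    congr 1
    exact (Circle.coe_inj.1 (dir_eq_of_norm_one (Circle.norm_coe w))).symm
  · rw [extHnd_of_ge h1.le ht, lay_eq_iff hh (lev_mul_mem.2 ⟨by linarith, by linarith⟩)] at H
    obtain ⟨rfl, rfl⟩ := H
    refine ⟨?_, rfl⟩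
    rw [← mul_assoc, lev_mul_self]; ring

theorem hnd_eq_extHnd_self (c : G.Circles) (d : closedBall (0 : ℂ) 1) (t : ℝ) :
    hnd c d t = extHnd c d t := by
  have hd : ‖(d : ℂ)‖ ≤ 1 := mem_closedBall_zero_iff.1 d.2
  rw [extHnd_of_le hd, show retr d = d from Subtype.ext (retr_coe hd)]

theorem hnd_eq_extHnd {c c' : G.Circles} {d : closedBall (0 : ℂ) 1} {t t' : ℝ} {ζ : ℂ}
    (hζ : ‖ζ‖ < 3) (ht : t ∈ Icc (-1 : ℝ) 1) (ht' : t' ∈ Icc (-1 : ℝ) 1)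
    (H : hnd c' d t = extHnd c ζ t') : c' = c ∧ (d : ℂ) = ζ ∧ t = t' := by
  by_cases hs : c.1 = c'.1
  · have hd : ‖(d : ℂ)‖ ≤ 1 := mem_closedBall_zero_iff.1 d.2
    rw [hnd_eq_extHnd_self] at H
    exact extHnd_inj hs.symm (by linarith) hζ.le ht ht' H
  · rcases le_or_gt ‖ζ‖ 1 with h1 | h1
    · rw [extHnd_of_le h1, hnd_eq_iff ht ht'] at H
      exact (hs (congrArg _ H.1.symm)).elim
    · rw [extHnd_of_ge h1.le ht', eq_comm,
        lay_eq_hnd_iff (lev_mul_mem.2 ⟨by linarith, by linarith⟩) ht, lev_of_ne hs] at H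
      have := H.1
      rcases lev_cases c.1 with h | h <;> rw [h] at this <;> linarith

/-- The coordinates of the collar of the ends of the handles. -/
def discCollar (c : G.Circles) (σ : Bool) (d : ℂ) (ρ : ℝ) : G.HandleManifold :=
  extHnd c (((1 + ρ : ℝ) : ℂ) * d) (lev σ * (1 - ρ * (1 - ‖d‖)))

theorem norm_discCollar {ρ : ℝ} (hρ : 0 ≤ ρ) (d : ℂ) : ‖((1 + ρ : ℝ) : ℂ) * d‖ = (1 + ρ) * ‖d‖ := by
  rw [norm_mul, Complex.norm_real, Real.norm_of_nonneg (by linarith)]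

theorem discCollar_bounds {ρ b : ℝ} (hρ : ρ ∈ Icc (0 : ℝ) (1 / 2)) (hb0 : 0 ≤ b) (hb : b ≤ 1) :
    (1 + ρ) * b < 3 ∧ 1 - ρ * (1 - b) ∈ Icc (1 / 2 : ℝ) 1 := by
  refine ⟨by nlinarith [hρ.1, hρ.2], ?_, ?_⟩ <;> nlinarith [hρ.1, hρ.2]

theorem lev_mul_mem_of_half {σ : Bool} {u : ℝ} (hu : u ∈ Icc (1 / 2 : ℝ) 1) :
    lev σ * u ∈ Icc (-1 : ℝ) 1 := lev_mul_mem.2 ⟨by linarith [hu.1], hu.2⟩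

theorem abs_lev_mul {σ : Bool} {u : ℝ} (hu : 0 ≤ u) : |lev σ * u| = u := by
  rcases lev_cases σ with h | h <;> rw [h] <;> simp [abs_of_nonneg hu]

theorem lev_mul_inj {σ σ' : Bool} {u u' : ℝ} (hu : 0 < u) (hu' : 0 < u')
    (h : lev σ * u = lev σ' * u') : σ = σ' ∧ u = u' := by
  have h1 := congrArg abs h
  rw [abs_lev_mul hu.le, abs_lev_mul hu'.le] at h1
  subst h1
  refine ⟨?_, rfl⟩
  by_contra hs
  rw [lev_of_ne hs] at h
  rcases lev_cases σ with h' | h' <;> rw [h'] at h <;> linarith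

theorem outer_ann {s : Bool} {c : G.Circles} (hc : c.1 = s) {w : Circle} {t : ℝ}
    (ht : t ∈ Icc (-1 : ℝ) 1) (h : ann c w t ∈ outer G s) : |t| = 1 := by
  obtain ⟨s', i⟩ := c
  subst hc
  rcases (ann_mem_outer_iff ht).1 h with rfl | rfl <;> simp

/-- The collar of the surgered surface, with coordinates on its pieces. -/
def collarMap (s : Bool) : (outer G s × Icc (0 : ℝ) 1) ⊕
    (Fin (G.numCircles s) × closedBall (0 : ℂ) 1 × Bool × Icc (0 : ℝ) 1) → G.HandleManifold :=
  Sum.elim (fun k => lay k.1.1 (lev s * (1 - (k.2 : ℝ) / 2)))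
    fun k => discCollar ⟨s, k.1⟩ k.2.2.1 k.2.1 ((k.2.2.2 : ℝ) / 2)

/-- The pieces of the surgered surface. -/
def surgeredMap (s : Bool) : (outer G s × Icc (0 : ℝ) 1) ⊕
    (Fin (G.numCircles s) × closedBall (0 : ℂ) 1 × Bool × Icc (0 : ℝ) 1) →
      G.surgered s × Icc (0 : ℝ) 1 :=
  Sum.elim (fun k => (⟨lay k.1.1 (lev s), (lay_mem_surgered_iff (lev_mem s)).2 ⟨rfl, k.1.2⟩⟩, k.2))
    fun k => (⟨hnd ⟨s, k.1⟩ k.2.1 (lev k.2.2.1), (hnd_mem_surgered_iff (lev_mem _)).2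
      ⟨rfl, (lev_cases _).symm⟩⟩, k.2.2.2)

theorem half_mem (r : Icc (0 : ℝ) 1) : (r : ℝ) / 2 ∈ Icc (0 : ℝ) (1 / 2) :=
  ⟨by linarith [r.2.1], by linarith [r.2.2]⟩

theorem continuous_collarMap (s : Bool) : Continuous (collarMap (G := G) s) := by
  refine Continuous.sumElim ?_ ?_
  · exact continuous_lay.comp (f := fun k : outer G s × Icc (0 : ℝ) 1 =>
      ((k.1 : G.Surface), lev s * (1 - (k.2 : ℝ) / 2))) (by fun_prop)
  · rw [continuous_prod_of_discrete_left]
    intro i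
    have : Continuous fun k : closedBall (0 : ℂ) 1 × Bool × Icc (0 : ℝ) 1 => lev k.2.1 :=
      (continuous_of_discreteTopology (f := lev)).comp (by fun_prop : Continuous
        fun k : closedBall (0 : ℂ) 1 × Bool × Icc (0 : ℝ) 1 => k.2.1)
    refine (continuousOn_extHnd ⟨s, i⟩).comp_continuous
      (f := fun k : closedBall (0 : ℂ) 1 × Bool × Icc (0 : ℝ) 1 =>
        (((1 + (k.2.2 : ℝ) / 2 : ℝ) : ℂ) * (k.1 : ℂ),
          lev k.2.1 * (1 - (k.2.2 : ℝ) / 2 * (1 - ‖(k.1 : ℂ)‖)))) (by fun_prop) fun k => ?_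
    exact lev_mul_mem_of_half (discCollar_bounds (half_mem _) (norm_nonneg _)
      (mem_closedBall_zero_iff.1 k.1.2)).2

theorem continuous_surgeredMap (s : Bool) : Continuous (surgeredMap (G := G) s) := by
  refine Continuous.sumElim ?_ ?_
  · exact (Continuous.subtype_mk (continuous_lay.comp (f := fun k : outer G s × Icc (0 : ℝ) 1 =>
      ((k.1 : G.Surface), lev s)) (by fun_prop)) _).prodMk (by fun_prop)
  · rw [continuous_prod_of_discrete_left]
    intro i
    have : Continuous fun k : closedBall (0 : ℂ) 1 × Bool × Icc (0 : ℝ) 1 => lev k.2.1 :=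
      (continuous_of_discreteTopology (f := lev)).comp (by fun_prop : Continuous
        fun k : closedBall (0 : ℂ) 1 × Bool × Icc (0 : ℝ) 1 => k.2.1)
    exact (Continuous.subtype_mk ((continuous_hnd ⟨s, i⟩).comp
      (f := fun k : closedBall (0 : ℂ) 1 × Bool × Icc (0 : ℝ) 1 => (k.1, lev k.2.1))
        (by fun_prop)) _).prodMk (by fun_prop)

theorem surgeredMap_surjective (s : Bool) : Function.Surjective (surgeredMap (G := G) s) := by
  rintro ⟨⟨m, hm⟩, r⟩
  rcases mem_surgered_iff.1 hm with ⟨x, hx, rfl⟩ | ⟨i, d, t, ht, rfl⟩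
  · exact ⟨.inl (⟨x, hx⟩, r), rfl⟩
  · rcases ht with rfl | rfl
    · exact ⟨.inr (i, d, false, r), rfl⟩
    · exact ⟨.inr (i, d, true, r), rfl⟩

/-- Collar and surface make the same identifications. A point of the surface part meets a point of a
handle part only when the disc coordinate has norm `1` and the depths agree, which is `corner_inj`
applied with radius `1`. -/
theorem collarMap_eq_iff (s : Bool) (x y) :
    surgeredMap (G := G) s x = surgeredMap s y ↔ collarMap s x = collarMap s y := by
  have hm : ∀ r : Icc (0 : ℝ) 1, lev s * (1 - (r : ℝ) / 2) ∈ Icc (-1 : ℝ) 1 := fun r =>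
    lev_mul_mem.2 ⟨by linarith [r.2.2], by linarith [r.2.1]⟩
  have hls : lev s ≠ 0 := by rcases lev_cases s with h | h <;> rw [h] <;> norm_num
  have mixed : ∀ (x : outer G s) (r r' : Icc (0 : ℝ) 1) (i : Fin (G.numCircles s))
      (d : closedBall (0 : ℂ) 1) (σ : Bool),
      (lay x.1 (lev s) = hnd ⟨s, i⟩ d (lev σ) ∧ r = r') ↔
        lay x.1 (lev s * (1 - (r : ℝ) / 2)) = discCollar ⟨s, i⟩ σ d ((r' : ℝ) / 2) := by
    intro x r r' i d σ
    have hd : ‖(d : ℂ)‖ ≤ 1 := mem_closedBall_zero_iff.1 d.2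
    obtain ⟨hb1, hb2⟩ := discCollar_bounds (half_mem r') (norm_nonneg (d : ℂ)) hd
    constructor
    · rintro ⟨h, rfl⟩
      obtain ⟨-, w, hw, hx⟩ := (lay_eq_hnd_iff (lev_mem s) (lev_mem σ)).1 h
      have h1 : ‖(d : ℂ)‖ = 1 := by rw [hw, Circle.norm_coe]
      rw [discCollar, h1, hw, sub_self, mul_zero, sub_zero, mul_one,
        extHnd_mul (by linarith [r.2.1]) w (lev_mem σ), hx]
      congr 2
      ring
    · intro h
      obtain ⟨h1, h2⟩ := lay_eq_extHnd (hm r) (by rw [norm_discCollar (half_mem r').1]; exact hb1.le)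
        (lev_mul_mem_of_half hb2) h
      rw [norm_discCollar (half_mem r').1, ← mul_assoc, lev_mul_self, one_mul] at h1
      have h3 := outer_ann (c := ⟨s, i⟩) rfl (lev_mul_mem_of_half hb2) (h2 ▸ x.2)
      rw [abs_lev_mul (by linarith [hb2.1])] at h3
      have h4 : (r' : ℝ) / 2 = (r : ℝ) / 2 ∧ ‖(d : ℂ)‖ = 1 :=
        corner_inj (half_mem r').1 (half_mem r).1 hd le_rfl (by linarith) (by linarith)
      have h5 : r = r' := Subtype.ext (by linarith [h4.1])
      refine ⟨(lay_eq_hnd_iff (lev_mem s) (lev_mem σ)).2 ⟨rfl, dir d, ?_, ?_⟩, h5⟩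
      · exact (dir_eq_of_norm_one h4.2).symm
      · have h6 : dir (((1 + (r' : ℝ) / 2 : ℝ) : ℂ) * (d : ℂ)) = dir (d : ℂ) := by
          conv_lhs => rw [← dir_eq_of_norm_one h4.2]
          exact dir_mul (by linarith [(half_mem r').1]) _
        rw [h2, h6, h3, mul_one]
  rcases x with ⟨x, r⟩ | ⟨i, d, σ, r⟩ <;> rcases y with ⟨x', r'⟩ | ⟨i', d', σ', r'⟩
  · simp only [surgeredMap, collarMap, Sum.elim_inl, Prod.mk.injEq, Subtype.mk.injEq]
    rw [lay_eq_iff (lev_mem s) (lev_mem s), lay_eq_iff (hm r) (hm r'), and_iff_left rfl]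
    refine and_congr_right fun _ => ?_
    rw [mul_right_inj' hls, Subtype.ext_iff]
    constructor <;> intro h <;> linarith
  · simp only [surgeredMap, collarMap, Sum.elim_inl, Sum.elim_inr, Prod.mk.injEq, Subtype.mk.injEq]
    exact mixed x r r' i' d' σ'
  · simp only [surgeredMap, collarMap, Sum.elim_inl, Sum.elim_inr, Prod.mk.injEq, Subtype.mk.injEq]
    exact (and_congr eq_comm eq_comm).trans ((mixed x' r' r i d σ).trans eq_comm)
  · simp only [surgeredMap, collarMap, Sum.elim_inr, Prod.mk.injEq, Subtype.mk.injEq]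
    have hd : ‖(d : ℂ)‖ ≤ 1 := mem_closedBall_zero_iff.1 d.2
    have hd' : ‖(d' : ℂ)‖ ≤ 1 := mem_closedBall_zero_iff.1 d'.2
    obtain ⟨hb1, hb2⟩ := discCollar_bounds (half_mem r) (norm_nonneg (d : ℂ)) hd
    obtain ⟨hb1', hb2'⟩ := discCollar_bounds (half_mem r') (norm_nonneg (d' : ℂ)) hd'
    rw [hnd_eq_iff (lev_mem σ) (lev_mem σ')]
    constructor
    · rintro ⟨⟨h1, rfl, h2⟩, rfl⟩
      obtain ⟨rfl, -⟩ := lev_mul_inj one_pos one_pos (by rwa [mul_one, mul_one] : lev σ * 1 = lev σ' * 1)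
      rw [h1]
    · intro h
      obtain ⟨h1, h2, h3⟩ := extHnd_inj (c := ⟨s, i⟩) (c' := ⟨s, i'⟩) rfl
        (by rw [norm_discCollar (half_mem r).1]; exact hb1.le)
        (by rw [norm_discCollar (half_mem r').1]; exact hb1'.le) (lev_mul_mem_of_half hb2)
        (lev_mul_mem_of_half hb2') h
      obtain ⟨rfl, h4⟩ := lev_mul_inj (by linarith [hb2.1]) (by linarith [hb2'.1]) h3
      have h5 := congrArg norm h2
      rw [norm_discCollar (half_mem r).1, norm_discCollar (half_mem r').1] at h5
      obtain ⟨h6, -⟩ := corner_inj (half_mem r).1 (half_mem r').1 hd hd' h5 (by linarith)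
      have h7 : r = r' := Subtype.ext (by linarith)
      subst h7
      have h8 : ((1 + (r : ℝ) / 2 : ℝ) : ℂ) ≠ 0 := by
        rw [Complex.ofReal_ne_zero]; linarith [(half_mem r).1]
      exact ⟨⟨h1, Subtype.ext (mul_left_cancel₀ h8 h2), rfl⟩, rfl⟩

/-- The open collar of the surgered surface. -/
def collarDomain (G : DecoratedGaussDiagram) (s : Bool) : Set G.HandleManifold :=
  {m | ∃ k, (surgeredMap (G := G) s k).2 < 1 ∧ collarMap s k = m}

/-- Strict inequalities for the open collar inside the old collar; the second one only matters below
the annuli of the family, where the corner is turned. -/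
theorem lay_mem_collarDomain_iff {s : Bool} {x : G.Surface} {h : ℝ} (hh : h ∈ Icc (-1 : ℝ) 1) :
    lay x h ∈ collarDomain G s ↔ 1 / 2 < lev s * h ∧ ∀ i w, ∀ t ∈ Icc (-1 : ℝ) 1,
      x = ann ⟨s, i⟩ w t → 2 * (1 - |t|) + 2 * (2 - lev s * h) / 3 < 1 := by
  constructor
  · rintro ⟨⟨x', r⟩ | ⟨i, d, σ, r⟩, hr, H⟩
    · simp only [surgeredMap, collarMap, Sum.elim_inl] at hr H
      have hr' : (r : ℝ) < 1 := hr
      obtain ⟨rfl, rfl⟩ := (lay_eq_iff (lev_mul_mem.2 ⟨by linarith [r.2.2], by linarith [r.2.1]⟩) hh).1 H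
      rw [← mul_assoc, lev_mul_self, one_mul]
      refine ⟨by linarith, fun i w t ht hx => ?_⟩
      have := outer_ann (c := ⟨s, i⟩) rfl ht (hx ▸ x'.2)
      rw [this]
      linarith
    · simp only [surgeredMap, collarMap, Sum.elim_inr] at hr H
      have hr' : (r : ℝ) < 1 := hr
      have hd : ‖(d : ℂ)‖ ≤ 1 := mem_closedBall_zero_iff.1 d.2
      obtain ⟨hb1, hb2⟩ := discCollar_bounds (half_mem r) (norm_nonneg (d : ℂ)) hd
      obtain ⟨h1, h2⟩ := lay_eq_extHnd hh (by rw [norm_discCollar (half_mem r).1]; exact hb1.le)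
        (lev_mul_mem_of_half hb2) H.symm
      rw [norm_discCollar (half_mem r).1] at h1
      have h3 := corner_lt (by linarith : (r : ℝ) / 2 < 1 / 2) hd
      have h4 := (half_mem r).1
      refine ⟨?_, fun j w t ht hx => ?_⟩
      · have : (1 + (r : ℝ) / 2) * ‖(d : ℂ)‖ < 3 / 2 := by nlinarith
        change _ = 2 - lev s * h at h1
        linarith
      · obtain ⟨-, -, rfl⟩ := (ann_eq_iff (c := ⟨s, i⟩) (c' := ⟨s, j⟩) rfl
          (lev_mul_mem_of_half hb2) ht).1 (h2.symm.trans hx)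
        rw [abs_lev_mul (by linarith [hb2.1])]
        change _ = 2 - lev s * h at h1
        rw [← h1]
        linarith
  · rintro ⟨h1, h2⟩
    have hl := (lev_mul_mem (s := s)).2 hh
    by_cases hx : x ∈ outer G s
    · refine ⟨.inl (⟨x, hx⟩, ⟨2 * (1 - lev s * h), by linarith [hl.2], by linarith⟩), ?_, ?_⟩
      · exact (by linarith : 2 * (1 - lev s * h) < 1)
      · simp only [collarMap, Sum.elim_inl]
        rw [show lev s * (1 - 2 * (1 - lev s * h) / 2) = lev s * lev s * h by ring, lev_mul_self,
          one_mul]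
    · simp only [outer, mem_ofPred_eq] at hx
      push Not at hx
      obtain ⟨i, w, t, ht, rfl⟩ := hx
      have ht' := Ioo_subset_Icc_self ht
      obtain ⟨ρ, hρ, β, hβ, hb, hτ⟩ := exists_corner (b := 2 - lev s * h) (τ := 1 - |t|)
        (by linarith [hl.2]) (by linarith [abs_le.2 ht']) (h2 i w t ht' rfl)
      obtain ⟨σ, hσ⟩ : ∃ σ, t = lev σ * |t| := by
        rcases le_total 0 t with h | h
        · exact ⟨true, by simp [lev, abs_of_nonneg h]⟩
        · exact ⟨false, by simp [lev, abs_of_nonpos h]⟩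
      have hn : ‖(β : ℂ) * w‖ = β := norm_mul_circle hβ.1 w
      refine ⟨.inr (i, ⟨β * w, by rw [mem_closedBall_zero_iff, hn]; exact hβ.2⟩, σ,
        ⟨2 * ρ, by linarith [hρ.1], by linarith [hρ.2]⟩), ?_, ?_⟩
      · exact (by linarith [hρ.2] : 2 * ρ < 1)
      · simp only [collarMap, Sum.elim_inr, discCollar, hn]
        rw [mul_div_cancel_left₀ _ two_ne_zero, hτ, ← mul_assoc, ← Complex.ofReal_mul, hb, sub_sub_cancel,
          ← hσ, extHnd_mul (by linarith [hl.2]) w ht', sub_sub_cancel, ← mul_assoc, lev_mul_self,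
          one_mul]

theorem hnd_mem_collarDomain_iff {s : Bool} {c : G.Circles} {d : closedBall (0 : ℂ) 1} {t : ℝ}
    (ht : t ∈ Icc (-1 : ℝ) 1) : hnd c d t ∈ collarDomain G s ↔
      c.1 = s ∧ 2 * (1 - |t|) + 2 * ‖(d : ℂ)‖ / 3 < 1 := by
  constructor
  · rintro ⟨⟨x', r⟩ | ⟨i, d', σ, r⟩, hr, H⟩
    · simp only [surgeredMap, collarMap, Sum.elim_inl] at hr H
      have hr' : (r : ℝ) < 1 := hr
      obtain ⟨h1, w, hw, h2⟩ := (lay_eq_hnd_iff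
        (lev_mul_mem.2 ⟨by linarith [r.2.2], by linarith [r.2.1]⟩) ht).1 H
      obtain ⟨h3, -⟩ := lev_mul_inj (by linarith) one_pos (h1.trans (mul_one _).symm)
      have := outer_ann h3.symm ht (h2 ▸ x'.2)
      refine ⟨h3.symm, ?_⟩
      rw [this, hw, Circle.norm_coe]; norm_num
    · simp only [surgeredMap, collarMap, Sum.elim_inr] at hr H
      have hr' : (r : ℝ) < 1 := hr
      have hd : ‖(d' : ℂ)‖ ≤ 1 := mem_closedBall_zero_iff.1 d'.2
      obtain ⟨hb1, hb2⟩ := discCollar_bounds (half_mem r) (norm_nonneg (d' : ℂ)) hd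
      obtain ⟨rfl, h1, rfl⟩ := hnd_eq_extHnd (by rw [norm_discCollar (half_mem r).1]; exact hb1)
        ht (lev_mul_mem_of_half hb2) H.symm
      refine ⟨rfl, ?_⟩
      rw [h1, norm_discCollar (half_mem r).1, abs_lev_mul (by linarith [hb2.1])]
      have h3 := corner_lt (by linarith : (r : ℝ) / 2 < 1 / 2) hd
      linarith
  · obtain ⟨s', i⟩ := c
    rintro ⟨rfl, h2⟩
    obtain ⟨ρ, hρ, β, hβ, hb, hτ⟩ := exists_corner (norm_nonneg (d : ℂ))
      (by linarith [abs_le.2 ht] : 0 ≤ 1 - |t|) h2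
    obtain ⟨σ, hσ⟩ : ∃ σ, t = lev σ * |t| := by
      rcases le_total 0 t with h | h
      · exact ⟨true, by simp [lev, abs_of_nonneg h]⟩
      · exact ⟨false, by simp [lev, abs_of_nonpos h]⟩
    have h0 : 0 < 1 + ρ := by linarith [hρ.1]
    have hn : ‖((1 + ρ : ℝ)⁻¹ : ℂ) * (d : ℂ)‖ = β := by
      rw [norm_mul, norm_inv, Complex.norm_real, Real.norm_of_nonneg h0.le, ← hb]
      field_simp
    refine ⟨.inr (i, ⟨((1 + ρ : ℝ)⁻¹ : ℂ) * (d : ℂ), by rw [mem_closedBall_zero_iff, hn]; exact hβ.2⟩, σ,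
      ⟨2 * ρ, by linarith [hρ.1], by linarith [hρ.2]⟩), ?_, ?_⟩
    · exact (by linarith [hρ.2] : 2 * ρ < 1)
    · simp only [collarMap, Sum.elim_inr, discCollar, hn]
      have h1 : ((1 + ρ : ℝ) : ℂ) ≠ 0 := Complex.ofReal_ne_zero.2 h0.ne'
      rw [mul_div_cancel_left₀ _ two_ne_zero, hτ, mul_inv_cancel_left₀ h1, sub_sub_cancel, ← hσ,
        hnd_eq_extHnd_self]

theorem isOpen_collarDomain (s : Bool) : IsOpen (collarDomain G s) := by
  change IsOpen ((Quot.mk G.HandleRel) ⁻¹' _)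
  rw [isOpen_sum_iff]
  constructor
  · let K : Set (Circle × Icc (-1 : ℝ) 1 × Icc (-1 : ℝ) 1) :=
      {k | 1 ≤ 2 * (1 - |(k.2.1 : ℝ)|) + 2 * (2 - lev s * (k.2.2 : ℝ)) / 3}
    have hK : IsClosed K := isClosed_le continuous_const (by fun_prop)
    have h1 : IsClosed (⋃ i : Fin (G.numCircles s),
        (fun k : Circle × Icc (-1 : ℝ) 1 × Icc (-1 : ℝ) 1 =>
          (ann (G := G) ⟨s, i⟩ k.1 k.2.1, k.2.2)) '' K) := by
      refine isClosed_iUnion_of_finite fun i => (hK.isCompact.image ?_).isClosed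
      exact ((continuous_ann ⟨s, i⟩).comp (f := fun k : Circle × Icc (-1 : ℝ) 1 × Icc (-1 : ℝ) 1 =>
        (k.1, (k.2.1 : ℝ))) (by fun_prop)).prodMk (by fun_prop)
    have h2 : IsOpen {p : G.Surface × Icc (-1 : ℝ) 1 | 1 / 2 < lev s * (p.2 : ℝ)} :=
      isOpen_lt (by fun_prop) (by fun_prop)
    convert h2.inter h1.isOpen_compl using 1
    ext ⟨x, h⟩
    have h3 : (Quot.mk G.HandleRel (Sum.inl (x, h)) : G.HandleManifold) = lay x h := by
      rw [lay, ic_val]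
    refine (Eq.to_iff (congrArg (· ∈ collarDomain G s) h3)).trans
      ((lay_mem_collarDomain_iff h.2).trans (and_congr Iff.rfl ?_))
    simp only [mem_compl_iff, mem_iUnion, mem_image, Prod.mk.injEq, not_exists, not_and, Prod.forall]
    refine forall_congr' fun i => forall_congr' fun w => ?_
    constructor
    · rintro H t h' hk hx rfl
      exact absurd (H t t.2 hx.symm) (not_lt.2 hk)
    · intro H t ht hx
      by_contra hn
      exact H ⟨t, ht⟩ h (not_lt.1 hn) hx.symm rfl
  · have h2 : IsOpen {k : G.Circles × closedBall (0 : ℂ) 1 × Icc (-1 : ℝ) 1 |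
        k.1.1 = s ∧ 2 * (1 - |(k.2.2 : ℝ)|) + 2 * ‖(k.2.1 : ℂ)‖ / 3 < 1} :=
      ((isOpen_discrete {c : G.Circles | c.1 = s}).preimage continuous_fst).inter
        (isOpen_lt (f := fun k : G.Circles × closedBall (0 : ℂ) 1 × Icc (-1 : ℝ) 1 =>
          2 * (1 - |(k.2.2 : ℝ)|) + 2 * ‖(k.2.1 : ℂ)‖ / 3) (by fun_prop) continuous_const)
    convert h2 using 1
    ext ⟨c, d, t⟩
    have h3 : (Quot.mk G.HandleRel (Sum.inr (c, d, t)) : G.HandleManifold) = hnd c d t := by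
      rw [hnd, ic_val]
    exact (Eq.to_iff (congrArg (· ∈ collarDomain G s) h3)).trans (hnd_mem_collarDomain_iff t.2)

theorem collarDomain_disjoint {s s' : Bool} (h : s ≠ s') {m : G.HandleManifold}
    (hm : m ∈ collarDomain G s) (hm' : m ∈ collarDomain G s') : False := by
  rcases exists_lay_or_hnd m with ⟨x, k, hh, rfl⟩ | ⟨c, d, t, ht, rfl⟩
  · have h1 := ((lay_mem_collarDomain_iff hh).1 hm).1
    have h2 := ((lay_mem_collarDomain_iff hh).1 hm').1
    rw [lev_of_ne h] at h2
    linarith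
  · exact h (((hnd_mem_collarDomain_iff ht).1 hm).1.symm.trans ((hnd_mem_collarDomain_iff ht).1 hm').1)

instance (s : Bool) : CompactSpace (outer G s) :=
  isCompact_iff_compactSpace.1 (isClosed_outer s).isCompact

/-- The collar of the surgered surface. -/
theorem exists_collar (s : Bool) : ∃ κ : G.surgered s × Icc (0 : ℝ) 1 → G.HandleManifold,
    Continuous κ ∧ Function.Injective κ ∧ (∀ b, κ (b, 0) = b) ∧
      (∀ k, κ (surgeredMap s k) = collarMap s k) ∧ κ '' {k | k.2 < 1} = collarDomain G s ∧
      ∀ b r s', κ (b, r) ∈ G.surgered s' → r = 0 := by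
  let g : C(_, G.surgered s × Icc (0 : ℝ) 1) := ⟨surgeredMap s, continuous_surgeredMap s⟩
  let f : C(_, G.HandleManifold) := ⟨collarMap s, continuous_collarMap s⟩
  -- A continuous surjection from a compact space to a Hausdorff space is a quotient map, so the
  -- collar descends from its description on the pieces.
  have hq : Topology.IsQuotientMap g :=
    (continuous_surgeredMap s).isClosedMap.isQuotientMap (continuous_surgeredMap s)
      (surgeredMap_surjective s)
  have hf : Function.FactorsThrough f g := fun x y h => (collarMap_eq_iff s x y).1 h
  let κ := hq.lift f hf
  have hκ : ∀ k, κ (surgeredMap s k) = collarMap s k := fun k =>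
    DFunLike.congr_fun (hq.lift_comp f hf) k
  refine ⟨κ, κ.continuous, ?_, ?_, hκ, ?_, ?_⟩
  · intro a b h
    obtain ⟨x, rfl⟩ := surgeredMap_surjective s a
    obtain ⟨y, rfl⟩ := surgeredMap_surjective s b
    rw [hκ, hκ] at h
    exact (collarMap_eq_iff s x y).2 h
  · intro b
    obtain ⟨⟨x, r⟩ | ⟨i, d, σ, r⟩, h⟩ := surgeredMap_surjective s (b, 0)
    · rw [← h, hκ]
      obtain ⟨rfl, rfl⟩ := Prod.mk_inj.1 h
      simp [collarMap]
    · rw [← h, hκ]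
      obtain ⟨rfl, rfl⟩ := Prod.mk_inj.1 h
      simp [collarMap, discCollar, hnd_eq_extHnd_self]
  · ext m
    constructor
    · rintro ⟨k, hk, rfl⟩
      obtain ⟨x, rfl⟩ := surgeredMap_surjective s k
      exact ⟨x, hk, (hκ x).symm⟩
    · rintro ⟨x, hx, rfl⟩
      exact ⟨_, hx, hκ x⟩
  · intro b r s' h
    obtain ⟨⟨x, r⟩ | ⟨i, d, σ, r⟩, he⟩ := surgeredMap_surjective s (b, r)
    · rw [← he, hκ] at h
      obtain ⟨rfl, rfl⟩ := Prod.mk_inj.1 he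
      simp only [collarMap, Sum.elim_inl] at h
      have h1 := ((lay_mem_surgered_iff (lev_mul_mem.2 ⟨by linarith [r.2.2], by linarith [r.2.1]⟩)).1 h).1
      obtain ⟨-, h2⟩ := lev_mul_inj (by linarith [r.2.2]) one_pos (h1.trans (mul_one _).symm)
      exact Subtype.ext (by simp only [Icc.coe_zero]; linarith)
    · rw [← he, hκ] at h
      obtain ⟨rfl, rfl⟩ := Prod.mk_inj.1 he
      simp only [collarMap, Sum.elim_inr] at h
      have hd : ‖(d : ℂ)‖ ≤ 1 := mem_closedBall_zero_iff.1 d.2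
      obtain ⟨hb1, hb2⟩ := discCollar_bounds (half_mem r) (norm_nonneg (d : ℂ)) hd
      have h0 : (r : ℝ) / 2 = 0 ∧ ‖(d : ℂ)‖ = (1 + (r : ℝ) / 2) * ‖(d : ℂ)‖ := by
        rcases mem_surgered_iff.1 h with ⟨x, hx, H⟩ | ⟨j, d', t, ht, H⟩
        · obtain ⟨h1, h2⟩ := lay_eq_extHnd (lev_mem s')
            (by rw [norm_discCollar (half_mem r).1]; exact hb1.le) (lev_mul_mem_of_half hb2) H
          rw [norm_discCollar (half_mem r).1] at h1
          change _ = 2 - lev s * lev s' at h1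
          have hs : s = s' := by
            by_contra hs
            rw [lev_of_ne hs, mul_neg, lev_mul_self] at h1
            linarith
          subst hs
          rw [lev_mul_self] at h1
          have h3 := outer_ann (c := ⟨s, i⟩) rfl (lev_mul_mem_of_half hb2) (h2 ▸ hx)
          rw [abs_lev_mul (by linarith [hb2.1])] at h3
          have := corner_inj (half_mem r).1 le_rfl hd le_rfl (by linarith : _ = (1 + 0) * (1 : ℝ))
            (by linarith : _ = (0 : ℝ) * (1 - 1))
          exact ⟨this.1, by rw [this.1]; ring⟩
        · have ht' : t ∈ Icc (-1 : ℝ) 1 := by rcases ht with rfl | rfl <;> simp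
          obtain ⟨-, h1, rfl⟩ := hnd_eq_extHnd (by rw [norm_discCollar (half_mem r).1]; exact hb1)
            ht' (lev_mul_mem_of_half hb2) H
          have h2 : ‖(d' : ℂ)‖ ≤ 1 := mem_closedBall_zero_iff.1 d'.2
          rw [h1, norm_discCollar (half_mem r).1] at h2
          have h3 : |lev σ * (1 - (r : ℝ) / 2 * (1 - ‖(d : ℂ)‖))| = 1 := by
            rcases ht with h | h <;> rw [h] <;> simp
          rw [abs_lev_mul (by linarith [hb2.1])] at h3
          have := corner_inj (half_mem r).1 le_rfl hd h2
            (by ring : _ = (1 + 0) * ((1 + (r : ℝ) / 2) * ‖(d : ℂ)‖)) (by linarith)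
          exact this
      exact Subtype.ext (by simp only [Icc.coe_zero]; linarith [h0.1])

end DecoratedGaussDiagram

/-! ### Components of the surgered surface -/

namespace GaussDiagram

variable {G : GaussDiagram}

/-- The point `p` lies in the ribbon graph in an open annulus of the family `s`. -/
def InOpenAnnulus (s : Bool) (p : G.Annuli) : Prop :=
  ∃ q : G.Annuli, q.1.1 = s ∧ |(q.2.2 : ℝ)| < 1 ∧ rmk p = rmk q

theorem inOpenAnnulus_annPt {s : Bool} {h : Fin G.numChords} {w : ℝ} {y : Icc (-1 : ℝ) 1}
    (hw : |w| < 1 / 4) : InOpenAnnulus (!s) (G.annPt s h w y) := by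
  have hw4 : |4 * w| < 1 := by rw [abs_mul, show |(4 : ℝ)| = 4 by norm_num]; linarith
  have hm : ∀ δ : ℤˣ, ((δ : ℤ) : ℝ) * (4 * w) ∈ Icc (-1 : ℝ) 1 := fun δ =>
    abs_le.1 (by rw [abs_units_mul]; exact hw4.le)
  have hss : (((G.sign h : ℤ) : ℝ)) * ((G.sign h : ℤ) : ℝ) = 1 := by
    rcases units_real (G.sign h) with h | h <;> rw [h] <;> norm_num
  cases s
  · refine ⟨G.annPt true h ((-((G.sign h : ℤ) : ℝ) * y) / 4) ⟨_, hm (G.sign h)⟩, rfl,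
      by simpa only [annPt, abs_units_mul] using hw4, (Quot.sound (couponRel_iff.2
        ⟨h, ⟨-((G.sign h : ℤ) : ℝ) * y, ?_⟩, ⟨_, hm (G.sign h)⟩, y, ?_, rfl, ?_⟩)).symm⟩
    · have := units_mul_mem (-G.sign h) y
      push_cast at this
      exact this
    · simp only; linear_combination -(y : ℝ) * hss
    · congr 1; simp only; linear_combination w * hss
  · refine ⟨G.annPt false h (((G.sign h : ℤ) : ℝ) * (y : ℝ) / 4) ⟨_, hm (-G.sign h)⟩, rfl,
      by simpa only [annPt, abs_units_mul] using hw4, Quot.sound (couponRel_iff.2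
        ⟨h, ⟨4 * w, abs_le.1 hw4.le⟩, y, ⟨_, hm (-G.sign h)⟩, ?_, ?_, rfl⟩)⟩
    · push_cast; ring
    · congr 1; simp only; ring

/-- The open annuli of a family are closed under going deeper. -/
theorem InOpenAnnulus.deeper {s : Bool} {a : G.Arc} {t ρ r : ℝ} (ht : t ∈ Icc (0 : ℝ) 1)
    (hρ : 0 ≤ ρ) (hρr : ρ ≤ r) (hr : r ≤ 1) (H : InOpenAnnulus s (G.trap a t ρ)) :
    InOpenAnnulus s (G.trap a t r) := by
  -- Going deeper multiplies the distance from the edge midpoint by `(1 + r) / (1 + ρ)`, which is at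
  -- least `1`. The point moves towards the chord end without passing it and remains in the strip of
  -- the crossing annulus.
  have key : ∀ {s h w y}, |w| < 1 / 4 → G.annPt s h w y = G.trap a t ρ →
      InOpenAnnulus (!s) (G.trap a t r) := by
    intro s h w y hw he
    rcases a with ⟨s', g, δ⟩ | ⟨c, δ⟩
    swap
    · exact (annPt_ne he).elim
    set e := ((δ : ℤ) : ℝ) * ((1 + ρ) * (t / 2 - 1 / 4))
    set e' := ((δ : ℤ) : ℝ) * ((1 + r) * (t / 2 - 1 / 4)) with he'
    have h1 := trap_half_le δ ht (r := ρ) ⟨hρ, hρr.trans hr⟩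
    have h2 := trap_half_le δ ht (r := r) ⟨hρ.trans hρr, hr⟩
    have h3 : (1 + r) * e = (1 + ρ) * e' := by simp only [e, e']; ring
    obtain ⟨rfl, -, h4⟩ := annPt_window (h1.trans (by linarith)) hw.le he.symm
    rw [abs_lt] at hw
    rw [abs_le] at h2
    change _ ≤ e' ∧ e' ≤ _ at h2
    change InOpenAnnulus _ (G.annPt s' g (1 / 2 + e') (depth δ r))
    rcases h4 with ⟨rfl, rfl⟩ | ⟨rfl, rfl⟩
    · change -(1 / 4) < 1 / 2 + e ∧ 1 / 2 + e < 1 / 4 at hw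
      refine inOpenAnnulus_annPt (abs_lt.2 ⟨?_, ?_⟩)
      · linarith [h2.1]
      · have : e' ≤ e := by nlinarith
        linarith [hw.2]
    · change -(1 / 4) < e - 1 / 2 ∧ e - 1 / 2 < 1 / 4 at hw
      have h5 : G.annPt s' g (1 / 2 + e') (depth δ r) =
          G.annPt s' (G.succ s' g) (e' - 1 / 2) (depth δ r) := by
        rw [annPt_succ]; congr 1; ring
      rw [h5]
      refine inOpenAnnulus_annPt (abs_lt.2 ⟨?_, ?_⟩)
      · have : e ≤ e' := by nlinarith
        linarith [hw.1]
      · linarith [h2.2]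
  obtain ⟨q, rfl, hq, H⟩ := H
  rcases couponRel_isGluing.mk_eq_iff.1 H with H | H | H
  · obtain ⟨u₀, δ, X, hδ, -, -, hs⟩ := exists_trap_eq a
    have hmem : ∀ x ∈ Icc (0 : ℝ) 1, -(δ * (1 - x)) ∈ Icc (-1 : ℝ) 1 := by
      rintro x ⟨h0, h1⟩
      rcases hδ with rfl | rfl <;> constructor <;> linarith
    have hab : ∀ x ∈ Icc (0 : ℝ) 1, |-(δ * (1 - x))| = 1 - x := by
      rintro x ⟨h0, h1⟩
      have : |δ| = 1 := by rcases hδ with rfl | rfl <;> simp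
      rw [abs_neg, abs_mul, this, one_mul, abs_of_nonneg (by linarith)]
    have h1 : ρ ∈ Icc (0 : ℝ) 1 := ⟨hρ, hρr.trans hr⟩
    have h2 : r ∈ Icc (0 : ℝ) 1 := ⟨hρ.trans hρr, hr⟩
    rw [← H, hs t ρ h1] at hq ⊢
    simp only [ic_coe (hmem _ h1), hab _ h1] at hq
    refine ⟨G.trap a t r, by rw [hs t r h2], ?_, rfl⟩
    rw [hs t r h2]
    simp only [ic_coe (hmem _ h2), hab _ h2]
    linarith
  · obtain ⟨h, x, y, v, hv, h1, rfl⟩ := couponRel_iff.1 H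
    refine key (s := true) ?_ h1
    change |(v : ℝ)| < 1 at hq
    rw [hv, neg_mul, abs_neg, abs_units_mul] at hq
    rw [abs_div, show |(4 : ℝ)| = 4 by norm_num]; linarith
  · obtain ⟨h, x, y, v, hv, rfl, h1⟩ := couponRel_iff.1 H
    refine key (s := false) ?_ h1
    change |(y : ℝ)| < 1 at hq
    rw [mul_div_assoc, abs_units_mul, abs_div, show |(4 : ℝ)| = 4 by norm_num]; linarith

end GaussDiagram

namespace DecoratedGaussDiagram

/-- All holes are centred on the real axis, so the vertical ray leading away from this axis stays in
the space and tends to infinity. -/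
theorem HoledSphere.mem_connectedComponent_infty (J : Set ℕ) (p : HoledSphere J) :
    p ∈ connectedComponent (HoledSphere.infty J) := by
  obtain ⟨p, hp⟩ := p
  induction p using OnePoint.rec with
  | infty => exact mem_connectedComponent
  | coe z =>
    obtain ⟨σ, hσ, hσz⟩ : ∃ σ : ℝ, |σ| = 1 ∧ 0 ≤ σ * z.im := by
      rcases le_total 0 z.im with h | h
      · exact ⟨1, by simp, by simpa⟩
      · exact ⟨-1, by simp, by linarith⟩
    have hmem : ∀ u : Ici (0 : ℝ), ∀ j ∈ J, ∀ z' : ℂ,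
        ((z + (σ * u : ℝ) * Complex.I : ℂ) : OnePoint ℂ) = z' → 1 ≤ ‖z' - 3 * (j : ℂ)‖ := by
      intro u j hj z' h
      rw [← OnePoint.coe_injective h]
      refine (hp j hj z rfl).trans ?_
      have hu : (0 : ℝ) ≤ u := u.2
      have hσ2 : σ * σ = 1 := by rw [← abs_mul_abs_self, hσ, one_mul]
      refine Real.sqrt_le_sqrt ?_
      simp only [Complex.normSq_apply, Complex.sub_re, Complex.add_re, Complex.mul_re, Complex.sub_im,
        Complex.add_im, Complex.mul_im, Complex.ofReal_re, Complex.ofReal_im, Complex.I_re,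
        Complex.I_im, Complex.natCast_re, Complex.natCast_im, Complex.re_ofNat, Complex.im_ofNat]
      nlinarith [mul_nonneg hσz hu, mul_self_nonneg (σ * u)]
    let f : Ici (0 : ℝ) → HoledSphere J := fun u =>
      ⟨((z + (σ * u : ℝ) * Complex.I : ℂ) : OnePoint ℂ), hmem u⟩
    have hf : Continuous f :=
      Continuous.subtype_mk (OnePoint.continuous_coe.comp (by fun_prop)) _
    have hlim : Filter.Tendsto f Filter.atTop (𝓝 (HoledSphere.infty J)) := by
      refine tendsto_subtype_rng.2 ?_
      refine (OnePoint.tendsto_coe_infty (X := ℂ)).comp ?_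
      rw [Filter.coclosedCompact_eq_cocompact, ← Metric.cobounded_eq_cocompact,
        ← tendsto_norm_atTop_iff_cobounded]
      have h1 : Filter.Tendsto (fun u : Ici (0 : ℝ) => (u : ℝ) - ‖z‖) Filter.atTop Filter.atTop :=
        Filter.tendsto_atTop_add_const_right _ _ (Filter.tendsto_Ici_atTop.1 Filter.tendsto_id)
      refine Filter.tendsto_atTop_mono (fun u => ?_) h1
      have hu : (0 : ℝ) ≤ u := u.2
      have h2 : ‖((σ * u : ℝ) : ℂ) * Complex.I‖ = u := by
        rw [norm_mul, Complex.norm_I, mul_one, Complex.norm_real, Real.norm_eq_abs, abs_mul, hσ,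
          one_mul, abs_of_nonneg hu]
      have := norm_sub_norm_le (((σ * u : ℝ) : ℂ) * Complex.I) (-z)
      rw [h2, norm_neg, sub_neg_eq_add, add_comm] at this
      linarith
    have h0 : f ⟨0, by simp⟩ = ⟨(z : OnePoint ℂ), hp⟩ := by
      refine Subtype.ext ?_
      simp [f]
    have hI : PreconnectedSpace (Ici (0 : ℝ)) := Subtype.preconnectedSpace isPreconnected_Ici
    have hpre : IsPreconnected (closure (range f)) := (isPreconnected_range hf).closure
    have h1 : HoledSphere.infty J ∈ closure (range f) :=
      mem_closure_of_tendsto hlim (Filter.Eventually.of_forall fun u => mem_range_self u)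
    exact hpre.subset_connectedComponent h1 (subset_closure ⟨_, h0⟩)

instance (J : Set ℕ) : PreconnectedSpace (HoledSphere J) := by
  refine ⟨?_⟩
  have : connectedComponent (HoledSphere.infty J) = univ := eq_univ_of_forall (HoledSphere.mem_connectedComponent_infty J)
  rw [← this]
  exact isPreconnected_connectedComponent

end DecoratedGaussDiagram

theorem ConnectedComponents.coe_eq_of_continuous {Z X : Type*} [TopologicalSpace Z]
    [TopologicalSpace X] [PreconnectedSpace Z] {f : Z → X} (hf : Continuous f) (a b : Z) :
    (f a : ConnectedComponents X) = f b :=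
  ConnectedComponents.coe_eq_coe'.2
    ((isPreconnected_range hf).subset_connectedComponent (mem_range_self b) (mem_range_self a))

namespace DecoratedGaussDiagram

open GaussDiagram

variable {G : DecoratedGaussDiagram}

theorem ribbon_mem_outer_iff {s : Bool} {p : G.Annuli} :
    ribbon (rmk p) ∈ outer G s ↔ ¬ InOpenAnnulus s p := by
  simp only [outer, InOpenAnnulus, mem_ofPred_eq]
  push Not
  constructor
  · rintro h ⟨⟨s', i⟩, w, t⟩ rfl ht he
    refine h i w t (abs_lt.1 ht) ?_
    rw [ann, ic_val, he]
    rfl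
  · intro h i w t ht he
    exact h (⟨s, i⟩, w, ic t) rfl (by rw [ic_coe (Ioo_subset_Icc_self ht)]; exact abs_lt.2 ht)
      (ribbon_injective he)

theorem slab_mem_outer {s : Bool} {a : G.Arc} {t ρ r : ℝ} (ht : t ∈ Icc (0 : ℝ) 1)
    (hρ : 0 ≤ ρ) (hρr : ρ ≤ r) (hr : r ≤ 1) (h : slab a t r ∈ outer G s) : slab a t ρ ∈ outer G s :=
  ribbon_mem_outer_iff.2 fun H => ribbon_mem_outer_iff.1 h (H.deeper ht hρ hρr hr)

theorem region_mem_outer (s : Bool) (c : Fin G.numColors) (p : G.Region c) : region c p ∈ outer G s := by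
  intro i w t ht he
  obtain ⟨a, t', ht', h1, -⟩ := ribbon_eq_region_iff.1 he.symm
  have := abs_eq_one_of_mk_trap_zero ht' h1.symm
  rw [ic_coe (Ioo_subset_Icc_self ht)] at this
  exact (abs_lt.2 ht).ne this

/-- The copies of the outer part of the surface in the surgered surface. -/
def shore (s : Bool) (x : outer G s) : G.surgered s :=
  ⟨lay x (lev s), (lay_mem_surgered_iff (lev_mem s)).2 ⟨rfl, x.2⟩⟩

theorem continuous_shore (s : Bool) : Continuous (shore (G := G) s) :=
  Continuous.subtype_mk (continuous_lay.comp (f := fun k : outer G s => ((k : G.Surface), lev s))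
    (by fun_prop)) _

/-- The component of the surgered surface containing a region. -/
def regionComponent (s : Bool) (c : Fin G.numColors) : ConnectedComponents (G.surgered s) :=
  ((shore s ⟨region c (HoledSphere.infty _), region_mem_outer s c _⟩ : G.surgered s) :)

theorem component_region (s : Bool) (c : Fin G.numColors) (p : G.Region c) :
    ((shore s ⟨region c p, region_mem_outer s c _⟩ : G.surgered s) :
      ConnectedComponents (G.surgered s)) = regionComponent s c := by
  have : PreconnectedSpace (G.Region c) := inferInstanceAs (PreconnectedSpace (HoledSphere _))
  exact ConnectedComponents.coe_eq_of_continuous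
    (f := fun p => shore s ⟨region c p, region_mem_outer s c _⟩)
    ((continuous_shore s).comp (Continuous.subtype_mk (continuous_region c) _)) p
    (HoledSphere.infty _)

/-- By `slab_mem_outer` a point outside the open annuli can be moved along its slab up to the
boundary of a region without entering them. -/
theorem component_outer (s : Bool) (x : outer G s) : ∃ c,
    ((shore s x : G.surgered s) : ConnectedComponents (G.surgered s)) = regionComponent s c := by
  obtain ⟨x, hx⟩ := x
  rcases exists_slab_or_region x with ⟨a, t, ht, r, hr, rfl⟩ | ⟨c, p, rfl⟩
  swap
  · exact ⟨c, component_region s c p⟩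
  refine ⟨G.color (cyc a), ?_⟩
  have hz : slab a t 0 = region (G.color (cyc a)) (holePt a t) :=
    (slab_eq_region_iff ht (by simp)).2 ⟨rfl, rfl, rfl⟩
  have : PreconnectedSpace (Icc (0 : ℝ) r) := Subtype.preconnectedSpace isPreconnected_Icc
  rw [← component_region s _ (holePt a t)]
  have := ConnectedComponents.coe_eq_of_continuous (f := fun ρ : Icc (0 : ℝ) r =>
    shore s ⟨slab a t ρ, slab_mem_outer ht ρ.2.1 ρ.2.2 hr.2 hx⟩) ((continuous_shore s).comp
      (Continuous.subtype_mk ((continuous_slab a).comp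
        (f := fun ρ : Icc (0 : ℝ) r => (t, (ρ : ℝ))) (by fun_prop)) _))
      ⟨r, hr.1, le_rfl⟩ ⟨0, le_rfl, hr.1⟩
  rw [this]
  congr 2
  exact Subtype.ext hz

/-- The end discs of handles are connected and reach the outer part along their boundaries. Hence
there are finitely many components, which makes them clopen, and each contains a place where its
collar can be compared with an interior plot. -/
theorem exists_component_region (s : Bool) (C : ConnectedComponents (G.surgered s)) :
    ∃ c, C = regionComponent s c := by
  obtain ⟨⟨m, hm⟩, rfl⟩ := ConnectedComponents.surjective_coe C
  rcases mem_surgered_iff.1 hm with ⟨x, hx, rfl⟩ | ⟨i, d, t, ht, rfl⟩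
  · exact component_outer s ⟨x, hx⟩
  · have ht' : t ∈ Icc (-1 : ℝ) 1 := by rcases ht with rfl | rfl <;> simp
    have hp : PreconnectedSpace (closedBall (0 : ℂ) 1) :=
      Subtype.preconnectedSpace (convex_closedBall _ _).isPreconnected
    have hx : ann ⟨s, i⟩ 1 t ∈ outer G s := (ann_mem_outer_iff ht').2 ht
    obtain ⟨c, hc⟩ := component_outer s ⟨_, hx⟩
    refine ⟨c, ?_⟩
    rw [← hc]
    have := ConnectedComponents.coe_eq_of_continuous (f := fun d : closedBall (0 : ℂ) 1 =>
      (⟨hnd ⟨s, i⟩ d t, (hnd_mem_surgered_iff ht').2 ⟨rfl, ht⟩⟩ : G.surgered s))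
      (Continuous.subtype_mk ((continuous_hnd ⟨s, i⟩).comp
        (f := fun d : closedBall (0 : ℂ) 1 => (d, t)) (by fun_prop)) _) d ⟨1, by simp⟩
    rw [this]
    congr 1
    exact Subtype.ext ((lay_eq_hnd_iff (lev_mem s) ht').2 ⟨rfl, 1, by simp, rfl⟩).symm

instance (s : Bool) : Finite (ConnectedComponents (G.surgered s)) :=
  Finite.of_surjective (regionComponent (G := G) s) fun C =>
    (exists_component_region s C).imp fun _ h => h.symm

instance (s : Bool) : CompactSpace (G.surgered s) := by
  obtain ⟨κ, hκ, -, h0, -⟩ := exists_collar (G := G) s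
  have := isCompact_range (continuous_surgeredMap (G := G) s)
  rw [(surgeredMap_surjective s).range_eq] at this
  have := this.image continuous_fst
  rw [image_univ, Prod.range_fst] at this
  exact isCompact_univ_iff.1 this

instance (s : Bool) : DiscreteTopology (ConnectedComponents (G.surgered s)) := inferInstance

theorem isClopen_component {s : Bool} (C : ConnectedComponents (G.surgered s)) :
    IsClopen {x : G.surgered s | (x : ConnectedComponents (G.surgered s)) = C} :=
  (isClopen_discrete {C}).preimage ConnectedComponents.continuous_coe

/-- The collar of the surgered surface. -/
def collar (s : Bool) : G.surgered s × Icc (0 : ℝ) 1 → G.HandleManifold := (exists_collar s).choose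

end DecoratedGaussDiagram

namespace DecoratedGaussDiagram

open GaussDiagram

variable {G : DecoratedGaussDiagram}

/-! ### Level preserving plots of the collar -/

/-- The retraction of the line to the unit interval. -/
def clip (r : ℝ) : Icc (0 : ℝ) 1 := projIcc 0 1 zero_le_one r

theorem clip_coe {r : ℝ} (hr : r ∈ Icc (0 : ℝ) 1) : (clip r : ℝ) = r := by
  rw [clip, projIcc_of_mem _ hr]

theorem clip_val (r : Icc (0 : ℝ) 1) : clip r = r := projIcc_val _ r

theorem continuous_clip : Continuous clip :=
  continuous_projIcc (h := zero_le_one)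

theorem continuous_collar (s : Bool) : Continuous (collar (G := G) s) :=
  (exists_collar s).choose_spec.1

theorem collar_injective (s : Bool) : Function.Injective (collar (G := G) s) :=
  (exists_collar s).choose_spec.2.1

theorem collar_zero {s : Bool} (b : G.surgered s) : collar s (b, 0) = b :=
  (exists_collar s).choose_spec.2.2.1 b

theorem collar_shore {s : Bool} (x : outer G s) (r : Icc (0 : ℝ) 1) :
    collar s (shore s x, r) = lay x (lev s * (1 - (r : ℝ) / 2)) :=
  (exists_collar s).choose_spec.2.2.2.1 (.inl (x, r))

theorem image_collar (s : Bool) : collar s '' {k | k.2 < 1} = collarDomain G s :=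
  (exists_collar s).choose_spec.2.2.2.2.1

theorem eq_zero_of_collar_mem {s s' : Bool} {b : G.surgered s} {r : Icc (0 : ℝ) 1}
    (h : collar s (b, r) ∈ G.surgered s') : r = 0 :=
  (exists_collar s).choose_spec.2.2.2.2.2 b r s' h

/-- Within the open collar domain the complement of the image is the image of a compact set. -/
theorem isOpen_image_collar {s : Bool} {U : Set (G.surgered s × Icc (0 : ℝ) 1)} (hU : IsOpen U)
    (h1 : U ⊆ {k | k.2 < 1}) : IsOpen (collar s '' U) := by
  have : collar s '' U = collarDomain G s \ collar s '' Uᶜ := by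
    rw [← image_collar, ← image_sdiff (collar_injective s), sdiff_eq, compl_compl,
      inter_eq_right.2 h1]
  rw [this]
  exact (isOpen_collarDomain s).sdiff ((hU.isClosed_compl.isCompact.image (continuous_collar s)).isClosed)

/-- The change of coordinates between the distance from the boundary and the height. -/
def heightHomeo (s : Bool) : (ℂ × ℝ) ≃ₜ (ℂ × ℝ) where
  toFun y := (y.1, lev s * (1 - y.2 / 2))
  invFun y := (y.1, 2 * (1 - lev s * y.2))
  left_inv y := by
    refine Prod.ext rfl ?_
    simp only
    linear_combination (-2 + y.2) * lev_mul_self s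
  right_inv y := by
    refine Prod.ext rfl ?_
    simp only
    linear_combination y.2 * lev_mul_self s
  continuous_toFun := by fun_prop
  continuous_invFun := by fun_prop

theorem heightHomeo_apply (s : Bool) (y : ℂ × ℝ) :
    heightHomeo s y = (y.1, lev s * (1 - y.2 / 2)) := rfl

theorem continuous_complex_mk {X : Type*} [TopologicalSpace X] {f g : X → ℝ} (hf : Continuous f)
    (hg : Continuous g) : Continuous fun x => (⟨f x, g x⟩ : ℂ) :=
  Complex.equivRealProdCLM.symm.continuous.comp (hf.prodMk hg)

theorem OPR_heightHomeo (s : Bool) (x : ℂ × ℝ) : OPR R3 (heightHomeo s) x := by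
  cases s
  · left
    have := OP.of_strictMonoOn (φ₁ := id) (φ₂ := id) (φ₃ := fun u => -1 + u / 2) (x := x) one_pos
      (strictMono_id.strictMonoOn _) (strictMono_id.strictMonoOn _)
      (fun a _ b _ h => by simp only; linarith) (by fun_prop) (by fun_prop) (by fun_prop)
    refine this.congr (Filter.Eventually.of_forall fun y => ?_)
    rw [heightHomeo_apply]
    refine Prod.ext rfl ?_
    simp only [lev]; simp; ring
  · right
    have h1 := OP.of_strictMonoOn (φ₁ := id) (φ₂ := id) (φ₃ := fun u => -1 + u / 2) (x := x) one_pos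
      (strictMono_id.strictMonoOn _) (strictMono_id.strictMonoOn _)
      (fun a _ b _ h => by simp only; linarith) (by fun_prop) (by fun_prop) (by fun_prop)
    -- Two quarter turns negate the imaginary part and the height. So on the upper side the height
    -- reversal is a reflection, which `R3` undoes.
    have h2 := (h1.comp (OP.rot _) ?_).comp (OP.rot _) ?_
    · refine h2.congr (Filter.Eventually.of_forall fun y => ?_)
      simp only [Function.comp, R3_apply, heightHomeo_apply]
      refine Prod.ext (Complex.ext ?_ ?_) ?_ <;> simp [lev]
      ring
    · exact ((continuous_complex_mk (by fun_prop) (by fun_prop)).prodMk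
        (by fun_prop)).continuousAt
    · refine Continuous.continuousAt ?_
      exact (continuous_complex_mk (by simp only [id]; fun_prop) (by fun_prop)).prodMk
        (by simp only [id]; fun_prop)

theorem region_infty_notMem_ribbon (c : Fin G.numColors) :
    region c (HoledSphere.infty _) ∉ range (ribbon (G := G)) := by
  rintro ⟨x, hx⟩
  obtain ⟨a, t, -, -, -, h⟩ := ribbon_eq_region_iff.1 hx
  exact OnePoint.infty_ne_coe _ h

/-- This supplies the single comparison of orientations that each filling needs. Over a sphere with
holes the collar is vertical, so the interior plot, with the height replaced by the depth, respects
its levels. Its relation to the interior plot is the explicit map `heightHomeo`, of known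
orientation up to reflection. -/
theorem exists_levelPlot (s : Bool) (c : Fin G.numColors) :
    ∃ (k : ℂ → G.surgered s) (l : OpenPartialHomeomorph (ℂ × ℝ) G.HandleManifold) (x : ℂ × ℝ),
      x ∈ l.source ∧
      (∀ y ∈ l.source, y.2 ∈ Ioo (0 : ℝ) 1 ∧ l y = collar s (k y.1, clip y.2) ∧
        (k y.1 : ConnectedComponents (G.surgered s)) = regionComponent s c) ∧
      ∃ e ∈ G.interiorPlots, l x ∈ e.target ∧ OPR R3 (fun y => e.symm (l y)) x := by
  classical
  -- Points of the plot off the ribbon graph lie in the sphere with holes, which avoids the open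
  -- annuli of both families.
  let O : Set ℂ := (surfacePlot c).source ∩ surfacePlot c ⁻¹' (range ribbon)ᶜ
  have hO : IsOpen O := (surfacePlot c).isOpen_inter_preimage
    (isCompact_range continuous_ribbon).isClosed.isOpen_compl
  have hreg : ∀ z ∈ O, ∃ p, surfacePlot c z = region c p := by
    intro z hz
    have := (surfacePlot c).map_source hz.1
    rw [surfacePlot_target] at this
    rcases this with ⟨p, hp⟩ | ⟨a, -, t, ht, r, hr, h⟩
    · exact ⟨p, hp.symm⟩
    · exact (hz.2 ⟨_, h⟩).elim
  -- The second branch only makes `k` total; on the source of `l` the first one applies.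
  let k : ℂ → G.surgered s := fun z =>
    if h : surfacePlot c z ∈ outer G s then shore s ⟨_, h⟩
    else shore s ⟨region c (HoledSphere.infty _), region_mem_outer s c _⟩
  let l := ((heightHomeo s).toOpenPartialHomeomorph.trans (regionPlot c)).restrOpen
    (O ×ˢ Ioo 0 1) (hO.prod isOpen_Ioo)
  have hl : ∀ y ∈ l.source, y.1 ∈ O ∧ y.2 ∈ Ioo (0 : ℝ) 1 := fun y hy => hy.2
  have hlh : ∀ u ∈ Ioo (0 : ℝ) 1, lev s * (1 - u / 2) ∈ Ioo (-1 : ℝ) 1 := fun u hu =>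
    lev_mul_mem_Ioo.2 ⟨by linarith [hu.2], by linarith [hu.1]⟩
  have h0 : (0 : ℂ) ∈ O := ⟨(exists_regionPlot c).choose_spec.choose_spec.2.1, by
    have := (exists_regionPlot (G := G) c).choose_spec.choose_spec.2.2.1
    have h : surfacePlot c 0 ∉ range (ribbon (G := G)) := by
      rw [surfacePlot, this]
      exact region_infty_notMem_ribbon c
    exact h⟩
  have hx : ((0, 1 / 2) : ℂ × ℝ) ∈ l.source := by
    refine ⟨⟨mem_univ _, mem_regionPlot_source.2 ⟨h0.1, hlh _ ?_⟩⟩, h0, ?_⟩ <;> norm_num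
  refine ⟨k, l, (0, 1 / 2), hx, fun y hy => ?_, regionPlot c, Or.inr ⟨c, rfl⟩, ?_, ?_⟩
  · obtain ⟨h1, h2⟩ := hl y hy
    obtain ⟨p, hp⟩ := hreg _ h1
    have hout : surfacePlot c y.1 ∈ outer G s := hp ▸ region_mem_outer s c p
    have hk : k y.1 = shore s ⟨_, hout⟩ := dif_pos hout
    refine ⟨h2, ?_, ?_⟩
    · rw [hk, collar_shore, clip_coe (Ioo_subset_Icc_self h2)]
      exact regionPlot_apply (hlh _ h2)
    · rw [hk, ← component_region s c p]
      congr 2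
      exact Subtype.ext hp
  · exact (regionPlot c).map_source hx.1.2
  · have he : (fun y => (regionPlot c).symm (l y)) =ᶠ[𝓝 (0, 1 / 2)] heightHomeo s := by
      filter_upwards [l.open_source.mem_nhds hx] with y hy
      exact (regionPlot c).left_inv hy.1.2
    refine (OPR_heightHomeo s _).imp (fun h => h.congr he.symm) (fun h => h.congr ?_)
    filter_upwards [he] with y hy
    rw [hy]

end DecoratedGaussDiagram

/-! ### Filling boundary components -/

section Fill

variable {T W X N : Type*} [TopologicalSpace T] [CompactSpace T] [T2Space T] [Nonempty T]
  [NormedAddCommGroup W] [NormedSpace ℝ W] [ProperSpace W] [TopologicalSpace X] [TopologicalSpace N]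
  [T2Space N]

/-- The piece `T × D` and the collar of its boundary form an open set with the coordinates of
`T × 2 D`. -/
theorem exists_fillPlot {a : X → N} (ha : Continuous a) (hai : Function.Injective a)
    {κ : (T × sphere (0 : W) 1) × Icc (0 : ℝ) 1 → X} (hκ : Continuous κ)
    (hκi : Function.Injective κ) {b : T × closedBall (0 : W) 1 → N} (hb : Continuous b)
    (hbi : Function.Injective b)
    (hab : ∀ τ v x, b (τ, v) = a x ↔ ∃ σ : sphere (0 : W) 1, (σ : W) = v ∧ κ ((τ, σ), 0) = x)
    (hopen : IsOpen (range b ∪ (fun k => a (κ k)) '' {k | k.2 < 1})) :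
    ∃ e : OpenPartialHomeomorph (T × W) N, e.source = univ ×ˢ ball 0 2 ∧
      e.target = range b ∪ (fun k => a (κ k)) '' {k | k.2 < 1} ∧
      (∀ τ, ∀ v : closedBall (0 : W) 1, e (τ, v) = b (τ, v)) ∧
      ∀ τ, ∀ σ : sphere (0 : W) 1, ∀ r : Icc (0 : ℝ) 1, r < 1 →
        e (τ, (1 + (r : ℝ)) • (σ : W)) = a (κ ((τ, σ), r)) := by
  have hsph : ∀ σ : sphere (0 : W) 1, ‖(σ : W)‖ = 1 := fun σ => mem_sphere_zero_iff_norm.1 σ.2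
  have hnorm : ∀ (σ : sphere (0 : W) 1) (r : Icc (0 : ℝ) 1), ‖(1 + (r : ℝ)) • (σ : W)‖ = 1 + r :=
    fun σ r => by
      rw [norm_smul, hsph, mul_one, Real.norm_of_nonneg (by linarith [r.2.1])]
  let p : (T × closedBall (0 : W) 1) ⊕ ((T × sphere (0 : W) 1) × Icc (0 : ℝ) 1) → T × W :=
    Sum.elim (fun x => (x.1, x.2)) fun k => (k.1.1, (1 + (k.2 : ℝ)) • (k.1.2 : W))
  let q : (T × closedBall (0 : W) 1) ⊕ ((T × sphere (0 : W) 1) × Icc (0 : ℝ) 1) → N :=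
    Sum.elim b fun k => a (κ k)
  have hp : Continuous p := Continuous.sumElim (by fun_prop) (by fun_prop)
  have hq : Continuous q := hb.sumElim (ha.comp hκ)
  have hmix : ∀ (τ : T) (v : closedBall (0 : W) 1) (k : (T × sphere (0 : W) 1) × Icc (0 : ℝ) 1),
      (b (τ, v) = a (κ k) ↔ ((τ, (v : W)) : T × W) = (k.1.1, (1 + (k.2 : ℝ)) • (k.1.2 : W))) := by
    rintro τ v ⟨⟨τ', σ'⟩, r⟩
    rw [hab]
    constructor
    · rintro ⟨σ, h1, h2⟩
      have := hκi h2
      simp only [Prod.mk.injEq] at this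
      obtain ⟨⟨rfl, rfl⟩, rfl⟩ := this
      simp [h1]
    · intro h
      obtain ⟨rfl, h⟩ := Prod.mk.inj h
      have h1 : ‖(v : W)‖ ≤ 1 := mem_closedBall_zero_iff.1 v.2
      simp only at h
      rw [h, hnorm] at h1
      obtain rfl : r = 0 := Subtype.ext (le_antisymm (by simpa using h1) r.2.1)
      exact ⟨σ', by simp [h], rfl⟩
  have hfib : ∀ x y, p x = p y ↔ q x = q y := by
    rintro (⟨τ, v⟩ | k) (⟨τ', v'⟩ | k')
    · rw [show q (.inl (τ, v)) = b (τ, v) from rfl, show q (.inl (τ', v')) = b (τ', v') from rfl,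
        hbi.eq_iff]
      simp [p, Subtype.ext_iff]
    · exact (hmix τ v k').symm
    · exact eq_comm.trans ((hmix τ' v' k).symm.trans eq_comm)
    · rw [show q (.inr k) = a (κ k) from rfl, show q (.inr k') = a (κ k') from rfl,
        hai.eq_iff, hκi.eq_iff]
      obtain ⟨⟨τ, σ⟩, r⟩ := k
      obtain ⟨⟨τ', σ'⟩, r'⟩ := k'
      refine ⟨fun h => ?_, fun h => by rw [h]⟩
      obtain ⟨rfl, h⟩ := Prod.mk.inj h
      simp only at h
      have h1 := congrArg norm h
      rw [hnorm, hnorm] at h1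
      obtain rfl : r = r' := Subtype.ext (by linarith)
      obtain rfl : σ = σ' := Subtype.ext
        (smul_right_injective W (by linarith [r.2.1] : 1 + (r : ℝ) ≠ 0) h)
      rfl
  have hmem : ∀ x, p x ∈ (univ ×ˢ ball 0 2 : Set (T × W)) ↔
      q x ∈ range b ∪ (fun k => a (κ k)) '' {k | k.2 < 1} := by
    rintro (⟨τ, v⟩ | k)
    · refine iff_of_true ⟨mem_univ _, ?_⟩ (Or.inl (mem_range_self _))
      exact mem_ball_zero_iff.2 ((mem_closedBall_zero_iff.1 v.2).trans_lt (by norm_num))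
    · have h1 : p (.inr k) ∈ (univ ×ˢ ball 0 2 : Set (T × W)) ↔ k.2 < 1 := by
        simp only [p, Sum.elim_inr, mem_prod, mem_univ, true_and, mem_ball_zero_iff, hnorm]
        rw [← Subtype.coe_lt_coe, Icc.coe_one]
        constructor <;> intro h <;> linarith
      rw [h1]
      constructor
      · intro h
        exact Or.inr ⟨k, h, rfl⟩
      · rintro (⟨⟨τ, v⟩, h⟩ | ⟨k', h, he⟩)
        · have h2 := (Prod.mk.inj ((hmix τ v k).1 h)).2
          have h3 : ‖(v : W)‖ ≤ 1 := mem_closedBall_zero_iff.1 v.2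
          rw [h2, hnorm] at h3
          rw [← Subtype.coe_lt_coe, Icc.coe_one]
          linarith
        · rw [← hκi (hai he)]
          exact h
  have : Nonempty ((T × closedBall (0 : W) 1) ⊕ ((T × sphere (0 : W) 1) × Icc (0 : ℝ) 1)) :=
    ⟨.inl (Classical.arbitrary T, ⟨0, by simp⟩)⟩
  obtain ⟨e, h1, h2, h3, -⟩ := exists_openPartialHomeomorph_of_fibers hp hq
    (isOpen_univ.prod isOpen_ball : IsOpen (univ ×ˢ ball 0 2 : Set (T × W))) hopen
    (by
      rintro ⟨τ, v⟩ ⟨-, hv⟩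
      rw [mem_ball_zero_iff] at hv
      rcases le_or_gt ‖v‖ 1 with h | h
      · exact ⟨.inl (τ, ⟨v, mem_closedBall_zero_iff.2 h⟩), rfl⟩
      · refine ⟨.inr ((τ, ⟨‖v‖⁻¹ • v, ?_⟩), ⟨‖v‖ - 1, by linarith, by linarith⟩), ?_⟩
        · rw [mem_sphere_zero_iff_norm, norm_smul, norm_inv, norm_norm,
            inv_mul_cancel₀ (by linarith)]
        · refine Prod.ext rfl ?_
          simp only [p, Sum.elim_inr, add_sub_cancel]
          rw [smul_inv_smul₀ (by linarith)])
    (by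
      rintro n (⟨x, rfl⟩ | ⟨k, -, rfl⟩)
      · exact ⟨.inl x, rfl⟩
      · exact ⟨.inr k, rfl⟩) hmem fun x y _ _ => hfib x y
  refine ⟨e, h1, h2, fun τ v => h3 (.inl (τ, v)) ?_, fun τ σ r hr => h3 (.inr ((τ, σ), r)) ?_⟩
  · exact (hmem (.inl (τ, v))).2 (Or.inl (mem_range_self _))
  · exact (hmem (.inr ((τ, σ), r))).2 (Or.inr ⟨_, hr, rfl⟩)

end Fill

/-! ### Inverses and germs of maps with local degree one -/

section Inverse

variable {F : Type*} [NormedAddCommGroup F] [NormedSpace ℝ F] {R : F ≃L[ℝ] F}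

theorem OP.symm (φ : OpenPartialHomeomorph F F) {x : F} (hx : x ∈ φ.source) (h : OP φ x) :
    OP φ.symm (φ x) := by
  refine OP.of_comp (f := φ) (T := φ.symm) ?_ h (φ.continuousAt hx)
    (Tame.of_injOn φ.open_target (φ.map_source hx) φ.continuousOn_symm φ.symm.injOn)
  refine (OP.id x).congr ?_
  filter_upwards [φ.open_source.mem_nhds hx] with y hy
  exact (φ.left_inv hy).symm

theorem OPR.symm (hR : ∀ v, R (R v) = v) (φ : OpenPartialHomeomorph F F) {x : F}
    (hx : x ∈ φ.source) (h : OPR R φ x) : OPR R φ.symm (φ x) := by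
  rcases h with h | h
  · exact Or.inl (h.symm φ hx)
  · right
    have h1 := OP.symm (φ.trans R.toHomeomorph.toOpenPartialHomeomorph) (x := x) (by simp [hx]) h
    have h2 := h1.conj R
    have hRs : ∀ v, R.symm v = R v := fun v => by
      rw [ContinuousLinearEquiv.symm_apply_eq, hR]
    refine (show R ((φ.trans R.toHomeomorph.toOpenPartialHomeomorph) x) = φ x from hR _) ▸
      h2.congr (Filter.Eventually.of_forall fun y => ?_)
    have : R.toHomeomorph.toOpenPartialHomeomorph.symm (R.symm y) = y := by
      change R.symm (R.symm y) = y
      rw [hRs, hRs, hR]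
    simp only [Function.comp, OpenPartialHomeomorph.coe_trans_symm, this]

theorem OPR.congr {f g : F → F} {x : F} (hf : OPR R f x) (h : f =ᶠ[𝓝 x] g) : OPR R g x :=
  hf.imp (fun hf => hf.congr h) fun hf => hf.congr (h.mono fun y hy => congrArg R hy)

end Inverse

/-! ### Comparison of level preserving plots -/

section LevelComparison

variable {K M : Type*} [TopologicalSpace M]

/-- Two plots with the same levels have the same orientation up to a reflection. -/
theorem OPR.of_levels {κ : K × ℝ → M} (hκ : ∀ k k' r r', r ∈ Ioo (0 : ℝ) 1 → r' ∈ Ioo (0 : ℝ) 1 →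
      κ (k, r) = κ (k', r') → k = k' ∧ r = r')
    {l l' : OpenPartialHomeomorph (ℂ × ℝ) M} {k k' : ℂ → K} {x x' : ℂ × ℝ} (hx : x ∈ l.source)
    (hx' : x' ∈ l'.source) (he : l x = l' x')
    (h : ∀ y ∈ l.source, y.2 ∈ Ioo (0 : ℝ) 1 ∧ l y = κ (k y.1, y.2))
    (h' : ∀ y ∈ l'.source, y.2 ∈ Ioo (0 : ℝ) 1 ∧ l' y = κ (k' y.1, y.2)) :
    OPR R3 (fun y => l'.symm (l y)) x := by
  have key : ∀ y ∈ l.source, ∀ y' ∈ l'.source, l y = l' y' → k y.1 = k' y'.1 ∧ y.2 = y'.2 := by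
    intro y hy y' hy' e
    rw [(h y hy).2, (h' y' hy').2] at e
    exact hκ _ _ _ _ (h y hy).1 (h' y' hy').1 e
  let φ := l.trans l'.symm
  have hφx : x ∈ φ.source := by simp [φ, hx, he, hx']
  have hφ : φ x = x' := by simp [φ, he, hx']
  refine OPR.of_level φ hφx (fun q => (φ (q, x.2)).1) ?_
  obtain ⟨U, hU, V, hV, hUV⟩ := mem_nhds_prod_iff.1 (l'.open_source.mem_nhds hx')
  have hc : ContinuousAt φ x := φ.continuousAt hφx
  have h1 : ∀ᶠ y in 𝓝 x, y ∈ φ.source ∧ (φ y).1 ∈ U ∧ (φ y).2 ∈ V :=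
    (φ.open_source.eventually_mem hφx).and (((continuous_fst.continuousAt.comp hc).eventually
      (by rw [hφ]; exact hU : U ∈ 𝓝 (φ x).1)).and
      ((continuous_snd.continuousAt.comp hc).eventually
        (by rw [hφ]; exact hV : V ∈ 𝓝 (φ x).2)))
  have h2 : Filter.Tendsto (fun y : ℂ × ℝ => (y.1, x.2)) (𝓝 x) (𝓝 x) :=
    (by fun_prop : Continuous fun y : ℂ × ℝ => (y.1, x.2)).tendsto x
  filter_upwards [h1, h2.eventually h1] with y ⟨h3, h4, h5⟩ ⟨h6, h7, h8⟩
  have h9 : ∀ y ∈ φ.source, k y.1 = k' (φ y).1 ∧ y.2 = (φ y).2 := by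
    intro y hy
    have : y ∈ l.source ∧ l y ∈ l'.target := by simpa [φ] using hy
    refine key y this.1 (φ y) (l'.map_target this.2) ?_
    exact (l'.right_inv this.2).symm
  have h10 : ((φ (y.1, x.2)).1, (φ y).2) ∈ l'.source := hUV ⟨h7, h5⟩
  have h11 : ((φ y).1, (φ y).2) ∈ l'.source := hUV ⟨h4, h5⟩
  -- Both points have the same level and the same value of `k'`, because the value of `k` does not
  -- depend on the level. Injectivity of `l'` then shows that the planar part of the transition map
  -- is independent of the level, as `OPR.of_level` requires.
  have h12 : ((φ (y.1, x.2)).1, (φ y).2) = φ y := by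
    refine l'.injOn h10 h11 ?_
    rw [(h' _ h10).2, (h' _ h11).2, ← (h9 _ h6).1, ← (h9 _ h3).1]
  rw [(h9 _ h3).2]
  exact h12.symm

end LevelComparison

theorem OpenPartialHomeomorph.exists_of_isOpen_image {X N : Type*} [TopologicalSpace X]
    [TopologicalSpace N] [Nonempty X] {a : X → N} (ha : Continuous a) (hai : Function.Injective a) {U : Set X}
    (hU : IsOpen U) (hUo : ∀ O ⊆ U, IsOpen O → IsOpen (a '' O)) :
    ∃ α : OpenPartialHomeomorph X N, α.source = U ∧ α.target = a '' U ∧ ∀ x, α x = a x := by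
  let p : PartialEquiv X N := (hai.injOn (s := U)).toPartialEquiv a U
  refine ⟨OpenPartialHomeomorph.ofContinuousOpenRestrict p ha.continuousOn ?_ hU, rfl, rfl,
    fun x => rfl⟩
  intro O hO
  have : (U.domRestrict a) '' O = a '' (Subtype.val '' O) := by
    rw [← image_comp]; rfl
  change IsOpen ((U.domRestrict a) '' O)
  have hOo := hU.isOpenMap_subtype_val _ hO
  rw [this]
  exact hUo _ (by rintro _ ⟨x, -, rfl⟩; exact x.2) hOo

open DecoratedGaussDiagram

/-! ### Oriented atlases of filled spaces -/

section FillAtlas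

variable {T W X N ι : Type*} [TopologicalSpace T] [CompactSpace T] [T2Space T]
  [NormedAddCommGroup W] [NormedSpace ℝ W] [ProperSpace W] [TopologicalSpace X] [CompactSpace X]
  [T2Space X] [TopologicalSpace N] [T2Space N]

/-- Filling the boundary components of `X` with collars `κ i` by copies `b i` of `T × D`
yields the space `N`. -/
structure IsFilling (a : X → N) (κ : ι → (T × sphere (0 : W) 1) × Icc (0 : ℝ) 1 → X)
    (b : ι → T × closedBall (0 : W) 1 → N) : Prop where
  cont : Continuous a
  inj : Function.Injective a
  contCollar : ∀ i, Continuous (κ i)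
  injCollar : ∀ i, Function.Injective (κ i)
  openCollar : ∀ i, IsOpen (κ i '' {k | k.2 < 1})
  disjCollar : ∀ i j k k', k.2 < 1 → k'.2 < 1 → κ i k = κ j k' → i = j
  contPiece : ∀ i, Continuous (b i)
  injPiece : ∀ i j p q, b i p = b j q → i = j ∧ p = q
  glue : ∀ i τ v x, b i (τ, v) = a x ↔ ∃ σ : sphere (0 : W) 1, (σ : W) = v ∧ κ i ((τ, σ), 0) = x
  cover : ∀ n, (∃ x, a x = n) ∨ ∃ i p, b i p = n

variable {a : X → N} {κ : ι → (T × sphere (0 : W) 1) × Icc (0 : ℝ) 1 → X}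
  {b : ι → T × closedBall (0 : W) 1 → N}

theorem IsFilling.glue' (h : IsFilling a κ b) {i : ι} {p : T × closedBall (0 : W) 1} {x : X}
    (hx : b i p = a x) : ∃ k, κ i (k, 0) = x := by
  obtain ⟨σ, -, h⟩ := (h.glue i p.1 p.2 x).1 hx
  exact ⟨_, h⟩

theorem IsFilling.isOpen_piece [Finite ι] (h : IsFilling a κ b) (i : ι) :
    IsOpen (range (b i) ∪ (fun k => a (κ i k)) '' {k | k.2 < 1}) := by
  have h01 : (0 : Icc (0 : ℝ) 1) < 1 := zero_lt_one
  have : range (b i) ∪ (fun k => a (κ i k)) '' {k | k.2 < 1} =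
      (a '' (κ i '' {k | k.2 < 1})ᶜ ∪ ⋃ j ∈ {j | j ≠ i}, range (b j))ᶜ := by
    ext n
    simp only [mem_union, mem_compl_iff, mem_iUnion, not_or]
    constructor
    · rintro (⟨p, rfl⟩ | ⟨k, hk, rfl⟩)
      · refine ⟨?_, ?_⟩
        · rintro ⟨x, hx, hx'⟩
          obtain ⟨k, rfl⟩ := h.glue' hx'.symm
          exact hx ⟨_, h01, rfl⟩
        · rintro ⟨j, hj, q, hq⟩
          exact hj (h.injPiece _ _ _ _ hq).1
      · refine ⟨?_, ?_⟩
        · rintro ⟨x, hx, hx'⟩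
          rw [h.inj hx'] at hx
          exact hx ⟨_, hk, rfl⟩
        · rintro ⟨j, hj, q, hq⟩
          obtain ⟨k', hk'⟩ := h.glue' hq
          exact hj (h.disjCollar j i (k', 0) k h01 hk hk')
    · rintro ⟨h1, h2⟩
      rcases h.cover n with ⟨x, rfl⟩ | ⟨j, p, rfl⟩
      · by_cases hx : x ∈ κ i '' {k | k.2 < 1}
        · obtain ⟨k, hk, rfl⟩ := hx
          exact Or.inr ⟨k, hk, rfl⟩
        · exact (h1 ⟨x, hx, rfl⟩).elim
      · by_cases hj : j = i
        · subst hj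
          exact Or.inl ⟨p, rfl⟩
        · exact (h2 ⟨j, hj, p, rfl⟩).elim
  rw [this, isOpen_compl_iff]
  refine IsClosed.union ?_ ?_
  · exact ((h.openCollar i).isClosed_compl.isCompact.image h.cont).isClosed
  · exact (Set.toFinite _).isClosed_biUnion fun j _ => (isCompact_range (h.contPiece j)).isClosed

/-- An open set disjoint from the glued boundary has as complement the image of a compact set and
the finitely many compact pieces. -/
theorem IsFilling.isOpen_image [Finite ι] (h : IsFilling a κ b) {O : Set X} (hO : IsOpen O)
    (hd : ∀ i k, κ i (k, 0) ∉ O) : IsOpen (a '' O) := by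
  have : a '' O = (a '' Oᶜ ∪ ⋃ j, range (b j))ᶜ := by
    ext n
    simp only [mem_union, mem_compl_iff, mem_iUnion, not_or]
    constructor
    · rintro ⟨x, hx, rfl⟩
      refine ⟨?_, ?_⟩
      · rintro ⟨y, hy, hy'⟩
        rw [h.inj hy'] at hy
        exact hy hx
      · rintro ⟨j, p, hp⟩
        obtain ⟨k, rfl⟩ := h.glue' hp
        exact hd _ _ hx
    · rintro ⟨h1, h2⟩
      rcases h.cover n with ⟨x, rfl⟩ | ⟨j, p, rfl⟩
      · by_cases hx : x ∈ O
        · exact ⟨x, hx, rfl⟩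
        · exact (h1 ⟨x, hx, rfl⟩).elim
      · exact (h2 ⟨j, p, rfl⟩).elim
  rw [this, isOpen_compl_iff]
  refine IsClosed.union ?_ ?_
  · exact (hO.isClosed_compl.isCompact.image h.cont).isClosed
  · exact isClosed_iUnion_of_finite fun j => (isCompact_range (h.contPiece j)).isClosed

theorem IsFilling.exists_plot [Nonempty T] [Finite ι] (h : IsFilling a κ b) (i : ι) :
    ∃ e : OpenPartialHomeomorph (T × W) N, e.source = univ ×ˢ ball 0 2 ∧
      e.target = range (b i) ∪ (fun k => a (κ i k)) '' {k | k.2 < 1} ∧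
      (∀ τ, ∀ v : closedBall (0 : W) 1, e (τ, v) = b i (τ, v)) ∧
      ∀ τ, ∀ σ : sphere (0 : W) 1, ∀ r : Icc (0 : ℝ) 1, r < 1 →
        e (τ, (1 + (r : ℝ)) • (σ : W)) = a (κ i ((τ, σ), r)) :=
  exists_fillPlot h.cont h.inj (h.contCollar i) (h.injCollar i) (h.contPiece i)
    (fun p q hpq => (h.injPiece i i p q hpq).2) (h.glue i) (h.isOpen_piece i)

theorem Ioo_clip {r : ℝ} (hr : r ∈ Ioo (0 : ℝ) 1) : clip r < 1 ∧ clip r ≠ 0 := by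
  have := clip_coe (Ioo_subset_Icc_self hr)
  constructor
  · rw [← Subtype.coe_lt_coe, this]; exact hr.2
  · intro h
    rw [h] at this
    exact hr.1.ne this

variable (T W) in
/-- Near each point there are polar coordinates of `T × 2 D` in which the orientation is known. -/
def HasPolarPlots : Prop :=
  ∀ (κ₀ : T × sphere (0 : W) 1), ∀ r₀ ∈ Ioo (0 : ℝ) 1,
    ∃ Ψ : OpenPartialHomeomorph (ℂ × ℝ) (T × W), Ψ.target = univ ×ˢ ball 0 2 ∧
      ∃ (k' : ℂ → T × sphere (0 : W) 1) (P : OpenPartialHomeomorph (ℂ × ℝ) (ℂ × ℝ)) (z : ℂ),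
        (z, r₀) ∈ P.source ∧ OP P (z, r₀) ∧ k' z = κ₀ ∧ ∀ y ∈ P.source, y.2 ∈ Ioo (0 : ℝ) 1 ∧
          P y ∈ Ψ.source ∧ Ψ (P y) = ((k' y.1).1, (1 + y.2) • ((k' y.1).2 : W))

/-- An oriented atlas of the complement of `Z` in `X` extends over the pieces of a filling. -/
theorem IsFilling.exists_atlas [Nonempty X] [Nonempty T] [Finite ι] 
    [PreconnectedSpace (T × sphere (0 : W) 1)] (h : IsFilling a κ b)
    {A : Set (OpenPartialHomeomorph (ℂ × ℝ) X)} {Z : Set X}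
    (hcov : ∀ x, (∃ e ∈ A, x ∈ e.target) ↔ x ∉ Z)
    (hA : ∀ e ∈ A, ∀ e' ∈ A, ∀ m ∈ e.target, m ∈ e'.target → Compat e e' m)
    (hZ0 : ∀ i k, κ i (k, 0) ∈ Z) (hZ : ∀ i k r, κ i (k, r) ∈ Z → r = 0)
    (hpol : HasPolarPlots T W)
    (hlev : ∀ i, ∃ (k : ℂ → T × sphere (0 : W) 1) (l : OpenPartialHomeomorph (ℂ × ℝ) X) (x : ℂ × ℝ),
      x ∈ l.source ∧ (∀ y ∈ l.source, y.2 ∈ Ioo (0 : ℝ) 1 ∧ l y = κ i (k y.1, clip y.2)) ∧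
      (∃ e ∈ A, l x ∈ e.target ∧ OPR R3 (fun y => e.symm (l y)) x)) :
    ∃ B : Set (OpenPartialHomeomorph (ℂ × ℝ) N),
      (∀ e ∈ B, ∀ e' ∈ B, ∀ m ∈ e.target, m ∈ e'.target → Compat e e' m) ∧
      (∀ n, (∃ e ∈ B, n ∈ e.target) ↔ ∀ x ∈ Z, a x = n → ∃ i k, κ i (k, 0) = x) ∧
      ∀ e ∈ A, ∃ e' ∈ B, ∀ x ∈ e.target, a x ∈ e'.target ∧ e'.symm (a x) = e.symm x := by
  choose k l x hx hl hor using hlev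
  choose Ψ hΨ k' P z hz hP hk hPy using fun i => hpol (k i (x i).1) (x i).2 (hl i _ (hx i)).1
  choose e he1 he2 he3 he4 using h.exists_plot
  obtain ⟨α, hα1, -, hα2⟩ := OpenPartialHomeomorph.exists_of_isOpen_image h.cont h.inj
    (U := {x | ∀ i k, κ i (k, 0) ≠ x}) (by
      have : {x | ∀ i k, κ i (k, 0) ≠ x} = (⋃ i, range fun k => κ i (k, 0))ᶜ := by
        ext x; simp
      rw [this, isOpen_compl_iff]
      exact isClosed_iUnion_of_finite fun i =>
        (isCompact_range ((h.contCollar i).comp (by fun_prop))).isClosed)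
    (fun O hOU hO => h.isOpen_image hO fun i k hk => hOU hk i k rfl)
  have hαZ : ∀ x ∉ Z, x ∈ α.source := fun x hx => by
    rw [hα1]; rintro i k rfl; exact hx (hZ0 i k)
  let A₁ : Set (OpenPartialHomeomorph (ℂ × ℝ) N) := (fun e => e.trans α) '' A
  have hA₁t : ∀ n, (∃ e ∈ A₁, n ∈ e.target) ↔ ∃ x ∉ Z, a x = n := by
    intro n
    constructor
    · rintro ⟨_, ⟨e, he, rfl⟩, hn⟩
      obtain ⟨h1, h2⟩ : n ∈ α.target ∧ α.symm n ∈ e.target := by simpa using hn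
      exact ⟨α.symm n, (hcov _).1 ⟨e, he, h2⟩, by rw [← hα2, α.right_inv h1]⟩
    · rintro ⟨x, hx, rfl⟩
      obtain ⟨e, he, hxe⟩ := (hcov x).2 hx
      refine ⟨_, ⟨e, he, rfl⟩, ?_⟩
      rw [← hα2]
      simp [hαZ x hx, hxe]
  have hA₁ : ∀ e ∈ A₁, ∀ e' ∈ A₁, ∀ m ∈ e.target, m ∈ e'.target → Compat e e' m := by
    rintro _ ⟨e, he, rfl⟩ _ ⟨e', he', rfl⟩ n hn hn'
    obtain ⟨h1, h2⟩ : n ∈ α.target ∧ α.symm n ∈ e.target := by simpa using hn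
    obtain ⟨-, h3⟩ : n ∈ α.target ∧ α.symm n ∈ e'.target := by simpa using hn'
    have := (hA e he e' he' _ h2 h3).map α (α.map_target h1)
    rwa [α.right_inv h1] at this
  have hψt : ∀ i, ((Ψ i).trans (e i)).target = (e i).target := fun i => by
    ext n
    simp only [OpenPartialHomeomorph.trans_target, mem_inter_iff, mem_preimage, hΨ,
      and_iff_left_iff_imp]
    intro hn
    rw [← he1 i]
    exact (e i).map_target hn
  have hmemt : ∀ i n, n ∈ (e i).target ↔
      (∃ p, b i p = n) ∨ ∃ k r, r < 1 ∧ a (κ i (k, r)) = n := by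
    intro i n
    rw [he2]
    refine or_congr Iff.rfl ⟨?_, ?_⟩
    · rintro ⟨⟨k, r⟩, hr, rfl⟩
      exact ⟨k, r, hr, rfl⟩
    · rintro ⟨k, r, hr, rfl⟩
      exact ⟨(k, r), hr, rfl⟩
  -- The plot of a piece meets the already oriented part in its open collar, the product of a
  -- connected space with an interval. So `exists_compat_plot` needs just one point at which the
  -- orientations are comparable.
  have hex : ∀ i, ∃ ψ : OpenPartialHomeomorph (ℂ × ℝ) N, ψ.target = ((Ψ i).trans (e i)).target ∧
      ∀ e' ∈ A₁, ∀ m ∈ e'.target, m ∈ ((Ψ i).trans (e i)).target → Compat e' ψ m := by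
    intro i
    refine exists_compat_plot R3_R3 A₁ hA₁ ((Ψ i).trans (e i))
      (W := (fun k : (T × sphere (0 : W) 1) × ℝ => a (κ i (k.1, clip k.2))) '' (univ ×ˢ Ioo 0 1))
      ?_ ?_ ?_
    · exact (isPreconnected_univ.prod isPreconnected_Ioo).image _ (h.cont.comp ((h.contCollar i).comp
        (by have := continuous_clip; fun_prop))).continuousOn
    · intro n
      rw [hψt, hmemt, hA₁t]
      constructor
      · rintro ⟨⟨k, r⟩, ⟨-, hr⟩, rfl⟩
        exact ⟨Or.inr ⟨k, clip r, (Ioo_clip hr).1, rfl⟩, _,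
          fun hz => (Ioo_clip hr).2 (hZ i k _ hz), rfl⟩
      · rintro ⟨⟨p, hp⟩ | ⟨k, r, hr, rfl⟩, x, hx, hxn⟩
        · rw [← hxn] at hp
          obtain ⟨k, rfl⟩ := h.glue' hp
          exact (hx (hZ0 i k)).elim
        · rw [h.inj hxn] at hx
          refine ⟨(k, (r : ℝ)), ⟨mem_univ _, ?_, hr⟩, by simp only [clip_val]⟩
          refine lt_of_le_of_ne r.2.1 fun h0 => hx ?_
          rw [show r = 0 from Subtype.ext h0.symm]
          exact hZ0 i k
    · intro _
      obtain ⟨e', he', hxe, hor⟩ := hor i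
      replace hx := hx i
      replace hl := hl i
      replace hz := hz i
      replace hP := hP i
      replace hk := hk i
      replace hPy := hPy i
      generalize k i = k, l i = l, x i = x, k' i = k', P i = P, z i = z at *
      have hxZ : l x ∉ Z := (hcov _).1 ⟨e', he', hxe⟩
      have hxα := hαZ _ hxZ
      set ψ := (Ψ i).trans (e i) with hψ
      have hPψ : ∀ y ∈ P.source, P y ∈ ψ.source ∧ ψ (P y) = a (κ i (k' y.1, clip y.2)) := by
        intro y hy
        obtain ⟨h1, h2, h3⟩ := hPy y hy
        refine ⟨?_, ?_⟩
        · have := (Ψ i).map_source h2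
          rw [hΨ, ← he1 i] at this
          simp [hψ, h2, this]
        · have := he4 i (k' y.1).1 (k' y.1).2 (clip y.2) (Ioo_clip h1).1
          rw [clip_coe (Ioo_subset_Icc_self h1)] at this
          rw [hψ, OpenPartialHomeomorph.coe_trans, Function.comp, h3, this]
      have hm : a (l x) ∈ (e'.trans α).target := by
        rw [← hα2]; simp [hxα, hxe]
      have hlk := hl x hx
      have hm' : a (l x) = ψ (P (z, x.2)) := by
        rw [(hPψ _ hz).2, hk, hlk.2]
      refine ⟨e'.trans α, ⟨e', he', rfl⟩, a (l x), hm, ?_, ?_⟩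
      · rw [hm']
        exact ψ.map_source (hPψ _ hz).1
      have hpt : (e'.trans α).symm (a (l x)) = e'.symm (l x) := by
        rw [← hα2]; simp [hxα]
      rw [hpt]
      -- Both the given level plot `l` and the polar coordinates of the piece respect the levels of
      -- the collar, so `OPR.of_levels` compares them without further knowledge of the boundary
      -- component.
      have h1 : OPR R3 (fun y => (P.trans ψ).symm ((l.trans α) y)) x := by
        refine OPR.of_levels (κ := fun q : (T × sphere (0 : W) 1) × ℝ => a (κ i (q.1, clip q.2)))
          (k := k) (k' := k') (x' := (z, x.2)) ?_ (by simp [hx, hxα])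
          (by simp [hz, (hPψ _ hz).1]) ?_ ?_ ?_
        · intro k₁ k₂ r r' hr hr' he
          have h2 := (Prod.mk.inj (h.injCollar i (h.inj he)))
          refine ⟨h2.1, ?_⟩
          rw [← clip_coe (Ioo_subset_Icc_self hr), h2.2, clip_coe (Ioo_subset_Icc_self hr')]
        · simpa [hα2] using hm'
        · intro y hy
          have : y ∈ l.source := hy.1
          exact ⟨(hl y this).1, by simp [hα2, (hl y this).2]⟩
        · intro y hy
          have : y ∈ P.source := hy.1
          exact ⟨(hPy y this).1, (hPψ y this).2⟩
      have hxl : x ∈ (l.trans α).source := by simp [hx, hxα]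
      have hlax : (l.trans α) x = ψ (P (z, x.2)) := by simpa [hα2] using hm'
      have hxs : x ∈ ((l.trans α).trans (P.trans ψ).symm).source := by
        refine ⟨hxl, ?_⟩
        change (l.trans α) x ∈ (P.trans ψ).target
        rw [hlax]
        exact (P.trans ψ).map_source (x := (z, x.2)) (by simp [hz, (hPψ _ hz).1])
      have hxz : (P.trans ψ).symm ((l.trans α) x) = (z, x.2) := by
        rw [hlax]
        exact (P.trans ψ).left_inv (x := (z, x.2)) (by simp [hz, (hPψ _ hz).1])
      have h2 : OPR R3 (fun y => ψ.symm (α (l y))) x := by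
        refine (OPR.comp R3_R3 h1 (g := P) (by rw [hxz]; exact Or.inl hP)
          (((l.trans α).trans (P.trans ψ).symm).continuousAt hxs)).congr ?_
        filter_upwards [((l.trans α).trans (P.trans ψ).symm).open_source.mem_nhds hxs] with y hy
        have h3 : (l.trans α) y ∈ (P.trans ψ).target := hy.2
        exact P.right_inv h3.2
      have hf : x ∈ (l.trans e'.symm).source := by simp [hx, hxe]
      -- The chain is completed from the old plot `e'` to `l` by the inverse of the hypothesis, and
      -- from `l` to the plot of the piece by `h2`.
      have h4 := OPR.symm R3_R3 (l.trans e'.symm) hf hor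
      have h5 := (l.trans e'.symm).map_source hf
      have hle : (l.trans e'.symm).symm ((l.trans e'.symm) x) = x := (l.trans e'.symm).left_inv hf
      refine (OPR.comp R3_R3 (g := fun y => ψ.symm (α (l y))) h4 (by rw [hle]; exact h2)
        ((l.trans e'.symm).symm.continuousAt h5)).congr ?_
      filter_upwards [(l.trans e'.symm).open_target.mem_nhds h5] with y hy
      have h6 : e' y ∈ l.target := by simpa using hy.2
      simp [l.right_inv h6]
  choose ψ hψ1 hψ2 using hex
  have hcross : ∀ i, ∀ e' ∈ A₁, ∀ m ∈ e'.target, m ∈ (ψ i).target → Compat e' (ψ i) m :=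
    fun i e' he' m hm hm' => hψ2 i e' he' m hm (hψ1 i ▸ hm')
  have hψm : ∀ i n, n ∈ (ψ i).target ↔
      (∃ p, b i p = n) ∨ ∃ k r, r < 1 ∧ a (κ i (k, r)) = n := fun i n => by
    rw [hψ1, hψt, hmemt]
  have h01 : (0 : Icc (0 : ℝ) 1) < 1 := zero_lt_one
  have hself : ∀ i j n, n ∈ (ψ i).target → n ∈ (ψ j).target → i = j := by
    intro i j n hi hj
    rcases (hψm i n).1 hi with ⟨p, rfl⟩ | ⟨k, r, hr, rfl⟩ <;>
      rcases (hψm j _).1 hj with ⟨q, hq⟩ | ⟨k', r', hr', hq⟩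
    · exact (h.injPiece _ _ _ _ hq).1.symm
    · obtain ⟨k, hk⟩ := h.glue' hq.symm
      exact h.disjCollar i j (k, 0) _ h01 hr' hk
    · obtain ⟨k', hk⟩ := h.glue' hq
      exact (h.disjCollar j i (k', 0) _ h01 hr hk).symm
    · exact (h.disjCollar j i _ _ hr' hr (h.inj hq)).symm
  -- The last clause, that old plots survive with unchanged coordinates, is what allows a second
  -- filling on top of the first.
  refine ⟨A₁ ∪ range ψ, ?_, fun n => ⟨?_, fun hn => ?_⟩, fun e he =>
    ⟨e.trans α, Or.inl ⟨e, he, rfl⟩, fun x hx => ?_⟩⟩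
  · rintro e₁ (h1 | ⟨i, rfl⟩) e₂ (h2 | ⟨j, rfl⟩) m hm hm'
    · exact hA₁ e₁ h1 e₂ h2 m hm hm'
    · exact hcross j e₁ h1 m hm hm'
    · exact (hcross i e₂ h2 m hm' hm).symm
    · obtain rfl := hself i j m hm hm'
      exact Compat.refl _ hm
  · rintro ⟨e', he' | ⟨i, rfl⟩, hn⟩ x hx rfl
    · obtain ⟨y, hy, hyx⟩ := (hA₁t _).1 ⟨e', he', hn⟩
      exact (hy (h.inj hyx ▸ hx)).elim
    · rcases (hψm i _).1 hn with ⟨p, hp⟩ | ⟨k, r, hr, hk⟩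
      · obtain ⟨k, hk⟩ := h.glue' hp
        exact ⟨i, k, hk⟩
      · obtain rfl := h.inj hk
        obtain rfl := hZ i k r hx
        exact ⟨i, k, rfl⟩
  · have hψn : ∀ i, n ∈ (ψ i).target → ∃ e ∈ A₁ ∪ range ψ, n ∈ e.target := fun i hi =>
      ⟨ψ i, Or.inr ⟨i, rfl⟩, hi⟩
    rcases h.cover n with ⟨x, rfl⟩ | ⟨i, p, rfl⟩
    · by_cases hx : x ∈ Z
      · obtain ⟨i, k, rfl⟩ := hn x hx rfl
        exact hψn i ((hψm i _).2 (Or.inr ⟨k, 0, h01, rfl⟩))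
      · obtain ⟨e', he', h1⟩ := (hA₁t _).2 ⟨x, hx, rfl⟩
        exact ⟨e', Or.inl he', h1⟩
    · exact hψn i ((hψm i _).2 (Or.inl ⟨p, rfl⟩))
  · have hxα := hαZ x ((hcov x).1 ⟨e, he, hx⟩)
    rw [← hα2]
    simp [hxα, hx]

end FillAtlas

open DecoratedGaussDiagram

/-! ### Polar coordinates of the ball -/

/-- The square of the Euclidean norm on `ℂ × ℝ`. -/
def nsq (v : ℂ × ℝ) : ℝ := ‖v.1‖ ^ 2 + v.2 ^ 2

theorem exists_isometry (V : Type*) [NormedAddCommGroup V] [InnerProductSpace ℝ V]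
    [FiniteDimensional ℝ V] (hV : Module.finrank ℝ V = 3) :
    ∃ L : (ℂ × ℝ) ≃L[ℝ] V, ∀ v, ‖L v‖ ^ 2 = nsq v := by
  have h : Module.finrank ℝ (WithLp 2 (ℂ × ℝ)) = Module.finrank ℝ V := by
    rw [hV, (WithLp.linearEquiv 2 ℝ (ℂ × ℝ)).finrank_eq, Module.finrank_prod,
      Complex.finrank_real_complex, Module.finrank_self]
  let J : WithLp 2 (ℂ × ℝ) ≃ₗᵢ[ℝ] V := LinearIsometryEquiv.trans
    (stdOrthonormalBasis ℝ (WithLp 2 (ℂ × ℝ))).repr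
      ((LinearIsometryEquiv.piLpCongrLeft 2 ℝ ℝ (finCongr h)).trans (stdOrthonormalBasis ℝ V).repr.symm)
  refine ⟨(WithLp.prodContinuousLinearEquiv 2 ℝ ℂ ℝ).symm.trans J.toContinuousLinearEquiv, fun v => ?_⟩
  have h1 : ‖J ((WithLp.prodContinuousLinearEquiv 2 ℝ ℂ ℝ).symm v)‖ ^ 2 = nsq v := by
    rw [J.norm_map, WithLp.prod_norm_sq_eq_of_L2]
    simp [nsq]
  exact h1

/-- Stereographic coordinates miss one pole; if `σ` is this pole, the axis is reversed. -/
theorem exists_isometry_ne (V : Type*) [NormedAddCommGroup V] [InnerProductSpace ℝ V]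
    [FiniteDimensional ℝ V] (hV : Module.finrank ℝ V = 3) {σ : V} (hσ : ‖σ‖ = 1) :
    ∃ L : (ℂ × ℝ) ≃L[ℝ] V, (∀ v, ‖L v‖ ^ 2 = nsq v) ∧ 0 < 1 + (L.symm σ).2 := by
  obtain ⟨L, hL⟩ := exists_isometry V hV
  have h1 : nsq (L.symm σ) = 1 := by rw [← hL, L.apply_symm_apply, hσ]; norm_num
  have h2 : (L.symm σ).2 ^ 2 ≤ 1 := by
    rw [← h1, nsq]; nlinarith [sq_nonneg ‖(L.symm σ).1‖]
  by_cases h : 0 < 1 + (L.symm σ).2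
  · exact ⟨L, hL, h⟩
  · let f : (ℂ × ℝ) ≃L[ℝ] (ℂ × ℝ) :=
      (ContinuousLinearEquiv.refl ℝ ℂ).prodCongr (ContinuousLinearEquiv.neg ℝ)
    refine ⟨f.trans L, fun v => ?_, ?_⟩
    · rw [ContinuousLinearEquiv.trans_apply, hL]
      simp [nsq, f]
    · have : ((f.trans L).symm σ).2 = -(L.symm σ).2 := by
        rw [ContinuousLinearEquiv.symm_trans_apply]
        rfl
      rw [this]
      nlinarith

theorem nsq_smul (c : ℝ) (v : ℂ × ℝ) : nsq (c • v) = c ^ 2 * nsq v := by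
  simp only [nsq, Prod.smul_fst, Prod.smul_snd, norm_smul, smul_eq_mul, Real.norm_eq_abs, mul_pow,
    sq_abs]
  ring

/-- The inverse of the stereographic projection. -/
def stereo (p : ℂ) : ℂ × ℝ := ((2 / (1 + ‖p‖ ^ 2)) • p, (1 - ‖p‖ ^ 2) / (1 + ‖p‖ ^ 2))

theorem one_add_sq_pos (p : ℂ) : 0 < 1 + ‖p‖ ^ 2 := by positivity

theorem nsq_stereo (p : ℂ) : nsq (stereo p) = 1 := by
  have := (one_add_sq_pos p).ne'
  simp only [nsq, stereo, norm_smul, Real.norm_eq_abs, mul_pow, sq_abs]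
  field_simp
  ring

theorem continuous_stereo : Continuous stereo := by
  have := fun p => (one_add_sq_pos p).ne'
  unfold stereo
  fun_prop (disch := assumption)

theorem stereo_snd (p : ℂ) : 1 + (stereo p).2 = 2 / (1 + ‖p‖ ^ 2) := by
  have := (one_add_sq_pos p).ne'
  simp only [stereo]
  field_simp
  ring

theorem inv_smul_stereo (p : ℂ) : (1 + (stereo p).2)⁻¹ • (stereo p).1 = p := by
  rw [stereo_snd]
  have := (one_add_sq_pos p).ne'
  simp only [stereo, smul_smul]
  rw [inv_mul_cancel₀ (by positivity), one_smul]

theorem stereo_inv {v : ℂ × ℝ} (hv : nsq v = 1) (h : 0 < 1 + v.2) :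
    stereo ((1 + v.2)⁻¹ • v.1) = v := by
  have h1 : ‖v.1‖ ^ 2 = (1 - v.2) * (1 + v.2) := by rw [nsq] at hv; linarith
  have h2 : ‖(1 + v.2)⁻¹ • v.1‖ ^ 2 = (1 - v.2) / (1 + v.2) := by
    rw [norm_smul, mul_pow, h1, norm_inv, Real.norm_of_nonneg h.le]
    field_simp
  have h3 : 1 + (1 - v.2) / (1 + v.2) = 2 / (1 + v.2) := by field_simp; ring
  refine Prod.ext ?_ ?_
  · simp only [stereo, h2, h3, smul_smul]
    rw [show 2 / (2 / (1 + v.2)) * (1 + v.2)⁻¹ = 1 by field_simp, one_smul]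
  · simp only [stereo, h2, h3]
    field_simp
    ring

theorem sqrt_nsq_smul_stereo {c : ℝ} (hc : 0 ≤ c) (p : ℂ) : √(nsq (c • stereo p)) = c := by
  rw [nsq_smul, nsq_stereo, mul_one, Real.sqrt_sq hc]

theorem continuous_nsq : Continuous nsq := by unfold nsq; fun_prop

/-- Polar coordinates of a ball. -/
def ballPolar : OpenPartialHomeomorph (ℂ × ℝ) (ℂ × ℝ) where
  toFun y := (1 + y.2) • stereo y.1
  invFun v := ((√(nsq v) + v.2)⁻¹ • v.1, √(nsq v) - 1)
  source := {y | y.2 ∈ Ioo (0 : ℝ) 1}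
  target := {v | √(nsq v) ∈ Ioo (1 : ℝ) 2 ∧ 0 < √(nsq v) + v.2}
  map_source' y hy := by
    have h1 := sqrt_nsq_smul_stereo (by linarith [hy.1] : 0 ≤ 1 + y.2) y.1
    have h2 : 0 < 1 + (stereo y.1).2 := by
      rw [stereo_snd]; have := one_add_sq_pos y.1; positivity
    simp only [mem_ofPred_eq, h1]
    refine ⟨⟨by linarith [hy.1], by linarith [hy.2]⟩, ?_⟩
    simp only [Prod.smul_snd, smul_eq_mul]
    nlinarith [hy.1]
  map_target' v hv := ⟨by linarith [hv.1.1], by linarith [hv.1.2]⟩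
  left_inv' y hy := by
    have h1 := sqrt_nsq_smul_stereo (by linarith [hy.1] : 0 ≤ 1 + y.2) y.1
    have h2 : 0 < 1 + y.2 := by linarith [hy.1]
    simp only [h1]
    refine Prod.ext ?_ (by simp)
    simp only [Prod.smul_snd, Prod.smul_fst, smul_eq_mul, smul_smul]
    refine Eq.trans ?_ (inv_smul_stereo y.1)
    congr 1
    rw [show 1 + y.2 + (1 + y.2) * (stereo y.1).2 = (1 + y.2) * (1 + (stereo y.1).2) by ring,
      mul_inv_rev, mul_assoc, inv_mul_cancel₀ h2.ne', mul_one]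
  right_inv' v hv := by
    have h0 : 0 < √(nsq v) := by linarith [hv.1.1]
    have h1 : nsq ((√(nsq v))⁻¹ • v) = 1 := by
      rw [nsq_smul, inv_pow, Real.sq_sqrt (Real.sqrt_pos.1 h0).le,
        inv_mul_cancel₀ (Real.sqrt_pos.1 h0).ne']
    have h2 : 0 < 1 + ((√(nsq v))⁻¹ • v).2 := by
      have : 1 + ((√(nsq v))⁻¹ • v).2 = (√(nsq v))⁻¹ * (√(nsq v) + v.2) := by
        simp only [Prod.smul_snd, smul_eq_mul]; field_simp
      rw [this]
      have := hv.2
      positivity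
    have h3 := stereo_inv h1 h2
    have h4 : (√(nsq v) + v.2)⁻¹ • v.1 = (1 + ((√(nsq v))⁻¹ • v).2)⁻¹ • ((√(nsq v))⁻¹ • v).1 := by
      simp only [Prod.smul_snd, Prod.smul_fst, smul_eq_mul, smul_smul]
      congr 1
      have := hv.2.ne'
      field_simp
    simp only [h4, h3, add_sub_cancel]
    rw [smul_inv_smul₀ h0.ne']
  open_source := isOpen_Ioo.preimage continuous_snd
  open_target := (isOpen_Ioo.preimage (Real.continuous_sqrt.comp continuous_nsq)).inter
    (isOpen_lt continuous_const ((Real.continuous_sqrt.comp continuous_nsq).add continuous_snd))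
  continuousOn_toFun := by
    have := continuous_stereo
    fun_prop
  continuousOn_invFun := by
    have h := Real.continuous_sqrt.comp continuous_nsq
    have h1 : ContinuousOn (fun v : ℂ × ℝ => √(nsq v) + v.2)
        {v | √(nsq v) ∈ Ioo (1 : ℝ) 2 ∧ 0 < √(nsq v) + v.2} := (h.add continuous_snd).continuousOn
    refine ContinuousOn.prodMk ((h1.inv₀ fun v hv => hv.2.ne').smul continuous_fst.continuousOn) ?_
    · exact (h.sub continuous_const).continuousOn

/-- The source is convex and the map is injective, so one point suffices. At the point over the
north pole the horizontal part of the increment is a positive multiple of the displacement, and the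
straight homotopy works. -/
theorem OP_ballPolar {x : ℂ × ℝ} (hx : x ∈ ballPolar.source) : OP ballPolar x := by
  have hU : Convex ℝ ballPolar.source := by
    have : ballPolar.source = univ ×ˢ Ioo (0 : ℝ) 1 := by ext y; simp [ballPolar]
    rw [this]
    exact convex_univ.prod (convex_Ioo 0 1)
  have h0 : ((0, 1 / 2) : ℂ × ℝ) ∈ ballPolar.source := by
    change (1 / 2 : ℝ) ∈ Ioo (0 : ℝ) 1
    constructor <;> norm_num
  refine OP.of_convex ballPolar.open_source hU ballPolar.continuousOn ballPolar.injOn h0 hx ?_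
  have hc : Continuous ballPolar := by
    have := continuous_stereo
    change Continuous fun y : ℂ × ℝ => (1 + y.2) • stereo y.1
    fun_prop
  refine OP.of_straight one_pos hc.continuousOn fun s hs v hv hv1 he => hv ?_
  have h2 : |v.2| < 1 := (norm_snd_le v).trans_lt hv1
  rw [abs_lt] at h2
  have hval : ∀ y, ballPolar y = (1 + y.2) • stereo y.1 := fun y => rfl
  have e1 := congrArg Prod.fst he
  have e2 := congrArg Prod.snd he
  simp only [hval, stereo, Prod.fst_add, Prod.snd_add, Prod.smul_fst, Prod.smul_snd, Prod.fst_sub,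
    Prod.snd_sub, zero_add, norm_zero, smul_zero, sub_zero, smul_smul, Prod.fst_zero, Prod.snd_zero,
    ← add_smul, smul_eq_mul] at e1 e2
  have hp := one_add_sq_pos v.1
  have h1 : v.1 = 0 := by
    refine (smul_eq_zero.1 e1).resolve_left (ne_of_gt ?_)
    have h3 : 0 < (1 + (1 / 2 + v.2)) * (2 / (1 + ‖v.1‖ ^ 2)) := mul_pos (by linarith) (by positivity)
    have h4 : 0 < (1 - s) + s * ((1 + (1 / 2 + v.2)) * (2 / (1 + ‖v.1‖ ^ 2))) := by
      rcases hs.1.eq_or_lt with rfl | hs0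
      · simp
      · have := mul_pos hs0 h3
        linarith [hs.2]
    convert h4 using 1
  refine Prod.ext h1 ?_
  rw [h1] at e2
  simp only [norm_zero] at e2
  change v.2 = 0
  linear_combination e2

theorem hasPolarPlots_ball (V : Type*) [NormedAddCommGroup V] [InnerProductSpace ℝ V]
    [FiniteDimensional ℝ V] (hV : Module.finrank ℝ V = 3) : HasPolarPlots Unit V := by
  rintro ⟨⟨⟩, σ⟩ r₀ hr₀
  have hσ : ‖(σ : V)‖ = 1 := mem_sphere_zero_iff_norm.1 σ.2
  obtain ⟨L, hL, hpos⟩ := exists_isometry_ne V hV hσ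
  have hLn : ∀ v, ‖L v‖ = √(nsq v) := fun v => by
    rw [← hL, Real.sqrt_sq (norm_nonneg _)]
  have hLs : ∀ p, ‖L (stereo p)‖ = 1 := fun p => by rw [hLn, nsq_stereo, Real.sqrt_one]
  let Ψ : OpenPartialHomeomorph (ℂ × ℝ) (Unit × V) :=
    (L.toHomeomorph.trans (Homeomorph.punitProd V).symm).toOpenPartialHomeomorph.trans
      (OpenPartialHomeomorph.ofSet (univ ×ˢ ball 0 2) (isOpen_univ.prod isOpen_ball))
  have hΨ : ∀ y, Ψ y = ((), L y) := fun y => rfl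
  refine ⟨Ψ, by simp [Ψ], fun p => ((), ⟨L (stereo p), mem_sphere_zero_iff_norm.2 (hLs p)⟩),
    ballPolar, (1 + (L.symm (σ : V)).2)⁻¹ • (L.symm (σ : V)).1, hr₀, OP_ballPolar hr₀, ?_, ?_⟩
  · refine Prod.ext rfl (Subtype.ext ?_)
    change L (stereo _) = _
    rw [stereo_inv (by rw [← hL, L.apply_symm_apply, hσ]; norm_num) hpos, L.apply_symm_apply]
  · intro y hy
    have hval : ballPolar y = (1 + y.2) • stereo y.1 := rfl
    refine ⟨hy, ?_, ?_⟩
    · refine ⟨mem_univ _, mem_univ _, mem_ball_zero_iff.2 ?_⟩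
      change ‖L (ballPolar y)‖ < 2
      rw [hLn, hval, sqrt_nsq_smul_stereo (by linarith [hy.1])]
      linarith [hy.2]
    · rw [hΨ, hval, map_smul]

open DecoratedGaussDiagram

/-! ### Polar coordinates of the solid torus -/

/-- The coordinate of the meridian disc of a solid torus of revolution. -/
def meridian (v : ℂ × ℝ) : ℂ := ⟨‖v.1‖ - 3, v.2⟩

theorem continuous_meridian : Continuous meridian := continuous_complex_mk (by fun_prop) (by fun_prop)

/-- The solid torus of revolution. -/
def torusPlot (w₀ σ₀ : Circle) : OpenPartialHomeomorph (ℂ × ℝ) (Circle × ℂ) where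
  toFun v := (w₀ * dir v.1, σ₀ * meridian v)
  invFun p := (((3 + ((σ₀⁻¹ : Circle) * p.2 : ℂ).re : ℝ) : ℂ) * ((w₀⁻¹ * p.1 : Circle) : ℂ),
    ((σ₀⁻¹ : Circle) * p.2 : ℂ).im)
  source := {v | ‖meridian v‖ < 2}
  target := univ ×ˢ ball 0 2
  map_source' v hv := by
    refine ⟨mem_univ _, mem_ball_zero_iff.2 ?_⟩
    rw [norm_mul, Circle.norm_coe, one_mul]
    exact hv
  map_target' p hp := by
    have h1 : ‖p.2‖ < 2 := mem_ball_zero_iff.1 hp.2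
    have h2 : ‖((σ₀⁻¹ : Circle) * p.2 : ℂ)‖ < 2 := by rwa [norm_mul, Circle.norm_coe, one_mul]
    have h3 := (abs_lt.1 ((Complex.abs_re_le_norm _).trans_lt h2)).1
    simp only [mem_ofPred_eq, meridian]
    rw [norm_mul_circle (by linarith), add_sub_cancel_left]
    exact h2
  left_inv' v hv := by
    simp only [mem_ofPred_eq] at hv
    have h1 : ((σ₀⁻¹ : Circle) * (σ₀ * meridian v) : ℂ) = meridian v := by
      rw [← mul_assoc, ← Circle.coe_mul, inv_mul_cancel, Circle.coe_one, one_mul]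
    simp only [h1, inv_mul_cancel_left]
    refine Prod.ext ?_ rfl
    simp only [meridian, add_sub_cancel]
    exact norm_mul_dir _
  right_inv' p hp := by
    have h1 : ‖p.2‖ < 2 := mem_ball_zero_iff.1 hp.2
    have h2 : ‖((σ₀⁻¹ : Circle) * p.2 : ℂ)‖ < 2 := by rwa [norm_mul, Circle.norm_coe, one_mul]
    have h3 := (abs_lt.1 ((Complex.abs_re_le_norm _).trans_lt h2)).1
    have h4 : 0 < 3 + ((σ₀⁻¹ : Circle) * p.2 : ℂ).re := by linarith
    simp only
    rw [dir_mul h4, mul_inv_cancel_left]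
    refine Prod.ext rfl ?_
    simp only [meridian]
    rw [norm_mul_circle h4.le, add_sub_cancel_left, Complex.eta, ← mul_assoc, ← Circle.coe_mul,
      mul_inv_cancel, Circle.coe_one, one_mul]
  open_source := isOpen_lt continuous_meridian.norm continuous_const
  open_target := isOpen_univ.prod isOpen_ball
  continuousOn_toFun := by
    refine ContinuousOn.prodMk (continuousOn_const.mul (continuousOn_dir.comp
      continuous_fst.continuousOn fun v hv => ?_)) ?_
    · rintro (h0 : v.1 = 0)
      simp only [mem_ofPred_eq, meridian, h0, norm_zero] at hv
      have := (abs_lt.1 ((Complex.abs_re_le_norm _).trans_lt hv)).1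
      simp at this
      linarith
    · exact (continuous_const.mul continuous_meridian).continuousOn
  continuousOn_invFun := by
    refine Continuous.continuousOn ?_
    fun_prop

/-- Polar coordinates of a solid torus of revolution. -/
def torusPolarFun (y : ℂ × ℝ) : ℂ × ℝ :=
  (((3 + (1 + y.2) * Real.cos y.1.im : ℝ) : ℂ) * Circle.exp y.1.re, (1 + y.2) * Real.sin y.1.im)

theorem continuous_torusPolarFun : Continuous torusPolarFun := by unfold torusPolarFun; fun_prop

theorem norm_torusPolarFun {y : ℂ × ℝ} (hy : y.2 ∈ Ioo (0 : ℝ) 1) : 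
    0 < 3 + (1 + y.2) * Real.cos y.1.im := by
  nlinarith [hy.1, hy.2, Real.neg_one_le_cos y.1.im]

theorem circle_exp_coe (φ : ℝ) : (Circle.exp φ : ℂ) = ⟨Real.cos φ, Real.sin φ⟩ := by
  rw [Circle.coe_exp]
  refine Complex.ext ?_ ?_
  · simp [Complex.exp_ofReal_mul_I_re]
  · simp [Complex.exp_ofReal_mul_I_im]

theorem meridian_torusPolarFun {y : ℂ × ℝ} (hy : y.2 ∈ Ioo (0 : ℝ) 1) :
    meridian (torusPolarFun y) = ((1 + y.2 : ℝ) : ℂ) * Circle.exp y.1.im := by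
  rw [meridian, torusPolarFun, norm_mul_circle (norm_torusPolarFun hy).le, circle_exp_coe]
  refine Complex.ext ?_ ?_ <;> simp

/-- The map is composed of polar coordinates in the meridian disc, permutations and rotations, and
polar coordinates around the axis. Angle zero is enough, because the rotations `w₀` and `σ₀` in
`torusPlot` bring any prescribed boundary point there. -/
theorem OP_torusPolarFun {r : ℝ} (hr : r ∈ Ioo (0 : ℝ) 1) : OP torusPolarFun (0, r) := by
  have h1 := OP.mul_const (c := -Complex.I) (by simp) ((0, r) : ℂ × ℝ)
  have h2 := OP.polar (α := 1) (β := 1) (γ := 1) (by norm_num) 1 0 0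
    (-Complex.I * ((0, r) : ℂ × ℝ).1, r) (by simp; linarith [hr.1])
  have h3 := h1.comp h2 (Continuous.continuousAt (by fun_prop))
  have h4 := h3.comp (OP.cyclic (α := 1) (β := 1) (γ := 1) (by norm_num) _)
    (Continuous.continuousAt (by simp only [Function.comp_def]; fun_prop))
  have h5 := h4.comp (OP.rot _) (Continuous.continuousAt (by
    simp only [Function.comp_def]
    exact (continuous_complex_mk (by fun_prop) (by fun_prop)).prodMk (by fun_prop)))
  have h6 := h5.comp (OP.mul_const (c := -1) (by simp) _) (Continuous.continuousAt (by
    simp only [Function.comp_def]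
    exact (continuous_complex_mk (by fun_prop) (by fun_prop)).prodMk (by fun_prop)))
  have h7 := h6.comp (OP.polar (α := 1) (β := 1) (γ := 1) (by norm_num) 3 0 0 _ ?_)
    (Continuous.continuousAt (by
      simp only [Function.comp_def]
      exact (continuous_const.mul (continuous_complex_mk (by fun_prop) (by fun_prop))).prodMk
        (by fun_prop)))
  · refine h7.congr (Filter.Eventually.of_forall fun y => ?_)
    simp only [Function.comp_def, torusPolarFun, circle_exp_coe]
    refine Prod.ext (Complex.ext ?_ ?_) ?_ <;> simp
  · simp
    linarith [hr.1]

theorem arg_mul_exp {ρ θ : ℝ} (hρ : 0 < ρ) (hθ : θ ∈ Ioo (-Real.pi) Real.pi) :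
    Complex.arg ((ρ : ℂ) * Circle.exp θ) = θ := by
  rw [Complex.arg_real_mul _ hρ, Circle.arg_exp hθ.1 hθ.2.le]

theorem mul_exp_mem_slitPlane {ρ θ : ℝ} (hρ : 0 < ρ) (hθ : θ ∈ Ioo (-Real.pi) Real.pi) :
    (ρ : ℂ) * Circle.exp θ ∈ Complex.slitPlane := by
  rw [Complex.mem_slitPlane_iff_arg, arg_mul_exp hρ hθ]
  exact ⟨hθ.2.ne, mul_ne_zero (by exact_mod_cast hρ.ne') (Circle.coe_ne_zero _)⟩

theorem arg_mem_of_slitPlane {z : ℂ} (hz : z ∈ Complex.slitPlane) :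
    Complex.arg z ∈ Ioo (-Real.pi) Real.pi :=
  ⟨Complex.neg_pi_lt_arg z, (Complex.arg_le_pi z).lt_of_ne (Complex.mem_slitPlane_iff_arg.1 hz).1⟩

/-- Local polar coordinates of a solid torus of revolution. -/
def torusPolar : OpenPartialHomeomorph (ℂ × ℝ) (ℂ × ℝ) where
  toFun := torusPolarFun
  invFun v := (⟨Complex.arg v.1, Complex.arg (meridian v)⟩, ‖meridian v‖ - 1)
  source := {y | (y.1.re ∈ Ioo (-Real.pi) Real.pi ∧ y.1.im ∈ Ioo (-Real.pi) Real.pi) ∧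
    y.2 ∈ Ioo (0 : ℝ) 1}
  target := {v | (v.1 ∈ Complex.slitPlane ∧ meridian v ∈ Complex.slitPlane) ∧
    ‖meridian v‖ ∈ Ioo (1 : ℝ) 2}
  map_source' y hy := by
    refine ⟨⟨mul_exp_mem_slitPlane (norm_torusPolarFun hy.2) hy.1.1, ?_⟩, ?_⟩ <;>
      simp only [meridian_torusPolarFun hy.2]
    · exact mul_exp_mem_slitPlane (by linarith [hy.2.1]) hy.1.2
    · rw [norm_mul_circle (by linarith [hy.2.1])]
      exact ⟨by linarith [hy.2.1], by linarith [hy.2.2]⟩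
  map_target' v hv := by
    refine ⟨⟨arg_mem_of_slitPlane hv.1.1, arg_mem_of_slitPlane hv.1.2⟩, ?_⟩
    exact ⟨by linarith [hv.2.1], by linarith [hv.2.2]⟩
  left_inv' y hy := by
    simp only [meridian_torusPolarFun hy.2]
    rw [norm_mul_circle (by linarith [hy.2.1]), arg_mul_exp (by linarith [hy.2.1]) hy.1.2,
      torusPolarFun, arg_mul_exp (norm_torusPolarFun hy.2) hy.1.1, add_sub_cancel_left]
  right_inv' v hv := by
    have h2 : (1 + (‖meridian v‖ - 1)) * Real.cos (Complex.arg (meridian v)) = ‖v.1‖ - 3 := by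
      simp [meridian]
    have h3 : (1 + (‖meridian v‖ - 1)) * Real.sin (Complex.arg (meridian v)) = v.2 := by
      simp [meridian]
    refine Prod.ext ?_ h3
    simp only [torusPolarFun]
    rw [h2, add_sub_cancel]
    exact norm_mul_dir _
  open_source := by
    refine ((isOpen_Ioo.preimage ?_).inter (isOpen_Ioo.preimage ?_)).inter (isOpen_Ioo.preimage ?_) <;>
      fun_prop
  open_target := by
    refine ((Complex.isOpen_slitPlane.preimage continuous_fst).inter
      (Complex.isOpen_slitPlane.preimage continuous_meridian)).inter
      (isOpen_Ioo.preimage continuous_meridian.norm)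
  continuousOn_toFun := continuous_torusPolarFun.continuousOn
  continuousOn_invFun := by
    refine ContinuousOn.prodMk ?_ (continuous_meridian.norm.sub continuous_const).continuousOn
    refine Complex.equivRealProdCLM.symm.continuous.comp_continuousOn
      (f := fun v : ℂ × ℝ => (Complex.arg v.1, Complex.arg (meridian v))) ?_
    refine ContinuousOn.prodMk (fun v hv => ?_) fun v hv => ?_
    · exact ((Complex.continuousAt_arg hv.1.1).comp (f := fun v : ℂ × ℝ => v.1)
        continuous_fst.continuousAt).continuousWithinAt
    · exact ((Complex.continuousAt_arg hv.1.2).comp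
        continuous_meridian.continuousAt).continuousWithinAt

instance : PreconnectedSpace (sphere (0 : ℂ) 1) := by
  refine Subtype.preconnectedSpace (isPreconnected_sphere ?_ _ _)
  rw [Complex.rank_real_complex]
  exact Nat.one_lt_ofNat

theorem hasPolarPlots_torus : HasPolarPlots Circle ℂ := by
  rintro ⟨w₀, σ₀⟩ r₀ hr₀
  have hσ : ∀ w : Circle, ‖(w : ℂ)‖ = 1 := Circle.norm_coe
  let σ₁ : Circle := ⟨σ₀, σ₀.2⟩
  have h0 : ((0, r₀) : ℂ × ℝ) ∈ torusPolar.source := by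
    refine ⟨⟨?_, ?_⟩, hr₀⟩ <;> simp [Real.pi_pos]
  refine ⟨torusPlot w₀ σ₁, rfl, fun z => (w₀ * Circle.exp z.re,
    ⟨(σ₁ * Circle.exp z.im : Circle), mem_sphere_zero_iff_norm.2 (hσ _)⟩), torusPolar, 0, h0,
    OP_torusPolarFun hr₀, ?_, ?_⟩
  · refine Prod.ext (by simp) (Subtype.ext ?_)
    simp only [Complex.zero_im, Circle.exp_zero, mul_one]
    rfl
  · intro y hy
    have hval : torusPolar y = torusPolarFun y := rfl
    refine ⟨hy.2, ?_, ?_⟩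
    · change ‖meridian (torusPolar y)‖ < 2
      rw [hval, meridian_torusPolarFun hy.2, norm_mul_circle (by linarith [hy.2.1])]
      linarith [hy.2.2]
    · change (w₀ * dir (torusPolarFun y).1, (σ₁ : ℂ) * meridian (torusPolarFun y)) = _
      rw [meridian_torusPolarFun hy.2]
      refine Prod.ext ?_ ?_
      · simp only [torusPolarFun]
        rw [dir_mul (norm_torusPolarFun hy.2)]
      · simp only [Circle.coe_mul, Complex.real_smul]
        ring

open DecoratedGaussDiagram

/-! ### Surfaces of small genus -/

/-- Without holes nothing is glued, and the space is the one-point compactification of the plane. -/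
theorem genusSurface_zero : Nonempty (sphere (0 : EuclideanSpace ℝ (Fin 3)) 1 ≃ₜ GenusSurface 0) := by
  let e : OnePoint ℂ ≃ₜ GenusSurface 0 :=
  { toFun := fun p => Quot.mk _ ⟨p, fun j hj => (Nat.not_lt_zero _ (show j < 0 by simp at hj)).elim⟩
    invFun := Quot.lift (fun p => p.1) (by rintro p q ⟨k, hk, -⟩; exact (Nat.not_lt_zero _ hk).elim)
    left_inv := fun p => rfl
    right_inv := by rintro ⟨p⟩; rfl
    continuous_toFun := continuous_quot_mk.comp (Continuous.subtype_mk continuous_id fun p j hj =>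
      (Nat.not_lt_zero _ (show j < 0 by simp at hj)).elim)
    continuous_invFun := continuous_quot_lift _ continuous_subtype_val }
  have h2 : Module.finrank ℝ ℂ + 1 = Fintype.card (Fin 3) := by simp [Complex.finrank_real_complex]
  exact ⟨(onePointEquivSphereOfFinrankEq h2).symm.trans e⟩


/-- The limit points of the pencil of circles spanned by the boundary circles of the sphere with
two holes. -/
def limPt : ℝ := (3 + √5) / 2

theorem limPt_bounds : 2 < limPt ∧ limPt < 3 := by
  have h1 : (2 : ℝ) < √5 := by rw [Real.lt_sqrt] <;> norm_num
  have h2 : √5 < 3 := by rw [Real.sqrt_lt'] <;> norm_num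
  constructor <;> rw [limPt] <;> linarith

theorem limPt_mul : (3 - limPt) * limPt = 1 := by
  have : √5 * √5 = 5 := Real.mul_self_sqrt (by norm_num)
  rw [limPt]
  linear_combination -(1 / 4) * this

theorem limPt_mul_complex : (3 - (limPt : ℂ)) * limPt = 1 := by exact_mod_cast limPt_mul

theorem normSq_real_add_mul {a b : ℝ} (u : ℂ) :
    ‖(a : ℂ) + b * u‖ ^ 2 = a ^ 2 + b ^ 2 * ‖u‖ ^ 2 + 2 * a * b * u.re := by
  simp only [← Complex.normSq_eq_norm_sq, Complex.normSq_apply, Complex.add_re, Complex.mul_re,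
    Complex.ofReal_re, Complex.ofReal_im, Complex.add_im, Complex.mul_im]
  ring

/-- The coordinate with values in an annulus on the sphere with two holes. -/
theorem annulus_iff {u z : ℂ} (hz : z * (u - 1) = limPt * u - (3 - limPt)) (hu : u ≠ 1) :
    ((1 ≤ ‖z‖ ↔ 3 - limPt ≤ ‖u‖) ∧ (1 ≤ ‖z - 3‖ ↔ ‖u‖ ≤ limPt)) := by
  obtain ⟨h1, h2⟩ := limPt_bounds
  have h3 := limPt_mul
  have h0 : 0 < ‖u - 1‖ := norm_pos_iff.2 (sub_ne_zero.2 hu)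
  have e0 : ‖u - 1‖ ^ 2 = 1 + ‖u‖ ^ 2 - 2 * u.re := by
    have := normSq_real_add_mul (a := -1) (b := 1) u
    push_cast at this
    rw [one_mul, neg_add_eq_sub] at this
    rw [this]; ring
  have e1 : ‖z * (u - 1)‖ ^ 2 = (3 - limPt) ^ 2 + limPt ^ 2 * ‖u‖ ^ 2 - 2 * u.re := by
    have := normSq_real_add_mul (a := -(3 - limPt)) (b := limPt) u
    rw [hz, show (limPt : ℂ) * u - (3 - limPt) = ((-(3 - limPt) : ℝ) : ℂ) + limPt * u by
      push_cast; ring, this]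
    linear_combination (-2 * u.re) * h3
  have e2 : ‖(z - 3) * (u - 1)‖ ^ 2 = limPt ^ 2 + (3 - limPt) ^ 2 * ‖u‖ ^ 2 - 2 * u.re := by
    have := normSq_real_add_mul (a := limPt) (b := -(3 - limPt)) u
    rw [show (z - 3) * (u - 1) = ((limPt : ℝ) : ℂ) + ((-(3 - limPt) : ℝ) : ℂ) * u by
      push_cast; linear_combination hz, this]
    linear_combination (-2 * u.re) * h3
  have hq : 0 < limPt ^ 2 - 1 := by nlinarith
  have hp : 0 < 3 - limPt := by linarith
  -- Clearing the denominator `u - 1` turns the conditions into inequalities between squared norms;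
  -- their terms in the real part of `u` agree because of `limPt_mul`.
  have key : ∀ x : ℂ, 1 ≤ ‖x‖ ↔ ‖u - 1‖ ^ 2 ≤ ‖x * (u - 1)‖ ^ 2 := fun x => by
    rw [norm_mul, pow_le_pow_iff_left₀ h0.le (by positivity) two_ne_zero, le_mul_iff_one_le_left h0]
  rw [key, key, e0, e1, e2]
  have f1 : (3 - limPt) ^ 2 + limPt ^ 2 * ‖u‖ ^ 2 - 2 * u.re - (1 + ‖u‖ ^ 2 - 2 * u.re) =
      (limPt ^ 2 - 1) * (‖u‖ ^ 2 - (3 - limPt) ^ 2) := by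
    linear_combination ((3 - limPt) * limPt + 1) * h3
  have f2 : limPt ^ 2 + (3 - limPt) ^ 2 * ‖u‖ ^ 2 - 2 * u.re - (1 + ‖u‖ ^ 2 - 2 * u.re) =
      (limPt ^ 2 - 1) * (1 - (3 - limPt) ^ 2 * ‖u‖ ^ 2) := by
    linear_combination ((3 - limPt) * limPt + 1) * ‖u‖ ^ 2 * h3
  rw [← sub_nonneg, f1, ← sub_nonneg (b := 1 + ‖u‖ ^ 2 - 2 * u.re), f2, mul_nonneg_iff_of_pos_left hq,
    mul_nonneg_iff_of_pos_left hq, sub_nonneg, sub_nonneg,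
    pow_le_pow_iff_left₀ hp.le (norm_nonneg _) two_ne_zero, ← mul_pow]
  refine ⟨Iff.rfl, ?_⟩
  rw [sq_le_one_iff₀ (by positivity)]
  constructor
  · intro h
    nlinarith [norm_nonneg u]
  · intro h
    nlinarith [norm_nonneg u]

/-- An automorphism of the unit circle. -/
def moeb (a : ℝ) (t : ℂ) : ℂ := (t + a) / (1 + a * t)

theorem moeb_denom {a : ℝ} (ha : |a| < 1) {t : ℂ} (ht : ‖t‖ = 1) : 1 + a * t ≠ 0 := by
  intro h
  have h1 : ‖(a : ℂ) * t‖ = 1 := by rw [eq_neg_of_add_eq_zero_right h, norm_neg, norm_one]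
  rw [norm_mul, ht, mul_one, Complex.norm_real, Real.norm_eq_abs] at h1
  exact ha.ne h1

theorem norm_moeb {a : ℝ} (ha : |a| < 1) {t : ℂ} (ht : ‖t‖ = 1) : ‖moeb a t‖ = 1 := by
  rw [moeb, norm_div, div_eq_one_iff_eq (norm_ne_zero_iff.2 (moeb_denom ha ht)),
    ← sq_eq_sq₀ (norm_nonneg _) (norm_nonneg _)]
  have h1 := normSq_real_add_mul (a := a) (b := 1) t
  have h2 := normSq_real_add_mul (a := 1) (b := a) t
  push_cast at h1 h2
  rw [one_mul, add_comm] at h1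
  rw [h1, h2, ht]
  ring

theorem moeb_moeb {a : ℝ} (ha : |a| < 1) {t : ℂ} (ht : ‖t‖ = 1) : moeb (-a) (moeb a t) = t := by
  have h1 := moeb_denom ha ht
  have h2 := moeb_denom (a := -a) (by rwa [abs_neg]) (norm_moeb ha ht)
  rw [moeb, div_eq_iff h2]
  have hm : moeb a t * (1 + a * t) = t + a := div_mul_cancel₀ _ h1
  push_cast
  linear_combination hm

/-- The radius of the circle at the level `ρ` of the annulus. -/
def annRadius (ρ : ℝ) : ℝ := Real.exp ((2 * ρ - 1) * Real.log limPt)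

theorem annRadius_zero : annRadius 0 = 3 - limPt := by
  have := limPt_bounds.1
  rw [annRadius, show (2 * 0 - 1) * Real.log limPt = -Real.log limPt by ring, Real.exp_neg,
    Real.exp_log (by linarith), eq_inv_of_mul_eq_one_left limPt_mul]

theorem annRadius_one : annRadius 1 = limPt := by
  have := limPt_bounds.1
  rw [annRadius, show (2 * 1 - 1) * Real.log limPt = Real.log limPt by ring,
    Real.exp_log (by linarith)]

theorem annRadius_strictMono : StrictMono annRadius := fun x y h => by
  have := Real.log_pos (by linarith [limPt_bounds.1] : 1 < limPt)
  exact Real.exp_lt_exp.2 (by nlinarith)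

theorem annRadius_mem {ρ : ℝ} (hρ : ρ ∈ Icc (0 : ℝ) 1) :
    annRadius ρ ∈ Icc (3 - limPt) limPt := by
  have h := annRadius_strictMono.monotone
  have h0 := h hρ.1
  have h1 := h hρ.2
  rw [annRadius_zero] at h0
  rw [annRadius_one] at h1
  exact ⟨h0, h1⟩

theorem exists_annRadius {x : ℝ} (hx : x ∈ Icc (3 - limPt) limPt) :
    ∃ ρ ∈ Icc (0 : ℝ) 1, annRadius ρ = x := by
  rw [← annRadius_zero] at hx
  have : x ∈ Icc (annRadius 0) (annRadius 1) := ⟨hx.1, by rw [annRadius_one]; exact hx.2⟩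
  exact intermediate_value_Icc zero_le_one
    (show Continuous annRadius by unfold annRadius; fun_prop).continuousOn this

/-- The coordinate of the sphere with two holes. -/
def twoHoles (ρ : ℝ) (y : Circle) : ℂ :=
  annRadius ρ * moeb (3 - limPt) ((y * Circle.exp (-(Real.pi * (1 - ρ))) : Circle) : ℂ)

theorem abs_limPt : |3 - limPt| < 1 := by
  have := limPt_bounds
  rw [abs_lt]; constructor <;> linarith

theorem annRadius_pos (ρ : ℝ) : 0 < annRadius ρ := Real.exp_pos _

theorem norm_twoHoles (ρ : ℝ) (y : Circle) : ‖twoHoles ρ y‖ = annRadius ρ := by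
  rw [twoHoles, norm_mul, norm_moeb abs_limPt (Circle.norm_coe _), mul_one, Complex.norm_real,
    Real.norm_of_nonneg (annRadius_pos ρ).le]

theorem continuous_twoHoles : Continuous fun k : ℝ × Circle => twoHoles k.1 k.2 := by
  have h1 : ∀ k : ℝ × Circle, 1 + ((3 - limPt : ℝ) : ℂ) *
      ((k.2 * Circle.exp (-(Real.pi * (1 - k.1))) : Circle) : ℂ) ≠ 0 := fun k =>
    moeb_denom abs_limPt (Circle.norm_coe _)
  simp only [twoHoles, moeb, annRadius]
  exact (by fun_prop : Continuous fun k : ℝ × Circle =>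
    ((Real.exp ((2 * k.1 - 1) * Real.log limPt) : ℝ) : ℂ)).mul
    (Continuous.div (by fun_prop) (by fun_prop) h1)

theorem twoHoles_injective {ρ ρ' : ℝ} {y y' : Circle} (h : twoHoles ρ y = twoHoles ρ' y') :
    ρ = ρ' ∧ y = y' := by
  obtain rfl : ρ = ρ' := annRadius_strictMono.injective (by rw [← norm_twoHoles ρ y, h, norm_twoHoles])
  refine ⟨rfl, ?_⟩
  have h1 := mul_left_cancel₀ (by exact_mod_cast (annRadius_pos ρ).ne' : (annRadius ρ : ℂ) ≠ 0) h
  have h2 := congrArg (moeb (-(3 - limPt))) h1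
  rw [moeb_moeb abs_limPt (Circle.norm_coe _), moeb_moeb abs_limPt (Circle.norm_coe _)] at h2
  exact mul_right_cancel (Circle.coe_injective h2)

theorem exists_twoHoles {u : ℂ} (hu : ‖u‖ ∈ Icc (3 - limPt) limPt) :
    ∃ ρ ∈ Icc (0 : ℝ) 1, ∃ y, twoHoles ρ y = u := by
  obtain ⟨ρ, hρ, h⟩ := exists_annRadius hu
  have ha : |-(3 - limPt)| < 1 := by rw [abs_neg]; exact abs_limPt
  have hd : ‖(dir u : ℂ)‖ = 1 := Circle.norm_coe _
  let t : Circle := ⟨moeb (-(3 - limPt)) (dir u), mem_sphere_zero_iff_norm.2 (norm_moeb ha hd)⟩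
  refine ⟨ρ, hρ, t * Circle.exp (Real.pi * (1 - ρ)), ?_⟩
  have h1 : t * Circle.exp (Real.pi * (1 - ρ)) * Circle.exp (-(Real.pi * (1 - ρ))) = t := by
    rw [Circle.exp_neg, mul_inv_cancel_right]
  have h2 := moeb_moeb ha hd
  rw [neg_neg] at h2
  rw [twoHoles, h1, h]
  change (‖u‖ : ℂ) * moeb (3 - limPt) (moeb (-(3 - limPt)) (dir u)) = u
  rw [h2, norm_mul_dir]

/-- The point of the sphere with the coordinate `u`. -/
def pencilPt (u : ℂ) : OnePoint ℂ := invPlot limPt ((u - 1) / (2 * limPt - 3))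

theorem limPt_ne : (2 * (limPt : ℂ) - 3) ≠ 0 := by
  have : (2 * limPt - 3 : ℝ) ≠ 0 := by linarith [limPt_bounds.1]
  exact_mod_cast this

theorem pencilPt_eq_coe_iff {u z : ℂ} :
    pencilPt u = z ↔ u ≠ 1 ∧ z * (u - 1) = limPt * u - (3 - limPt) := by
  have h0 := limPt_ne
  rw [pencilPt]
  by_cases hu : u = 1
  · simp [hu, invPlot_zero]
  have h1 : u - 1 ≠ 0 := sub_ne_zero.2 hu
  rw [invPlot_of_ne _ (div_ne_zero h1 h0), OnePoint.coe_eq_coe, and_iff_right hu, inv_div,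
    ← eq_sub_iff_add_eq', div_eq_iff h1]
  constructor <;> intro h <;> linear_combination -h

theorem pencilPt_mem_iff {u : ℂ} (hu : ‖u‖ ∈ Icc (3 - limPt) limPt) :
    ∀ j ∈ ({j | j < 2 * 1} : Set ℕ), ∀ z : ℂ, pencilPt u = z → 1 ≤ ‖z - 3 * (j : ℂ)‖ := by
  intro j hj z hz
  obtain ⟨h1, h2⟩ := pencilPt_eq_coe_iff.1 hz
  have hj : j < 2 := hj
  obtain ⟨h3, h4⟩ := annulus_iff h2 h1
  interval_cases j
  · simpa using h3.2 hu.1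
  · simpa using h4.2 hu.2

theorem exists_pencilPt (p : HoledSphere {j | j < 2 * 1}) :
    ∃ u, ‖u‖ ∈ Icc (3 - limPt) limPt ∧ p.1 = pencilPt u := by
  obtain ⟨p, hp⟩ := p
  have h0 := limPt_ne
  have hl := limPt_bounds
  induction p using OnePoint.rec with
  | infty =>
    refine ⟨1, ?_, ?_⟩
    · rw [norm_one]; constructor <;> linarith
    · simp [pencilPt, invPlot_zero]
  | coe z =>
    have h3 := hp 0 (by simp) z rfl
    have h4 := hp 1 (by simp) z rfl
    simp only [Nat.cast_zero, mul_zero, sub_zero, Nat.cast_one, mul_one] at h3 h4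
    have hz : z - limPt ≠ 0 := by
      intro h
      rw [sub_eq_zero.1 h, show (limPt : ℂ) - 3 = ((limPt - 3 : ℝ) : ℂ) by push_cast; ring,
        Complex.norm_real, Real.norm_eq_abs, abs_sub_comm] at h4
      exact absurd h4 (not_le.2 abs_limPt)
    have h1 : (z - (3 - limPt)) / (z - limPt) ≠ 1 := by
      rw [Ne, div_eq_one_iff_eq hz]
      intro h
      exact h0 (by linear_combination h)
    have h2 : z * ((z - (3 - limPt)) / (z - limPt) - 1) =
        limPt * ((z - (3 - limPt)) / (z - limPt)) - (3 - limPt) := by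
      field_simp
      ring
    obtain ⟨h5, h6⟩ := annulus_iff h2 h1
    exact ⟨_, ⟨h5.1 h3, h6.1 h4⟩, (pencilPt_eq_coe_iff.2 ⟨h1, h2⟩).symm⟩

theorem pencilPt_injective : Function.Injective pencilPt := fun u u' h => by
  have h1 := (invPlot limPt).injOn (mem_univ _) (mem_univ _) h
  have := (div_left_inj' limPt_ne).1 h1
  linear_combination this

theorem continuous_pencilPt : Continuous pencilPt :=
  (continuousOn_univ.1 (invPlot limPt).continuousOn).comp
    (by fun_prop : Continuous fun u : ℂ => (u - 1) / (2 * limPt - 3))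

/-- The Möbius factor in `twoHoles` and its twist, a half turn at `ρ = 0` that has unwound at `ρ =
1`, are chosen for this formula and `pencilPt_twoHoles_one`. With them the gluing of the two
boundary circles becomes the identity of the second coordinate. -/
theorem pencilPt_twoHoles_zero (y : Circle) :
    pencilPt (twoHoles 0 y) = ((y : ℂ) : OnePoint ℂ) := by
  have hn := norm_twoHoles 0 y
  have hl := limPt_bounds
  refine pencilPt_eq_coe_iff.2 ⟨fun h => ?_, ?_⟩
  · rw [h, norm_one, annRadius_zero] at hn
    linarith
  · have h1 := moeb_denom abs_limPt (t := -(y : ℂ)) (by rw [norm_neg]; exact Circle.norm_coe y)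
    have h2 : ((y * Circle.exp (-(Real.pi * (1 - 0))) : Circle) : ℂ) = -y := by
      rw [sub_zero, mul_one, Circle.coe_mul, Circle.coe_exp, Complex.ofReal_neg, neg_mul,
        Complex.exp_neg, Complex.exp_pi_mul_I, inv_neg, inv_one, mul_neg_one]
    have hm : moeb (3 - limPt) (-y) * (1 + (3 - limPt : ℝ) * (-(y : ℂ))) = -y + (3 - limPt : ℝ) :=
      div_mul_cancel₀ _ h1
    rw [twoHoles, h2, annRadius_zero]
    have h3 := limPt_mul_complex
    refine mul_left_cancel₀ h1 ?_
    push_cast at hm ⊢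
    linear_combination (y * (3 - limPt) - limPt * (3 - limPt) : ℂ) * hm -
      (-(y : ℂ) + (3 - limPt)) * h3

theorem pencilPt_twoHoles_one (y : Circle) :
    pencilPt (twoHoles 1 y) = ((3 + (y⁻¹ : Circle) : ℂ) : OnePoint ℂ) := by
  have hn := norm_twoHoles 1 y
  have hl := limPt_bounds
  refine pencilPt_eq_coe_iff.2 ⟨fun h => ?_, ?_⟩
  · rw [h, norm_one, annRadius_one] at hn
    linarith
  · have h1 := moeb_denom abs_limPt (t := (y : ℂ)) (Circle.norm_coe y)
    have h2 : ((y * Circle.exp (-(Real.pi * (1 - 1))) : Circle) : ℂ) = y := by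
      rw [sub_self, mul_zero, neg_zero, Circle.exp_zero, mul_one]
    have hm : moeb (3 - limPt) y * (1 + (3 - limPt : ℝ) * (y : ℂ)) = y + (3 - limPt : ℝ) :=
      div_mul_cancel₀ _ h1
    rw [twoHoles, h2, annRadius_one, Circle.coe_inv]
    have h3 := limPt_mul_complex
    have h4 : (y : ℂ) * (y : ℂ)⁻¹ = 1 := mul_inv_cancel₀ (Circle.coe_ne_zero y)
    refine mul_left_cancel₀ (mul_ne_zero (Circle.coe_ne_zero y) h1) ?_
    push_cast at hm ⊢
    linear_combination ((3 * y + 1) * limPt - limPt ^ 2 * y : ℂ) * hm +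
      (limPt * moeb (3 - limPt) y - 1) * (1 + (3 - limPt) * (y : ℂ)) * h4 +
      (1 + (3 - limPt) * (y : ℂ)) * h3

open DecoratedGaussDiagram

/-- The parametrization of the sphere with two holes. -/
def twoHoledPt (k : Icc (0 : ℝ) 1 × Circle) : HoledSphere {j | j < 2 * 1} :=
  ⟨pencilPt (twoHoles k.1 k.2), pencilPt_mem_iff (by rw [norm_twoHoles]; exact annRadius_mem k.1.2)⟩

theorem continuous_twoHoledPt : Continuous twoHoledPt :=
  Continuous.subtype_mk (continuous_pencilPt.comp (continuous_twoHoles.comp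
    (f := fun k : Icc (0 : ℝ) 1 × Circle => ((k.1 : ℝ), k.2)) (by fun_prop))) _

theorem twoHoledPt_injective : Function.Injective twoHoledPt := fun k k' h => by
  obtain ⟨h1, h2⟩ := twoHoles_injective (pencilPt_injective (congrArg Subtype.val h))
  exact Prod.ext (Subtype.ext h1) h2

theorem twoHoledPt_surjective : Function.Surjective twoHoledPt := fun p => by
  obtain ⟨u, hu, hp⟩ := exists_pencilPt p
  obtain ⟨ρ, hρ, y, rfl⟩ := exists_twoHoles hu
  exact ⟨(⟨ρ, hρ⟩, y), Subtype.ext hp.symm⟩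

theorem isBoundaryPoint_zero_iff {p : HoledSphere {j | j < 2 * 1}} {w : Circle} :
    p.IsBoundaryPoint (2 * 0) w ↔ twoHoledPt (0, w) = p := by
  have h : twoHoledPt (0, w) = p ↔ pencilPt (twoHoles 0 w) = p.1 := Subtype.ext_iff
  rw [HoledSphere.IsBoundaryPoint, h, pencilPt_twoHoles_zero, eq_comm]
  simp

theorem isBoundaryPoint_one_iff {p : HoledSphere {j | j < 2 * 1}} {w : Circle} :
    p.IsBoundaryPoint (2 * 0 + 1) w⁻¹ ↔ twoHoledPt (1, w) = p := by
  have h : twoHoledPt (1, w) = p ↔ pencilPt (twoHoles 1 w) = p.1 := Subtype.ext_iff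
  rw [HoledSphere.IsBoundaryPoint, h, pencilPt_twoHoles_one, eq_comm]
  simp

theorem genusSurface_one_rel_iff (p q : HoledSphere {j | j < 2 * 1}) :
    (∃ k < 1, ∃ w : Circle, p.IsBoundaryPoint (2 * k) w ∧ q.IsBoundaryPoint (2 * k + 1) w⁻¹) ↔
      ∃ w, twoHoledPt (0, w) = p ∧ twoHoledPt (1, w) = q := by
  constructor
  · rintro ⟨k, hk, w, h1, h2⟩
    obtain rfl : k = 0 := by omega
    exact ⟨w, isBoundaryPoint_zero_iff.1 h1, isBoundaryPoint_one_iff.1 h2⟩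
  · rintro ⟨w, h1, h2⟩
    exact ⟨0, one_pos, w, isBoundaryPoint_zero_iff.2 h1, isBoundaryPoint_one_iff.2 h2⟩

theorem genusSurface_one_isGluing : IsGluing fun p q : HoledSphere {j | j < 2 * 1} =>
    ∃ k < 1, ∃ w : Circle, p.IsBoundaryPoint (2 * k) w ∧ q.IsBoundaryPoint (2 * k + 1) w⁻¹ := by
  refine IsGluing.of_compact (K := Circle) (f := fun w => twoHoledPt (0, w))
    (g := fun w => twoHoledPt (1, w)) (continuous_twoHoledPt.comp (by fun_prop))
    (continuous_twoHoledPt.comp (by fun_prop)) genusSurface_one_rel_iff (fun w w' => ?_)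
    fun w w' h => ?_
  · rw [twoHoledPt_injective.eq_iff, twoHoledPt_injective.eq_iff]
    simp
  · have := congrArg Prod.fst (twoHoledPt_injective h)
    simp at this

instance : T2Space (GenusSurface 1) := genusSurface_one_isGluing.t2Space

/-- The closed orientable surface of genus one is a torus. -/
theorem genusSurface_one : Nonempty (Circle × Circle ≃ₜ GenusSurface 1) := by
  -- The torus and the genus one surface are both quotients of the product of an interval and a
  -- circle, with the same fibres: the two ends are glued by the identity of the circle.
  let f : C(Icc (0 : ℝ) 1 × Circle, Circle × Circle) :=
    ⟨fun k => (Circle.exp (2 * Real.pi * k.1), k.2), by fun_prop⟩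
  let g : C(Icc (0 : ℝ) 1 × Circle, GenusSurface 1) :=
    ⟨fun k => Quot.mk _ (twoHoledPt k), continuous_quot_mk.comp continuous_twoHoledPt⟩
  have hf : Function.Surjective f := by
    rintro ⟨w, y⟩
    obtain ⟨θ, rfl⟩ := Circle.exp_surjective w
    refine ⟨(⟨Int.fract (θ / (2 * Real.pi)), Int.fract_nonneg _, (Int.fract_lt_one _).le⟩, y),
      Prod.ext ?_ rfl⟩
    refine Circle.exp_eq_exp.2 ⟨-⌊θ / (2 * Real.pi)⌋, ?_⟩
    have h3 := Int.floor_add_fract (θ / (2 * Real.pi))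
    have h4 : (2 * Real.pi) * (θ / (2 * Real.pi)) = θ := by field_simp
    push_cast
    linear_combination (2 * Real.pi) * h3 + h4
  have hg : Function.Surjective g := by
    rintro ⟨p⟩
    obtain ⟨k, rfl⟩ := twoHoledPt_surjective p
    exact ⟨k, rfl⟩
  have hfg : ∀ k k', f k = f k' ↔ g k = g k' := by
    rintro ⟨ρ, y⟩ ⟨ρ', y'⟩
    have h1 : g (ρ, y) = g (ρ', y') ↔ (ρ, y) = (ρ', y') ∨
        (∃ w, (0, w) = (ρ, y) ∧ (1, w) = (ρ', y')) ∨ ∃ w, (0, w) = (ρ', y') ∧ (1, w) = (ρ, y) := by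
      refine genusSurface_one_isGluing.mk_eq_iff.trans ?_
      rw [twoHoledPt_injective.eq_iff, genusSurface_one_rel_iff, genusSurface_one_rel_iff]
      simp only [twoHoledPt_injective.eq_iff]
    rw [h1]
    have h2 : Circle.exp (2 * Real.pi * ρ) = Circle.exp (2 * Real.pi * ρ') ↔
        ∃ m : ℤ, (ρ : ℝ) = ρ' + m := by
      simpa using GaussDiagram.circle_exp_eq_iff one_pos (x := ρ) (y := ρ')
    simp only [f, ContinuousMap.coe_mk, Prod.mk.injEq, h2]
    constructor
    · rintro ⟨⟨m, hm⟩, rfl⟩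
      have h3 : (-1 : ℝ) ≤ m := by linarith [ρ.2.1, ρ'.2.2]
      have h4 : (m : ℝ) ≤ 1 := by linarith [ρ.2.2, ρ'.2.1]
      have h3' : (-1 : ℤ) ≤ m := by exact_mod_cast h3
      have h4' : m ≤ 1 := by exact_mod_cast h4
      interval_cases m <;> push_cast at hm
      · right; left
        refine ⟨y, ⟨Subtype.ext ?_, rfl⟩, Subtype.ext ?_, rfl⟩
        · rw [Icc.coe_zero]; linarith [ρ.2.1, ρ'.2.2]
        · rw [Icc.coe_one]; linarith [ρ.2.1, ρ'.2.2]
      · exact Or.inl ⟨Subtype.ext (by linarith), rfl⟩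
      · right; right
        refine ⟨y, ⟨Subtype.ext ?_, rfl⟩, Subtype.ext ?_, rfl⟩
        · rw [Icc.coe_zero]; linarith [ρ.2.2, ρ'.2.1]
        · rw [Icc.coe_one]; linarith [ρ.2.2, ρ'.2.1]
    · rintro (⟨rfl, rfl⟩ | ⟨w, ⟨rfl, rfl⟩, rfl, rfl⟩ | ⟨w, ⟨rfl, rfl⟩, rfl, rfl⟩)
      · exact ⟨⟨0, by simp⟩, rfl⟩
      · exact ⟨⟨-1, by simp⟩, rfl⟩
      · exact ⟨⟨1, by simp⟩, rfl⟩
  have hqf : Topology.IsQuotientMap f := f.continuous.isClosedMap.isQuotientMap f.continuous hf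
  have hqg : Topology.IsQuotientMap g := g.continuous.isClosedMap.isQuotientMap g.continuous hg
  have h1 : ∀ k, hqf.lift g (fun k k' => (hfg k k').1) (f k) = g k := fun k =>
    DFunLike.congr_fun (hqf.lift_comp g fun k k' => (hfg k k').1) k
  have h2 : ∀ k, hqg.lift f (fun k k' => (hfg k k').2) (g k) = f k := fun k =>
    DFunLike.congr_fun (hqg.lift_comp f fun k k' => (hfg k k').2) k
  exact ⟨⟨⟨hqf.lift g fun k k' => (hfg k k').1, hqg.lift f fun k k' => (hfg k k').2,
    hf.forall.2 fun k => by rw [h1, h2], hg.forall.2 fun k => by rw [h2, h1]⟩,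
    ContinuousMap.continuous _, ContinuousMap.continuous _⟩⟩

open DecoratedGaussDiagram

/-! ### Fillings as quotient spaces, and knot exteriors -/

section FillGluing

variable {T W X Y ι : Type*} [TopologicalSpace T] [CompactSpace T] [T2Space T]
  [NormedAddCommGroup W] [NormedSpace ℝ W] [ProperSpace W] [TopologicalSpace X] [CompactSpace X]
  [T2Space X] [TopologicalSpace Y] [CompactSpace Y] [T2Space Y] [Finite ι]

/-- The relation `r` glues the pieces `j i` to `X` along the boundaries of the collars `κ i`. -/
structure FillData (κ : ι → (T × sphere (0 : W) 1) × Icc (0 : ℝ) 1 → X)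
    (j : ι → T × closedBall (0 : W) 1 → Y) (r : X ⊕ Y → X ⊕ Y → Prop) : Prop where
  contCollar : ∀ i, Continuous (κ i)
  injCollar : ∀ i, Function.Injective (κ i)
  openCollar : ∀ i, IsOpen (κ i '' {k | k.2 < 1})
  disjCollar : ∀ i j k k', k.2 < 1 → k'.2 < 1 → κ i k = κ j k' → i = j
  contPiece : ∀ i, Continuous (j i)
  injPiece : ∀ i i' p q, j i p = j i' q → i = i' ∧ p = q
  surjPiece : ∀ y, ∃ i p, j i p = y
  rel : ∀ a b, r a b ↔ ∃ i, ∃ k : T × sphere (0 : W) 1, Sum.inl (κ i (k, 0)) = a ∧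
    Sum.inr (j i (k.1, ⟨k.2, sphere_subset_closedBall k.2.2⟩)) = b

variable {κ : ι → (T × sphere (0 : W) 1) × Icc (0 : ℝ) 1 → X}
  {j : ι → T × closedBall (0 : W) 1 → Y} {r : X ⊕ Y → X ⊕ Y → Prop}

theorem FillData.isGluing (h : FillData κ j r) : IsGluing r := by
  have h01 : (0 : Icc (0 : ℝ) 1) < 1 := zero_lt_one
  refine IsGluing.of_compact (K := Σ _ : ι, T × sphere (0 : W) 1)
    (f := fun k => Sum.inl (κ k.1 (k.2, 0)))
    (g := fun k => Sum.inr (j k.1 (k.2.1, ⟨k.2.2, sphere_subset_closedBall k.2.2.2⟩))) ?_ ?_ ?_ ?_ ?_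
  · exact continuous_sigma fun i => continuous_inl.comp ((h.contCollar i).comp (by fun_prop))
  · exact continuous_sigma fun i => continuous_inr.comp ((h.contPiece i).comp (by fun_prop))
  · intro a b
    rw [h.rel]
    constructor
    · rintro ⟨i, k, h1, h2⟩
      exact ⟨⟨i, k⟩, h1, h2⟩
    · rintro ⟨⟨i, k⟩, h1, h2⟩
      exact ⟨i, k, h1, h2⟩
  · rintro ⟨i, k⟩ ⟨i', k'⟩
    rw [Sum.inl_injective.eq_iff, Sum.inr_injective.eq_iff]
    constructor
    · intro he
      obtain rfl := h.disjCollar _ _ (k, 0) (k', 0) h01 h01 he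
      obtain rfl := (Prod.mk.inj (h.injCollar _ he)).1
      rfl
    · intro he
      obtain ⟨h1, h2⟩ := h.injPiece _ _ _ _ he
      dsimp only at h1 h2
      subst h1
      obtain ⟨h3, h4⟩ := Prod.mk.inj h2
      have : k = k' := Prod.ext h3 (Subtype.ext (Subtype.mk.inj h4))
      rw [this]
  · rintro _ _ ⟨⟩

theorem FillData.isFilling (h : FillData κ j r) :
    IsFilling (fun x => Quot.mk r (.inl x)) κ (fun i p => Quot.mk r (.inr (j i p))) where
  cont := continuous_quot_mk.comp continuous_inl
  inj x y hxy := by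
    rcases h.isGluing.mk_eq_iff.1 hxy with h1 | h1 | h1
    · exact Sum.inl_injective h1
    · obtain ⟨_, _, -, ⟨⟩⟩ := (h.rel _ _).1 h1
    · obtain ⟨_, _, -, ⟨⟩⟩ := (h.rel _ _).1 h1
  contCollar := h.contCollar
  injCollar := h.injCollar
  openCollar := h.openCollar
  disjCollar := h.disjCollar
  contPiece i := continuous_quot_mk.comp (continuous_inr.comp (h.contPiece i))
  injPiece i i' p q hpq := by
    refine h.injPiece i i' p q ?_
    rcases h.isGluing.mk_eq_iff.1 hpq with h1 | h1 | h1
    · exact Sum.inr_injective h1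
    · obtain ⟨_, _, ⟨⟩, -⟩ := (h.rel _ _).1 h1
    · obtain ⟨_, _, ⟨⟩, -⟩ := (h.rel _ _).1 h1
  glue i τ v x := by
    constructor
    · intro he
      rcases h.isGluing.mk_eq_iff.1 he with ⟨⟨⟩⟩ | h1 | h1
      · obtain ⟨_, _, ⟨⟩, -⟩ := (h.rel _ _).1 h1
      · obtain ⟨i', k, h2, h3⟩ := (h.rel _ _).1 h1
        obtain ⟨rfl, h4⟩ := h.injPiece _ _ _ _ (Sum.inr_injective h3)
        obtain ⟨rfl, rfl⟩ := Prod.mk.inj h4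
        exact ⟨k.2, rfl, Sum.inl_injective h2⟩
    · rintro ⟨σ, hσ, rfl⟩
      refine (Quot.sound ((h.rel _ _).2 ⟨i, (τ, σ), rfl, ?_⟩)).symm
      have : v = ⟨σ, sphere_subset_closedBall σ.2⟩ := Subtype.ext hσ.symm
      rw [this]
  cover n := by
    obtain ⟨x | y, rfl⟩ := Quot.exists_rep n
    · exact Or.inl ⟨x, rfl⟩
    · obtain ⟨i, p, rfl⟩ := h.surjPiece y
      exact Or.inr ⟨i, p, rfl⟩

/-- A space is a knot exterior in the manifold obtained by filling it with a solid torus. -/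
theorem IsFilling.isKnotComplement {X N : Type} [TopologicalSpace X] [CompactSpace X] [T2Space X]
    [TopologicalSpace N] [T2Space N] {a : X → N}
    {κ : Unit → (Circle × sphere (0 : ℂ) 1) × Icc (0 : ℝ) 1 → X}
    {b : Unit → Circle × closedBall (0 : ℂ) 1 → N} (h : IsFilling a κ b)
    (hN : IsClosedOrientableManifold 3 N) : IsKnotComplement X := by
  obtain ⟨e, he1, -, he2, -⟩ := h.exists_plot ()
  have hj : Topology.IsOpenEmbedding
      (fun p : Circle × ball (0 : ℂ) 2 => ((p.1, (p.2 : ℂ)) : Circle × ℂ)) :=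
    Topology.IsOpenEmbedding.id.prodMap isOpen_ball.isOpenEmbedding_subtypeVal
  have hjs : ∀ p : Circle × ball (0 : ℂ) 2, (p.1, (p.2 : ℂ)) ∈ e.source := fun p => by
    rw [he1]; exact ⟨mem_univ _, p.2.2⟩
  refine ⟨N, inferInstance, hN, fun p => e (p.1, (p.2 : ℂ)),
    Topology.IsOpenEmbedding.of_continuous_injective_isOpenMap ?_ ?_ ?_, ?_⟩
  · exact e.continuousOn.comp_continuous hj.continuous hjs
  · exact fun p q hpq => hj.injective (e.injOn (hjs p) (hjs q) hpq)
  · intro O hO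
    have := e.isOpen_image_of_subset_source (hj.isOpenMap O hO)
      (by rintro _ ⟨p, -, rfl⟩; exact hjs p)
    rwa [image_image] at this
  · have hc : Topology.IsClosedEmbedding a := h.cont.isClosedEmbedding h.inj
    refine ⟨hc.isEmbedding.toHomeomorph.trans (Homeomorph.setCongr (t := {x : N | x ∉ _}) ?_)⟩
    ext n
    constructor
    · rintro ⟨x, rfl⟩ ⟨p, hp, hpx⟩
      have hp' : ‖(p.2 : ℂ)‖ < 1 := hp
      have := he2 p.1 ⟨p.2, mem_closedBall_zero_iff.2 hp'.le⟩
      obtain ⟨σ, hσ, -⟩ := (h.glue _ _ _ _).1 (this.symm.trans hpx)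
      have h1 := mem_sphere_zero_iff_norm.1 σ.2
      dsimp only at hσ
      rw [hσ] at h1
      exact hp'.ne h1
    · intro hn
      rcases h.cover n with hx | ⟨⟨⟩, p, rfl⟩
      · exact hx
      · have hp := mem_closedBall_zero_iff.1 p.2.2
        rcases hp.lt_or_eq with hp | hp
        · refine (hn ⟨(p.1, ⟨p.2, mem_ball_zero_iff.2 (hp.trans one_lt_two)⟩), hp, ?_⟩).elim
          exact he2 p.1 p.2
        · exact ⟨_, ((h.glue () p.1 p.2 _).2 ⟨⟨p.2, mem_sphere_zero_iff_norm.2 hp⟩, rfl, rfl⟩).symm⟩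

end FillGluing

namespace DecoratedGaussDiagram

variable {G : DecoratedGaussDiagram}

/-! ### Collars of single boundary components -/

section ComponentCollar

variable {K : Type*} [TopologicalSpace K] {s : Bool} {C : ConnectedComponents (G.surgered s)}

/-- The collar of a parametrized component of the surgered surface. -/
def componentCollar (θ : K ≃ₜ G.Component C) (k : K × Icc (0 : ℝ) 1) : G.HandleManifold :=
  collar s ((θ k.1).1, k.2)

theorem continuous_componentCollar (θ : K ≃ₜ G.Component C) : Continuous (componentCollar θ) :=
  (continuous_collar s).comp (by fun_prop)

theorem componentCollar_injective (θ : K ≃ₜ G.Component C) :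
    Function.Injective (componentCollar θ) := by
  intro k k' h
  obtain ⟨h1, h2⟩ := Prod.mk.inj (collar_injective s h)
  exact Prod.ext (θ.injective (Subtype.ext h1)) h2

/-- Components of the surgered surface are open since there are only finitely many of them. -/
theorem isOpen_image_componentCollar (θ : K ≃ₜ G.Component C) :
    IsOpen (componentCollar θ '' {k | k.2 < 1}) := by
  have : componentCollar θ '' {k | k.2 < 1} = collar s '' {k : G.surgered s × Icc (0 : ℝ) 1 |
      (k.1 : ConnectedComponents (G.surgered s)) = C ∧ k.2 < 1} := by
    ext m
    constructor
    · rintro ⟨k, hk, rfl⟩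
      exact ⟨((θ k.1).1, k.2), ⟨(θ k.1).2, hk⟩, rfl⟩
    · rintro ⟨⟨b, r⟩, ⟨h1, h2⟩, rfl⟩
      exact ⟨(θ.symm ⟨b, h1⟩, r), h2, by simp [componentCollar]⟩
  rw [this]
  exact isOpen_image_collar (((isClopen_component C).2.preimage continuous_fst).inter
    (isOpen_Iio.preimage continuous_snd)) fun k hk => hk.2

theorem componentCollar_zero_mem (θ : K ≃ₜ G.Component C) (k : K) :
    componentCollar θ (k, 0) ∈ G.surgered s := by
  rw [componentCollar, collar_zero]
  exact (θ k).1.2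

theorem exists_componentCollar_zero (θ : K ≃ₜ G.Component C) {b : G.surgered s}
    (hb : (b : ConnectedComponents (G.surgered s)) = C) : ∃ k, componentCollar θ (k, 0) = b :=
  ⟨θ.symm ⟨b, hb⟩, by simp [componentCollar, collar_zero]⟩

theorem eq_of_componentCollar_eq {K' : Type*} [TopologicalSpace K'] {s' : Bool}
    {C' : ConnectedComponents (G.surgered s')} {θ : K ≃ₜ G.Component C} {θ' : K' ≃ₜ G.Component C'}
    {k : K × Icc (0 : ℝ) 1} {k' : K' × Icc (0 : ℝ) 1} (hk : k.2 < 1) (hk' : k'.2 < 1)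
    (h : componentCollar θ k = componentCollar θ' k') :
    (⟨s, C⟩ : Σ s, ConnectedComponents (G.surgered s)) = ⟨s', C'⟩ := by
  by_cases hs : s = s'
  · subst hs
    have := (Prod.mk.inj (collar_injective s h)).1
    have h1 := (θ k.1).2
    rw [this, (θ' k'.1).2] at h1
    rw [h1]
  · refine (collarDomain_disjoint hs (m := componentCollar θ k) ?_ ?_).elim
    · rw [← image_collar]; exact ⟨_, hk, rfl⟩
    · rw [h, ← image_collar]; exact ⟨_, hk', rfl⟩

/-- The level plot over a region inside the component is rewritten in the given parametrization of
the component. -/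
theorem exists_componentCollar_levelPlot (θ : K ≃ₜ G.Component C) :
    ∃ (k : ℂ → K) (l : OpenPartialHomeomorph (ℂ × ℝ) G.HandleManifold) (x : ℂ × ℝ),
      x ∈ l.source ∧
      (∀ y ∈ l.source, y.2 ∈ Ioo (0 : ℝ) 1 ∧ l y = componentCollar θ (k y.1, clip y.2)) ∧
      ∃ e ∈ G.interiorPlots, l x ∈ e.target ∧ OPR R3 (fun y => e.symm (l y)) x := by
  classical
  obtain ⟨c, hc⟩ := exists_component_region s C
  obtain ⟨k, l, x, hx, hl, he⟩ := exists_levelPlot s c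
  have h0 : (k x.1 : ConnectedComponents (G.surgered s)) = C := by rw [hc, (hl x hx).2.2]
  let k' : ℂ → G.Component C := fun z =>
    if h : (k z : ConnectedComponents (G.surgered s)) = C then ⟨k z, h⟩ else ⟨_, h0⟩
  refine ⟨fun z => θ.symm (k' z), l, x, hx, fun y hy => ⟨(hl y hy).1, ?_⟩, he⟩
  have h1 : (k y.1 : ConnectedComponents (G.surgered s)) = C := by rw [hc, (hl y hy).2.2]
  rw [(hl y hy).2.1]
  simp [componentCollar, k', h1]

end ComponentCollar

/-! ### The filled manifold in the closed case and in the case of one torus -/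

section Fill

local notation "E3" => EuclideanSpace ℝ (Fin 3)

/-- The parametrization of a spherical boundary component chosen for the filling. -/
def sphereHomeo (B : G.Spheres) : Unit × sphere (0 : E3) 1 ≃ₜ G.Component B.2.1 :=
  (Homeomorph.punitProd _).trans (Classical.choice B.2.2)

/-- Balls are the case of a filling piece `T × D` in which `T` is a point. -/
theorem fillData : FillData (fun B : G.Spheres => componentCollar (sphereHomeo B))
    (fun B p => (⟨B, p.2⟩ : Σ _ : G.Spheres, closedBall (0 : E3) 1)) G.FillRel where
  contCollar B := continuous_componentCollar _
  injCollar B := componentCollar_injective _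
  openCollar B := isOpen_image_componentCollar _
  disjCollar := by
    rintro ⟨s, C, hC⟩ ⟨s', C', hC'⟩ k k' hk hk' h
    obtain ⟨rfl, h1⟩ := Sigma.mk.inj (eq_of_componentCollar_eq hk hk' h)
    obtain rfl := eq_of_heq h1
    rfl
  contPiece B := continuous_sigmaMk.comp continuous_snd
  injPiece B B' p q h := by
    obtain ⟨rfl, h1⟩ := Sigma.mk.inj h
    exact ⟨rfl, Prod.ext rfl (eq_of_heq h1)⟩
  surjPiece y := ⟨y.1, ((), y.2), rfl⟩
  rel a b := by
    constructor
    · rintro ⟨B, v⟩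
      exact ⟨B, ((), v), congrArg _ (collar_zero _), rfl⟩
    · rintro ⟨B, ⟨⟨⟩, v⟩, rfl, rfl⟩
      dsimp only
      rw [componentCollar, collar_zero]
      exact FillRel.glue B v

instance : T2Space G.Manifold := fillData.isGluing.t2Space

instance : CompactSpace G.Manifold := inferInstanceAs (CompactSpace (Quot _))

/-- The inclusion of the collar with handles into the manifold. -/
def toManifold (x : G.HandleManifold) : G.Manifold := Quot.mk _ (.inl x)

/-- The ball filling a spherical boundary component. -/
def fillingBall (B : G.Spheres) (p : Unit × closedBall (0 : E3) 1) : G.Manifold :=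
  Quot.mk _ (.inr ⟨B, p.2⟩)

theorem isFilling : IsFilling (toManifold (G := G)) (fun B : G.Spheres =>
    componentCollar (sphereHomeo B)) fillingBall :=
  fillData.isFilling

/-- Filling the spherical components leaves exactly the other boundary components uncovered. The
interior plots are kept with their coordinates so that these components can still be compared with
the atlas. -/
theorem exists_atlas_manifold [Nonempty G.HandleManifold] :
    ∃ B : Set (OpenPartialHomeomorph (ℂ × ℝ) G.Manifold),
      (∀ e ∈ B, ∀ e' ∈ B, ∀ m ∈ e.target, m ∈ e'.target → Compat e e' m) ∧
      (∀ n, (∃ e ∈ B, n ∈ e.target) ↔ ∀ (s : Bool) (b : G.surgered s), toManifold b = n →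
        G.IsSpherical (b : ConnectedComponents (G.surgered s))) ∧
      ∀ e ∈ G.interiorPlots, ∃ e' ∈ B, ∀ x ∈ e.target, toManifold x ∈ e'.target ∧
        e'.symm (toManifold x) = e.symm x := by
  have hps : PreconnectedSpace (sphere (0 : E3) 1) :=
    Subtype.preconnectedSpace (isPreconnected_sphere (by
      rw [← Module.finrank_eq_rank, finrank_euclideanSpace_fin]; norm_num) _ _)
  obtain ⟨B, h1, h2, h3⟩ := (isFilling (G := G)).exists_atlas (A := G.interiorPlots)
    (Z := {m | ∃ s, m ∈ G.surgered s})
    (fun x => by rw [exists_interiorPlot_iff]; simp)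
    (fun e he e' he' m hm hm' => compat_interiorPlots he he' hm hm')
    (fun B k => ⟨_, componentCollar_zero_mem _ k⟩)
    (fun B k r ⟨s, h⟩ => eq_zero_of_collar_mem h)
    (hasPolarPlots_ball _ finrank_euclideanSpace_fin)
    (fun B => exists_componentCollar_levelPlot _)
  refine ⟨B, h1, fun n => (h2 n).trans ⟨?_, ?_⟩, h3⟩
  · intro h s b hb
    obtain ⟨B, k, hk⟩ := h b ⟨s, b.2⟩ hb
    obtain ⟨k', hk'⟩ := exists_componentCollar_zero (Homeomorph.refl _) (b := b) rfl
    have := eq_of_componentCollar_eq (k := (k, 0)) (k' := (k', 0)) zero_lt_one zero_lt_one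
      (hk.trans hk'.symm)
    obtain ⟨s', C, hC⟩ := B
    obtain ⟨rfl, h1⟩ := Sigma.mk.inj this
    exact (eq_of_heq h1 : C = _) ▸ hC
  · rintro h x ⟨s, hx⟩ hxn
    have hS := h s ⟨x, hx⟩ hxn
    obtain ⟨k, hk⟩ := exists_componentCollar_zero (sphereHomeo ⟨s, _, hS⟩) (b := ⟨x, hx⟩) rfl
    exact ⟨_, k, hk⟩

/-- The empty diagram has to be treated apart, since the construction of the atlas needs a point;
without boundary components there are no balls either. -/
theorem isEmpty_manifold [IsEmpty G.HandleManifold] : IsEmpty G.Manifold := by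
  refine ⟨fun n => ?_⟩
  obtain ⟨x, -⟩ | ⟨B, p, -⟩ := isFilling.cover n
  · exact isEmptyElim x
  · have : Nontrivial E3 := inferInstance
    obtain ⟨v, hv⟩ := NormedSpace.sphere_nonempty (x := (0 : E3)).2 zero_le_one
    exact isEmptyElim (componentCollar (sphereHomeo B) (((), ⟨v, hv⟩), 0))

/-- If all boundary components are spheres, the manifold is closed. -/
theorem isClosedOrientableManifold (h : ∀ s, IsEmpty (G.InnerBoundary s)) :
    IsClosedOrientableManifold 3 G.Manifold := by
  obtain ⟨L, -⟩ := exists_isometry E3 finrank_euclideanSpace_fin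
  rcases isEmpty_or_nonempty G.HandleManifold with h0 | h0
  · have := isEmpty_manifold (G := G)
    exact isClosedOrientableManifold_of_plots L.symm ∅ (fun m => isEmptyElim m) (by simp)
  · obtain ⟨B, h1, h2, -⟩ := exists_atlas_manifold (G := G)
    refine isClosedOrientableManifold_of_plots L.symm B (fun m => (h2 m).2 fun s b _ => ?_) h1
    by_contra hb
    exact (h s).elim ⟨_, hb⟩

/-- If the only boundary component that is not a sphere is a torus, the manifold is a knot
exterior. -/
theorem isKnotComplement {s : Bool} {C : ConnectedComponents (G.surgered s)}
    (hC : ¬ G.IsSpherical C) (θ : Circle × sphere (0 : ℂ) 1 ≃ₜ G.Component C)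
    (huniq : ∀ (s' : Bool) (C' : ConnectedComponents (G.surgered s')), ¬ G.IsSpherical C' →
      (⟨s', C'⟩ : Σ s, ConnectedComponents (G.surgered s)) = ⟨s, C⟩) :
    IsKnotComplement G.Manifold := by
  have h01 : (0 : Icc (0 : ℝ) 1) < 1 := zero_lt_one
  let κ : Unit → (Circle × sphere (0 : ℂ) 1) × Icc (0 : ℝ) 1 → G.Manifold :=
    fun _ k => toManifold (componentCollar θ k)
  let j : Unit → Circle × closedBall (0 : ℂ) 1 → Circle × closedBall (0 : ℂ) 1 := fun _ p => p
  let r : (G.Manifold ⊕ Circle × closedBall (0 : ℂ) 1) →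
      (G.Manifold ⊕ Circle × closedBall (0 : ℂ) 1) → Prop := fun a b =>
    ∃ i, ∃ k : Circle × sphere (0 : ℂ) 1, Sum.inl (κ i (k, 0)) = a ∧
      Sum.inr (j i (k.1, ⟨k.2, sphere_subset_closedBall k.2.2⟩)) = b
  have hdis : ∀ (B : G.Spheres) k k', k'.2 < 1 →
      componentCollar (sphereHomeo B) (k, 0) ≠ componentCollar θ k' := by
    rintro ⟨s', C', hC'⟩ k k' hk' h
    obtain ⟨rfl, h1⟩ := Sigma.mk.inj (eq_of_componentCollar_eq (k := (k, 0)) h01 hk' h)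
    obtain rfl := eq_of_heq h1
    exact hC hC'
  have hd : FillData κ j r :=
    { contCollar := fun _ => isFilling.cont.comp (continuous_componentCollar θ)
      injCollar := fun _ => isFilling.inj.comp (componentCollar_injective θ)
      openCollar := fun _ => by
        have := isFilling.isOpen_image (isOpen_image_componentCollar θ) (by
          rintro B k ⟨k', hk', h⟩
          exact hdis B k k' hk' h.symm)
        rwa [image_image] at this
      disjCollar := fun _ _ _ _ _ _ _ => rfl
      contPiece := fun _ => continuous_id
      injPiece := fun _ _ _ _ h => ⟨rfl, h⟩
      surjPiece := fun y => ⟨(), y, rfl⟩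
      rel := fun _ _ => Iff.rfl }
  have hT2 : T2Space (Quot r) := hd.isGluing.t2Space
  have hcpt : CompactSpace (Quot r) := inferInstanceAs (CompactSpace (Quot _))
  have hf := hd.isFilling
  -- What remains is that the space with the solid torus glued in is a closed orientable manifold.
  -- The parametrization `θ` of the torus is arbitrary, since any choice of meridian gives an
  -- ambient manifold.
  refine hf.isKnotComplement ?_
  have hH : Nonempty G.HandleManifold := ⟨componentCollar θ ((1, ⟨1, by simp⟩), 0)⟩
  have hM : Nonempty G.Manifold := hH.map toManifold
  obtain ⟨A, hA, hcov, hext⟩ := exists_atlas_manifold (G := G)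
  have hcov' : ∀ n, (∃ e ∈ A, n ∈ e.target) ↔ n ∉ {n | ∃ k, κ () (k, 0) = n} := by
    intro n
    rw [hcov]
    constructor
    · rintro h ⟨k, rfl⟩
      have := h s (θ k).1 (congrArg toManifold (collar_zero _).symm)
      rw [(θ k).2] at this
      exact hC this
    · rintro h s' b rfl
      by_contra hb
      have h1 := huniq s' _ hb
      obtain rfl := congrArg Sigma.fst h1
      obtain ⟨k, hk⟩ := exists_componentCollar_zero θ (eq_of_heq (Sigma.mk.inj h1).2)
      exact h ⟨k, congrArg toManifold hk⟩
  have hZ : ∀ i k r, κ i (k, r) ∈ {n | ∃ k, κ () (k, 0) = n} → r = 0 := by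
    rintro _ k r ⟨k', hk'⟩
    exact (Prod.mk.inj (componentCollar_injective θ (isFilling.inj hk'))).2.symm
  obtain ⟨B, hB1, hB2, -⟩ := hf.exists_atlas hcov' hA (fun _ k => ⟨k, rfl⟩) hZ
    hasPolarPlots_torus fun _ => by
    obtain ⟨k, l, x, hx, hl, e, he, hxe, hor⟩ := exists_componentCollar_levelPlot θ
    obtain ⟨e', he', hee⟩ := hext e he
    -- The level plot lives in the collar of the torus, which misses the spheres filled before, so
    -- its image in the filled manifold is open and it remains a plot there.
    obtain ⟨α, hα1, -, hα2⟩ := OpenPartialHomeomorph.exists_of_isOpen_image isFilling.cont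
      isFilling.inj (U := l.target) l.open_target fun O hO hOo => isFilling.isOpen_image hOo
        fun B k₀ h => by
          have h1 := hl _ (l.map_target (hO h))
          rw [l.right_inv (hO h)] at h1
          exact hdis B k₀ _ (Ioo_clip h1.1).1 h1.2
    have hs : ∀ y ∈ l.source, y ∈ (l.trans α).source := fun y hy => by
      simp [hα1, hy]
    refine ⟨k, l.trans α, x, hs x hx, fun y hy => ?_, e', he', ?_, ?_⟩
    · obtain ⟨h1, h2⟩ := hl y hy.1
      exact ⟨h1, by simp [hα2, h2, κ]⟩
    · simpa [hα2] using (hee _ hxe).1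
    · refine hor.congr ?_
      filter_upwards [l.open_source.mem_nhds hx,
        (l.continuousAt hx).preimage_mem_nhds (e.open_target.mem_nhds hxe)] with y hy hy'
      simp [hα2, (hee _ hy').2]
  obtain ⟨L, -⟩ := exists_isometry E3 finrank_euclideanSpace_fin
  exact isClosedOrientableManifold_of_plots L.symm B
    (fun n => (hB2 n).2 fun x ⟨k, hk⟩ _ => ⟨(), k, hk⟩) hB1

end Fill

/-! ### From the sums of genera to the boundary components -/

section Genus

/-- A component of genus zero would be a sphere and hence already filled. As there are finitely many
components, the sum is a finite sum of positive integers. -/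
theorem BoundaryGenus.sum_eq {s : Bool} {g : ℕ} (h : G.BoundaryGenus s g) :
    ∃ γ : G.InnerBoundary s → ℕ, (∀ C, Nonempty (G.Component C.1 ≃ₜ GenusSurface (γ C))) ∧
      (∀ C, γ C ≠ 0) ∧ ∑ᶠ C, γ C = g := by
  obtain ⟨γ, h1, h2⟩ := h
  refine ⟨γ, h1, fun C h0 => C.2 ?_, ?_⟩
  · obtain ⟨e⟩ := h1 C
    rw [h0] at e
    exact genusSurface_zero.map fun f => f.trans e.symm
  · have := Fintype.ofFinite (G.InnerBoundary s)
    rw [finsum_eq_sum_of_fintype]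
    exact (hasSum_fintype γ).unique h2

theorem BoundaryGenus.isEmpty {s : Bool} (h : G.BoundaryGenus s 0) :
    IsEmpty (G.InnerBoundary s) := by
  obtain ⟨γ, -, h1, h2⟩ := h.sum_eq
  have := Fintype.ofFinite (G.InnerBoundary s)
  rw [finsum_eq_sum_of_fintype, Finset.sum_eq_zero_iff] at h2
  exact ⟨fun C => h1 C (h2 C (Finset.mem_univ C))⟩

/-- Positive integers with sum one: there is exactly one summand, and it equals one. -/
theorem BoundaryGenus.exists_torus {s : Bool} (h : G.BoundaryGenus s 1) :
    ∃ C : G.InnerBoundary s, Nonempty (Circle × Circle ≃ₜ G.Component C.1) ∧ ∀ C', C' = C := by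
  obtain ⟨γ, h0, h1, h2⟩ := h.sum_eq
  have := Fintype.ofFinite (G.InnerBoundary s)
  rw [finsum_eq_sum_of_fintype] at h2
  have hle : Fintype.card (G.InnerBoundary s) ≤ 1 := by
    rw [← h2, Fintype.card_eq_sum_ones]
    exact Finset.sum_le_sum fun C _ => Nat.one_le_iff_ne_zero.2 (h1 C)
  have hsub := Fintype.card_le_one_iff_subsingleton.1 hle
  rcases isEmpty_or_nonempty (G.InnerBoundary s) with hE | ⟨⟨C⟩⟩
  · simp at h2
  · refine ⟨C, ?_, fun C' => Subsingleton.elim _ _⟩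
    rw [Fintype.sum_subsingleton _ C] at h2
    obtain ⟨e⟩ := h0 C
    rw [h2] at e
    exact genusSurface_one.map fun f => f.trans e.symm

/-- The unit circle as a sphere in the plane. -/
def circleHomeoSphere : Circle ≃ₜ sphere (0 : ℂ) 1 where
  toFun w := ⟨w, mem_sphere_zero_iff_norm.2 w.norm_coe⟩
  invFun v := ⟨v, mem_sphere_zero_iff_norm.1 v.2 |> fun _ => by simp [Submonoid.unitSphere]⟩
  left_inv w := rfl
  right_inv v := rfl
  continuous_toFun := by fun_prop
  continuous_invFun := by
    refine Continuous.subtype_mk continuous_subtype_val _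

theorem isKnotComplement_of_genus {s s' : Bool} (hs : s ≠ s') (h : G.BoundaryGenus s 1)
    (h' : G.BoundaryGenus s' 0) : IsKnotComplement G.Manifold := by
  obtain ⟨C, ⟨θ⟩, hu⟩ := h.exists_torus
  refine isKnotComplement C.2
    (((Homeomorph.refl Circle).prodCongr circleHomeoSphere.symm).trans θ) fun t D hD => ?_
  by_cases ht : t = s
  · subst ht
    rw [← hu ⟨D, hD⟩]
  · obtain rfl : t = s' := by
      cases t <;> cases s <;> cases s' <;> simp_all
    exact (h'.isEmpty).elim ⟨D, hD⟩

end Genus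

end DecoratedGaussDiagram

end

theorem mainTheorem6 (G : DecoratedGaussDiagram) :
    (G.BoundaryGenus true 0 ∧ G.BoundaryGenus false 0 →
      IsClosedOrientableManifold 3 G.Manifold) ∧
    ((G.BoundaryGenus true 0 ∧ G.BoundaryGenus false 1) ∨
        (G.BoundaryGenus true 1 ∧ G.BoundaryGenus false 0) →
      IsKnotComplement G.Manifold) := by
  refine ⟨fun ⟨h1, h2⟩ => DecoratedGaussDiagram.isClosedOrientableManifold fun s => ?_, ?_⟩
  · cases s
    exacts [h2.isEmpty, h1.isEmpty]
  · rintro (⟨h1, h2⟩ | ⟨h1, h2⟩)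
    · exact DecoratedGaussDiagram.isKnotComplement_of_genus (by simp) h2 h1
    · exact DecoratedGaussDiagram.isKnotComplement_of_genus (by simp) h1 h2
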